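/- Let $L=K_1\cup K_2\subset S^3$ be a Hopf-like link, i.e. the link obtained from the Hopf link by tying a knot $K_1$ into its first component inside a ball $B_1$ and a knot $K_2$ into its second component inside a ball $B_2$ disjoint from $B_1$ (so $K_i$ agrees outside $B_i$ with the $i$-th component of the Hopf link). For a link $J$ let $X(J)=S^3\setminus\nu J$ be its exterior, $\nu J$ an open tubular neighbourhood. Let $P_i=X(L)\cap B_i$; the inclusion $P_i\subset X(K_i)$ induces an isomorphism $\pi_1(P_i)\cong\pi_1(X(K_i))$, and $P_i\subset X(L)$. Let $\mu_i$ be the meridian of $K_i$ and $x_i$ its class in $H_1$, so that $H_1(X(K_i);\mathbb Z)$ is infinite cyclic, generated by $x_i$, and $H_1(X(L);\mathbb Z)$ is free abelian with basis $x_1,x_2$. Let $\mathbb F$ be a field and $\alpha:\pi_1(X(L))\to \mathrm{GL}(\mathbb F,k)$ a representation; write $\alpha$ also for the representations of $\pi_1(X(K_i))\cong\pi_1(P_i)$ that it induces by restriction to $P_i$. For $X$ one of these exteriors let $F=H_1(X;\mathbb Z)$ modulo torsion and $\Lambda=\mathbb F[F]$, let $\pi_1(X)$ act on $\Lambda^k=\mathbb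 F^k\otimes_{\mathbb F}\Lambda$ by $g\cdot(v\otimes p)=\alpha(g)v\otimes [g]p$, and let $\Delta_X^{\alpha,n}\in\Lambda$ be the order of the $\Lambda$-module $H_n(C_*(\tilde X)\otimes_{\mathbb Z[\pi_1(X)]}\Lambda^k)$, where $\tilde X$ is the universal cover; that is, a generator of the smallest principal ideal containing its zeroth elementary ideal (it is well defined up to a unit). Write $\Delta_X^\alpha=\Delta_X^{\alpha,1}$. The twisted Alexander norm of $\phi\in H^1(X(L);\mathbb R)$ is $$\|\phi\|_A^\alpha=\sup\{\phi(f)-\phi(g)\;:\; f,g\in F \text{ occur with non-zero coefficients in } \Delta^\alpha_{X(L)}\},$$ and it is $0$ for all $\phi$ if $\Delta^\alpha_{X(L)}=0$. Assume $\Delta^\alpha_{X(K_i)}\neq0$ for $i=1,2$. Then $\phi\mapsto(\phi(x_1),\phi(x_2))$ identifies $H^1(X(L);\mathbb R)$ with $\mathbb R^2$, and for $i=1,2$ one has $\Delta^{\alpha,0}_{X(K_i)}\ne0$ and $$\Delta_i(x_i):=\Delta^\alpha_{X(K_i)}(x_i)\,\frac{\det(\alpha(\mu_i)x_i-\mathrm{id})}{\Delta^{\alpha,0}_{X(K_i)}(x_i)}\in\mathbb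 F[x_i^{\pm1}].$$ Let $d_i=\deg\Delta_i(x_i)$ be the difference between the largest and the smallest exponent of $x_i$ occurring in $\Delta_i(x_i)$. If $d_1>0$ and $d_2>0$, then the norm ball $\{\phi\in H^1(X(L);\mathbb R):\frac1k\|\phi\|_A^\alpha\le1\}$ has exactly four extreme vertices, namely $(\pm\frac{k}{d_1},0)$ and $(0,\pm\frac{k}{d_2})$. -/

import Mathlib

open scoped unitInterval MatrixGroups

noncomputable section

/-! ### Order of a finitely presented module -/

section Order

variable {R : Type*} [CommRing R]

/-- `P` is the matrix of a presentation `R^r → R^s → A → 0`: the rows of `P` are relations that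
generate all the relations among some `s` generators of `A`. -/
def IsPresentationMatrix (A : Type*) [AddCommGroup A] [Module R A] {r s : ℕ}
    (P : Matrix (Fin r) (Fin s) R) : Prop :=
  ∃ π : (Fin s → R) →ₗ[R] A,
    Function.Surjective π ∧ LinearMap.ker π = Submodule.span R (Set.range P)

/-- The zeroth elementary ideal: the ideal generated by the `s × s` minors of `P`
(so it is `0` if there are fewer than `s` rows, and `R` if `s = 0`). -/
def elementaryIdeal {r s : ℕ} (P : Matrix (Fin r) (Fin s) R) : Ideal R :=
  Ideal.span (Set.range fun f : Fin s → Fin r => (P.submatrix f id).det)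

/-- `Δ` is an order of `A`: it generates the smallest principal ideal containing the zeroth
elementary ideal of `A`. -/
def IsOrderOf (A : Type*) [AddCommGroup A] [Module R A] (Δ : R) : Prop :=
  ∃ (r s : ℕ) (P : Matrix (Fin r) (Fin s) R), IsPresentationMatrix A P ∧
    elementaryIdeal P ≤ Ideal.span {Δ} ∧
      ∀ d : R, elementaryIdeal P ≤ Ideal.span {d} → Ideal.span {Δ} ≤ Ideal.span {d}

open Classical in
/-- The order of `A`, well defined up to a unit: some element satisfying `IsOrderOf A`
(which exists for a finitely generated module over a Noetherian UFD). -/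
def moduleOrder (R : Type*) [CommRing R] (A : Type*) [AddCommGroup A] [Module R A] : R :=
  if h : ∃ Δ : R, IsOrderOf A Δ then h.choose else 0

end Order

/-! ### Twisted homology -/

section Homology

variable {X : Type*} [TopologicalSpace X]

/-- A singular `n`-simplex of the universal cover of `(X, x₀)`. A point of the universal cover
over `y` is a homotopy class of paths from `x₀` to `y`; a singular simplex of the universal cover
is a singular simplex `σ` of `X` with a lift of each of its points, such that the lift is
continuous, that is, moves along a path of the simplex by composition with the image of that
path. -/
structure CoverSimplex (x₀ : X) (n : ℕ) where
  /-- the underlying singular simplex of `X` -/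
  simplex : C(stdSimplex ℝ (Fin (n + 1)), X)
  /-- the lift of the points of the simplex to the universal cover -/
  lift : ∀ b, Path.Homotopic.Quotient x₀ (simplex b)
  coherent : ∀ {b b' : stdSimplex ℝ (Fin (n + 1))} (p : Path b b'),
    (lift b).trans (Path.Homotopic.Quotient.mk (p.map simplex.continuous)) = lift b'

/-- The `i`-th face inclusion of standard simplices. -/
def faceInclusion (n : ℕ) (i : Fin (n + 2)) :
    C(stdSimplex ℝ (Fin (n + 1)), stdSimplex ℝ (Fin (n + 2))) :=
  ⟨stdSimplex.map i.succAbove, stdSimplex.continuous_map _⟩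

/-- The `i`-th face of a singular simplex of the universal cover. -/
def CoverSimplex.face {x₀ : X} {n : ℕ} (i : Fin (n + 2)) (s : CoverSimplex x₀ (n + 1)) :
    CoverSimplex x₀ n where
  simplex := s.simplex.comp (faceInclusion n i)
  lift b := s.lift (faceInclusion n i b)
  coherent p := s.coherent (p.map (faceInclusion n i).continuous)

/-- The right action of the fundamental group on the singular simplices of the universal cover:
compose all the path classes with the loop `g` at the start. Since `g * h = h.trans g` in
`FundamentalGroup`, this is a right action. -/
def CoverSimplex.act {x₀ : X} {n : ℕ} (s : CoverSimplex x₀ n) (g : FundamentalGroup X x₀) :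
    CoverSimplex x₀ n where
  simplex := s.simplex
  lift b := Path.Homotopic.Quotient.trans g.toPath (s.lift b)
  coherent p := by
    rw [Path.Homotopic.Quotient.trans_assoc, s.coherent]

section Coefficients

variable {R : Type*} [CommRing R] {V : Type*} [AddCommGroup V] [Module R V]

variable (R V) in
/-- The singular boundary map `C_{n+1}(X̃) ⊗_ℤ V → C_n(X̃) ⊗_ℤ V`, where `C_n(X̃) ⊗_ℤ V` is the
module of finite formal combinations of the singular simplices of the universal cover with
coefficients in `V`. -/
def coverBoundary (x₀ : X) (n : ℕ) :
    (CoverSimplex x₀ (n + 1) →₀ V) →ₗ[R] (CoverSimplex x₀ n →₀ V) :=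
  ∑ i : Fin (n + 2), (-1 : R) ^ (i : ℕ) • Finsupp.lmapDomain V R (CoverSimplex.face i)

variable {x₀ : X}

/-- The relations `s · g ⊗ v = s ⊗ g · v` whose quotient is the tensor product
`C_n(X̃) ⊗_{ℤ[π₁(X)]} V`. -/
def tensorRelations (ρ : FundamentalGroup X x₀ →* Module.End R V) (n : ℕ) :
    Submodule R (CoverSimplex x₀ n →₀ V) :=
  Submodule.span R {c | ∃ (s : CoverSimplex x₀ n) (g : FundamentalGroup X x₀) (v : V),
    c = Finsupp.single (s.act g) v - Finsupp.single s (ρ g v)}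

/-- The chains that are cycles in `C_n(X̃) ⊗_{ℤ[π₁(X)]} V`. -/
def twistedCycles (ρ : FundamentalGroup X x₀ →* Module.End R V) :
    ∀ n : ℕ, Submodule R (CoverSimplex x₀ n →₀ V)
  | 0 => ⊤
  | n + 1 => (tensorRelations ρ n).comap (coverBoundary R V x₀ n)

/-- The chains that are boundaries in `C_n(X̃) ⊗_{ℤ[π₁(X)]} V`. -/
def twistedBoundaries (ρ : FundamentalGroup X x₀ →* Module.End R V) (n : ℕ) :
    Submodule R (CoverSimplex x₀ n →₀ V) :=
  LinearMap.range (coverBoundary R V x₀ n) ⊔ tensorRelations ρ n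

/-- The twisted homology module `H_n(C_*(X̃) ⊗_{ℤ[π₁(X)]} V)`. -/
abbrev TwistedHomology (ρ : FundamentalGroup X x₀ →* Module.End R V) (n : ℕ) : Type _ :=
  ↥(twistedCycles ρ n) ⧸ (twistedBoundaries ρ n).submoduleOf (twistedCycles ρ n)

end Coefficients

variable {𝔽 : Type*} [Field 𝔽] {k : ℕ} {F : Type*} [CommGroup F]

/-- The action of `π₁(X, x₀)` on `Λ^k = 𝔽^k ⊗ Λ`, with `Λ = 𝔽[F]`, through `α ⊗ ψ`:
`g · (v ⊗ p) = (α(g) v) ⊗ (ψ(g) p)`. -/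
def twistedAction {x₀ : X} (α : FundamentalGroup X x₀ →* GL (Fin k) 𝔽)
    (ψ : FundamentalGroup X x₀ →* F) :
    FundamentalGroup X x₀ →*
      Module.End (MonoidAlgebra 𝔽 F) (Fin k → MonoidAlgebra 𝔽 F) where
  toFun g := MonoidAlgebra.single (ψ g) (1 : 𝔽) •
    Matrix.toLin' ((α g).val.map (algebraMap 𝔽 (MonoidAlgebra 𝔽 F)))
  map_one' := by
    rw [map_one, map_one, ← MonoidAlgebra.one_def, one_smul, Units.val_one,
      Matrix.map_one _ (map_zero _) (map_one _), Matrix.toLin'_one]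
    rfl
  map_mul' g h := by
    rw [map_mul, map_mul, Units.val_mul, Matrix.map_mul, Matrix.toLin'_mul, smul_mul_smul_comm,
      MonoidAlgebra.single_mul_single, one_mul]
    rfl

/-- `FH₁(X; ℤ)`, the maximal free abelian quotient of `H₁(X; ℤ) = π₁(X, x₀)^{ab}`
(for `X` compact), written multiplicatively. -/
abbrev FreeH1 (X : Type*) [TopologicalSpace X] (x₀ : X) : Type _ :=
  Abelianization (FundamentalGroup X x₀) ⧸
    CommGroup.torsion (Abelianization (FundamentalGroup X x₀))

/-- The natural surjection `π₁(X, x₀) → FH₁(X; ℤ)`. -/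
def toFreeH1 (X : Type*) [TopologicalSpace X] (x₀ : X) :
    FundamentalGroup X x₀ →* FreeH1 X x₀ :=
  (QuotientGroup.mk' _).comp Abelianization.of

/-- The `n`-th twisted Alexander polynomial of `(X, α)`, in `𝔽[FH₁(X; ℤ)]`
(well defined up to a unit). -/
def alexanderPoly {x₀ : X} (α : FundamentalGroup X x₀ →* GL (Fin k) 𝔽) (n : ℕ) :
    MonoidAlgebra 𝔽 (FreeH1 X x₀) :=
  moduleOrder (MonoidAlgebra 𝔽 (FreeH1 X x₀))
    (TwistedHomology (twistedAction α (toFreeH1 X x₀)) n)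

/-- `H¹(X; ℝ) = Hom(FH₁(X; ℤ), ℝ)`. -/
abbrev RealH1 (X : Type*) [TopologicalSpace X] (x₀ : X) : Type _ :=
  Additive (FreeH1 X x₀) →+ ℝ

/-- The twisted Alexander norm: the supremum of `φ(f) - φ(g)` over the pairs `f, g` in the support
of the twisted Alexander polynomial (`0` if that polynomial is `0`, as `sSup ∅ = 0`). -/
def alexanderNorm {x₀ : X} (α : FundamentalGroup X x₀ →* GL (Fin k) 𝔽) (φ : RealH1 X x₀) : ℝ :=
  sSup {d : ℝ | ∃ f ∈ (alexanderPoly α 1).coeff.support, ∃ g ∈ (alexanderPoly α 1).coeff.support,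
    d = φ (Additive.ofMul f) - φ (Additive.ofMul g)}

/-- The unit ball of `(1/k) ‖-‖_A^α`. -/
def alexanderNormBall {x₀ : X} (α : FundamentalGroup X x₀ →* GL (Fin k) 𝔽) :
    Set (RealH1 X x₀) :=
  {φ | (1 / (k : ℝ)) * alexanderNorm α φ ≤ 1}

end Homology

/-- The degree of `p`, read as a Laurent polynomial in `x`: the largest difference of two exponents
of `x` that occur in `p` (and `0` for `p = 0`). -/
def laurentDegree {𝔽 : Type*} [Field 𝔽] {F : Type*} [CommGroup F] (x : F)
    (p : MonoidAlgebra 𝔽 F) : ℤ :=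
  sSup {d : ℤ | ∃ a b : ℤ, p.coeff (x ^ a) ≠ 0 ∧ p.coeff (x ^ b) ≠ 0 ∧ d = a - b}

/-! ### Knots and Hopf-like links -/

/-- The 3-sphere, as the unit sphere of `ℂ²`. -/
abbrev S3 : Type := Metric.sphere (0 : EuclideanSpace ℂ (Fin 2)) 1

/-- A tame knot in the 3-sphere with a tubular neighbourhood. The tubular neighbourhood is the
part `‖v‖ < 1` of a larger one, so that it has a collared torus as its boundary. -/
structure TubedKnot where
  /-- the parametrized neighbourhood of the knot -/
  param : Circle × ℂ → S3
  isOpenEmbedding : Topology.IsOpenEmbedding param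

namespace TubedKnot

/-- The knot itself. -/
def core (K : TubedKnot) : Set S3 := K.param '' {q | q.2 = 0}

/-- The open tubular neighbourhood `νK`. -/
def tube (K : TubedKnot) : Set S3 := K.param '' {q | ‖q.2‖ < 1}

/-- The exterior `X(K) = S³ ∖ νK`. -/
def exterior (K : TubedKnot) : Set S3 := K.tubeᶜ

end TubedKnot

/-- A Hopf-like link: up to a homeomorphism `h` of the 3-sphere, it is the Hopf link
`{x₁ = 0} ∪ {x₀ = 0}` in the unit sphere of `ℂ²`, with a knot tied into the component `i` inside
the ball `re xᵢ ≥ 4/5`; the two balls are disjoint. So the knot `Kᵢ` is the component `i`, it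
agrees with the circle `{x_{1-i} = 0}` outside that ball and is arbitrary inside it; and the tubular
neighbourhood is the standard one `‖x_{1-i}‖ < 1/2` outside the ball, so that it meets the bounding
sphere in two discs. -/
structure HopfLikeLink where
  /-- the components with their tubular neighbourhoods -/
  knot : Fin 2 → TubedKnot
  /-- the homeomorphism that puts the link into normal position -/
  h : S3 ≃ₜ S3
  mem_core_iff : ∀ (i : Fin 2) (x : S3), ((h x).1 i).re ≤ 4 / 5 →
    (x ∈ (knot i).core ↔ (h x).1 i.rev = 0)
  mem_tube_iff : ∀ (i : Fin 2) (x : S3), ((h x).1 i).re ≤ 4 / 5 →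
    (x ∈ (knot i).tube ↔ ‖(h x).1 i.rev‖ < 1 / 2)

/-- The circle in the unit sphere of `ℂ²` with `xᵢ = 4/5` and `x_{1-i} = (3/5) e^{2πit}`, a meridian
of `{x_{1-i} = 0}`. -/
def modelMeridian (i : Fin 2) (t : ℝ) : S3 :=
  ⟨WithLp.toLp 2 fun j => if j = i then (4 / 5 : ℂ)
    else (3 / 5 : ℂ) * Complex.exp ((2 * Real.pi * t : ℝ) * Complex.I), by
    rw [mem_sphere_zero_iff_norm, EuclideanSpace.norm_eq, Real.sqrt_eq_one, Fin.sum_univ_two]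
    fin_cases i <;> simp [-Complex.ofReal_mul, Complex.norm_exp_ofReal_mul_I] <;> norm_num⟩

theorem continuous_modelMeridian (i : Fin 2) : Continuous (modelMeridian i) := by
  refine Continuous.subtype_mk ((PiLp.continuous_toLp 2 _).comp (continuous_pi fun j => ?_)) _
  by_cases hj : j = i <;> simp only [hj, if_true, if_false] <;> fun_prop

theorem modelMeridian_self (i : Fin 2) (t : ℝ) : (modelMeridian i t).1 i = 4 / 5 := by
  simp [modelMeridian]

theorem norm_modelMeridian_rev (i : Fin 2) (t : ℝ) : ‖(modelMeridian i t).1 i.rev‖ = 3 / 5 := by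
  have hi : i.rev ≠ i := by fin_cases i <;> decide
  simp [modelMeridian, hi, -Complex.ofReal_mul, Complex.norm_exp_ofReal_mul_I]

theorem modelMeridian_one (i : Fin 2) : modelMeridian i 1 = modelMeridian i 0 := by
  simp [modelMeridian, Complex.exp_two_pi_mul_I]

namespace HopfLikeLink

variable (L : HopfLikeLink)

/-- The exterior `X(L) = S³ ∖ νL` of the link. -/
def exterior : Set S3 := (⋃ i, (L.knot i).tube)ᶜ

/-- The piece `Pᵢ` of `X(L)` cut off by the annulus `re xᵢ = 4/5`, the one that contains the
knotted part of the component `i`. -/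
def piece (i : Fin 2) : Set S3 := {x | x ∈ L.exterior ∧ 4 / 5 ≤ ((L.h x).1 i).re}

/-- The inclusion `Pᵢ → X(L)`. -/
def pieceToExterior (i : Fin 2) : C(L.piece i, L.exterior) :=
  ⟨Set.inclusion fun _ hx => hx.1, continuous_inclusion _⟩

/-- The inclusion `Pᵢ → X(Kᵢ)` (a homotopy equivalence). -/
def pieceToKnot (i : Fin 2) : C(L.piece i, (L.knot i).exterior) :=
  ⟨Set.inclusion fun _ hx hxi => hx.1 (Set.mem_iUnion_of_mem i hxi), continuous_inclusion _⟩

theorem meridian_mem_piece (i : Fin 2) (t : ℝ) : L.h.symm (modelMeridian i t) ∈ L.piece i := by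
  refine ⟨?_, ?_⟩
  · intro hx
    obtain ⟨j, hj⟩ := Set.mem_iUnion.1 hx
    by_cases hji : j = i
    · subst hji
      rw [L.mem_tube_iff, L.h.apply_symm_apply, norm_modelMeridian_rev] at hj
      · norm_num at hj
      · rw [L.h.apply_symm_apply, modelMeridian_self]
        norm_num
    · have hj' : j = i.rev := by
        fin_cases i <;> fin_cases j <;> first | rfl | exact absurd rfl hji
      subst hj'
      rw [L.mem_tube_iff, L.h.apply_symm_apply, Fin.rev_rev, modelMeridian_self] at hj
      · norm_num at hj
      · rw [L.h.apply_symm_apply]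
        refine (Complex.re_le_norm _).trans ?_
        rw [norm_modelMeridian_rev]
        norm_num
  · rw [L.h.apply_symm_apply, modelMeridian_self]
    norm_num

/-- The base point of `Pᵢ`. -/
def basePoint (i : Fin 2) : L.piece i :=
  ⟨L.h.symm (modelMeridian i 0), L.meridian_mem_piece i 0⟩

/-- The meridian `μᵢ` of `Kᵢ`, as a loop on the annulus in `Pᵢ`. -/
def meridianLoop (i : Fin 2) : Path (L.basePoint i) (L.basePoint i) where
  toFun t := ⟨L.h.symm (modelMeridian i t), L.meridian_mem_piece i t⟩
  continuous_toFun := Continuous.subtype_mk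
    (L.h.symm.continuous.comp ((continuous_modelMeridian i).comp continuous_subtype_val)) _
  source' := rfl
  target' := by simp [basePoint, modelMeridian_one]

/-- The class of `μᵢ` in `π₁(Pᵢ)`. -/
def meridian (i : Fin 2) : FundamentalGroup (L.piece i) (L.basePoint i) :=
  FundamentalGroup.fromPath (Path.Homotopic.Quotient.mk (L.meridianLoop i))

/-- The class of `μᵢ` in `π₁(X(Kᵢ))`. -/
def knotMeridian (i : Fin 2) :
    FundamentalGroup (L.knot i).exterior (L.pieceToKnot i (L.basePoint i)) :=
  FundamentalGroup.map (L.pieceToKnot i) _ (L.meridian i)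

/-- The generator `xᵢ` of `FH₁(X(Kᵢ); ℤ)`. -/
def knotVariable (i : Fin 2) :
    FreeH1 (L.knot i).exterior (L.pieceToKnot i (L.basePoint i)) :=
  toFreeH1 _ _ (L.knotMeridian i)

variable {x₀ : L.exterior}

/-- The homomorphism `π₁(Pᵢ) → π₁(X(L), x₀)` induced by the inclusion, with a path `γ` from `x₀` to
the base point of `Pᵢ`. -/
def pieceHom (i : Fin 2) (γ : Path x₀ (L.pieceToExterior i (L.basePoint i))) :
    FundamentalGroup (L.piece i) (L.basePoint i) →* FundamentalGroup L.exterior x₀ :=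
  (FundamentalGroup.fundamentalGroupMulEquivOfPath γ).symm.toMonoidHom.comp
    (FundamentalGroup.map (L.pieceToExterior i) _)

/-- The class `xᵢ` of the meridian `μᵢ` in `FH₁(X(L); ℤ)`. -/
def linkVariable (i : Fin 2) (γ : Path x₀ (L.pieceToExterior i (L.basePoint i))) :
    FreeH1 L.exterior x₀ :=
  toFreeH1 _ _ (L.pieceHom i γ (L.meridian i))

/-- The coordinates `(φ(x₁), φ(x₂))` on `H¹(X(L); ℝ)` given by the two meridians. -/
def coordinates (γ : ∀ i, Path x₀ (L.pieceToExterior i (L.basePoint i)))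
    (φ : RealH1 L.exterior x₀) : ℝ × ℝ :=
  (φ (Additive.ofMul (L.linkVariable 0 (γ 0))), φ (Additive.ofMul (L.linkVariable 1 (γ 1))))

variable {𝔽 : Type*} [Field 𝔽] {k : ℕ}

/-- `β` is the representation of `π₁(X(Kᵢ))` induced by the representation `α` of `π₁(X(L))`: the
restriction of `α` to `Pᵢ`, carried over by the isomorphism `π₁(Pᵢ) ≅ π₁(X(Kᵢ))`. -/
def IsInducedRep (i : Fin 2) (γ : Path x₀ (L.pieceToExterior i (L.basePoint i)))
    (α : FundamentalGroup L.exterior x₀ →* GL (Fin k) 𝔽)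
    (β : FundamentalGroup (L.knot i).exterior (L.pieceToKnot i (L.basePoint i)) →*
      GL (Fin k) 𝔽) : Prop :=
  β.comp (FundamentalGroup.map (L.pieceToKnot i) _) = α.comp (L.pieceHom i γ)

/-- `det(β(μᵢ) xᵢ - id)`, in `𝔽[xᵢ^{±1}] = 𝔽[FH₁(X(Kᵢ); ℤ)]`. -/
def meridianDet (i : Fin 2)
    (β : FundamentalGroup (L.knot i).exterior (L.pieceToKnot i (L.basePoint i)) →*
      GL (Fin k) 𝔽) :
    MonoidAlgebra 𝔽 (FreeH1 (L.knot i).exterior (L.pieceToKnot i (L.basePoint i))) :=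
  Matrix.det (MonoidAlgebra.single (L.knotVariable i) (1 : 𝔽) •
    (β (L.knotMeridian i)).val.map (algebraMap 𝔽 (MonoidAlgebra 𝔽
      (FreeH1 (L.knot i).exterior (L.pieceToKnot i (L.basePoint i))))) - 1)

/-- `Δ` is the Laurent polynomial
`Δᵢ(xᵢ) = Δ_{Kᵢ}^α(xᵢ) · det(α(μᵢ) xᵢ - id) / Δ_{Kᵢ}^{α,0}(xᵢ)`. -/
def IsFactor (i : Fin 2)
    (β : FundamentalGroup (L.knot i).exterior (L.pieceToKnot i (L.basePoint i)) →*
      GL (Fin k) 𝔽)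
    (Δ : MonoidAlgebra 𝔽 (FreeH1 (L.knot i).exterior (L.pieceToKnot i (L.basePoint i)))) : Prop :=
  alexanderPoly β 0 ≠ 0 ∧ Δ * alexanderPoly β 0 = alexanderPoly β 1 * L.meridianDet i β

end HopfLikeLink

end

/-!
The twisted Alexander polynomial of a Hopf-like link is the product `Δ₀(x₀) Δ₁(x₁)`. The widths of
Newton polytopes add up in products, so the Alexander norm of `φ` is `d₀ |φ(x₀)| + d₁ |φ(x₁)|`, and
the extreme points of the ball of a weighted `ℓ¹`-norm are its four vertices
(`associated_alexanderPoly`, `IsSupportMax.mul`, `alexanderNorm_eq_of_isFactor`,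
`extremePoints_l1_ball`).

*Algebra.* The first and the zeroth twisted homology of a space are the kernel and the cokernel of
the augmentation of the universal derivation module of its fundamental group
(`nonempty_twistedHomology_one_equiv`, `nonempty_twistedHomology_zero_equiv`). For a knot group `G`
with meridian `μ`, the derivations that vanish on `μ` form the relative homology of the pair
`(G, μ)`. Over the principal ideal domain `𝔽[x^±1]` the exact sequence of this pair shows that their
universal module has the order `Δ · det(α(μ) x - 1) / Δ⁰`, which is the factor `Δᵢ`
(`exists_order_relDerivationModule`, `exists_isFactor`). The group of the link is the free product
of the two knot groups with the relation that the meridians commute. So its derivations that vanish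
on both meridians are pairs of such derivations of the knot groups, and the universal module is the
direct sum of the base changes of those of the knots
(`IsAmalgam.nonempty_relDerivationModule_equiv`, `relDerivationModule_baseChange`), of the order
`Δ₀(x₀) Δ₁(x₁)`. The first homology of the link embeds in it, since the Koszul complex of the two
meridians is exact. The cokernel is killed by the two determinants `det(α(μᵢ) xᵢ - 1)`. They involve
different variables, hence are coprime, and the orders agree
(`isGcdOf_fittingIdeal_ker_augmentation`).

*Topology.* A homomorphism of a fundamental group is encoded as a function on paths that is
multiplicative on triangles (`IsCocycleOn`). Such cocycles can be glued along sets whose interiors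
cover the space (`exists_glue`), which replaces the theorem of Seifert and van Kampen. The exterior
of the link is covered by two knotted regions and a middle region, where the link is the Hopf link.
The middle region is a torus times an interval, so that the two meridians commute, and it meets the
knotted regions in thickened circles around the meridians (`isAmalgam_knotHom`).

The free abelianizations are computed from two facts. A homomorphism of a knot group that kills the
meridian is trivial, since it extends over the tube to the 3-sphere (`knot_hom_eq_one`). The
meridian has infinite order in homology, since there is a linking number: the winding number of a
function made from the spin operators of the vectors that point from the knot to the given point
(`exists_linking_function`, `exists_linking_cocycle`).
-/

noncomputable section

/-! ### Fitting ideals -/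

section Fitting

variable {R : Type*} [CommRing R]

/-- The ideal generated by the determinants of the square matrices whose rows lie in a submodule
`K` of `R^n`: the zeroth Fitting ideal of `R^n / K`. -/
def relationIdeal {n : Type*} [Fintype n] [DecidableEq n] (K : Submodule R (n → R)) : Ideal R :=
  Ideal.span {d | ∃ A : Matrix n n R, (∀ i, A i ∈ K) ∧ d = A.det}

theorem det_mem_relationIdeal {n : Type*} [Fintype n] [DecidableEq n] {K : Submodule R (n → R)}
    {A : Matrix n n R} (h : ∀ i, A i ∈ K) : A.det ∈ relationIdeal K :=
  Ideal.subset_span ⟨A, h, rfl⟩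

theorem exists_eq_mul_of_mem_span_range {m n ι : Type*} [Fintype m]
    (P : Matrix m n R) (A : Matrix ι n R) (h : ∀ i, A i ∈ Submodule.span R (Set.range P)) :
    ∃ C : Matrix ι m R, A = C * P := by
  have : ∀ i, ∃ c : m → R, ∑ j, c j • P j = A i := fun i =>
    (Submodule.mem_span_range_iff_exists_fun R).1 (h i)
  choose C hC using this
  refine ⟨Matrix.of C, ?_⟩
  ext i j
  rw [Matrix.mul_apply, ← hC i]
  simp

/-- The elementary ideal of a presentation matrix depends only on its row space. -/
theorem elementaryIdeal_eq_relationIdeal {r s : ℕ} (P : Matrix (Fin r) (Fin s) R) :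
    elementaryIdeal P = relationIdeal (Submodule.span R (Set.range P)) := by
  apply le_antisymm
  · refine Ideal.span_le.2 ?_
    rintro _ ⟨f, rfl⟩
    exact det_mem_relationIdeal fun i => Submodule.subset_span ⟨f i, rfl⟩
  · refine Ideal.span_le.2 ?_
    rintro _ ⟨A, hA, rfl⟩
    obtain ⟨C, rfl⟩ := exists_eq_mul_of_mem_span_range P A hA
    have key : (C * P).det = ∑ f : Fin s → Fin r, (∏ i, C i (f i)) * (P.submatrix f id).det := by
      have h1 : (C * P) = fun i => ∑ j, C i j • P j := by
        ext i j
        simp [Matrix.mul_apply]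
      rw [h1]
      change (Matrix.detRowAlternating (R := R) (n := Fin s)).toMultilinearMap _ = _
      rw [MultilinearMap.map_sum]
      refine Finset.sum_congr rfl fun f _ => ?_
      rw [MultilinearMap.map_smul_univ]
      rfl
    rw [SetLike.mem_coe, key]
    exact Ideal.sum_mem _ fun f _ => Ideal.mul_mem_left _ _ (Ideal.subset_span ⟨f, rfl⟩)

theorem relationIdeal_span_square {n : Type*} [Fintype n] [DecidableEq n] (P : Matrix n n R) :
    relationIdeal (Submodule.span R (Set.range P)) = Ideal.span {P.det} := by
  apply le_antisymm
  · refine Ideal.span_le.2 ?_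
    rintro _ ⟨A, hA, rfl⟩
    obtain ⟨C, rfl⟩ := exists_eq_mul_of_mem_span_range P A hA
    rw [Matrix.det_mul]
    exact Ideal.mul_mem_left _ _ (Ideal.mem_span_singleton_self _)
  · rw [Ideal.span_singleton_le_iff_mem]
    exact det_mem_relationIdeal fun i => Submodule.subset_span ⟨i, rfl⟩

/-- Additional columns do not matter, by Laplace expansion along them. -/
theorem det_mem_relationIdeal_of_castAdd {s : ℕ} {K : Submodule R (Fin s → R)} :
    ∀ (m : ℕ) (A : Matrix (Fin (s + m)) (Fin (s + m)) R),
      (∀ i, (fun j => A i (Fin.castAdd m j)) ∈ K) → A.det ∈ relationIdeal K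
  | 0, A, h => det_mem_relationIdeal h
  | m + 1, A, h => by
    rw [Matrix.det_succ_column (n := s + m) A (Fin.last _)]
    refine Ideal.sum_mem _ fun i _ => Ideal.mul_mem_left _ _ ?_
    refine det_mem_relationIdeal_of_castAdd m _ fun j => ?_
    simp only [Matrix.submatrix_apply, Fin.succAbove_last]
    exact h _

variable {M N : Type*} [AddCommGroup M] [Module R M] [AddCommGroup N] [Module R N]

/-- The comparison of Fitting ideals along a pair of maps whose composite is multiplication by
`u`: add the generators of `M` to those of `N`, with the relations `u • b = f (g b)`. -/
theorem pow_mul_mem_relationIdeal {s t : ℕ} (p : (Fin s → R) →ₗ[R] M) (hp : Function.Surjective p)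
    (q : (Fin t → R) →ₗ[R] N) (hq : Function.Surjective q) (f : M →ₗ[R] N) (g : N →ₗ[R] M) (u : R)
    (hfg : ∀ b, f (g b) = u • b) {e : R} (he : e ∈ relationIdeal (LinearMap.ker p)) :
    u ^ t * e ∈ relationIdeal (LinearMap.ker q) := by
  have hle : relationIdeal (LinearMap.ker p) ≤
      Submodule.comap (LinearMap.mulLeft R (u ^ t)) (relationIdeal (LinearMap.ker q)) := by
    refine Ideal.span_le.2 ?_
    rintro _ ⟨A, hA, rfl⟩
    have hT : ∀ k : Fin s, ∃ x, q x = f (p (Pi.single k 1)) := fun k => hq _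
    choose T hT using hT
    have hC : ∀ j : Fin t, ∃ x, p x = g (q (Pi.single j 1)) := fun j => hp _
    choose C hC using hC
    have hqT : ∀ x : Fin s → R, q (∑ k, x k • T k) = f (p x) := by
      intro x
      conv_rhs => rw [← Finset.univ_sum_single x]
      simp only [map_sum, map_smul, hT]
      refine Finset.sum_congr rfl fun k _ => ?_
      rw [← map_smul, ← map_smul, ← Pi.single_smul, smul_eq_mul, mul_one]
    let B : Matrix (Fin t ⊕ Fin s) (Fin t ⊕ Fin s) R :=
      Matrix.fromBlocks (u • 1) (-Matrix.of C) 0 A * Matrix.fromBlocks 1 0 (Matrix.of T) 1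
    have hB : B.det = u ^ t * A.det := by
      simp only [B, Matrix.det_mul, Matrix.det_fromBlocks_zero₂₁, Matrix.det_fromBlocks_zero₁₂,
        Matrix.det_smul, Matrix.det_one, Fintype.card_fin, mul_one]
    change u ^ t * A.det ∈ relationIdeal (LinearMap.ker q)
    rw [← hB, ← Matrix.det_submatrix_equiv_self finSumFinEquiv.symm B]
    refine det_mem_relationIdeal_of_castAdd s _ fun i => ?_
    obtain ⟨i, rfl⟩ := finSumFinEquiv.surjective i
    simp only [Matrix.submatrix_apply, Equiv.symm_apply_apply, finSumFinEquiv_symm_apply_castAdd]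
    rw [LinearMap.mem_ker]
    rcases i with j | k
    · have : (fun l => B (Sum.inl j) (Sum.inl l)) =
          u • Pi.single j (1 : R) - ∑ k, C j k • T k := by
        ext l
        simp [B, Matrix.fromBlocks_multiply, Matrix.mul_apply, Matrix.one_apply, Pi.single_apply,
          sub_eq_add_neg, eq_comm]
      rw [this, map_sub, hqT, hC, hfg, map_smul, sub_self]
    · have : (fun l => B (Sum.inr k) (Sum.inl l)) = ∑ l, A k l • T l := by
        ext l
        simp [B, Matrix.fromBlocks_multiply, Matrix.mul_apply]
      rw [this, hqT, LinearMap.mem_ker.1 (hA k), map_zero]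
  exact hle he

variable (R M) in
/-- The zeroth Fitting ideal of a finitely generated module. -/
def fittingIdeal : Ideal R :=
  ⨆ (s : ℕ) (p : (Fin s → R) →ₗ[R] M) (_ : Function.Surjective p),
    relationIdeal (LinearMap.ker p)

/-- The zeroth Fitting ideal can be computed from any presentation: two of them are compared by
`pow_mul_mem_relationIdeal` with `u = 1`. -/
theorem fittingIdeal_eq {s : ℕ} (p : (Fin s → R) →ₗ[R] M) (hp : Function.Surjective p) :
    fittingIdeal R M = relationIdeal (LinearMap.ker p) := by
  apply le_antisymm
  · refine iSup_le fun t => iSup_le fun q => iSup_le fun hq e he => ?_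
    simpa using pow_mul_mem_relationIdeal q hq p hp LinearMap.id LinearMap.id 1 (by simp) he
  · exact le_iSup_of_le s (le_iSup_of_le p (le_iSup_of_le hp le_rfl))

theorem exists_surjective_fin [Module.Finite R M] :
    ∃ (s : ℕ) (p : (Fin s → R) →ₗ[R] M), Function.Surjective p :=
  Module.Finite.exists_fin' R M

/-- If multiplication by `u` on `N` factors through `M`, then the Fitting ideal of `M` lies in that
of `N` up to a power of `u`. -/
theorem fittingIdeal_comparison [Module.Finite R M] [Module.Finite R N] (f : M →ₗ[R] N)
    (g : N →ₗ[R] M) (u : R) (hfg : ∀ b, f (g b) = u • b) :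
    ∃ n : ℕ, ∀ e ∈ fittingIdeal R M, u ^ n * e ∈ fittingIdeal R N := by
  obtain ⟨s, p, hp⟩ := exists_surjective_fin (R := R) (M := M)
  obtain ⟨t, q, hq⟩ := exists_surjective_fin (R := R) (M := N)
  refine ⟨t, fun e he => ?_⟩
  rw [fittingIdeal_eq p hp] at he
  rw [fittingIdeal_eq q hq]
  exact pow_mul_mem_relationIdeal p hp q hq f g u hfg he

theorem fittingIdeal_congr [Module.Finite R M] [Module.Finite R N] (e : M ≃ₗ[R] N) :
    fittingIdeal R M = fittingIdeal R N := by
  apply le_antisymm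
  · obtain ⟨n, hn⟩ := fittingIdeal_comparison e.toLinearMap e.symm.toLinearMap 1 (by simp)
    intro x hx
    simpa using hn x hx
  · obtain ⟨n, hn⟩ := fittingIdeal_comparison e.symm.toLinearMap e.toLinearMap 1 (by simp)
    intro x hx
    simpa using hn x hx

theorem fittingIdeal_eq_top_of_subsingleton [Subsingleton M] : fittingIdeal R M = ⊤ := by
  rw [fittingIdeal_eq (0 : (Fin 0 → R) →ₗ[R] M) fun x => ⟨0, Subsingleton.elim _ _⟩,
    Ideal.eq_top_iff_one]
  have : (1 : Matrix (Fin 0) (Fin 0) R).det ∈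
    relationIdeal (LinearMap.ker (0 : (Fin 0 → R) →ₗ[R] M)) :=
    det_mem_relationIdeal fun i => i.elim0
  simpa using this

/-- `Δ` generates the smallest principal ideal containing the Fitting ideal. -/
def IsGcdOf (𝔞 : Ideal R) (Δ : R) : Prop :=
  𝔞 ≤ Ideal.span {Δ} ∧ ∀ d : R, 𝔞 ≤ Ideal.span {d} → Ideal.span {Δ} ≤ Ideal.span {d}

theorem IsOrderOf.finite {Δ : R} (h : IsOrderOf M Δ) : Module.Finite R M := by
  obtain ⟨r, s, P, ⟨p, hp, -⟩, -⟩ := h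
  exact Module.Finite.of_surjective p hp

theorem IsOrderOf.isGcdOf {Δ : R} (h : IsOrderOf M Δ) : IsGcdOf (fittingIdeal R M) Δ := by
  obtain ⟨r, s, P, ⟨p, hp, hk⟩, h1, h2⟩ := h
  rw [elementaryIdeal_eq_relationIdeal, ← hk, ← fittingIdeal_eq p hp] at h1
  refine ⟨h1, fun d hd => h2 d ?_⟩
  rwa [elementaryIdeal_eq_relationIdeal, ← hk, ← fittingIdeal_eq p hp]

theorem IsGcdOf.isOrderOf [IsNoetherianRing R] [Module.Finite R M] {Δ : R}
    (h : IsGcdOf (fittingIdeal R M) Δ) : IsOrderOf M Δ := by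
  obtain ⟨s, p, hp⟩ := exists_surjective_fin (R := R) (M := M)
  obtain ⟨r, v, hv⟩ := Submodule.fg_iff_exists_fin_generating_family.1
    (IsNoetherian.noetherian (LinearMap.ker p))
  have hP : elementaryIdeal (Matrix.of v) = fittingIdeal R M := by
    rw [elementaryIdeal_eq_relationIdeal, fittingIdeal_eq p hp, ← hv]
    rfl
  refine ⟨r, s, Matrix.of v, ⟨p, hp, hv.symm⟩, ?_, ?_⟩
  · rw [hP]
    exact h.1
  · rw [hP]
    exact h.2

theorem isGcdOf_moduleOrder [IsNoetherianRing R] [Module.Finite R M] {δ : R}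
    (h : IsGcdOf (fittingIdeal R M) δ) : IsGcdOf (fittingIdeal R M) (moduleOrder R M) := by
  have hex : ∃ Δ : R, IsOrderOf M Δ := ⟨δ, h.isOrderOf⟩
  rw [moduleOrder, dif_pos hex]
  exact hex.choose_spec.isGcdOf

theorem isOrderOf_moduleOrder (h : moduleOrder R M ≠ 0) : IsOrderOf M (moduleOrder R M) := by
  by_cases hex : ∃ Δ : R, IsOrderOf M Δ
  · rw [moduleOrder, dif_pos hex]
    exact hex.choose_spec
  · rw [moduleOrder, dif_neg hex] at h
    exact absurd rfl h

theorem IsGcdOf.span_eq {𝔞 : Ideal R} {Δ : R} (h : IsGcdOf 𝔞 Δ) {δ : R} (hδ : 𝔞 = Ideal.span {δ}) :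
    Ideal.span {Δ} = Ideal.span {δ} :=
  le_antisymm (h.2 δ hδ.le) (hδ ▸ h.1)

theorem isGcdOf_span (δ : R) : IsGcdOf (Ideal.span {δ}) δ :=
  ⟨le_rfl, fun _ h => h⟩

/-! ### Fitting ideals of extensions -/

variable {L : Type*} [AddCommGroup L] [Module R L]

/-- An extension of modules with square presentation matrices has a block triangular presentation
matrix. -/
theorem exists_square_presentation_of_exact {s t : ℕ} (i : L →ₗ[R] M) (j : M →ₗ[R] N)
    (hj : Function.Surjective j) (hij : LinearMap.ker j = LinearMap.range i)
    (hi : Function.Injective i)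
    (p : (Fin s → R) →ₗ[R] L) (hp : Function.Surjective p) (P : Matrix (Fin s) (Fin s) R)
    (hP : LinearMap.ker p = Submodule.span R (Set.range P))
    (q : (Fin t → R) →ₗ[R] N) (hq : Function.Surjective q) (Q : Matrix (Fin t) (Fin t) R)
    (hQ : LinearMap.ker q = Submodule.span R (Set.range Q)) :
    fittingIdeal R M = Ideal.span {P.det * Q.det} := by
  have hC : ∀ k : Fin t, ∃ x, j x = q (Pi.single k 1) := fun k => hj _
  choose c hc using hC
  -- the generators of `M` are those of `L` and lifts of those of `N`
  let w : (Fin t → R) →ₗ[R] M := Fintype.linearCombination R c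
  have hw : ∀ x, j (w x) = q x := by
    intro x
    conv_rhs => rw [← Finset.univ_sum_single x]
    simp only [w, Fintype.linearCombination_apply, map_sum, map_smul, hc]
    refine Finset.sum_congr rfl fun k _ => ?_
    rw [← map_smul, ← Pi.single_smul, smul_eq_mul, mul_one]
  have hX : ∀ k : Fin t, ∃ x, i (p x) = w (Q k) := by
    intro k
    have h1 : w (Q k) ∈ LinearMap.ker j := by
      rw [LinearMap.mem_ker, hw, ← LinearMap.mem_ker, hQ]
      exact Submodule.subset_span ⟨k, rfl⟩
    rw [hij] at h1
    obtain ⟨y, hy⟩ := h1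
    obtain ⟨x, rfl⟩ := hp y
    exact ⟨x, hy⟩
  choose X hX using hX
  let e : (Fin (s + t) → R) ≃ₗ[R] (Fin s ⊕ Fin t → R) :=
    LinearEquiv.funCongrLeft R R finSumFinEquiv
  let m' : (Fin s ⊕ Fin t → R) →ₗ[R] M :=
    (i ∘ₗ p) ∘ₗ LinearMap.funLeft R R Sum.inl + w ∘ₗ LinearMap.funLeft R R Sum.inr
  have hm' : ∀ x, m' x = i (p (x ∘ Sum.inl)) + w (x ∘ Sum.inr) := fun x => rfl
  have hsurj : Function.Surjective m' := by
    intro y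
    obtain ⟨b, hb⟩ := hq (j y)
    have : y - w b ∈ LinearMap.ker j := by
      rw [LinearMap.mem_ker, map_sub, hw, hb, sub_self]
    rw [hij] at this
    obtain ⟨l, hl⟩ := this
    obtain ⟨a, rfl⟩ := hp l
    refine ⟨Sum.elim a b, ?_⟩
    rw [hm', Sum.elim_comp_inl, Sum.elim_comp_inr, hl, sub_add_cancel]
  let D : Matrix (Fin s ⊕ Fin t) (Fin s ⊕ Fin t) R :=
    Matrix.fromBlocks P 0 (-Matrix.of X) Q
  have hDl : ∀ k, D (Sum.inl k) = Sum.elim (P k) 0 := by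
    intro k
    ext (l | l) <;> simp [D]
  have hDr : ∀ k, D (Sum.inr k) = Sum.elim (-X k) (Q k) := by
    intro k
    ext (l | l) <;> simp [D]
  have hker : LinearMap.ker m' = Submodule.span R (Set.range D) := by
    apply le_antisymm
    · intro x hx
      rw [LinearMap.mem_ker, hm'] at hx
      have hb : x ∘ Sum.inr ∈ LinearMap.ker q := by
        rw [LinearMap.mem_ker, ← hw]
        have : j (i (p (x ∘ Sum.inl))) = 0 := by
          rw [← LinearMap.mem_ker, hij]
          exact ⟨_, rfl⟩
        rw [← zero_add (j (w (x ∘ Sum.inr))), ← this, ← map_add, hx, map_zero, this]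
      rw [hQ] at hb
      obtain ⟨y, hy⟩ := (Submodule.mem_span_range_iff_exists_fun R).1 hb
      have hwy : w (x ∘ Sum.inr) = i (p (∑ k, y k • X k)) := by
        rw [← hy]
        simp only [map_sum, map_smul, hX]
      have ha : x ∘ Sum.inl + ∑ k, y k • X k ∈ LinearMap.ker p := by
        rw [LinearMap.mem_ker]
        apply hi
        rw [map_add, map_add, ← hwy, hx, map_zero]
      rw [hP] at ha
      obtain ⟨z, hz⟩ := (Submodule.mem_span_range_iff_exists_fun R).1 ha
      have hxeq : x = ∑ k, z k • D (Sum.inl k) + ∑ k, y k • D (Sum.inr k) := by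
        ext (l | l)
        · have h1 := congrFun hz l
          simp only [Finset.sum_apply, Pi.smul_apply, Pi.add_apply, Function.comp_apply,
            smul_eq_mul] at h1
          simp only [hDl, hDr, Pi.add_apply, Finset.sum_apply, Pi.smul_apply, Sum.elim_inl,
            Pi.neg_apply, smul_eq_mul, mul_neg, Finset.sum_neg_distrib]
          rw [h1]
          ring
        · have h1 := congrFun hy l
          simp only [Finset.sum_apply, Pi.smul_apply, Function.comp_apply, smul_eq_mul] at h1
          simp [hDl, hDr, ← h1]
      rw [hxeq]
      exact add_mem (sum_mem fun k _ => Submodule.smul_mem _ _ (Submodule.subset_span ⟨_, rfl⟩))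
        (sum_mem fun k _ => Submodule.smul_mem _ _ (Submodule.subset_span ⟨_, rfl⟩))
    · refine Submodule.span_le.2 ?_
      rintro _ ⟨k | k, rfl⟩
      · rw [SetLike.mem_coe, LinearMap.mem_ker, hm', hDl, Sum.elim_comp_inl, Sum.elim_comp_inr,
          map_zero, add_zero]
        have : P k ∈ LinearMap.ker p := hP ▸ Submodule.subset_span ⟨k, rfl⟩
        rw [LinearMap.mem_ker.1 this, map_zero]
      · rw [SetLike.mem_coe, LinearMap.mem_ker, hm', hDr, Sum.elim_comp_inl, Sum.elim_comp_inr,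
          map_neg, map_neg, hX, neg_add_cancel]
  have hfin : fittingIdeal R M = relationIdeal (LinearMap.ker (m' ∘ₗ e.toLinearMap)) :=
    fittingIdeal_eq _ (hsurj.comp e.surjective)
  have hker2 : LinearMap.ker (m' ∘ₗ e.toLinearMap) =
      Submodule.span R (Set.range (D.submatrix finSumFinEquiv.symm finSumFinEquiv.symm)) := by
    rw [LinearMap.ker_comp, hker]
    have : (Submodule.span R (Set.range D)).comap e.toLinearMap =
        (Submodule.span R (Set.range D)).map e.symm.toLinearMap :=
      Submodule.comap_equiv_eq_map_symm _ _
    rw [this, Submodule.map_span]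
    congr 1
    ext x
    constructor
    · rintro ⟨_, ⟨k, rfl⟩, rfl⟩
      exact ⟨finSumFinEquiv k, by ext l; simp [e, LinearEquiv.funCongrLeft]⟩
    · rintro ⟨k, rfl⟩
      exact ⟨_, ⟨finSumFinEquiv.symm k, rfl⟩, by ext l; simp [e, LinearEquiv.funCongrLeft]⟩
  rw [hfin, hker2, relationIdeal_span_square, Matrix.det_submatrix_equiv_self,
    Matrix.det_fromBlocks_zero₁₂]

/-- Over a principal ideal domain every finitely generated module has a square presentation. -/
theorem exists_square_presentation [IsDomain R] [IsPrincipalIdealRing R] [Module.Finite R M] :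
    ∃ (s : ℕ) (p : (Fin s → R) →ₗ[R] M) (P : Matrix (Fin s) (Fin s) R),
      Function.Surjective p ∧ LinearMap.ker p = Submodule.span R (Set.range P) := by
  obtain ⟨s, p, hp⟩ := exists_surjective_fin (R := R) (M := M)
  obtain ⟨n, hn, b⟩ : ∃ n, ∃ _ : n ≤ s, Nonempty (Module.Basis (Fin n) R (LinearMap.ker p)) := by
    obtain ⟨n, b⟩ := Submodule.basisOfPid (Pi.basisFun R (Fin s)) (LinearMap.ker p)
    refine ⟨n, ?_, ⟨b⟩⟩
    have h1 := b.linearIndependent.map' (LinearMap.ker p).subtype (Submodule.ker_subtype _)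
    simpa using h1.fintype_card_le_finrank
  obtain ⟨b⟩ := b
  -- pad a basis of the relations by zero rows
  let P : Matrix (Fin s) (Fin s) R := fun i => if h : (i : ℕ) < n then (b ⟨i, h⟩ : Fin s → R) else 0
  refine ⟨s, p, P, hp, ?_⟩
  have h1 : LinearMap.ker p = Submodule.span R (Set.range fun i => (b i : Fin s → R)) := by
    have := congrArg (Submodule.map (LinearMap.ker p).subtype) b.span_eq
    rw [Submodule.map_span, ← Set.range_comp, Submodule.map_subtype_top] at this
    exact this.symm
  rw [h1]
  apply le_antisymm <;> refine Submodule.span_le.2 ?_ <;> rintro _ ⟨i, rfl⟩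
  · refine Submodule.subset_span ⟨Fin.castLE hn i, ?_⟩
    simp [P]
  · by_cases h : (i : ℕ) < n
    · refine Submodule.subset_span ⟨⟨i, h⟩, ?_⟩
      simp [P, h]
    · simp [P, h]

theorem fittingIdeal_of_square {s : ℕ} (p : (Fin s → R) →ₗ[R] M) (hp : Function.Surjective p)
    (P : Matrix (Fin s) (Fin s) R) (hP : LinearMap.ker p = Submodule.span R (Set.range P)) :
    fittingIdeal R M = Ideal.span {P.det} := by
  rw [fittingIdeal_eq p hp, hP, relationIdeal_span_square]

/-- Over a principal ideal domain Fitting ideals are multiplicative in extensions. -/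
theorem fittingIdeal_exact [IsDomain R] [IsPrincipalIdealRing R] [Module.Finite R L]
    [Module.Finite R N] (i : L →ₗ[R] M) (j : M →ₗ[R] N) (hj : Function.Surjective j)
    (hij : LinearMap.ker j = LinearMap.range i) (hi : Function.Injective i) :
    fittingIdeal R M = fittingIdeal R L * fittingIdeal R N := by
  obtain ⟨s, p, P, hp, hP⟩ := exists_square_presentation (R := R) (M := L)
  obtain ⟨t, q, Q, hq, hQ⟩ := exists_square_presentation (R := R) (M := N)
  rw [exists_square_presentation_of_exact i j hj hij hi p hp P hP q hq Q hQ,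
    fittingIdeal_of_square p hp P hP, fittingIdeal_of_square q hq Q hQ,
    Ideal.span_singleton_mul_span_singleton]

end Fitting

/-! ### The universal derivation module of a representation -/

section Derivations

variable {R : Type*} [CommRing R] {G : Type*} [Group G] {V : Type*} [AddCommGroup V] [Module R V]
  {W : Type*} [AddCommGroup W] [Module R W]

/-- A derivation of a group `G` with values in the linear maps `V → W`, where `G` acts on `V`
through `ρ` and trivially on `W`. -/
def IsDerivation (ρ : G →* Module.End R V) (d : G → V →ₗ[R] W) : Prop :=
  ∀ g h, d (g * h) = d h + d g ∘ₗ ρ h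

variable (ρ : G →* Module.End R V)

/-- The relations that make `g ↦ [g]` a derivation. -/
def derivationRelations : Submodule R (G →₀ V) :=
  Submodule.span R {c | ∃ (g h : G) (v : V),
    c = Finsupp.single (g * h) v - Finsupp.single h v - Finsupp.single g (ρ h v)}

/-- The module with the universal derivation `g ↦ (v ↦ [g] v)`. Topologically it is the
homology, relative to a base point, of a space with fundamental group `G`. -/
abbrev DerivationModule : Type _ := (G →₀ V) ⧸ derivationRelations ρ

/-- The universal derivation. -/
def univDerivation (g : G) : V →ₗ[R] DerivationModule ρ :=
  (derivationRelations ρ).mkQ ∘ₗ Finsupp.lsingle g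

theorem isDerivation_univDerivation : IsDerivation ρ (univDerivation ρ) := by
  intro g h
  ext v
  have : Finsupp.single (g * h) v - Finsupp.single h v - Finsupp.single g (ρ h v) ∈
    derivationRelations ρ := Submodule.subset_span ⟨g, h, v, rfl⟩
  rw [← Submodule.Quotient.mk_eq_zero, Submodule.Quotient.mk_sub, Submodule.Quotient.mk_sub,
    sub_sub, sub_eq_zero] at this
  exact this

variable {ρ}

theorem IsDerivation.map_one {d : G → V →ₗ[R] W} (hd : IsDerivation ρ d) : d 1 = 0 := by
  have := hd 1 1
  rw [mul_one, _root_.map_one, Module.End.one_eq_id, LinearMap.comp_id] at this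
  exact left_eq_add.1 this

theorem IsDerivation.comp {d : G → V →ₗ[R] W} (hd : IsDerivation ρ d) {W' : Type*}
    [AddCommGroup W'] [Module R W'] (f : W →ₗ[R] W') : IsDerivation ρ fun g => f ∘ₗ d g := by
  intro g h
  simp only [hd g h, LinearMap.comp_add, LinearMap.comp_assoc]

/-- The linear map on the universal derivation module that corresponds to a derivation. -/
def derivationLift (d : G → V →ₗ[R] W) (hd : IsDerivation ρ d) : DerivationModule ρ →ₗ[R] W :=
  (derivationRelations ρ).liftQ (Finsupp.lsum ℕ d) (by
    refine Submodule.span_le.2 ?_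
    rintro _ ⟨g, h, v, rfl⟩
    rw [SetLike.mem_coe, LinearMap.mem_ker, map_sub, map_sub]
    simp only [Finsupp.lsum_single]
    rw [hd g h]
    simp)

@[simp]
theorem derivationLift_apply (d : G → V →ₗ[R] W) (hd : IsDerivation ρ d) (g : G) (v : V) :
    derivationLift d hd (univDerivation ρ g v) = d g v := by
  change Finsupp.lsum ℕ d (Finsupp.single g v) = d g v
  rw [Finsupp.lsum_single]

theorem derivationModule_hom_ext {f f' : DerivationModule ρ →ₗ[R] W}
    (h : ∀ g v, f (univDerivation ρ g v) = f' (univDerivation ρ g v)) : f = f' := by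
  apply Submodule.linearMap_qext
  refine Finsupp.lhom_ext fun g v => ?_
  exact h g v

theorem derivationModule_induction {P : DerivationModule ρ → Prop} (x : DerivationModule ρ)
    (h0 : P 0) (hadd : ∀ x y, P x → P y → P (x + y)) (h1 : ∀ g v, P (univDerivation ρ g v)) :
    P x := by
  induction x using Submodule.Quotient.induction_on with
  | _ x =>
    induction x using Finsupp.induction_linear with
    | zero => exact h0
    | add x y hx hy => exact hadd _ _ hx hy
    | single g v => exact h1 g v

theorem isDerivation_sub_one : IsDerivation ρ fun g => ρ g - 1 := by
  intro g h
  ext v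
  simp

variable (ρ) in
/-- The map `[g] v ↦ g v - v`, whose kernel is the first and whose cokernel is the zeroth homology
of `G` with coefficients in `V`. -/
def augmentation : DerivationModule ρ →ₗ[R] V :=
  derivationLift (fun g => ρ g - 1) isDerivation_sub_one

@[simp]
theorem augmentation_apply (g : G) (v : V) : augmentation ρ (univDerivation ρ g v) = ρ g v - v := by
  simp [augmentation]

/-! ### Relative derivation modules -/

variable (ρ) in
/-- The submodule of the universal derivation module generated by the `[s] v` with `s ∈ S`. -/
def derivationSubmodule (S : Set G) : Submodule R (DerivationModule ρ) :=
  Submodule.span R {x | ∃ s ∈ S, ∃ v, x = univDerivation ρ s v}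

variable (ρ) in
/-- The universal module for derivations that vanish on `S`. -/
abbrev RelDerivationModule (S : Set G) : Type _ := DerivationModule ρ ⧸ derivationSubmodule ρ S

variable {S : Set G}

variable (ρ S) in
/-- The universal derivation that vanishes on `S`. -/
def relDerivation (g : G) : V →ₗ[R] RelDerivationModule ρ S :=
  (derivationSubmodule ρ S).mkQ ∘ₗ univDerivation ρ g

theorem isDerivation_relDerivation : IsDerivation ρ (relDerivation ρ S) :=
  (isDerivation_univDerivation ρ).comp _

theorem relDerivation_eq_zero {s : G} (hs : s ∈ S) : relDerivation ρ S s = 0 := by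
  ext v
  exact (Submodule.Quotient.mk_eq_zero _).2 (Submodule.subset_span ⟨s, hs, v, rfl⟩)

/-- The linear map that corresponds to a derivation that vanishes on `S`. -/
def relDerivationLift (d : G → V →ₗ[R] W) (hd : IsDerivation ρ d) (hS : ∀ s ∈ S, d s = 0) :
    RelDerivationModule ρ S →ₗ[R] W :=
  (derivationSubmodule ρ S).liftQ (derivationLift d hd) (by
    refine Submodule.span_le.2 ?_
    rintro _ ⟨s, hs, v, rfl⟩
    simp [hS s hs])

@[simp]
theorem relDerivationLift_apply (d : G → V →ₗ[R] W) (hd : IsDerivation ρ d)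
    (hS : ∀ s ∈ S, d s = 0) (g : G) (v : V) :
    relDerivationLift d hd hS (relDerivation ρ S g v) = d g v := by
  change derivationLift d hd (univDerivation ρ g v) = d g v
  simp

theorem relDerivationModule_hom_ext {f f' : RelDerivationModule ρ S →ₗ[R] W}
    (h : ∀ g v, f (relDerivation ρ S g v) = f' (relDerivation ρ S g v)) : f = f' := by
  apply Submodule.linearMap_qext
  exact derivationModule_hom_ext h

variable (ρ S) in
/-- The submodule of `V` generated by the `s v - v` with `s ∈ S`. -/
def augmentationSubmodule : Submodule R V := (derivationSubmodule ρ S).map (augmentation ρ)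

theorem sub_mem_augmentationSubmodule {s : G} (hs : s ∈ S) (v : V) :
    ρ s v - v ∈ augmentationSubmodule ρ S :=
  ⟨univDerivation ρ s v, Submodule.subset_span ⟨s, hs, v, rfl⟩, augmentation_apply s v⟩

theorem augmentationSubmodule_le {T : Submodule R V} (h : ∀ s ∈ S, ∀ v, ρ s v - v ∈ T) :
    augmentationSubmodule ρ S ≤ T := by
  rw [augmentationSubmodule, derivationSubmodule, Submodule.map_span_le]
  rintro _ ⟨s, hs, v, rfl⟩
  rw [augmentation_apply]
  exact h s hs v

variable (ρ S) in
/-- The boundary map of the exact sequence of the pair `(G, S)`. -/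
def relBoundary : RelDerivationModule ρ S →ₗ[R] V ⧸ augmentationSubmodule ρ S :=
  (derivationSubmodule ρ S).mapQ _ (augmentation ρ) (Submodule.le_comap_map _ _)

variable (ρ S) in
/-- The map from the first homology to the relative derivation module. -/
def kerToRel : LinearMap.ker (augmentation ρ) →ₗ[R] RelDerivationModule ρ S :=
  (derivationSubmodule ρ S).mkQ ∘ₗ (LinearMap.ker (augmentation ρ)).subtype

/-- Exactness of the sequence of the pair `(G, S)` at the relative derivation module. -/
theorem ker_relBoundary : LinearMap.ker (relBoundary ρ S) = LinearMap.range (kerToRel ρ S) := by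
  ext x
  obtain ⟨x, rfl⟩ := Submodule.mkQ_surjective _ x
  constructor
  · intro hx
    have hx' : augmentation ρ x ∈ augmentationSubmodule ρ S :=
      (Submodule.Quotient.mk_eq_zero _).1 hx
    obtain ⟨y, hy, hxy⟩ := hx'
    refine ⟨⟨x - y, ?_⟩, ?_⟩
    · rw [LinearMap.mem_ker, map_sub, hxy, sub_self]
    · change (derivationSubmodule ρ S).mkQ (x - y) = _
      rw [map_sub]
      have : (derivationSubmodule ρ S).mkQ y = 0 := (Submodule.Quotient.mk_eq_zero _).2 hy
      rw [this, sub_zero]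
  · rintro ⟨⟨y, hy⟩, hxy⟩
    rw [LinearMap.mem_ker] at hy ⊢
    rw [← hxy]
    change (augmentationSubmodule ρ S).mkQ (augmentation ρ y) = 0
    rw [hy, map_zero]

theorem kerToRel_injective
    (h : ∀ x ∈ derivationSubmodule ρ S, augmentation ρ x = 0 → x = 0) :
    Function.Injective (kerToRel ρ S) := by
  rw [← LinearMap.ker_eq_bot, LinearMap.ker_eq_bot']
  rintro ⟨x, hx⟩ hx0
  have : x ∈ derivationSubmodule ρ S := (Submodule.Quotient.mk_eq_zero _).1 hx0
  exact Subtype.ext (h x this hx)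

theorem mem_derivationSubmodule_singleton {s : G} {x : DerivationModule ρ}
    (hx : x ∈ derivationSubmodule ρ {s}) : ∃ v, x = univDerivation ρ s v := by
  have : derivationSubmodule ρ {s} ≤ LinearMap.range (univDerivation ρ s) := by
    refine Submodule.span_le.2 ?_
    rintro _ ⟨_, rfl, v, rfl⟩
    exact ⟨v, rfl⟩
  obtain ⟨v, rfl⟩ := this hx
  exact ⟨v, rfl⟩

theorem mem_derivationSubmodule_pair {s t : G} {x : DerivationModule ρ}
    (hx : x ∈ derivationSubmodule ρ {s, t}) :
    ∃ v w, x = univDerivation ρ s v + univDerivation ρ t w := by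
  have : derivationSubmodule ρ {s, t} ≤
      LinearMap.range (univDerivation ρ s) ⊔ LinearMap.range (univDerivation ρ t) := by
    refine Submodule.span_le.2 ?_
    rintro _ ⟨_, rfl | rfl, v, rfl⟩
    · exact Submodule.mem_sup_left ⟨v, rfl⟩
    · exact Submodule.mem_sup_right ⟨v, rfl⟩
  obtain ⟨_, ⟨v, rfl⟩, _, ⟨w, rfl⟩, rfl⟩ := Submodule.mem_sup.1 (this hx)
  exact ⟨v, w, rfl⟩

theorem augmentationSubmodule_singleton (s : G) :
    augmentationSubmodule ρ {s} = LinearMap.range (ρ s - 1) := by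
  apply le_antisymm
  · refine augmentationSubmodule_le ?_
    rintro _ rfl v
    exact ⟨v, by simp⟩
  · rintro _ ⟨v, rfl⟩
    simpa using sub_mem_augmentationSubmodule (ρ := ρ) (Set.mem_singleton s) v

/-! ### Coefficients in a free module -/

section Free

variable {k : ℕ} (ρ : G →* Module.End R (Fin k → R)) (μ : G)

theorem fittingIdeal_quotient_range (T : (Fin k → R) →ₗ[R] (Fin k → R)) :
    fittingIdeal R ((Fin k → R) ⧸ LinearMap.range T) = Ideal.span {LinearMap.det T} := by
  rw [← LinearMap.det_toMatrix', ← Matrix.det_transpose]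
  refine fittingIdeal_of_square (LinearMap.range T).mkQ (Submodule.mkQ_surjective _) _ ?_
  rw [Submodule.ker_mkQ, LinearMap.range_eq_map, ← (Pi.basisFun R (Fin k)).span_eq,
    Submodule.map_span, ← Set.range_comp]
  congr 2
  ext i j
  simp [LinearMap.toMatrix'_apply]

theorem injective_of_det_ne_zero [IsDomain R] {T : (Fin k → R) →ₗ[R] (Fin k → R)}
    (h : LinearMap.det T ≠ 0) {v : Fin k → R} (hv : T v = 0) : v = 0 := by
  rw [← LinearMap.det_toMatrix'] at h
  refine Matrix.eq_zero_of_mulVec_eq_zero h ?_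
  rw [← Matrix.toLin'_apply, Matrix.toLin'_toMatrix', hv]

theorem kerToRel_singleton_injective [IsDomain R] (h : LinearMap.det (ρ μ - 1) ≠ 0) :
    Function.Injective (kerToRel ρ {μ}) := by
  refine kerToRel_injective fun x hx hx0 => ?_
  obtain ⟨v, rfl⟩ := mem_derivationSubmodule_singleton hx
  rw [augmentation_apply] at hx0
  rw [injective_of_det_ne_zero h (v := v) (by simpa using hx0), map_zero]

/-- The exact sequence of the pair `(G, μ)`, as an identity of Fitting ideals: both sides are
`H₁ ↪ RelDerivationModule → V / (μ - 1) ↠ H₀`. -/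
theorem fittingIdeal_relDerivationModule [IsDomain R] [IsPrincipalIdealRing R]
    [Module.Finite R (LinearMap.ker (augmentation ρ))] (h : LinearMap.det (ρ μ - 1) ≠ 0) :
    Module.Finite R (RelDerivationModule ρ {μ}) ∧
    fittingIdeal R (RelDerivationModule ρ {μ}) *
      fittingIdeal R ((Fin k → R) ⧸ LinearMap.range (augmentation ρ)) =
    fittingIdeal R (LinearMap.ker (augmentation ρ)) * Ideal.span {LinearMap.det (ρ μ - 1)} := by
  set b := relBoundary ρ {μ} with hb
  have hinj := kerToRel_singleton_injective ρ μ h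
  have hker : LinearMap.ker b.rangeRestrict = LinearMap.range (kerToRel ρ {μ}) := by
    rw [LinearMap.ker_rangeRestrict]
    exact ker_relBoundary
  have e1 := fittingIdeal_exact (kerToRel ρ {μ}) b.rangeRestrict b.surjective_rangeRestrict hker
    hinj
  have hle : augmentationSubmodule ρ {μ} ≤ LinearMap.range (augmentation ρ) := by
    rw [augmentationSubmodule]
    exact LinearMap.map_le_range
  let j : ((Fin k → R) ⧸ augmentationSubmodule ρ {μ}) →ₗ[R]
      ((Fin k → R) ⧸ LinearMap.range (augmentation ρ)) := Submodule.factor hle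
  have hj : Function.Surjective j := Submodule.factor_surjective hle
  have hjk : LinearMap.ker j = LinearMap.range (LinearMap.range b).subtype := by
    rw [Submodule.range_subtype]
    ext y
    obtain ⟨y, rfl⟩ := Submodule.mkQ_surjective _ y
    have h1 : (augmentationSubmodule ρ {μ}).mkQ y ∈ LinearMap.ker j ↔
        y ∈ LinearMap.range (augmentation ρ) := by
      rw [LinearMap.mem_ker, ← Submodule.Quotient.mk_eq_zero]
      rfl
    rw [h1]
    constructor
    · rintro ⟨x, rfl⟩
      exact ⟨(derivationSubmodule ρ {μ}).mkQ x, rfl⟩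
    · rintro ⟨x, hx⟩
      obtain ⟨x, rfl⟩ := Submodule.mkQ_surjective _ x
      have h2 : augmentation ρ x - y ∈ augmentationSubmodule ρ {μ} :=
        (Submodule.Quotient.eq _).1 hx
      have h3 := (LinearMap.range (augmentation ρ)).sub_mem ⟨x, rfl⟩ (hle h2)
      simpa using h3
  have e2 := fittingIdeal_exact (LinearMap.range b).subtype j hj hjk (Submodule.subtype_injective _)
  have e3 : fittingIdeal R ((Fin k → R) ⧸ augmentationSubmodule ρ {μ}) =
      Ideal.span {LinearMap.det (ρ μ - 1)} := by
    rw [augmentationSubmodule_singleton, fittingIdeal_quotient_range]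
  rw [e3] at e2
  constructor
  · have h1 : Module.Finite R (LinearMap.range (kerToRel ρ {μ})) :=
      Module.Finite.range _
    have h2 : (⊤ : Submodule R (RelDerivationModule ρ {μ})).FG := by
      refine Submodule.fg_of_fg_map_of_fg_inf_ker b ?_ ?_
      · exact IsNoetherian.noetherian _
      · rw [top_inf_eq, ker_relBoundary]
        exact Module.Finite.iff_fg.1 h1
    exact ⟨h2⟩
  · rw [e1, mul_assoc, ← e2]

end Free

end Derivations

/-! ### Base change of relative derivation modules -/

section BaseChange

variable {R S : Type*} [CommRing R] [CommRing S] [Algebra R S] {G : Type*} [Group G] {k : ℕ}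

variable (R S) in
/-- The inclusion `R^n → S^n`. -/
def mapVec (n : Type*) : (n → R) →ₗ[R] (n → S) :=
  LinearMap.compLeft (Algebra.linearMap R S) n

@[simp]
theorem mapVec_apply {n : Type*} (v : n → R) (a : n) :
    mapVec R S n v a = algebraMap R S (v a) := rfl

theorem mapVec_single {n : Type*} [DecidableEq n] (a : n) :
    mapVec R S n (Pi.single a 1) = Pi.single a 1 := by
  ext b
  by_cases h : b = a
  · subst h
    simp
  · simp [h]

section Extend

variable {R S : Type*} [CommRing R] [CommRing S] {W : Type*} [AddCommGroup W] [Module R W]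
  [Module S W]

/-- The `S`-linear extension of an `R`-linear map on `R^n`. -/
def extendVec {n : Type*} [Finite n] [DecidableEq n] (f : (n → R) →ₗ[R] W) : (n → S) →ₗ[S] W :=
  (Pi.basisFun S n).constr S fun a => f (Pi.single a 1)

theorem extendVec_single {n : Type*} [Finite n] [DecidableEq n] (f : (n → R) →ₗ[R] W) (a : n) :
    (extendVec f : (n → S) →ₗ[S] W) (Pi.single a 1) = f (Pi.single a 1) := by
  have := (Pi.basisFun S n).constr_basis S (fun a => f (Pi.single a 1)) a
  rwa [Pi.basisFun_apply] at this

end Extend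

variable {W : Type*} [AddCommGroup W] [Module R W] [Module S W]

theorem extendVec_mapVec [IsScalarTower R S W] {n : Type*} [Finite n] [DecidableEq n] (f : (n → R) →ₗ[R] W) (v : n → R) :
    (extendVec f : (n → S) →ₗ[S] W) (mapVec R S n v) = f v := by
  have : ((extendVec f : (n → S) →ₗ[S] W).restrictScalars R) ∘ₗ mapVec R S n = f := by
    refine (Pi.basisFun R n).ext fun a => ?_
    rw [Pi.basisFun_apply, LinearMap.comp_apply, mapVec_single]
    exact extendVec_single f a
  exact LinearMap.congr_fun this v

theorem hom_ext_mapVec {W : Type*} [AddCommGroup W] [Module S W] {n : Type*} [Finite n]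
    {f f' : (n → S) →ₗ[S] W}
    (h : ∀ v : n → R, f (mapVec R S n v) = f' (mapVec R S n v)) : f = f' := by
  classical
  refine (Pi.basisFun S n).ext fun a => ?_
  rw [Pi.basisFun_apply, ← mapVec_single (R := R)]
  exact h _

/-- The relative derivation module over `S` has the same presentation matrix as the one over `R`,
also if the representation over `S` is conjugated by `A`. -/
theorem relDerivationModule_baseChange (ρ : G →* Module.End R (Fin k → R))
    (ρ' : G →* Module.End S (Fin k → S)) (A : (Fin k → S) ≃ₗ[S] (Fin k → S))
    (hA : ∀ g v, ρ' g (A (mapVec R S _ v)) = A (mapVec R S _ (ρ g v))) (T : Set G) {s r : ℕ}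
    (p : (Fin s → R) →ₗ[R] RelDerivationModule ρ T) (hp : Function.Surjective p)
    (P : Matrix (Fin r) (Fin s) R) (hP : LinearMap.ker p = Submodule.span R (Set.range P)) :
    ∃ q : (Fin s → S) →ₗ[S] RelDerivationModule ρ' T, Function.Surjective q ∧
      LinearMap.ker q = Submodule.span S (Set.range (P.map (algebraMap R S))) := by
  -- `Φ` compares the two universal modules. The module `C` with the extended presentation maps
  -- back by `Ψ`, which extends the projection `Θ` of the module over `R`; it shows that there are
  -- no further relations.
  let Φ : RelDerivationModule ρ T →ₗ[R] RelDerivationModule ρ' T :=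
    relDerivationLift (fun g => (relDerivation ρ' T g).restrictScalars R ∘ₗ
        A.toLinearMap.restrictScalars R ∘ₗ mapVec R S (Fin k))
      (by
        intro g h
        refine LinearMap.ext fun v => ?_
        simp only [LinearMap.comp_apply, LinearMap.add_apply, LinearMap.restrictScalars_apply,
          LinearEquiv.coe_coe]
        rw [isDerivation_relDerivation g h, LinearMap.add_apply, LinearMap.comp_apply, hA])
      (by
        intro s hs
        rw [relDerivation_eq_zero hs]
        rfl)
  have hΦ : ∀ g v, Φ (relDerivation ρ T g v) = relDerivation ρ' T g (A (mapVec R S _ v)) :=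
    fun g v => relDerivationLift_apply _ _ _ g v
  let C := (Fin s → S) ⧸ Submodule.span S (Set.range (P.map (algebraMap R S)))
  let mk : (Fin s → S) →ₗ[S] C := Submodule.mkQ _
  have hmk : ∀ x, p x = 0 → mk (mapVec R S _ x) = 0 := by
    intro x hx
    rw [← LinearMap.mem_ker, hP] at hx
    induction hx using Submodule.span_induction with
    | mem x h =>
      obtain ⟨i, rfl⟩ := h
      exact (Submodule.Quotient.mk_eq_zero _).2 (Submodule.subset_span ⟨i, rfl⟩)
    | zero => rw [map_zero, map_zero]
    | add x y _ _ hx hy => rw [map_add, map_add, hx, hy, add_zero]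
    | smul a x _ hx =>
      rw [map_smul, ← algebraMap_smul S a, map_smul, hx, smul_zero]
  let Θ : RelDerivationModule ρ T →ₗ[R] C :=
    (((LinearMap.ker p).liftQ (mk.restrictScalars R ∘ₗ mapVec R S (Fin s))
      (fun x hx => hmk x hx)) ∘ₗ (p.quotKerEquivOfSurjective hp).symm.toLinearMap)
  have hΘ : ∀ x, Θ (p x) = mk (mapVec R S _ x) := by
    intro x
    have : (p.quotKerEquivOfSurjective hp).symm (p x) = Submodule.Quotient.mk x := by
      rw [LinearEquiv.symm_apply_eq]
      rfl
    simp only [Θ, LinearMap.comp_apply, LinearEquiv.coe_coe, this]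
    rfl
  let Ψ : RelDerivationModule ρ' T →ₗ[S] C :=
    relDerivationLift (fun g => extendVec (Θ ∘ₗ relDerivation ρ T g) ∘ₗ A.symm.toLinearMap)
      (by
        intro g h
        have : ∀ f f' : (Fin k → S) →ₗ[S] C, f ∘ₗ A.toLinearMap = f' ∘ₗ A.toLinearMap → f = f' := by
          intro f f' h
          refine LinearMap.ext fun v => ?_
          obtain ⟨v, rfl⟩ := A.surjective v
          exact LinearMap.congr_fun h v
        apply this
        apply hom_ext_mapVec (R := R)
        intro v
        simp only [LinearMap.comp_apply, LinearMap.add_apply, LinearEquiv.coe_coe, hA,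
          LinearEquiv.symm_apply_apply, extendVec_mapVec]
        rw [isDerivation_relDerivation g h, LinearMap.add_apply, LinearMap.comp_apply]
        exact map_add Θ _ _)
      (by
        intro s hs
        rw [relDerivation_eq_zero hs, LinearMap.comp_zero]
        ext
        simp [extendVec])
  have hΨ : ∀ x, Ψ (Φ x) = Θ x := by
    intro x
    have : Ψ.restrictScalars R ∘ₗ Φ = Θ := by
      refine relDerivationModule_hom_ext fun g v => ?_
      rw [LinearMap.comp_apply, hΦ, LinearMap.restrictScalars_apply]
      refine (relDerivationLift_apply _ _ _ _ _).trans ?_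
      rw [LinearMap.comp_apply, LinearEquiv.coe_coe, LinearEquiv.symm_apply_apply, extendVec_mapVec,
        LinearMap.comp_apply]
    exact LinearMap.congr_fun this x
  let q : (Fin s → S) →ₗ[S] RelDerivationModule ρ' T := extendVec (Φ ∘ₗ p)
  have hq : ∀ x, q (mapVec R S _ x) = Φ (p x) := fun x => extendVec_mapVec _ x
  refine ⟨q, ?_, ?_⟩
  · rw [← LinearMap.range_eq_top, eq_top_iff]
    intro y _
    have hrel : ∀ g v, relDerivation ρ' T g v ∈ LinearMap.range q := by
      intro g v
      have h1 : (LinearMap.range q).mkQ ∘ₗ relDerivation ρ' T g ∘ₗ A.toLinearMap = 0 := by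
        apply hom_ext_mapVec (R := R)
        intro v
        rw [LinearMap.comp_apply, LinearMap.comp_apply, LinearEquiv.coe_coe, ← hΦ]
        obtain ⟨x, hx⟩ := hp (relDerivation ρ T g v)
        rw [← hx, ← hq]
        exact (Submodule.Quotient.mk_eq_zero _).2 ⟨_, rfl⟩
      have h2 := LinearMap.congr_fun h1 (A.symm v)
      simp only [LinearMap.comp_apply, LinearEquiv.coe_coe, LinearEquiv.apply_symm_apply] at h2
      exact (Submodule.Quotient.mk_eq_zero _).1 h2
    obtain ⟨y, rfl⟩ := Submodule.mkQ_surjective _ y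
    induction y using derivationModule_induction with
    | h0 => rw [map_zero]; exact zero_mem _
    | hadd x y hx hy => rw [map_add]; exact add_mem (hx trivial) (hy trivial)
    | h1 g v => exact hrel g v
  · apply le_antisymm
    · intro x hx
      have : Ψ ∘ₗ q = mk := by
        apply hom_ext_mapVec (R := R)
        intro v
        rw [LinearMap.comp_apply, hq, hΨ, hΘ]
      rw [← Submodule.Quotient.mk_eq_zero]
      change mk x = 0
      rw [← this, LinearMap.comp_apply, LinearMap.mem_ker.1 hx, map_zero]
    · refine Submodule.span_le.2 ?_
      rintro _ ⟨i, rfl⟩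
      have h1 : P i ∈ LinearMap.ker p := hP ▸ Submodule.subset_span ⟨i, rfl⟩
      have h2 := hq (P i)
      rw [LinearMap.mem_ker.1 h1, map_zero] at h2
      exact h2

end BaseChange

/-! ### Amalgams of groups -/

section Amalgam

universe u

variable {R : Type*} [CommRing R] {π : Type*} [Group π] {V : Type*} [AddCommGroup V] [Module R V]
  {W : Type*} [AddCommGroup W] [Module R W]

/-- The action of a group on the linear maps `V → W` through `g • D = D ∘ g⁻¹`. -/
def homAction (ρ : π →* Module.End R V) (W : Type*) [AddCommGroup W] [Module R W] :
    π →* MulAut (Multiplicative (V →ₗ[R] W)) where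
  toFun g :=
    { toFun := fun D => Multiplicative.ofAdd (D.toAdd ∘ₗ ρ g⁻¹)
      invFun := fun D => Multiplicative.ofAdd (D.toAdd ∘ₗ ρ g)
      left_inv := fun D => by
        apply Multiplicative.toAdd.injective
        simp only [toAdd_ofAdd, LinearMap.comp_assoc]
        rw [← Module.End.mul_eq_comp (ρ g⁻¹), ← map_mul, inv_mul_cancel, map_one]
        rfl
      right_inv := fun D => by
        apply Multiplicative.toAdd.injective
        simp only [toAdd_ofAdd, LinearMap.comp_assoc]
        rw [← Module.End.mul_eq_comp (ρ g), ← map_mul, mul_inv_cancel, map_one]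
        rfl
      map_mul' := fun D D' => by
        apply Multiplicative.toAdd.injective
        simp only [toAdd_ofAdd, toAdd_mul, LinearMap.add_comp] }
  map_one' := by
    ext1 D
    apply Multiplicative.toAdd.injective
    change D.toAdd ∘ₗ ρ 1⁻¹ = D.toAdd
    rw [inv_one, map_one]
    rfl
  map_mul' g h := by
    ext1 D
    apply Multiplicative.toAdd.injective
    change D.toAdd ∘ₗ ρ (g * h)⁻¹ = (D.toAdd ∘ₗ ρ h⁻¹) ∘ₗ ρ g⁻¹
    rw [mul_inv_rev, map_mul]
    rfl

theorem homAction_apply (ρ : π →* Module.End R V) (g : π) (D : Multiplicative (V →ₗ[R] W)) :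
    (homAction ρ W g D).toAdd = D.toAdd ∘ₗ ρ g⁻¹ := rfl

/-- A derivation along `θ : G → π` is the same as a homomorphism to a semidirect product
over `θ`. -/
def derivationHom (ρ : π →* Module.End R V) {G : Type*} [Group G] (θ : G →* π)
    (d : G → V →ₗ[R] W) (hd : IsDerivation (ρ.comp θ) d) :
    G →* Multiplicative (V →ₗ[R] W) ⋊[homAction ρ W] π where
  toFun g := ⟨Multiplicative.ofAdd (d g ∘ₗ ρ (θ g)⁻¹), θ g⟩
  map_one' := by
    rw [hd.map_one, LinearMap.zero_comp, map_one]
    rfl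
  map_mul' g h := by
    refine SemidirectProduct.ext ?_ (map_mul θ g h)
    apply Multiplicative.toAdd.injective
    change d (g * h) ∘ₗ ρ (θ (g * h))⁻¹ =
      d g ∘ₗ ρ (θ g)⁻¹ + (d h ∘ₗ ρ (θ h)⁻¹) ∘ₗ ρ (θ g)⁻¹
    rw [hd g h, map_mul, mul_inv_rev, map_mul, LinearMap.add_comp, add_comm]
    congr 1
    have h1 : ρ (θ h) * (ρ (θ h)⁻¹ * ρ (θ g)⁻¹) = ρ (θ g)⁻¹ := by
      rw [← mul_assoc, ← map_mul, mul_inv_cancel, map_one, one_mul]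
    exact congrArg (d g ∘ₗ ·) h1

/-- A section of the projection of the semidirect product is a derivation, the converse to
`derivationHom`. -/
theorem isDerivation_of_hom (ρ : π →* Module.End R V)
    (f : π →* Multiplicative (V →ₗ[R] W) ⋊[homAction ρ W] π)
    (hf : ∀ g, (f g).right = g) : IsDerivation ρ fun g => (f g).left.toAdd ∘ₗ ρ g := by
  intro g h
  have : (f (g * h)).left.toAdd = (f g).left.toAdd + (f h).left.toAdd ∘ₗ ρ g⁻¹ := by
    rw [map_mul, SemidirectProduct.mul_left, toAdd_mul, homAction_apply, hf]
  have h1 : ρ g⁻¹ * ρ (g * h) = ρ h := by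
    rw [← map_mul, inv_mul_cancel_left]
  change (f (g * h)).left.toAdd ∘ₗ ρ (g * h) = _
  rw [this, LinearMap.add_comp, LinearMap.comp_assoc, ← Module.End.mul_eq_comp (ρ g⁻¹), h1, map_mul,
    add_comm]
  rfl

/-- The data of a group `π` generated by two groups `G i`, such that the images of `μ i ∈ G i`
commute and `π` is the universal such group with respect to targets in the universe `u`. -/
structure IsAmalgam {G : Fin 2 → Type*} [∀ i, Group (G i)] (μ : ∀ i, G i)
    (θ : ∀ i, G i →* π) : Prop where
  commute : Commute (θ 0 (μ 0)) (θ 1 (μ 1))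
  hom_ext : ∀ (H : Type u) [Group H] (f f' : π →* H),
    (∀ i, f.comp (θ i) = f'.comp (θ i)) → f = f'
  exists_hom : ∀ (H : Type u) [Group H] (f : ∀ i, G i →* H), Commute (f 0 (μ 0)) (f 1 (μ 1)) →
    ∃ F : π →* H, ∀ i, F.comp (θ i) = f i

/-- Derivations on the factors that vanish on the `μ i` extend to the amalgam: the corresponding
homomorphisms to the semidirect product send the `μ i` to commuting elements. -/
theorem IsAmalgam.exists_derivation {π : Type} [Group π] {G : Fin 2 → Type} [∀ i, Group (G i)]
    {μ : ∀ i, G i} {θ : ∀ i, G i →* π} (h : IsAmalgam.{u} μ θ)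
    {R V W : Type u} [CommRing R] [AddCommGroup V] [Module R V] [AddCommGroup W] [Module R W]
    (ρ : π →* Module.End R V) (d : ∀ i, G i → V →ₗ[R] W)
    (hd : ∀ i, IsDerivation (ρ.comp (θ i)) (d i)) (hμ : ∀ i, d i (μ i) = 0) :
    ∃ D : π → V →ₗ[R] W, IsDerivation ρ D ∧ ∀ i g, D (θ i g) = d i g := by
  have hμ' : ∀ i, derivationHom ρ (θ i) (d i) (hd i) (μ i) = SemidirectProduct.inr (θ i (μ i)) := by
    intro i
    refine SemidirectProduct.ext ?_ rfl
    apply Multiplicative.toAdd.injective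
    change d i (μ i) ∘ₗ _ = 0
    rw [hμ, LinearMap.zero_comp]
  obtain ⟨F, hF⟩ := h.exists_hom _ (fun i => derivationHom ρ (θ i) (d i) (hd i)) (by
    rw [hμ', hμ']
    exact h.commute.map _)
  have hFθ : ∀ i g, F (θ i g) = derivationHom ρ (θ i) (d i) (hd i) g :=
    fun i g => DFunLike.congr_fun (hF i) g
  have hr : (SemidirectProduct.inr (φ := homAction ρ W)).comp
      (SemidirectProduct.rightHom.comp F) = SemidirectProduct.inr := by
    refine h.hom_ext _ _ _ fun i => ?_
    ext1 g
    rw [MonoidHom.comp_apply, MonoidHom.comp_apply, MonoidHom.comp_apply, hFθ]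
    rfl
  have hr' : ∀ g, (F g).right = g := fun g =>
    SemidirectProduct.inr_injective (DFunLike.congr_fun hr g)
  refine ⟨_, isDerivation_of_hom ρ F hr', fun i g => ?_⟩
  rw [hFθ]
  change (d i g ∘ₗ ρ (θ i g)⁻¹) ∘ₗ ρ (θ i g) = d i g
  rw [LinearMap.comp_assoc, ← Module.End.mul_eq_comp (ρ _), ← map_mul, inv_mul_cancel, map_one]
  rfl

theorem IsAmalgam.derivation_ext {π : Type} [Group π] {G : Fin 2 → Type} [∀ i, Group (G i)]
    {μ : ∀ i, G i} {θ : ∀ i, G i →* π} (h : IsAmalgam.{u} μ θ)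
    {R V W : Type u} [CommRing R] [AddCommGroup V] [Module R V] [AddCommGroup W] [Module R W]
    (ρ : π →* Module.End R V) {D D' : π → V →ₗ[R] W} (hD : IsDerivation ρ D)
    (hD' : IsDerivation ρ D') (hDD : ∀ i g, D (θ i g) = D' (θ i g)) : D = D' := by
  have := h.hom_ext _ (derivationHom ρ (MonoidHom.id π) D hD)
    (derivationHom ρ (MonoidHom.id π) D' hD') fun i => by
      ext1 g
      refine SemidirectProduct.ext ?_ rfl
      apply Multiplicative.toAdd.injective
      change D (θ i g) ∘ₗ _ = D' (θ i g) ∘ₗ _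
      rw [hDD]
  ext1 g
  have h1 := congrArg (fun x => x.left.toAdd) (DFunLike.congr_fun this g)
  have h2 : D g ∘ₗ ρ g⁻¹ = D' g ∘ₗ ρ g⁻¹ := h1
  have h3 : ρ g⁻¹ ∘ₗ ρ g = LinearMap.id := by
    rw [← Module.End.mul_eq_comp, ← map_mul, inv_mul_cancel, map_one]
    rfl
  rw [← LinearMap.comp_id (D g), ← LinearMap.comp_id (D' g), ← h3, ← LinearMap.comp_assoc, h2,
    LinearMap.comp_assoc]

/-- The relative derivation module of an amalgam is the product of those of its factors. -/
theorem IsAmalgam.nonempty_relDerivationModule_equiv {π : Type} [Group π] {G : Fin 2 → Type}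
    [∀ i, Group (G i)] {μ : ∀ i, G i} {θ : ∀ i, G i →* π} (h : IsAmalgam.{u} μ θ)
    {R V : Type u} [CommRing R] [AddCommGroup V] [Module R V] (ρ : π →* Module.End R V) :
    Nonempty (RelDerivationModule ρ {θ 0 (μ 0), θ 1 (μ 1)} ≃ₗ[R]
      RelDerivationModule (ρ.comp (θ 0)) {μ 0} × RelDerivationModule (ρ.comp (θ 1)) {μ 1}) := by
  set S : Set π := {θ 0 (μ 0), θ 1 (μ 1)} with hS
  have hmem : ∀ i, θ i (μ i) ∈ S := by
    intro i
    fin_cases i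
    · exact Set.mem_insert _ _
    · exact Set.mem_insert_of_mem _ rfl
  let f : ∀ i, RelDerivationModule (ρ.comp (θ i)) {μ i} →ₗ[R] RelDerivationModule ρ S := fun i =>
    relDerivationLift (fun g => relDerivation ρ S (θ i g))
      (by
        intro g g'
        change relDerivation ρ S (θ i (g * g')) = _
        rw [map_mul, isDerivation_relDerivation]
        rfl)
      (by
        rintro _ rfl
        exact relDerivation_eq_zero (hmem i))
  have hf : ∀ i g v, f i (relDerivation _ _ g v) = relDerivation ρ S (θ i g) v :=
    fun i g v => relDerivationLift_apply _ _ _ g v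
  let ι : ∀ i : Fin 2, RelDerivationModule (ρ.comp (θ i)) {μ i} →ₗ[R]
      RelDerivationModule (ρ.comp (θ 0)) {μ 0} × RelDerivationModule (ρ.comp (θ 1)) {μ 1} := fun i =>
    match i with
    | 0 => LinearMap.inl R _ _
    | 1 => LinearMap.inr R _ _
  obtain ⟨D, hD, hDθ⟩ := h.exists_derivation ρ
    (fun i g => ι i ∘ₗ relDerivation (ρ.comp (θ i)) {μ i} g)
    (fun i => isDerivation_relDerivation.comp _)
    (fun i => by rw [relDerivation_eq_zero (Set.mem_singleton _), LinearMap.comp_zero])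
  let b : RelDerivationModule ρ S →ₗ[R] _ := relDerivationLift D hD (by
    rintro _ (rfl | rfl)
    · rw [hDθ, relDerivation_eq_zero (Set.mem_singleton _), LinearMap.comp_zero]
    · rw [hDθ, relDerivation_eq_zero (Set.mem_singleton _), LinearMap.comp_zero])
  have hb : ∀ g v, b (relDerivation ρ S g v) = D g v :=
    fun g v => relDerivationLift_apply _ _ _ g v
  have hbf : ∀ i x, b (f i x) = ι i x := by
    intro i x
    have : b ∘ₗ f i = ι i := by
      refine relDerivationModule_hom_ext fun g v => ?_
      rw [LinearMap.comp_apply, hf, hb, hDθ, LinearMap.comp_apply]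
    exact LinearMap.congr_fun this x
  refine ⟨LinearEquiv.ofLinearMap b ((f 0).coprod (f 1)) ?_ ?_⟩
  · ext1
    · refine LinearMap.ext fun x => ?_
      exact (congrArg b (LinearMap.congr_fun (LinearMap.coprod_inl (f 0) (f 1)) x)).trans (hbf _ x)
    · refine LinearMap.ext fun x => ?_
      exact (congrArg b (LinearMap.congr_fun (LinearMap.coprod_inr (f 0) (f 1)) x)).trans (hbf _ x)
  · refine relDerivationModule_hom_ext fun g v => ?_
    have hcop : ∀ i x, (f 0).coprod (f 1) (ι i x) = f i x := by
      intro i x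
      fin_cases i
      · simp [ι]
      · simp [ι]
    have := h.derivation_ext ρ (D := fun g => (f 0).coprod (f 1) ∘ₗ D g)
      (D' := relDerivation ρ S) (hD.comp _) isDerivation_relDerivation (by
        intro i g
        refine LinearMap.ext fun v => ?_
        rw [hDθ]
        simp only [LinearMap.comp_apply, hcop, hf])
    rw [LinearMap.comp_apply, hb]
    exact LinearMap.congr_fun (congrFun this g) v

end Amalgam

/-! ### The first homology of an amalgam -/

section Koszul

/-- A common divisor of the multiples of `t` by two coprime elements divides `t`. -/
theorem dvd_of_dvd_mul_of_isRelPrime {R : Type*} [CommRing R] [IsDomain R]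
    [UniqueFactorizationMonoid R] {d x y t : R} (hx : d ∣ x * t) (hy : d ∣ y * t)
    (h : IsRelPrime x y) : d ∣ t := by
  obtain ⟨d₁, d₂, ⟨x', rfl⟩, ⟨t', rfl⟩, rfl⟩ := exists_dvd_and_dvd_of_dvd_mul hx
  rcases eq_or_ne d₂ 0 with rfl | h0
  · simp
  have h1 : d₁ ∣ y * t' := by
    rw [mul_comm d₁, mul_left_comm] at hy
    exact (mul_dvd_mul_iff_left h0).1 hy
  have h2 : IsRelPrime d₁ y := h.of_mul_left_left
  rw [mul_comm d₁]
  exact mul_dvd_mul_left _ (h2.dvd_of_dvd_mul_left h1)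

variable {R : Type*} [CommRing R] {k : ℕ}

theorem exists_adjugate (T : (Fin k → R) →ₗ[R] (Fin k → R)) :
    ∃ T' : (Fin k → R) →ₗ[R] (Fin k → R),
      (∀ v, T (T' v) = LinearMap.det T • v) ∧ ∀ v, T' (T v) = LinearMap.det T • v := by
  obtain ⟨A, rfl⟩ := Matrix.toLin'.surjective T
  refine ⟨Matrix.toLin' A.adjugate, fun v => ?_, fun v => ?_⟩
  · rw [← LinearMap.comp_apply, ← Matrix.toLin'_mul, Matrix.mul_adjugate, LinearMap.det_toLin']
    simp
  · rw [← LinearMap.comp_apply, ← Matrix.toLin'_mul, Matrix.adjugate_mul, LinearMap.det_toLin']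
    simp

/-- Exactness of the Koszul complex of two commuting endomorphisms with coprime determinants. -/
theorem exists_of_commute_of_isRelPrime_det [IsDomain R] [UniqueFactorizationMonoid R]
    {A B : (Fin k → R) →ₗ[R] (Fin k → R)} (hAB : ∀ v, A (B v) = B (A v))
    (hB : LinearMap.det B ≠ 0)
    (h : IsRelPrime (LinearMap.det A) (LinearMap.det B)) {v w : Fin k → R} (hvw : A v + B w = 0) :
    ∃ y, v = B y ∧ w = -A y := by
  obtain ⟨A', hA1, hA2⟩ := exists_adjugate A
  obtain ⟨B', hB1, hB2⟩ := exists_adjugate B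
  have inj : ∀ x y, B x = B y → x = y := by
    intro x y hxy
    rw [← sub_eq_zero]
    exact injective_of_det_ne_zero hB (by rw [map_sub, hxy, sub_self])
  have hcomm : A (B' v) = B' (A v) := by
    apply inj
    rw [← hAB, hB1, hB1, map_smul]
  have h1 : A (B' v) = -(LinearMap.det B • w) := by
    rw [hcomm, eq_neg_of_add_eq_zero_left hvw, map_neg, hB2]
  have h2 : LinearMap.det A • B' v = -(LinearMap.det B • A' w) := by
    rw [← hA2, h1, map_neg, map_smul]
  have h3 : ∀ j, ∃ c, B' v j = LinearMap.det B * c := by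
    intro j
    have h4 : LinearMap.det B ∣ LinearMap.det A * B' v j := by
      refine ⟨-(A' w j), ?_⟩
      have := congrFun h2 j
      simpa using this
    exact h.symm.dvd_of_dvd_mul_left h4
  choose y hy using h3
  have hy' : B' v = LinearMap.det B • y := funext hy
  have canc : ∀ x z : Fin k → R, LinearMap.det B • x = LinearMap.det B • z → x = z := fun x z hxz =>
    smul_right_injective _ hB hxz
  refine ⟨y, canc _ _ ?_, canc _ _ ?_⟩
  · rw [← hB1, hy', map_smul]
  · rw [smul_neg, ← map_smul, ← hy', h1, neg_neg]

variable {π : Type*} [Group π] (ρ : π →* Module.End R (Fin k → R))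

/-- For commuting `a`, `b` the relation `[a] (b v) + [b] v = [b] (a v) + [a] v` is the only reason
for a combination of `[a] v`, `[b] w` to be a cycle, by exactness of the Koszul complex. -/
theorem kerToRel_pair_injective [IsDomain R] [UniqueFactorizationMonoid R] {a b : π}
    (hab : Commute a b) (hB : LinearMap.det (ρ b - 1) ≠ 0)
    (h : IsRelPrime (LinearMap.det (ρ a - 1)) (LinearMap.det (ρ b - 1))) :
    Function.Injective (kerToRel ρ {a, b}) := by
  refine kerToRel_injective fun x hx hx0 => ?_
  obtain ⟨v, w, rfl⟩ := mem_derivationSubmodule_pair hx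
  rw [map_add, augmentation_apply, augmentation_apply] at hx0
  have hcomm : ρ a * ρ b = ρ b * ρ a := by rw [← map_mul, hab.eq, map_mul]
  have hcomm' : ∀ v, ρ a (ρ b v) = ρ b (ρ a v) := fun v => LinearMap.congr_fun hcomm v
  obtain ⟨y, rfl, rfl⟩ := exists_of_commute_of_isRelPrime_det (A := ρ a - 1) (B := ρ b - 1)
    (fun v => by simp [hcomm']; abel) hB h (v := v) (w := w) hx0
  have h1 := LinearMap.congr_fun (isDerivation_univDerivation ρ a b) y
  have h2 := LinearMap.congr_fun (isDerivation_univDerivation ρ b a) y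
  rw [hab.eq, h2] at h1
  simp only [LinearMap.add_apply, LinearMap.comp_apply] at h1
  simp only [LinearMap.sub_apply, Module.End.one_apply, map_sub, map_neg]
  rw [← sub_eq_zero] at h1
  rw [← neg_eq_zero, ← h1]
  abel

/-- The inclusion of the first homology into the derivations relative to `S` has a cokernel that is
killed by `det(ρ(a) - 1)`, so that multiplication by this determinant factors through it. -/
theorem exists_factor_of_det (S : Set π) (hinj : Function.Injective (kerToRel ρ S)) {a : π}
    (ha : a ∈ S) :
    ∃ g : RelDerivationModule ρ S →ₗ[R] LinearMap.ker (augmentation ρ),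
      (∀ x, kerToRel ρ S (g x) = LinearMap.det (ρ a - 1) • x) ∧
      ∀ x, g (kerToRel ρ S x) = LinearMap.det (ρ a - 1) • x := by
  obtain ⟨A', hA, -⟩ := exists_adjugate (ρ a - 1)
  have hmem : ∀ x, (LinearMap.det (ρ a - 1) •
      (LinearMap.id : RelDerivationModule ρ S →ₗ[R] RelDerivationModule ρ S)) x ∈ LinearMap.range (kerToRel ρ S) := by
    intro x
    rw [← ker_relBoundary, LinearMap.mem_ker, LinearMap.smul_apply, map_smul, LinearMap.id_apply]
    obtain ⟨v, hv⟩ := Submodule.mkQ_surjective _ (relBoundary ρ S x)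
    rw [← hv, ← map_smul, ← hA]
    exact (Submodule.Quotient.mk_eq_zero _).2 (sub_mem_augmentationSubmodule ha _)
  let e := LinearEquiv.ofInjective (kerToRel ρ S) hinj
  let g := e.symm.toLinearMap ∘ₗ LinearMap.codRestrict _ _ hmem
  have hg : ∀ x, kerToRel ρ S (g x) = LinearMap.det (ρ a - 1) • x := by
    intro x
    have : e (g x) = ⟨_, hmem x⟩ := e.apply_symm_apply _
    exact congrArg Subtype.val this
  refine ⟨g, hg, fun x => hinj ?_⟩
  rw [hg, map_smul]

/-- The first homology embeds in the derivations relative to `a`, `b`, with a cokernel that is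
killed by `det(ρ(a) - 1)` and by `det(ρ(b) - 1)`. So the elements of each Fitting ideal lie in
the other up to powers of either of two coprime elements, and the greatest common divisors agree. -/
theorem isGcdOf_fittingIdeal_ker_augmentation [IsDomain R] [UniqueFactorizationMonoid R]
    [IsNoetherianRing R] {a b : π}
    (hab : Commute a b) (hB : LinearMap.det (ρ b - 1) ≠ 0)
    (h : IsRelPrime (LinearMap.det (ρ a - 1)) (LinearMap.det (ρ b - 1)))
    [Module.Finite R (RelDerivationModule ρ {a, b})] {δ : R}
    (hδ : fittingIdeal R (RelDerivationModule ρ {a, b}) = Ideal.span {δ}) :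
    Module.Finite R (LinearMap.ker (augmentation ρ)) ∧
      IsGcdOf (fittingIdeal R (LinearMap.ker (augmentation ρ))) δ := by
  have hinj := kerToRel_pair_injective ρ hab hB h
  have hfin : Module.Finite R (LinearMap.ker (augmentation ρ)) :=
    Module.Finite.of_injective _ hinj
  refine ⟨hfin, ?_⟩
  have key : ∀ c ∈ ({a, b} : Set π), (∃ n : ℕ, ∀ e ∈ fittingIdeal R (LinearMap.ker (augmentation ρ)),
      δ ∣ LinearMap.det (ρ c - 1) ^ n * e) ∧
      ∃ n : ℕ, LinearMap.det (ρ c - 1) ^ n * δ ∈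
        fittingIdeal R (LinearMap.ker (augmentation ρ)) := by
    intro c hc
    obtain ⟨g, hg1, hg2⟩ := exists_factor_of_det ρ _ hinj hc
    obtain ⟨n, hn⟩ := fittingIdeal_comparison (kerToRel ρ {a, b}) g _ hg1
    obtain ⟨m, hm⟩ := fittingIdeal_comparison g (kerToRel ρ {a, b}) _ hg2
    rw [hδ] at hn hm
    exact ⟨⟨n, fun e he => Ideal.mem_span_singleton.1 (hn e he)⟩, m,
      hm δ (Ideal.mem_span_singleton_self δ)⟩
  obtain ⟨⟨n, hn⟩, n', hn'⟩ := key a (Set.mem_insert _ _)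
  obtain ⟨⟨m, hm⟩, m', hm'⟩ := key b (Set.mem_insert_of_mem _ rfl)
  constructor
  · intro e he
    rw [Ideal.mem_span_singleton]
    exact dvd_of_dvd_mul_of_isRelPrime (hn e he) (hm e he) (h.pow)
  · intro d hd
    rw [Ideal.span_singleton_le_span_singleton]
    exact dvd_of_dvd_mul_of_isRelPrime (Ideal.mem_span_singleton.1 (hd hn'))
      (Ideal.mem_span_singleton.1 (hd hm')) (h.pow)

end Koszul

/-! ### Twisted homology in degrees zero and one -/

section TwistedHomology

variable {X : Type*} [TopologicalSpace X] {x₀ : X}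

/-- The points of the universal cover of `(X, x₀)`. -/
abbrev CoverPoint (x₀ : X) : Type _ := Σ y : X, Path.Homotopic.Quotient x₀ y

namespace CoverSimplex

/-- The points of a singular simplex of the universal cover. -/
def pt {n : ℕ} (s : CoverSimplex x₀ n) (b : stdSimplex ℝ (Fin (n + 1))) : CoverPoint x₀ :=
  ⟨s.simplex b, s.lift b⟩

theorem ext_pt {n : ℕ} {s s' : CoverSimplex x₀ n} (h : s.simplex = s'.simplex)
    (b : stdSimplex ℝ (Fin (n + 1))) (hb : s.pt b = s'.pt b) : s = s' := by
  obtain ⟨f, l, hl⟩ := s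
  obtain ⟨f', l', hl'⟩ := s'
  obtain rfl : f = f' := h
  have hb' : l b = l' b := eq_of_heq (Sigma.mk.inj hb).2
  have : l = l' := by
    funext b'
    have : JoinedIn (stdSimplex ℝ (Fin (n + 1))) b b' :=
      (convex_stdSimplex ℝ (Fin (n + 1))).isPathConnected ⟨_, b.2⟩ |>.joinedIn _ b.2 _ b'.2
    obtain ⟨p⟩ : Joined b b' := this.joined_subtype
    rw [← hl p, ← hl' p, hb']
  subst this
  rfl

@[simp]
theorem pt_face {n : ℕ} (i : Fin (n + 2)) (s : CoverSimplex x₀ (n + 1))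
    (b : stdSimplex ℝ (Fin (n + 1))) : (s.face i).pt b = s.pt (faceInclusion n i b) := rfl

end CoverSimplex

/-- The right action of the fundamental group on the points of the universal cover. -/
def CoverPoint.act (c : CoverPoint x₀) (g : FundamentalGroup X x₀) : CoverPoint x₀ :=
  ⟨c.1, Path.Homotopic.Quotient.trans g.toPath c.2⟩

@[simp]
theorem CoverSimplex.pt_act {n : ℕ} (s : CoverSimplex x₀ n) (g : FundamentalGroup X x₀)
    (b : stdSimplex ℝ (Fin (n + 1))) : (s.act g).pt b = (s.pt b).act g := rfl

theorem CoverPoint.act_act (c : CoverPoint x₀) (g h : FundamentalGroup X x₀) :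
    (c.act g).act h = c.act (g * h) := by
  refine Sigma.ext rfl (heq_of_eq ?_)
  exact (Path.Homotopic.Quotient.trans_assoc h.toPath g.toPath c.2).symm

theorem coverPoint_mk_trans {y z : X} (q : Path y z) (hq : ∀ t, q t = y)
    (l : Path.Homotopic.Quotient x₀ y) :
    (⟨z, l.trans (Path.Homotopic.Quotient.mk q)⟩ : CoverPoint x₀) = ⟨y, l⟩ := by
  obtain rfl : z = y := q.target.symm.trans (hq 1)
  obtain rfl : q = Path.refl z := by
    ext t
    exact hq t
  rw [Path.Homotopic.Quotient.mk_refl, Path.Homotopic.Quotient.trans_refl]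

/-! Simplices of the universal cover that factor through a map of the plane to `X`. -/

/-- The affine simplex in the plane with the given vertices. -/
def affineSimplex {n : ℕ} (v : Fin (n + 1) → ℝ × ℝ) : C(stdSimplex ℝ (Fin (n + 1)), ℝ × ℝ) where
  toFun b := ∑ i, b i • v i
  continuous_toFun := continuous_finsetSum _ fun i _ =>
    ((continuous_apply i).comp continuous_subtype_val).smul continuous_const

theorem affineSimplex_comp_faceInclusion {n : ℕ} (v : Fin (n + 2) → ℝ × ℝ) (i : Fin (n + 2)) :
    (affineSimplex v).comp (faceInclusion n i) = affineSimplex (v ∘ i.succAbove) := by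
  ext1 b
  change ∑ j, (stdSimplex.map i.succAbove b) j • v j = ∑ j, b j • v (i.succAbove j)
  rw [Fin.sum_univ_succAbove _ i]
  simp only [stdSimplex.map_coe, FunOnFinite.linearMap_apply_apply]
  have h0 : ∀ j : Fin (n + 1), i.succAbove j ≠ i := fun j => Fin.succAbove_ne i j
  simp [h0, Finset.sum_filter]

theorem affineSimplex_vertex {n : ℕ} (v : Fin (n + 1) → ℝ × ℝ) (i : Fin (n + 1)) :
    affineSimplex v (stdSimplex.vertex i) = v i := by
  change ∑ j, (stdSimplex.vertex (S := ℝ) i) j • v j = v i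
  simp [Pi.single_apply]

variable (f : C(ℝ × ℝ, X)) (l : Path.Homotopic.Quotient x₀ (f 0))

/-- The simplex of the universal cover that lies over an affine simplex in the plane, for the lift
of the map of the plane that starts at `l`. -/
def planeSimplex {n : ℕ} (v : Fin (n + 1) → ℝ × ℝ) : CoverSimplex x₀ n where
  simplex := f.comp (affineSimplex v)
  lift b := l.trans (Path.Homotopic.Quotient.mk
    ((Path.segment 0 (affineSimplex v b)).map f.continuous))
  coherent p := by
    rw [Path.Homotopic.Quotient.trans_assoc, ← Path.Homotopic.Quotient.mk_trans]
    congr 1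
    rw [Path.Homotopic.Quotient.eq]
    have h := SimplyConnectedSpace.paths_homotopic
      ((Path.segment (0 : ℝ × ℝ) (affineSimplex v _)).trans (p.map (affineSimplex v).continuous))
      (Path.segment (0 : ℝ × ℝ) (affineSimplex v _))
    have h' := h.map f
    rw [Path.map_trans] at h'
    exact h'

theorem face_planeSimplex {n : ℕ} (v : Fin (n + 2) → ℝ × ℝ) (i : Fin (n + 2)) :
    (planeSimplex f l v).face i = planeSimplex f l (v ∘ i.succAbove) := by
  have h := affineSimplex_comp_faceInclusion v i
  refine CoverSimplex.ext_pt (b := stdSimplex.vertex 0) ?_ ?_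
  · change f.comp ((affineSimplex v).comp _) = _
    rw [h]
    rfl
  · have h1 : affineSimplex v (faceInclusion n i (stdSimplex.vertex 0)) =
        affineSimplex (v ∘ i.succAbove) (stdSimplex.vertex 0) := DFunLike.congr_fun h _
    change (⟨_, l.trans (Path.Homotopic.Quotient.mk ((Path.segment 0
      (affineSimplex v (faceInclusion n i (stdSimplex.vertex 0)))).map f.continuous))⟩ :
        CoverPoint x₀) = ⟨_, l.trans (Path.Homotopic.Quotient.mk ((Path.segment 0
      (affineSimplex (v ∘ i.succAbove) (stdSimplex.vertex 0))).map f.continuous))⟩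
    rw [h1]

variable {f l} in
theorem pt_planeSimplex_of_const {n : ℕ} {v : Fin (n + 1) → ℝ × ℝ} {i : Fin (n + 1)}
    (h : ∀ t, f (Path.segment 0 (v i) t) = f 0) :
    (planeSimplex f l v).pt (stdSimplex.vertex i) = ⟨f 0, l⟩ := by
  refine coverPoint_mk_trans ((Path.segment 0 (affineSimplex v _)).map f.continuous)
    (fun t => ?_) l
  rw [Path.map_coe, Function.comp_apply, affineSimplex_vertex]
  exact h t

section Coefficients

variable {R : Type*} [CommRing R] {V : Type*} [AddCommGroup V] [Module R V]

theorem coverBoundary_single {n : ℕ} (s : CoverSimplex x₀ (n + 1)) (v : V) :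
    coverBoundary R V x₀ n (Finsupp.single s v) =
      ∑ i : Fin (n + 2), Finsupp.single (s.face i) (((-1 : R) ^ (i : ℕ)) • v) := by
  simp [coverBoundary, Finsupp.lmapDomain_apply, Finsupp.mapDomain_single]

variable (R) in
theorem planeSimplex_triangle (a b c : ℝ × ℝ) (v : V) :
    Finsupp.single (planeSimplex f l ![b, c]) v - Finsupp.single (planeSimplex f l ![a, c]) v +
      Finsupp.single (planeSimplex f l ![a, b]) v ∈ LinearMap.range (coverBoundary R V x₀ 1) := by
  refine ⟨Finsupp.single (planeSimplex f l ![a, b, c]) v, ?_⟩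
  rw [coverBoundary_single, Fin.sum_univ_three]
  simp only [face_planeSimplex]
  have h0 : ![a, b, c] ∘ (0 : Fin 3).succAbove = ![b, c] := by
    ext i <;> fin_cases i <;> rfl
  have h1 : ![a, b, c] ∘ (1 : Fin 3).succAbove = ![a, c] := by
    ext i <;> fin_cases i <;> rfl
  have h2 : ![a, b, c] ∘ (2 : Fin 3).succAbove = ![a, b] := by
    ext i <;> fin_cases i <;> rfl
  rw [h0, h1, h2]
  simp [sub_eq_add_neg]

/-- The path run through by a singular edge. -/
theorem CoverSimplex.exists_path (s : CoverSimplex x₀ 1) {y y' : X}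
    {m : Path.Homotopic.Quotient x₀ y} {m' : Path.Homotopic.Quotient x₀ y'}
    (h : s.pt (stdSimplex.vertex 0) = ⟨y, m⟩) (h' : s.pt (stdSimplex.vertex 1) = ⟨y', m'⟩) :
    ∃ p : Path y y', (∀ b, s.simplex b = p (stdSimplexHomeomorphUnitInterval b)) ∧
      m.trans (Path.Homotopic.Quotient.mk p) = m' := by
  cases h
  cases h'
  let q : Path (stdSimplex.vertex 0 : stdSimplex ℝ (Fin 2)) (stdSimplex.vertex 1) :=
    { toFun := stdSimplexHomeomorphUnitInterval.symm
      continuous_toFun := stdSimplexHomeomorphUnitInterval.symm.continuous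
      source' := by
        rw [Homeomorph.symm_apply_eq]
        exact stdSimplexHomeomorphUnitInterval_zero.symm
      target' := by
        rw [Homeomorph.symm_apply_eq]
        exact stdSimplexHomeomorphUnitInterval_one.symm }
  refine ⟨q.map s.simplex.continuous, fun b => ?_, s.coherent q⟩
  change _ = s.simplex (stdSimplexHomeomorphUnitInterval.symm (stdSimplexHomeomorphUnitInterval b))
  rw [Homeomorph.symm_apply_apply]

variable (R) in
/-- Three edges of the universal cover that are joined as the sides of a triangle form a boundary,
since the universal cover is simply connected. -/
theorem CoverSimplex.triangle {s₁ s₂ s₃ : CoverSimplex x₀ 1} {c₀ c₁ c₂ : CoverPoint x₀}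
    (h₁ : s₁.pt (stdSimplex.vertex 0) = c₀) (h₁' : s₁.pt (stdSimplex.vertex 1) = c₁)
    (h₂ : s₂.pt (stdSimplex.vertex 0) = c₁) (h₂' : s₂.pt (stdSimplex.vertex 1) = c₂)
    (h₃ : s₃.pt (stdSimplex.vertex 0) = c₀) (h₃' : s₃.pt (stdSimplex.vertex 1) = c₂) (v : V) :
    Finsupp.single s₃ v - (Finsupp.single s₁ v + Finsupp.single s₂ v) ∈
      LinearMap.range (coverBoundary R V x₀ 1) := by
  obtain ⟨y₀, m₀⟩ := c₀
  obtain ⟨y₁, m₁⟩ := c₁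
  obtain ⟨y₂, m₂⟩ := c₂
  obtain ⟨p₁, hp₁, e₁⟩ := s₁.exists_path h₁ h₁'
  obtain ⟨p₂, hp₂, e₂⟩ := s₂.exists_path h₂ h₂'
  obtain ⟨p₃, hp₃, e₃⟩ := s₃.exists_path h₃ h₃'
  have hp : (p₁.trans p₂).Homotopic p₃ := by
    rw [← Path.Homotopic.Quotient.eq, Path.Homotopic.Quotient.mk_trans]
    have : m₀.trans (Path.Homotopic.Quotient.mk p₃) = m₀.trans
        ((Path.Homotopic.Quotient.mk p₁).trans (Path.Homotopic.Quotient.mk p₂)) := by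
      rw [e₃, ← Path.Homotopic.Quotient.trans_assoc, e₁, e₂]
    have h := congrArg (m₀.symm.trans ·) this
    simp only [← Path.Homotopic.Quotient.trans_assoc, Path.Homotopic.Quotient.symm_trans,
      Path.Homotopic.Quotient.refl_trans] at h
    exact h.symm
  obtain ⟨H⟩ := hp
  let pr : ℝ → I := Set.projIcc 0 1 zero_le_one
  have hpr : Continuous pr := continuous_projIcc
  let f : C(ℝ × ℝ, X) := ⟨fun z => H (pr z.1, pr z.2), by fun_prop⟩
  have hpr0 : pr 0 = 0 := Set.projIcc_left zero_le_one
  have hpr1 : pr 1 = 1 := Set.projIcc_right zero_le_one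
  have hf0 : f 0 = y₀ := by
    change H (pr 0, pr 0) = _
    rw [hpr0, H.source]
  have hsum (b : stdSimplex ℝ (Fin 2)) : b 0 + b 1 = 1 := stdSimplex.add_eq_one b
  have hb (b : stdSimplex ℝ (Fin 2)) : pr (b 1) = stdSimplexHomeomorphUnitInterval b :=
    Set.projIcc_val zero_le_one (stdSimplexHomeomorphUnitInterval b)
  have haff (z z' : ℝ × ℝ) (b : stdSimplex ℝ (Fin 2)) :
      affineSimplex ![z, z'] b = (b 0 * z.1 + b 1 * z'.1, b 0 * z.2 + b 1 * z'.2) := by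
    change ∑ i, b i • (![z, z'] i) = _
    rw [Fin.sum_univ_two]
    simp [Prod.ext_iff]
  let l : Path.Homotopic.Quotient x₀ (f 0) := m₀.cast rfl hf0
  have hl : (⟨f 0, l⟩ : CoverPoint x₀) = ⟨y₀, m₀⟩ :=
    Sigma.ext hf0 (Path.Homotopic.Quotient.cast_heq rfl hf0)
  -- the homotopy square has the corners `0`, `(0, 1)`, `(1, 0)`, `(1, 1)`
  have t₁ := planeSimplex_triangle f l R 0 (0, 1 / 2) (0, 1) v
  have t₂ := planeSimplex_triangle f l R 0 (0, 1) (1, 1) v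
  have t₃ := planeSimplex_triangle f l R 0 (1, 0) (1, 1) v
  have t₄ := planeSimplex_triangle f l R 0 0 0 v
  have t₅ := planeSimplex_triangle f l R (0, 1) (0, 1) (0, 1) v
  have q₁ : planeSimplex f l ![0, (0, 1 / 2)] = s₁ := by
    refine CoverSimplex.ext_pt (b := stdSimplex.vertex 0) ?_ ?_
    · ext b
      change f (affineSimplex _ b) = _
      rw [hp₁ b, haff, ← hb b]
      change H (pr _, pr _) = _
      simp only [Prod.fst_zero, Prod.snd_zero, mul_zero, add_zero, zero_add]
      rw [hpr0, H.apply_zero]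
      change (p₁.trans p₂).extend (b 1 * (1 / 2)) = p₁.extend (b 1)
      have h1 := stdSimplex.le_one b 1
      rw [Path.extend_trans_of_le_half _ _ (by linarith)]
      congr 1
      ring
    · rw [h₁, ← hl]
      refine pt_planeSimplex_of_const fun t => ?_
      change f (Path.segment 0 0 t) = f 0
      rw [Path.segment_same]
      rfl
  have q₂ : planeSimplex f l ![(0, 1 / 2), (0, 1)] = s₂ := by
    refine CoverSimplex.ext_pt (b := stdSimplex.vertex 0) ?_ ?_
    · ext b
      change f (affineSimplex _ b) = _
      rw [hp₂ b, haff, ← hb b]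
      change H (pr _, pr _) = _
      simp only [mul_zero, add_zero]
      rw [hpr0, H.apply_zero]
      change (p₁.trans p₂).extend (b 0 * (1 / 2) + b 1 * 1) = p₂.extend (b 1)
      have h0 := stdSimplex.zero_le b 1
      have h2 := hsum b
      rw [Path.extend_trans_of_half_le _ _ (by linarith)]
      congr 1
      linarith
    · rw [h₂, ← h₁', ← q₁]
      have h0 : affineSimplex ![((0 : ℝ), (1 / 2 : ℝ)), (0, 1)] (stdSimplex.vertex 0) =
          affineSimplex ![0, ((0 : ℝ), (1 / 2 : ℝ))] (stdSimplex.vertex 1) := by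
        rw [affineSimplex_vertex, affineSimplex_vertex]
        rfl
      change (⟨f _, l.trans (Path.Homotopic.Quotient.mk ((Path.segment 0
        (affineSimplex _ _)).map f.continuous))⟩ : CoverPoint x₀) = ⟨f _, l.trans
          (Path.Homotopic.Quotient.mk ((Path.segment 0
            (affineSimplex _ _)).map f.continuous))⟩
      rw [h0]
  have q₃ : planeSimplex f l ![(1, 0), (1, 1)] = s₃ := by
    refine CoverSimplex.ext_pt (b := stdSimplex.vertex 0) ?_ ?_
    · ext b
      change f (affineSimplex _ b) = _
      rw [hp₃ b, haff, ← hb b]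
      change H (pr _, pr _) = _
      simp only [mul_zero, mul_one, zero_add, hsum b]
      rw [hpr1, H.apply_one]
      rfl
    · rw [h₃, ← hl]
      refine pt_planeSimplex_of_const fun t => ?_
      rw [hf0, Path.segment_apply]
      change H (pr _, pr _) = _
      simp [AffineMap.lineMap_apply, hpr0]
  have q₄ : planeSimplex f l ![0, (1, 0)] = planeSimplex f l ![0, 0] := by
    refine CoverSimplex.ext_pt (b := stdSimplex.vertex 0) ?_ ?_
    · ext b
      change f (affineSimplex _ b) = f (affineSimplex _ b)
      rw [haff, haff]
      change H (pr _, pr _) = H (pr _, pr _)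
      simp [hpr0]
    · rw [pt_planeSimplex_of_const, pt_planeSimplex_of_const] <;> intro t <;>
        change f (Path.segment 0 0 t) = f 0 <;> rw [Path.segment_same] <;> rfl
  have q₅ : planeSimplex f l ![(0, 1), (1, 1)] = planeSimplex f l ![(0, 1), (0, 1)] := by
    refine CoverSimplex.ext_pt (b := stdSimplex.vertex 0) ?_ ?_
    · ext b
      change f (affineSimplex _ b) = f (affineSimplex _ b)
      rw [haff, haff]
      change H (pr _, pr _) = H (pr _, pr _)
      simp only [mul_one, hsum b, hpr1, H.target]
    · have h0 : affineSimplex ![((0 : ℝ), (1 : ℝ)), (1, 1)] (stdSimplex.vertex 0) =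
          affineSimplex ![((0 : ℝ), (1 : ℝ)), (0, 1)] (stdSimplex.vertex 0) := by
        rw [affineSimplex_vertex, affineSimplex_vertex]
        rfl
      change (⟨f _, l.trans (Path.Homotopic.Quotient.mk ((Path.segment 0
        (affineSimplex _ _)).map f.continuous))⟩ : CoverPoint x₀) = ⟨f _, l.trans
          (Path.Homotopic.Quotient.mk ((Path.segment 0
            (affineSimplex _ _)).map f.continuous))⟩
      rw [h0]
  rw [q₁, q₂] at t₁
  rw [q₅] at t₂
  rw [q₃, q₄] at t₃
  have := add_mem (sub_mem (sub_mem t₃ t₂) t₁) (sub_mem t₅ t₄)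
  convert this using 1
  abel

end Coefficients



/-! #### The comparison with the derivation module -/

/-- The universal cover is path connected. -/
theorem CoverSimplex.exists_edge (c c' : CoverPoint x₀) :
    ∃ s : CoverSimplex x₀ 1, s.pt (stdSimplex.vertex 0) = c ∧ s.pt (stdSimplex.vertex 1) = c' := by
  obtain ⟨y, m⟩ := c
  obtain ⟨y', m'⟩ := c'
  obtain ⟨p, hp⟩ := Path.Homotopic.Quotient.mk_surjective (m.symm.trans m')
  let f : C(ℝ × ℝ, X) := ⟨fun z => p.extend z.1, by fun_prop⟩
  have hf0 : f 0 = y := p.extend_zero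
  let l : Path.Homotopic.Quotient x₀ (f 0) := m.cast rfl hf0
  have hl : (⟨f 0, l⟩ : CoverPoint x₀) = ⟨y, m⟩ :=
    Sigma.ext hf0 (Path.Homotopic.Quotient.cast_heq rfl hf0)
  let s := planeSimplex f l ![0, (1, 0)]
  have h0 : s.pt (stdSimplex.vertex 0) = ⟨y, m⟩ := by
    rw [← hl]
    refine pt_planeSimplex_of_const fun t => ?_
    change f (Path.segment 0 0 t) = f 0
    rw [Path.segment_same]
    rfl
  refine ⟨s, h0, ?_⟩
  have h1 : (s.pt (stdSimplex.vertex 1)).1 = y' := by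
    change f (affineSimplex _ _) = _
    rw [affineSimplex_vertex]
    exact p.extend_one
  obtain ⟨z, n, hz⟩ : ∃ z n, s.pt (stdSimplex.vertex 1) = ⟨z, n⟩ := ⟨_, _, rfl⟩
  obtain ⟨q, hq, rfl⟩ := s.exists_path h0 hz
  rw [hz] at h1
  obtain rfl : z = y' := h1
  have hpq : q = p := by
    ext t
    obtain ⟨b, rfl⟩ := stdSimplexHomeomorphUnitInterval.surjective t
    rw [← hq b]
    change f (affineSimplex ![0, (1, 0)] b) = _
    have : affineSimplex ![0, ((1 : ℝ), (0 : ℝ))] b = (b 1, 0) := by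
      change ∑ i, b i • (![0, ((1 : ℝ), (0 : ℝ))] i) = _
      rw [Fin.sum_univ_two]
      simp
    rw [this]
    exact p.extend_extends' (stdSimplexHomeomorphUnitInterval b)
  rw [hz, hpq, hp, ← Path.Homotopic.Quotient.trans_assoc, Path.Homotopic.Quotient.trans_symm,
    Path.Homotopic.Quotient.refl_trans]

/-- The base point of the universal cover. -/
def baseCoverPoint (x₀ : X) : CoverPoint x₀ := ⟨x₀, Path.Homotopic.Quotient.refl x₀⟩

theorem CoverSimplex.exists_vertex (c : CoverPoint x₀) :
    ∃ s : CoverSimplex x₀ 0, s.pt (stdSimplex.vertex 0) = c := by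
  obtain ⟨s, hs, -⟩ := CoverSimplex.exists_edge c c
  refine ⟨s.face 1, ?_⟩
  rw [CoverSimplex.pt_face, ← hs]
  congr 1
  exact stdSimplex.map_vertex _ _

theorem CoverSimplex.pt_face_zero (s : CoverSimplex x₀ 1) :
    (s.face 0).pt (stdSimplex.vertex 0) = s.pt (stdSimplex.vertex 1) := by
  rw [CoverSimplex.pt_face]
  congr 1
  exact stdSimplex.map_vertex _ _

theorem CoverSimplex.pt_face_one (s : CoverSimplex x₀ 1) :
    (s.face 1).pt (stdSimplex.vertex 0) = s.pt (stdSimplex.vertex 0) := by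
  rw [CoverSimplex.pt_face]
  congr 1
  exact stdSimplex.map_vertex _ _

theorem CoverSimplex.ext_vertex {s s' : CoverSimplex x₀ 0}
    (h : s.pt (stdSimplex.vertex 0) = s'.pt (stdSimplex.vertex 0)) : s = s' := by
  refine CoverSimplex.ext_pt ?_ (stdSimplex.vertex 0) h
  ext b
  rw [Subsingleton.elim b (stdSimplex.vertex 0)]
  exact congrArg Sigma.fst h

section Edges

variable {R : Type*} [CommRing R] {V : Type*} [AddCommGroup V] [Module R V]
  (ρ : FundamentalGroup X x₀ →* Module.End R V)

theorem coverBoundary_edge (s : CoverSimplex x₀ 1) (v : V) :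
    coverBoundary R V x₀ 0 (Finsupp.single s v) =
      Finsupp.single (s.face 0) v - Finsupp.single (s.face 1) v := by
  rw [coverBoundary_single, Fin.sum_univ_two]
  simp [sub_eq_add_neg]

/-- A singular edge of the universal cover with the given end points. -/
def coverEdge (c c' : CoverPoint x₀) : CoverSimplex x₀ 1 := (CoverSimplex.exists_edge c c').choose

theorem coverEdge_zero (c c' : CoverPoint x₀) :
    (coverEdge c c').pt (stdSimplex.vertex 0) = c := (CoverSimplex.exists_edge c c').choose_spec.1

theorem coverEdge_one (c c' : CoverPoint x₀) :
    (coverEdge c c').pt (stdSimplex.vertex 1) = c' := (CoverSimplex.exists_edge c c').choose_spec.2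

/-- The class of an edge modulo boundaries. -/
def edgeClass (s : CoverSimplex x₀ 1) : V →ₗ[R] (CoverSimplex x₀ 1 →₀ V) ⧸ twistedBoundaries ρ 1 :=
  (twistedBoundaries ρ 1).mkQ ∘ₗ Finsupp.lsingle s

theorem edgeClass_triangle {s₁ s₂ s₃ : CoverSimplex x₀ 1} {c₀ c₁ c₂ : CoverPoint x₀}
    (h₁ : s₁.pt (stdSimplex.vertex 0) = c₀) (h₁' : s₁.pt (stdSimplex.vertex 1) = c₁)
    (h₂ : s₂.pt (stdSimplex.vertex 0) = c₁) (h₂' : s₂.pt (stdSimplex.vertex 1) = c₂)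
    (h₃ : s₃.pt (stdSimplex.vertex 0) = c₀) (h₃' : s₃.pt (stdSimplex.vertex 1) = c₂) :
    edgeClass ρ s₃ = edgeClass ρ s₁ + edgeClass ρ s₂ := by
  refine LinearMap.ext fun v => ?_
  change (twistedBoundaries ρ 1).mkQ (Finsupp.single s₃ v) = (twistedBoundaries ρ 1).mkQ
    (Finsupp.single s₁ v) + (twistedBoundaries ρ 1).mkQ (Finsupp.single s₂ v)
  rw [← map_add, ← sub_eq_zero, ← map_sub]
  refine (Submodule.Quotient.mk_eq_zero _).2 ?_
  exact Submodule.mem_sup_left (CoverSimplex.triangle R h₁ h₁' h₂ h₂' h₃ h₃' v)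

theorem edgeClass_eq {s s' : CoverSimplex x₀ 1}
    (h : s.pt (stdSimplex.vertex 0) = s'.pt (stdSimplex.vertex 0))
    (h' : s.pt (stdSimplex.vertex 1) = s'.pt (stdSimplex.vertex 1)) :
    edgeClass ρ s = edgeClass ρ s' := by
  have hc (c : CoverPoint x₀) : edgeClass ρ (coverEdge c c) = 0 := by
    have := edgeClass_triangle ρ (coverEdge_zero c c) (coverEdge_one c c) (coverEdge_zero c c)
      (coverEdge_one c c) (coverEdge_zero c c) (coverEdge_one c c)
    exact left_eq_add.1 this
  have := edgeClass_triangle ρ h h' (coverEdge_zero _ _) (coverEdge_one _ _) rfl rfl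
  rw [hc, add_zero] at this
  exact this.symm

theorem edgeClass_act (s : CoverSimplex x₀ 1) (g : FundamentalGroup X x₀) :
    edgeClass ρ (s.act g) = edgeClass ρ s ∘ₗ ρ g := by
  refine LinearMap.ext fun v => ?_
  change Submodule.Quotient.mk (Finsupp.single (s.act g) v) =
    Submodule.Quotient.mk (Finsupp.single s (ρ g v))
  rw [Submodule.Quotient.eq]
  exact Submodule.mem_sup_right (Submodule.subset_span ⟨s, g, v, rfl⟩)

/-- The class of an edge with the given end points. -/
def joinClass (c c' : CoverPoint x₀) : V →ₗ[R] (CoverSimplex x₀ 1 →₀ V) ⧸ twistedBoundaries ρ 1 :=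
  edgeClass ρ (coverEdge c c')

theorem edgeClass_eq_joinClass (s : CoverSimplex x₀ 1) :
    edgeClass ρ s = joinClass ρ (s.pt (stdSimplex.vertex 0)) (s.pt (stdSimplex.vertex 1)) :=
  edgeClass_eq ρ (coverEdge_zero _ _).symm (coverEdge_one _ _).symm

theorem joinClass_trans (c₀ c₁ c₂ : CoverPoint x₀) :
    joinClass ρ c₀ c₂ = joinClass ρ c₀ c₁ + joinClass ρ c₁ c₂ :=
  edgeClass_triangle ρ (coverEdge_zero _ _) (coverEdge_one _ _) (coverEdge_zero _ _)
    (coverEdge_one _ _) (coverEdge_zero _ _) (coverEdge_one _ _)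

theorem joinClass_act (c c' : CoverPoint x₀) (g : FundamentalGroup X x₀) :
    joinClass ρ (c.act g) (c'.act g) = joinClass ρ c c' ∘ₗ ρ g := by
  rw [joinClass, joinClass, ← edgeClass_act, edgeClass_eq_joinClass, edgeClass_eq_joinClass,
    coverEdge_zero, coverEdge_one, CoverSimplex.pt_act, CoverSimplex.pt_act, coverEdge_zero,
    coverEdge_one]

theorem isDerivation_joinClass : IsDerivation ρ fun g =>
    joinClass ρ (baseCoverPoint x₀) ((baseCoverPoint x₀).act g) := by
  intro g h
  simp only
  rw [← joinClass_act, ← joinClass_trans, CoverPoint.act_act]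

end Edges

variable [PathConnectedSpace X]

variable (x₀) in
/-- For each point of `X` a point of the universal cover above it. -/
def CoverPoint.section (y : X) : Path.Homotopic.Quotient x₀ y :=
  open Classical in
  if h : x₀ = y then h ▸ Path.Homotopic.Quotient.refl x₀
  else Path.Homotopic.Quotient.mk (PathConnectedSpace.somePath x₀ y)

theorem CoverPoint.section_self : CoverPoint.section x₀ x₀ = Path.Homotopic.Quotient.refl x₀ := by
  rw [CoverPoint.section, dif_pos rfl]

/-- The element of the fundamental group that moves the chosen point of a fibre to the given
one. -/
def CoverPoint.deck (c : CoverPoint x₀) : FundamentalGroup X x₀ :=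
  FundamentalGroup.fromPath (c.2.trans (CoverPoint.section x₀ c.1).symm)

theorem CoverPoint.section_act_deck (c : CoverPoint x₀) :
    CoverPoint.act ⟨c.1, CoverPoint.section x₀ c.1⟩ c.deck = c := by
  refine Sigma.ext rfl (heq_of_eq ?_)
  change Path.Homotopic.Quotient.trans
    (Path.Homotopic.Quotient.trans c.2 (CoverPoint.section x₀ c.1).symm) _ = c.2
  rw [Path.Homotopic.Quotient.trans_assoc, Path.Homotopic.Quotient.symm_trans,
    Path.Homotopic.Quotient.trans_refl]

theorem CoverPoint.deck_act (c : CoverPoint x₀) (g : FundamentalGroup X x₀) :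
    (c.act g).deck = c.deck * g :=
  Path.Homotopic.Quotient.trans_assoc g.toPath c.2 (CoverPoint.section x₀ c.1).symm

theorem deck_baseCoverPoint : (baseCoverPoint x₀).deck = 1 := by
  change Path.Homotopic.Quotient.trans (Path.Homotopic.Quotient.refl x₀)
    (CoverPoint.section x₀ x₀).symm = _
  rw [CoverPoint.section_self, Path.Homotopic.Quotient.trans_symm]
  rfl

section Comparison

variable {R : Type*} [CommRing R] {V : Type*} [AddCommGroup V] [Module R V]
  (ρ : FundamentalGroup X x₀ →* Module.End R V)

/-- The value of a chain of points of the universal cover in the coefficients. -/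
def vertexEval : (CoverSimplex x₀ 0 →₀ V) →ₗ[R] V :=
  Finsupp.lsum ℕ fun s => ρ (s.pt (stdSimplex.vertex 0)).deck

theorem vertexEval_single (s : CoverSimplex x₀ 0) (v : V) :
    vertexEval ρ (Finsupp.single s v) = ρ (s.pt (stdSimplex.vertex 0)).deck v := by
  simp [vertexEval]

theorem tensorRelations_le_ker_vertexEval :
    tensorRelations ρ 0 ≤ LinearMap.ker (vertexEval ρ) := by
  refine Submodule.span_le.2 ?_
  rintro _ ⟨s, g, v, rfl⟩
  rw [SetLike.mem_coe, LinearMap.mem_ker, map_sub, vertexEval_single, vertexEval_single,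
    CoverSimplex.pt_act, CoverPoint.deck_act, map_mul, Module.End.mul_apply, sub_self]

/-- The value of a chain of edges of the universal cover in the derivation module. -/
def edgeEval : (CoverSimplex x₀ 1 →₀ V) →ₗ[R] DerivationModule ρ :=
  Finsupp.lsum ℕ fun s => univDerivation ρ (s.pt (stdSimplex.vertex 1)).deck -
    univDerivation ρ (s.pt (stdSimplex.vertex 0)).deck

theorem edgeEval_single (s : CoverSimplex x₀ 1) (v : V) :
    edgeEval ρ (Finsupp.single s v) = univDerivation ρ (s.pt (stdSimplex.vertex 1)).deck v -
      univDerivation ρ (s.pt (stdSimplex.vertex 0)).deck v := by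
  simp [edgeEval]

theorem augmentation_edgeEval (c : CoverSimplex x₀ 1 →₀ V) :
    augmentation ρ (edgeEval ρ c) = vertexEval ρ (coverBoundary R V x₀ 0 c) := by
  induction c using Finsupp.induction_linear with
  | zero => simp
  | add c c' h h' => simp only [map_add, h, h']
  | single s v =>
    rw [edgeEval_single, coverBoundary_edge, map_sub, map_sub, vertexEval_single,
      vertexEval_single, augmentation_apply, augmentation_apply, CoverSimplex.pt_face_zero,
      CoverSimplex.pt_face_one]
    abel

theorem univDerivation_mul_apply {G : Type*} [Group G] (ρ : G →* Module.End R V) (g h : G)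
    (v : V) : univDerivation ρ (g * h) v = univDerivation ρ h v + univDerivation ρ g (ρ h v) := by
  rw [isDerivation_univDerivation]
  rfl

theorem twistedBoundaries_le_ker_edgeEval :
    twistedBoundaries ρ 1 ≤ LinearMap.ker (edgeEval ρ) := by
  refine sup_le ?_ (Submodule.span_le.2 ?_)
  · rintro _ ⟨c, rfl⟩
    rw [LinearMap.mem_ker]
    induction c using Finsupp.induction_linear with
    | zero => simp
    | add c c' h h' => rw [map_add, map_add, h, h', add_zero]
    | single s v =>
      rw [coverBoundary_single, Fin.sum_univ_three]
      have e (i : Fin 3) (j : Fin 2) : (s.face i).pt (stdSimplex.vertex j) =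
          s.pt (stdSimplex.vertex (i.succAbove j)) := by
        rw [CoverSimplex.pt_face]
        congr 1
        exact stdSimplex.map_vertex _ _
      simp only [map_add, edgeEval_single, e]
      have a0 : (0 : Fin 3).succAbove (0 : Fin 2) = 1 := rfl
      have a1 : (0 : Fin 3).succAbove (1 : Fin 2) = 2 := rfl
      have a2 : (1 : Fin 3).succAbove (0 : Fin 2) = 0 := rfl
      have a3 : (1 : Fin 3).succAbove (1 : Fin 2) = 2 := rfl
      have a4 : (2 : Fin 3).succAbove (0 : Fin 2) = 0 := rfl
      have a5 : (2 : Fin 3).succAbove (1 : Fin 2) = 1 := rfl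
      rw [a0, a1, a2, a3, a4, a5]
      simp
      abel
  · rintro _ ⟨s, g, v, rfl⟩
    rw [SetLike.mem_coe, LinearMap.mem_ker, map_sub, edgeEval_single, edgeEval_single,
      CoverSimplex.pt_act, CoverSimplex.pt_act, CoverPoint.deck_act, CoverPoint.deck_act,
      univDerivation_mul_apply, univDerivation_mul_apply]
    abel

/-- The map from the derivation module to the edges modulo boundaries. -/
def derivationToEdges : DerivationModule ρ →ₗ[R]
    (CoverSimplex x₀ 1 →₀ V) ⧸ twistedBoundaries ρ 1 :=
  derivationLift _ (isDerivation_joinClass ρ)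

/-- The edges from the base point to the chosen points of the fibres, as a chain homotopy. -/
def coneMap : (CoverSimplex x₀ 0 →₀ V) →ₗ[R] (CoverSimplex x₀ 1 →₀ V) ⧸ twistedBoundaries ρ 1 :=
  Finsupp.lsum ℕ fun s => joinClass ρ (baseCoverPoint x₀)
    ⟨(s.pt (stdSimplex.vertex 0)).1, CoverPoint.section x₀ (s.pt (stdSimplex.vertex 0)).1⟩ ∘ₗ
      ρ (s.pt (stdSimplex.vertex 0)).deck

theorem coneMap_single (s : CoverSimplex x₀ 0) (v : V) :
    coneMap ρ (Finsupp.single s v) = joinClass ρ (baseCoverPoint x₀)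
    ⟨(s.pt (stdSimplex.vertex 0)).1, CoverPoint.section x₀ (s.pt (stdSimplex.vertex 0)).1⟩
      (ρ (s.pt (stdSimplex.vertex 0)).deck v) := by
  simp [coneMap]

theorem tensorRelations_le_ker_coneMap :
    tensorRelations ρ 0 ≤ LinearMap.ker (coneMap ρ) := by
  refine Submodule.span_le.2 ?_
  rintro _ ⟨s, g, v, rfl⟩
  rw [SetLike.mem_coe, LinearMap.mem_ker, map_sub, coneMap_single, coneMap_single,
    CoverSimplex.pt_act, CoverPoint.deck_act, map_mul, Module.End.mul_apply, sub_eq_zero]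
  rfl

theorem joinClass_base (c : CoverPoint x₀) (v : V) :
    joinClass ρ (baseCoverPoint x₀) c v =
      joinClass ρ (baseCoverPoint x₀) ((baseCoverPoint x₀).act c.deck) v +
        joinClass ρ (baseCoverPoint x₀) ⟨c.1, CoverPoint.section x₀ c.1⟩ (ρ c.deck v) := by
  rw [joinClass_trans ρ _ ((baseCoverPoint x₀).act c.deck) c, LinearMap.add_apply]
  congr 1
  have h := joinClass_act ρ (baseCoverPoint x₀) ⟨c.1, CoverPoint.section x₀ c.1⟩ c.deck
  rw [CoverPoint.section_act_deck] at h
  rw [h]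
  rfl

/-- The chain homotopy formula. -/
theorem mk_eq_derivationToEdges_add (c : CoverSimplex x₀ 1 →₀ V) :
    (twistedBoundaries ρ 1).mkQ c = derivationToEdges ρ (edgeEval ρ c) +
      coneMap ρ (coverBoundary R V x₀ 0 c) := by
  induction c using Finsupp.induction_linear with
  | zero => simp
  | add c c' h h' =>
    simp only [map_add, h, h']
    abel
  | single s v =>
    have h1 : (twistedBoundaries ρ 1).mkQ (Finsupp.single s v) = edgeClass ρ s v := rfl
    have h2 := LinearMap.congr_fun (joinClass_trans ρ (baseCoverPoint x₀)
      (s.pt (stdSimplex.vertex 0)) (s.pt (stdSimplex.vertex 1))) v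
    rw [LinearMap.add_apply, joinClass_base ρ (s.pt (stdSimplex.vertex 1)),
      joinClass_base ρ (s.pt (stdSimplex.vertex 0))] at h2
    rw [h1, edgeClass_eq_joinClass, edgeEval_single, map_sub, derivationToEdges,
      derivationLift_apply, derivationLift_apply, coverBoundary_edge, map_sub, coneMap_single,
      coneMap_single, CoverSimplex.pt_face_zero, CoverSimplex.pt_face_one]
    rw [← sub_eq_iff_eq_add'.2 h2]
    abel

/-- The boundary of an edge from the base point, modulo the tensor relations. -/
theorem exists_boundary_eq (x : DerivationModule ρ) (s₀ : CoverSimplex x₀ 0)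
    (hs₀ : s₀.pt (stdSimplex.vertex 0) = baseCoverPoint x₀) :
    ∃ c : CoverSimplex x₀ 1 →₀ V, edgeEval ρ c = x ∧
      coverBoundary R V x₀ 0 c - Finsupp.single s₀ (augmentation ρ x) ∈ tensorRelations ρ 0 := by
  induction x using derivationModule_induction with
  | h0 => exact ⟨0, by simp⟩
  | hadd x y hx hy =>
    obtain ⟨c, rfl, hc⟩ := hx
    obtain ⟨c', rfl, hc'⟩ := hy
    refine ⟨c + c', map_add _ _ _, ?_⟩
    convert add_mem hc hc' using 1
    simp only [map_add, Finsupp.single_add]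
    abel
  | h1 g v =>
    refine ⟨Finsupp.single (coverEdge (baseCoverPoint x₀) ((baseCoverPoint x₀).act g)) v, ?_, ?_⟩
    · rw [edgeEval_single, coverEdge_zero, coverEdge_one, CoverPoint.deck_act, deck_baseCoverPoint,
        one_mul, (isDerivation_univDerivation ρ).map_one, LinearMap.zero_apply, sub_zero]
    · have h1 : (coverEdge (baseCoverPoint x₀) ((baseCoverPoint x₀).act g)).face 1 = s₀ := by
        refine CoverSimplex.ext_vertex ?_
        rw [CoverSimplex.pt_face_one, coverEdge_zero, hs₀]
      have h0 : (coverEdge (baseCoverPoint x₀) ((baseCoverPoint x₀).act g)).face 0 = s₀.act g := by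
        refine CoverSimplex.ext_vertex ?_
        rw [CoverSimplex.pt_face_zero, coverEdge_one, CoverSimplex.pt_act, hs₀]
      rw [coverBoundary_edge, h0, h1, augmentation_apply, Finsupp.single_sub]
      have : Finsupp.single (s₀.act g) v - Finsupp.single s₀ (ρ g v) ∈ tensorRelations ρ 0 :=
        Submodule.subset_span ⟨s₀, g, v, rfl⟩
      convert this using 1
      abel

/-- The first twisted homology is the first homology of the fundamental group. -/
theorem nonempty_twistedHomology_one_equiv :
    Nonempty (TwistedHomology ρ 1 ≃ₗ[R] LinearMap.ker (augmentation ρ)) := by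
  have hcyc : ∀ c ∈ twistedCycles ρ 1, edgeEval ρ c ∈ LinearMap.ker (augmentation ρ) := by
    intro c hc
    rw [LinearMap.mem_ker, augmentation_edgeEval]
    exact tensorRelations_le_ker_vertexEval ρ hc
  let f : twistedCycles ρ 1 →ₗ[R] LinearMap.ker (augmentation ρ) := (edgeEval ρ).restrict hcyc
  have hf : Function.Surjective f := by
    rintro ⟨x, hx⟩
    obtain ⟨s₀, hs₀⟩ := CoverSimplex.exists_vertex (baseCoverPoint x₀)
    obtain ⟨c, rfl, hc⟩ := exists_boundary_eq ρ x s₀ hs₀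
    rw [LinearMap.mem_ker] at hx
    rw [hx, Finsupp.single_zero, sub_zero] at hc
    exact ⟨⟨c, hc⟩, rfl⟩
  have hker : (twistedBoundaries ρ 1).submoduleOf (twistedCycles ρ 1) = LinearMap.ker f := by
    ext ⟨c, hc⟩
    change c ∈ twistedBoundaries ρ 1 ↔ _
    rw [LinearMap.mem_ker]
    constructor
    · intro h
      exact Subtype.ext (twistedBoundaries_le_ker_edgeEval ρ h)
    · intro h
      have h1 : edgeEval ρ c = 0 := congrArg Subtype.val h
      have h2 := mk_eq_derivationToEdges_add ρ c
      rw [h1, map_zero, zero_add, tensorRelations_le_ker_coneMap ρ hc] at h2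
      exact (Submodule.Quotient.mk_eq_zero _).1 h2
  exact ⟨(Submodule.quotEquivOfEq _ _ hker).trans (f.quotKerEquivOfSurjective hf)⟩

/-- The zeroth twisted homology is the zeroth homology of the fundamental group. -/
theorem nonempty_twistedHomology_zero_equiv :
    Nonempty (TwistedHomology ρ 0 ≃ₗ[R] V ⧸ LinearMap.range (augmentation ρ)) := by
  obtain ⟨s₀, hs₀⟩ := CoverSimplex.exists_vertex (baseCoverPoint x₀)
  let f : twistedCycles ρ 0 →ₗ[R] V ⧸ LinearMap.range (augmentation ρ) :=
    (LinearMap.range (augmentation ρ)).mkQ ∘ₗ vertexEval ρ ∘ₗ (twistedCycles ρ 0).subtype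
  have hf : Function.Surjective f := by
    intro y
    obtain ⟨v, rfl⟩ := Submodule.mkQ_surjective _ y
    refine ⟨⟨Finsupp.single s₀ v, trivial⟩, ?_⟩
    change Submodule.mkQ _ (vertexEval ρ (Finsupp.single s₀ v)) = _
    rw [vertexEval_single, hs₀, deck_baseCoverPoint, map_one, Module.End.one_apply]
  have key (c : CoverSimplex x₀ 0 →₀ V) :
      c - Finsupp.single s₀ (vertexEval ρ c) ∈ twistedBoundaries ρ 0 := by
    induction c using Finsupp.induction_linear with
    | zero => simp
    | add c c' h h' =>
      convert add_mem h h' using 1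
      simp only [map_add, Finsupp.single_add]
      abel
    | single s v =>
      rw [vertexEval_single]
      set c := s.pt (stdSimplex.vertex 0) with hc
      let e := coverEdge (baseCoverPoint x₀) ⟨c.1, CoverPoint.section x₀ c.1⟩
      have h0 : (e.face 0).act c.deck = s := by
        refine CoverSimplex.ext_vertex ?_
        rw [CoverSimplex.pt_act, CoverSimplex.pt_face_zero, coverEdge_one,
          CoverPoint.section_act_deck]
      have h1 : e.face 1 = s₀ := by
        refine CoverSimplex.ext_vertex ?_
        rw [CoverSimplex.pt_face_one, coverEdge_zero, hs₀]
      have m1 : Finsupp.single ((e.face 0).act c.deck) v - Finsupp.single (e.face 0) (ρ c.deck v) ∈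
        twistedBoundaries ρ 0 :=
          Submodule.mem_sup_right (Submodule.subset_span ⟨_, _, _, rfl⟩)
      have m2 : Finsupp.single (e.face 0) (ρ c.deck v) - Finsupp.single (e.face 1) (ρ c.deck v) ∈
        twistedBoundaries ρ 0 :=
          Submodule.mem_sup_left ⟨Finsupp.single e (ρ c.deck v), coverBoundary_edge _ _⟩
      rw [h0] at m1
      rw [h1] at m2
      convert add_mem m1 m2 using 1
      abel
  have hker : (twistedBoundaries ρ 0).submoduleOf (twistedCycles ρ 0) = LinearMap.ker f := by
    ext ⟨c, hc⟩
    change c ∈ twistedBoundaries ρ 0 ↔ _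
    have hf' : f ⟨c, hc⟩ = 0 ↔ vertexEval ρ c ∈ LinearMap.range (augmentation ρ) :=
      Submodule.Quotient.mk_eq_zero _
    rw [LinearMap.mem_ker, hf']
    constructor
    · intro h
      obtain ⟨_, ⟨b, rfl⟩, r, hr, rfl⟩ := Submodule.mem_sup.1 h
      rw [map_add, tensorRelations_le_ker_vertexEval ρ hr, add_zero, ← augmentation_edgeEval]
      exact ⟨_, rfl⟩
    · rintro ⟨x, hx⟩
      obtain ⟨b, -, hb⟩ := exists_boundary_eq ρ x s₀ hs₀
      have h1 := key c
      rw [← hx] at h1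
      have h2 : coverBoundary R V x₀ 0 b ∈ twistedBoundaries ρ 0 := Submodule.mem_sup_left ⟨b, rfl⟩
      have h3 := sub_mem (add_mem h1 h2) (Submodule.mem_sup_right (S := LinearMap.range
        (coverBoundary R V x₀ 0)) hb)
      convert h3 using 1
      abel
  exact ⟨(Submodule.quotEquivOfEq _ _ hker).trans (f.quotKerEquivOfSurjective hf)⟩

end Comparison

end TwistedHomology

/-! ### Cocycles on paths -/

section Cocycles

variable {X : Type*} [TopologicalSpace X] {𝒢 : Type*} [Group 𝒢]

/-- The lower side of the triangle with vertices `(0, 0)`, `(1, 0)`, `(1, 1)`. -/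
def lowerSide : C(I, I × I) := ⟨fun t => (t, 0), by fun_prop⟩

/-- The right side of the triangle with vertices `(0, 0)`, `(1, 0)`, `(1, 1)`. -/
def rightSide : C(I, I × I) := ⟨fun t => (1, t), by fun_prop⟩

/-- The diagonal side of the triangle with vertices `(0, 0)`, `(1, 0)`, `(1, 1)`. -/
def diagonalSide : C(I, I × I) := ⟨fun t => (t, t), by fun_prop⟩

/-- A function on the paths of `X` is a cocycle on `W` if it is multiplicative on the triangles
in `W`. Such a function is the same as a homomorphism of the fundamental groupoid of `W` to the
group, since constant paths are sent to `1` and homotopic paths to the same element; its values on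
paths that leave `W` carry no information. -/
def IsCocycleOn (W : Set X) (v : C(I, X) → 𝒢) : Prop :=
  ∀ f : C(I × I, X), (∀ z, f z ∈ W) →
    v (f.comp diagonalSide) = v (f.comp rightSide) * v (f.comp lowerSide)

namespace IsCocycleOn

variable {W W' : Set X} {v v' : C(I, X) → 𝒢}

theorem mono (hv : IsCocycleOn W v) (h : W' ⊆ W) : IsCocycleOn W' v :=
  fun f hf => hv f fun z => h (hf z)

theorem const (hv : IsCocycleOn W v) {x : X} (hx : x ∈ W) : v (.const I x) = 1 := by
  have := hv (.const (I × I) x) fun _ => hx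
  exact left_eq_mul.1 this

theorem comap (hv : IsCocycleOn W v) {Y : Type*} [TopologicalSpace Y] (g : C(Y, X)) :
    IsCocycleOn (g ⁻¹' W) fun γ => v (g.comp γ) :=
  fun f hf => hv (g.comp f) hf

/-- A change of the trivialization of the fibres by `u`: cocycles on `W` up to twists are
representations of the fundamental groupoid up to isomorphism. -/
theorem twist (hv : IsCocycleOn W v) (u : X → 𝒢) :
    IsCocycleOn W fun γ => u (γ 1) * v γ * (u (γ 0))⁻¹ := by
  intro f hf
  have h1 : (f.comp diagonalSide) 0 = (f.comp lowerSide) 0 := rfl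
  have h2 : (f.comp diagonalSide) 1 = (f.comp rightSide) 1 := rfl
  have h3 : (f.comp lowerSide) 1 = (f.comp rightSide) 0 := rfl
  simp only [h1, h2, h3, hv f hf]
  group

theorem trans (hv : IsCocycleOn W v) {x y z : X} (p : Path x y) (q : Path y z)
    (hp : ∀ t, p t ∈ W) (hq : ∀ t, q t ∈ W) : v (p.trans q) = v q * v p := by
  let f : C(I × I, X) := ⟨fun z => (p.trans q).extend ((z.1 + z.2 : ℝ) / 2), by fun_prop⟩
  have hW : ∀ t, (p.trans q).extend t ∈ W := by
    intro t
    have : (p.trans q).extend t ∈ Set.range (p.trans q) := by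
      rw [← Path.extend_range]
      exact ⟨t, rfl⟩
    rw [Path.trans_range] at this
    rcases this with ⟨s, hs⟩ | ⟨s, hs⟩
    · exact hs ▸ hp s
    · exact hs ▸ hq s
  have := hv f fun _ => hW _
  have e1 : f.comp diagonalSide = (p.trans q : C(I, X)) := by
    ext t
    change (p.trans q).extend ((t + t : ℝ) / 2) = (p.trans q) t
    rw [add_self_div_two, Path.extend_extends']
  have e2 : f.comp rightSide = (q : C(I, X)) := by
    ext t
    change (p.trans q).extend (((1 : I) + t : ℝ) / 2) = q t
    rw [Path.extend_trans_of_half_le, ← q.extend_extends' t]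
    · congr 1
      simp
      ring
    · have := t.2.1
      simp
      linarith
  have e3 : f.comp lowerSide = (p : C(I, X)) := by
    ext t
    change (p.trans q).extend ((t + (0 : I) : ℝ) / 2) = p t
    rw [Path.extend_trans_of_le_half, ← p.extend_extends' t]
    · congr 1
      simp
      ring
    · have := t.2.2
      simp
      linarith
  rwa [e1, e2, e3] at this

theorem symm (hv : IsCocycleOn W v) {x y : X} (p : Path x y) (hp : ∀ t, p t ∈ W) :
    v p.symm = (v p)⁻¹ := by
  let f : C(I × I, X) := ⟨fun z => p.extend (z.1 - z.2 : ℝ), by fun_prop⟩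
  have hW : ∀ t, p.extend t ∈ W := fun t => hp _
  have := hv f fun _ => hW _
  have e1 : f.comp diagonalSide = .const I x := by
    ext t
    change p.extend (t - t : ℝ) = x
    rw [sub_self, Path.extend_zero]
  have e2 : f.comp rightSide = (p.symm : C(I, X)) := by
    ext t
    change p.extend ((1 : I) - t : ℝ) = p (σ t)
    rw [← p.extend_extends']
    simp
  have e3 : f.comp lowerSide = (p : C(I, X)) := by
    ext t
    change p.extend (t - (0 : I) : ℝ) = p t
    rw [← p.extend_extends']
    simp
  have hx : x ∈ W := by
    have := hp 0
    rwa [p.source] at this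
  rw [e1, e2, e3, hv.const hx] at this
  exact eq_inv_of_mul_eq_one_left this.symm

/-- A cocycle takes equal values on paths that are homotopic in `W` relative to the end points:
split the square along its diagonal. -/
theorem of_homotopy (hv : IsCocycleOn W v) (H : C(I × I, X)) (hH : ∀ z, H z ∈ W)
    (h0 : ∀ s, H (s, 0) = H (0, 0)) (h1 : ∀ s, H (s, 1) = H (0, 1)) {p q : C(I, X)}
    (hp : ∀ t, H (0, t) = p t) (hq : ∀ t, H (1, t) = q t) : v p = v q := by
  have e1 := hv H hH
  have e2 := hv (H.comp ⟨Prod.swap, continuous_swap⟩) fun _ => hH _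
  have a1 : H.comp lowerSide = .const I (H (0, 0)) := by
    ext t
    exact h0 t
  have a2 : (H.comp ⟨Prod.swap, continuous_swap⟩).comp rightSide = .const I (H (0, 1)) := by
    ext t
    exact h1 t
  have a3 : H.comp rightSide = q := by
    ext t
    exact hq t
  have a4 : (H.comp ⟨Prod.swap, continuous_swap⟩).comp lowerSide = p := by
    ext t
    exact hp t
  rw [a1, a3, hv.const (hH _), mul_one] at e1
  rw [a2, a4, hv.const (hH _), one_mul] at e2
  rw [← e1, ← e2]
  rfl

theorem of_homotopic (hv : IsCocycleOn Set.univ v) {x y : X} {p q : Path x y}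
    (h : p.Homotopic q) : v p = v q := by
  obtain ⟨H⟩ := h
  exact hv.of_homotopy ⟨H, H.continuous⟩ (fun _ => trivial) (fun s => by simp) (fun s => by simp)
    (fun t => H.apply_zero t) (fun t => H.apply_one t)

/-- The homomorphism on a fundamental group given by a cocycle. -/
def toHom (hv : IsCocycleOn Set.univ v) (x : X) : FundamentalGroup X x →* 𝒢 where
  toFun g := Quotient.lift (fun p : Path x x => v p) (fun _ _ h => hv.of_homotopic h) g.toPath
  map_one' := hv.const (x := x) trivial
  map_mul' g h := by
    obtain ⟨p, hp⟩ := Path.Homotopic.Quotient.mk_surjective g.toPath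
    obtain ⟨q, hq⟩ := Path.Homotopic.Quotient.mk_surjective h.toPath
    have hm : FundamentalGroup.toPath (g * h) = Path.Homotopic.Quotient.mk (q.trans p) := by
      rw [Path.Homotopic.Quotient.mk_trans, hp, hq]
      rfl
    rw [hm, ← hp, ← hq]
    exact hv.trans q p (fun _ => trivial) fun _ => trivial

end IsCocycleOn

theorem isCocycleOn_one {W : Set X} : IsCocycleOn W fun _ => (1 : 𝒢) := by
  intro f _
  simp

/-- Extension of a function on the paths of a subspace. -/
def extendCocycle (W : Set X) (v : C(I, W) → 𝒢) (γ : C(I, X)) : 𝒢 :=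
  open Classical in
  if h : ∀ t, γ t ∈ W then v ⟨fun t => ⟨γ t, h t⟩, by fun_prop⟩ else 1

theorem extendCocycle_comp {W : Set X} (v : C(I, W) → 𝒢) (γ : C(I, W)) :
    extendCocycle W v (ContinuousMap.comp ⟨Subtype.val, continuous_subtype_val⟩ γ) = v γ := by
  exact dif_pos fun t => (γ t).2

theorem IsCocycleOn.extend {W : Set X} {v : C(I, W) → 𝒢} (hv : IsCocycleOn Set.univ v) :
    IsCocycleOn W (extendCocycle W v) := by
  intro f hf
  let f' : C(I × I, W) := ⟨fun z => ⟨f z, hf z⟩, by fun_prop⟩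
  exact ((extendCocycle_comp v _).trans (hv f' fun _ => trivial)).trans
    (congrArg₂ _ (extendCocycle_comp v _) (extendCocycle_comp v _)).symm

/-- Every homomorphism on the fundamental group comes from a cocycle. -/
theorem exists_isCocycleOn_of_hom [PathConnectedSpace X] {x₀ : X}
    (φ : FundamentalGroup X x₀ →* 𝒢) : ∃ v : C(I, X) → 𝒢, IsCocycleOn Set.univ v ∧
      ∀ p : Path x₀ x₀, v p = φ (FundamentalGroup.fromPath (Path.Homotopic.Quotient.mk p)) := by
  let m {x y : X} (p : Path x y) : FundamentalGroup X x₀ := FundamentalGroup.fromPath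
    (((CoverPoint.section x₀ x).trans (Path.Homotopic.Quotient.mk p)).trans
      (CoverPoint.section x₀ y).symm)
  refine ⟨fun γ => φ (m (⟨γ, rfl, rfl⟩ : Path (γ 0) (γ 1))), ?_, ?_⟩
  · intro f _
    refine (congrArg φ ?_).trans (map_mul φ _ _)
    let p : Path (f (0, 0)) (f (1, 0)) := ⟨f.comp lowerSide, rfl, rfl⟩
    let q : Path (f (1, 0)) (f (1, 1)) := ⟨f.comp rightSide, rfl, rfl⟩
    let r : Path (f (0, 0)) (f (1, 1)) := ⟨f.comp diagonalSide, rfl, rfl⟩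
    change m r = m q * m p
    have hr : r.Homotopic (p.trans q) := by
      let p' : Path ((0, 0) : I × I) (1, 0) := ⟨lowerSide, rfl, rfl⟩
      let q' : Path ((1, 0) : I × I) (1, 1) := ⟨rightSide, rfl, rfl⟩
      let r' : Path ((0, 0) : I × I) (1, 1) := ⟨diagonalSide, rfl, rfl⟩
      have hc : ContractibleSpace I :=
        (convex_Icc (0 : ℝ) 1).contractibleSpace ⟨0, by simp⟩
      have h := (SimplyConnectedSpace.paths_homotopic r' (p'.trans q')).map f
      rw [Path.map_trans] at h
      exact h
    have h1 : Path.Homotopic.Quotient.mk r = (Path.Homotopic.Quotient.mk p).trans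
        (Path.Homotopic.Quotient.mk q) := by
      rw [← Path.Homotopic.Quotient.mk_trans]
      exact Path.Homotopic.Quotient.eq.2 hr
    change _ = Path.Homotopic.Quotient.trans
      (((CoverPoint.section x₀ _).trans (Path.Homotopic.Quotient.mk p)).trans
        (CoverPoint.section x₀ _).symm)
      (((CoverPoint.section x₀ _).trans (Path.Homotopic.Quotient.mk q)).trans
        (CoverPoint.section x₀ _).symm)
    change ((CoverPoint.section x₀ _).trans (Path.Homotopic.Quotient.mk r)).trans
        (CoverPoint.section x₀ _).symm = _
    rw [h1]
    simp only [Path.Homotopic.Quotient.trans_assoc]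
    rw [← Path.Homotopic.Quotient.trans_assoc (CoverPoint.section x₀ _).symm,
      Path.Homotopic.Quotient.symm_trans, Path.Homotopic.Quotient.refl_trans]
  · intro p
    have hq (x y : X) (q : Path x y) (hx : x = x₀) (hy : y = x₀)
        (hqp : (q : C(I, X)) = (p : C(I, X))) :
        m q = FundamentalGroup.fromPath (Path.Homotopic.Quotient.mk p) := by
      subst hx
      subst hy
      obtain rfl : q = p := by
        ext t
        exact DFunLike.congr_fun hqp t
      change ((CoverPoint.section y y).trans (Path.Homotopic.Quotient.mk q)).trans
        (CoverPoint.section y y).symm = _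
      rw [CoverPoint.section_self, Path.Homotopic.Quotient.refl_trans]
      have : (Path.Homotopic.Quotient.refl y).symm = Path.Homotopic.Quotient.refl y := rfl
      rw [this, Path.Homotopic.Quotient.trans_refl]
    exact congrArg φ (hq _ _ ⟨p, rfl, rfl⟩ p.source p.target rfl)

/-- A cocycle on a path connected subspace is determined up to a twist by its values on loops. -/
theorem IsCocycleOn.exists_twist {W : Set X} {v v' : C(I, X) → 𝒢} (hv : IsCocycleOn W v)
    (hv' : IsCocycleOn W v') {x₀ : X} (hW : ∀ x ∈ W, JoinedIn W x₀ x) (e : 𝒢)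
    (h : ∀ p : Path x₀ x₀, (∀ t, p t ∈ W) → v' p = e * v p * e⁻¹) :
    ∃ u : X → 𝒢, (x₀ ∈ W → u x₀ = e) ∧
      ∀ γ : C(I, X), (∀ t, γ t ∈ W) → v' γ = u (γ 1) * v γ * (u (γ 0))⁻¹ := by
  classical
  let u : X → 𝒢 := fun x => if hx : x ∈ W then
    v' (hW x hx).somePath * e * (v (hW x hx).somePath)⁻¹ else 1
  have hu {x y : X} (p : Path x y) (hp : ∀ t, p t ∈ W) : v' p = u y * v p * (u x)⁻¹ := by
    have hx : x ∈ W := p.source ▸ hp 0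
    have hy : y ∈ W := p.target ▸ hp 1
    have hpx := (hW x hx).somePath_mem
    have hpy := (hW y hy).somePath_mem
    have hpy' : ∀ t, (hW y hy).somePath.symm t ∈ W := fun t => hpy _
    have hq : ∀ t, (p.trans (hW y hy).somePath.symm) t ∈ W := by
      intro t
      rw [Path.trans_apply]
      split_ifs
      · exact hp _
      · exact hpy _
    have hr : ∀ t, ((hW x hx).somePath.trans (p.trans (hW y hy).somePath.symm)) t ∈ W := by
      intro t
      rw [Path.trans_apply]
      split_ifs
      · exact hpx _
      · exact hq _
    have := h _ hr
    rw [hv.trans _ _ hpx hq, hv.trans _ _ hp hpy', hv.symm _ hpy, hv'.trans _ _ hpx hq,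
      hv'.trans _ _ hp hpy', hv'.symm _ hpy] at this
    have h2 : v' p = v' (hW y hy).somePath *
        ((v' (hW y hy).somePath)⁻¹ * v' p * v' (hW x hx).somePath) *
        (v' (hW x hx).somePath)⁻¹ := by group
    rw [h2, this]
    simp only [u, dif_pos hx, dif_pos hy]
    group
  refine ⟨u, fun hx => ?_, fun γ hγ => hu (⟨γ, rfl, rfl⟩ : Path (γ 0) (γ 1)) hγ⟩
  simp only [u, dif_pos hx]
  rw [h _ (hW x₀ hx).somePath_mem]
  group

/-! ### Gluing of cocycles -/

/-- The restriction of a map of the plane to a segment. -/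
def segmentMap {E : Type*} [NormedAddCommGroup E] [NormedSpace ℝ E] (f : C(E, X)) (z w : E) :
    C(I, X) := ⟨fun t => f (AffineMap.lineMap z w (t : ℝ)), by fun_prop⟩

/-- A cocycle is multiplicative on affine triangles, also degenerate ones. -/
theorem IsCocycleOn.segment_mul {W : Set X} {v : C(I, X) → 𝒢} (hv : IsCocycleOn W v)
    {E : Type*} [NormedAddCommGroup E] [NormedSpace ℝ E] (f : C(E, X)) {C : Set E}
    (hC : Convex ℝ C) (hf : ∀ z ∈ C, f z ∈ W) {a b c : E} (ha : a ∈ C) (hb : b ∈ C) (hc : c ∈ C) :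
    v (segmentMap f a c) = v (segmentMap f b c) * v (segmentMap f a b) := by
  let T : C(I × I, E) := ⟨fun z => a + (z.1 : ℝ) • (b - a) + (min z.1 z.2 : ℝ) • (c - b),
    by fun_prop⟩
  have hT : ∀ z, T z ∈ C := by
    rintro ⟨⟨s, hs0, hs1⟩, ⟨t, ht0, ht1⟩⟩
    change a + s • (b - a) + (min s t) • (c - b) ∈ C
    have h1 : a + s • (b - a) + (min s t) • (c - b) =
        (1 - s) • a + s • b + (min s t) • (c - b) := by module
    by_cases h : s = 0
    · subst h
      rw [min_eq_left ht0]
      simpa using ha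
    · have hs : 0 < s := lt_of_le_of_ne hs0 (Ne.symm h)
      have h2 : a + s • (b - a) + (min s t) • (c - b) =
          (1 - s) • a + s • ((1 - min s t / s) • b + (min s t / s) • c) := by
        have : min s t = s * (min s t / s) := by field_simp
        generalize min s t / s = r at this ⊢
        rw [this]
        module
      rw [h2]
      have h3 : min s t / s ≤ 1 := by
        rw [div_le_one hs]
        exact min_le_left _ _
      have h4 : 0 ≤ min s t / s := by positivity
      exact hC ha (hC hb hc (by linarith) h4 (by ring)) (by linarith) hs0 (by ring)
  have := hv (f.comp T) fun z => hf _ (hT z)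
  convert this using 2
  · ext t
    change f _ = f _
    congr 1
    change AffineMap.lineMap a c (t : ℝ) = a + (t : ℝ) • (b - a) + (min t t : ℝ) • (c - b)
    rw [min_self, AffineMap.lineMap_apply]
    simp only [vsub_eq_sub, vadd_eq_add]
    module
  · congr 1
    ext t
    change f _ = f _
    congr 1
    change AffineMap.lineMap b c (t : ℝ) = a + (1 : ℝ) • (b - a) + (min (1 : ℝ) t) • (c - b)
    rw [min_eq_right t.2.2, AffineMap.lineMap_apply]
    simp only [vsub_eq_sub, vadd_eq_add]
    module
  · congr 1
    ext t
    change f _ = f _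
    congr 1
    change AffineMap.lineMap a b (t : ℝ) = a + (t : ℝ) • (b - a) + (min (t : ℝ) 0) • (c - b)
    rw [min_eq_right t.2.1, AffineMap.lineMap_apply]
    simp only [vsub_eq_sub, vadd_eq_add]
    module

/-- A local cocycle of pairs of points in a ball is locally a coboundary. -/
theorem exists_primitive {E : Type*} [NormedAddCommGroup E] [NormedSpace ℝ E]
    (c : E → E → 𝒢) {δ : ℝ} (hδ : 0 < δ) (hc : ∀ x y z w : E, dist x y < δ → dist x z < δ →
      dist x w < δ → c w z * c y w = c y z) (r : ℝ) :
    ∃ F : E → 𝒢, ∀ z w, ‖z‖ ≤ r → ‖w‖ ≤ r → dist z w < δ / 2 → F w = c z w * F z := by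
  obtain ⟨N, hN⟩ := exists_nat_gt (2 * r / δ)
  let N' : ℝ := N + 1
  have hN0 : 0 < N' := by positivity
  have hN' : r / N' < δ / 2 := by
    rw [div_lt_iff₀ hN0]
    rw [div_lt_iff₀ hδ] at hN
    simp only [N']
    linarith
  let F : ℕ → E → 𝒢 := fun k => Nat.rec (fun _ => 1)
    (fun k G z => c ((k / N') • z) (((k + 1 : ℕ) / N') • z) * G z) k
  have hF (k : ℕ) (z : E) : F (k + 1) z =
    c ((k / N') • z) (((k + 1 : ℕ) / N') • z) * F k z := rfl
  have key (z w : E) (hz : ‖z‖ ≤ r) (hw : ‖w‖ ≤ r) (hzw : dist z w < δ / 2) (k : ℕ)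
      (hk : k ≤ N + 1) : F k w = c ((k / N') • z) ((k / N') • w) * F k z := by
    induction k with
    | zero =>
      have : c 0 0 = 1 := by
        have := hc 0 0 0 0 (by simpa) (by simpa) (by simpa)
        exact mul_eq_left.1 this
      change 1 = c _ _ * 1
      simp [this]
    | succ k ih =>
      rw [hF, hF, ih (by omega), ← mul_assoc, ← mul_assoc]
      congr 1
      have hk1 : (k / N' : ℝ) ≤ 1 := by
        rw [div_le_one hN0]
        simp only [N']
        exact_mod_cast (by omega : k ≤ N + 1)
      have hk2 : ((k + 1 : ℕ) / N' : ℝ) ≤ 1 := by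
        rw [div_le_one hN0]
        simp only [N']
        exact_mod_cast hk
      have d1 (a : ℝ) (ha : 0 ≤ a) (ha1 : a ≤ 1) : dist (a • z) (a • w) < δ / 2 := by
        rw [dist_smul₀, Real.norm_of_nonneg ha]
        calc a * dist z w ≤ 1 * dist z w := by gcongr
          _ < δ / 2 := by rwa [one_mul]
      have d2 (x : E) (hx : ‖x‖ ≤ r) :
          dist ((k / N') • x) (((k + 1 : ℕ) / N') • x) < δ / 2 := by
        rw [dist_eq_norm, ← sub_smul, norm_smul]
        have : (k / N' - (k + 1 : ℕ) / N' : ℝ) = -(1 / N') := by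
          push_cast
          ring
        rw [this, norm_neg, Real.norm_of_nonneg (by positivity)]
        calc 1 / N' * ‖x‖ ≤ 1 / N' * r := by gcongr
          _ = r / N' := by ring
          _ < δ / 2 := hN'
      have e1 := d1 (k / N') (by positivity) hk1
      have e2 := d1 ((k + 1 : ℕ) / N') (by positivity) hk2
      have e3 := d2 z hz
      have e4 := d2 w hw
      have f1 : c ((k / N') • w) (((k + 1 : ℕ) / N') • w) * c ((k / N') • z) ((k / N') • w) =
          c ((k / N') • z) (((k + 1 : ℕ) / N') • w) := by
        refine hc ((k / N') • w) _ _ _ ?_ ?_ ?_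
        · rw [dist_comm]; linarith
        · linarith
        · rwa [dist_self]
      have f2 : c (((k + 1 : ℕ) / N') • z) (((k + 1 : ℕ) / N') • w) *
          c ((k / N') • z) (((k + 1 : ℕ) / N') • z) = c ((k / N') • z) (((k + 1 : ℕ) / N') • w) := by
        refine hc (((k + 1 : ℕ) / N') • z) _ _ _ ?_ ?_ ?_
        · rw [dist_comm]; linarith
        · linarith
        · rwa [dist_self]
      rw [f1, f2]
  refine ⟨F (N + 1), fun z w hz hw hzw => ?_⟩
  have := key z w hz hw hzw (N + 1) le_rfl
  have h1 : ((N + 1 : ℕ) / N' : ℝ) = 1 := by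
    simp only [N']
    push_cast
    exact div_self (by positivity)
  rwa [h1, one_smul, one_smul] at this

/-- A function on the unit interval that is constant on small intervals is constant. -/
theorem eq_of_locally_constant {α : Type*} (G : ℝ → α) {δ : ℝ} (hδ : 0 < δ)
    (h : ∀ s ∈ I, ∀ t ∈ I, dist s t < δ → G s = G t) : G 0 = G 1 := by
  obtain ⟨N, hN⟩ := exists_nat_gt (1 / δ)
  have hN0 : (0 : ℝ) < N := lt_trans (by positivity) hN
  have key (k : ℕ) (hk : k ≤ N) : G 0 = G (k / N) := by
    induction k with
    | zero => simp
    | succ k ih =>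
      rw [ih (by omega)]
      have hk' : ((k + 1 : ℕ) : ℝ) ≤ N := by exact_mod_cast hk
      refine h _ ⟨by positivity, ?_⟩ _ ⟨by positivity, ?_⟩ ?_
      · rw [div_le_one hN0]
        push_cast at hk'
        linarith
      · rwa [div_le_one hN0]
      · rw [Real.dist_eq, ← sub_div]
        push_cast
        rw [abs_div, abs_of_pos hN0, div_lt_iff₀ hN0]
        rw [div_lt_iff₀ hδ] at hN
        simp
        linarith
  rw [key N le_rfl, div_self hN0.ne']

/-- The extension of a path to the real line. -/
def extendPath (γ : C(I, X)) : C(ℝ, X) := γ.comp ⟨Set.projIcc 0 1 zero_le_one, continuous_projIcc⟩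

theorem segmentMap_extendPath (γ : C(I, X)) : segmentMap (extendPath γ) 0 1 = γ := by
  ext t
  change γ (Set.projIcc 0 1 zero_le_one (AffineMap.lineMap (0 : ℝ) 1 (t : ℝ))) = γ t
  have : (AffineMap.lineMap (0 : ℝ) 1 (t : ℝ)) = (t : ℝ) := by simp [AffineMap.lineMap_apply]
  rw [this]
  congr 1
  exact Set.projIcc_val zero_le_one t

section Glue

variable {ι : Type*} {W : ι → Set X} (hW : ∀ x, ∃ i, W i ∈ nhds x)
  {v : ι → C(I, X) → 𝒢} (hv : ∀ i, IsCocycleOn (W i) (v i))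
  (hcompat : ∀ i j (γ : C(I, X)), (∀ t, γ t ∈ W i) → (∀ t, γ t ∈ W j) → v i γ = v j γ)

variable (W v) in
/-- The common value of the cocycles on a path that lies in one of the sets. -/
def localValue (γ : C(I, X)) : 𝒢 :=
  open Classical in if h : ∃ i, ∀ t, γ t ∈ W i then v h.choose γ else 1

variable (W v) in
/-- A function on `I` that changes by the local values along a path. -/
def IsPrimitive (γ : C(I, X)) (F : ℝ → 𝒢) : Prop :=
  ∃ δ > 0, ∀ s ∈ I, ∀ t ∈ I, dist s t < δ →
    F t = localValue W v (segmentMap (extendPath γ) s t) * F s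

include hcompat in
theorem localValue_eq {γ : C(I, X)} {i : ι} (h : ∀ t, γ t ∈ W i) : localValue W v γ = v i γ := by
  have h' : ∃ i, ∀ t, γ t ∈ W i := ⟨i, h⟩
  rw [localValue, dif_pos h']
  exact hcompat _ _ _ h'.choose_spec h

theorem IsPrimitive.unique {γ : C(I, X)} {F F' : ℝ → 𝒢} (hF : IsPrimitive W v γ F)
    (hF' : IsPrimitive W v γ F') : F 1 * (F 0)⁻¹ = F' 1 * (F' 0)⁻¹ := by
  obtain ⟨δ, hδ, h⟩ := hF
  obtain ⟨δ', hδ', h'⟩ := hF'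
  have := eq_of_locally_constant (fun t => (F' t)⁻¹ * F t) (lt_min hδ hδ') fun s hs t ht hst => by
    rw [h s hs t ht (hst.trans_le (min_le_left _ _)), h' s hs t ht (hst.trans_le (min_le_right _ _))]
    group
  beta_reduce at this
  rw [inv_mul_eq_iff_eq_mul] at this
  rw [mul_inv_eq_iff_eq_mul]
  rw [this]
  group

/-- A Lebesgue number for a map of the square. -/
theorem exists_lebesgue_number (hW : ∀ x, ∃ i, W i ∈ nhds x) (f : C(I × I, X)) :
    ∃ δ > 0, ∀ z : I × I, ∃ i, ∀ w, dist w z < δ → f w ∈ W i := by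
  obtain ⟨δ, hδ, h⟩ := lebesgue_number_lemma_of_metric (isCompact_univ (X := I × I))
    (c := fun i => interior (f ⁻¹' W i)) (fun i => isOpen_interior) (by
      intro z _
      obtain ⟨i, hi⟩ := hW (f z)
      exact Set.mem_iUnion.2 ⟨i, mem_interior_iff_mem_nhds.2 (f.continuous.continuousAt hi)⟩)
  refine ⟨δ, hδ, fun z => ?_⟩
  obtain ⟨i, hi⟩ := h z trivial
  exact ⟨i, fun w hw => interior_subset (s := f ⁻¹' W i) (hi hw)⟩

/-- The extension of a map of the square to the plane. -/
def extendSquare (f : C(I × I, X)) : C(ℝ × ℝ, X) :=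
  f.comp ⟨fun z => (Set.projIcc 0 1 zero_le_one z.1, Set.projIcc 0 1 zero_le_one z.2), by
    have : Continuous (Set.projIcc (0 : ℝ) 1 zero_le_one) := continuous_projIcc
    fun_prop⟩

theorem exists_ball_of_extendSquare (hW : ∀ x, ∃ i, W i ∈ nhds x) (f : C(I × I, X)) :
    ∃ δ > 0, ∀ z : ℝ × ℝ, ∃ i, ∀ w ∈ Metric.ball z δ, extendSquare f w ∈ W i := by
  obtain ⟨δ, hδ, h⟩ := exists_lebesgue_number hW f
  refine ⟨δ, hδ, fun z => ?_⟩
  obtain ⟨i, hi⟩ := h (Set.projIcc 0 1 zero_le_one z.1, Set.projIcc 0 1 zero_le_one z.2)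
  refine ⟨i, fun w hw => hi _ ?_⟩
  have hlip : LipschitzWith 1 (Set.projIcc (0 : ℝ) 1 zero_le_one) := LipschitzWith.projIcc _
  rw [Metric.mem_ball, Prod.dist_eq, max_lt_iff] at hw
  rw [Prod.dist_eq, max_lt_iff]
  exact ⟨(by simpa using hlip.dist_le_mul w.1 z.1 : _ ≤ _).trans_lt hw.1,
    (by simpa using hlip.dist_le_mul w.2 z.2 : _ ≤ _).trans_lt hw.2⟩

include hW hv hcompat in
/-- A map of the square has a primitive on the square. -/
theorem exists_square_primitive (f : C(I × I, X)) :
    ∃ F : ℝ × ℝ → 𝒢, ∀ (γ : C(I, X)) (a b : ℝ × ℝ), a ∈ Set.Icc 0 1 → b ∈ Set.Icc 0 1 →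
      (∀ t : I, γ t = extendSquare f (AffineMap.lineMap a b (t : ℝ))) →
      IsPrimitive W v γ fun t => F (AffineMap.lineMap a b t) := by
  obtain ⟨δ, hδ, h⟩ := exists_ball_of_extendSquare hW f
  obtain ⟨F, hF⟩ := exists_primitive
    (fun z w => localValue W v (segmentMap (extendSquare f) z w)) hδ (by
      intro x y z w hy hz hw
      obtain ⟨i, hi⟩ := h x
      have hy' : y ∈ Metric.ball x δ := by rwa [Metric.mem_ball, dist_comm]
      have hz' : z ∈ Metric.ball x δ := by rwa [Metric.mem_ball, dist_comm]
      have hw' : w ∈ Metric.ball x δ := by rwa [Metric.mem_ball, dist_comm]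
      have hm : ∀ a ∈ Metric.ball x δ, ∀ b ∈ Metric.ball x δ,
          localValue W v (segmentMap (extendSquare f) a b) =
            v i (segmentMap (extendSquare f) a b) := by
        intro a ha b hb
        refine localValue_eq hcompat fun t => hi _ ?_
        exact (convex_ball x δ).lineMap_mem ha hb t.2
      rw [hm _ hw' _ hz', hm _ hy' _ hw', hm _ hy' _ hz']
      exact ((hv i).segment_mul (extendSquare f) (convex_ball x δ) hi hy' hw' hz').symm) 1
  refine ⟨F, fun γ a b ha hb hγ => ?_⟩
  have hnorm : ∀ z ∈ Set.Icc (0 : ℝ × ℝ) 1, ‖z‖ ≤ 1 := by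
    rintro ⟨x, y⟩ ⟨h0, h1⟩
    rw [Prod.le_def] at h0 h1
    rw [Prod.norm_def, max_le_iff, Real.norm_of_nonneg h0.1, Real.norm_of_nonneg h0.2]
    exact ⟨h1.1, h1.2⟩
  have hconv : Convex ℝ (Set.Icc (0 : ℝ × ℝ) 1) := convex_Icc 0 1
  refine ⟨δ / 2 / (1 + dist a b), by positivity, fun s hs t ht hst => ?_⟩
  have hd : dist (AffineMap.lineMap a b s : ℝ × ℝ) (AffineMap.lineMap a b t) < δ / 2 := by
    rw [dist_lineMap_lineMap]
    rw [lt_div_iff₀ (by positivity)] at hst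
    have := dist_nonneg (x := s) (y := t)
    nlinarith
  beta_reduce
  rw [hF _ _ (hnorm _ (hconv.lineMap_mem ha hb hs)) (hnorm _ (hconv.lineMap_mem ha hb ht)) hd]
  congr 2
  ext r
  have hr : AffineMap.lineMap s t (r : ℝ) ∈ I := (convex_Icc (0 : ℝ) 1).lineMap_mem hs ht r.2
  change extendSquare f _ = γ (Set.projIcc 0 1 zero_le_one (AffineMap.lineMap s t (r : ℝ)))
  rw [Set.projIcc_of_mem zero_le_one hr, hγ]
  congr 1
  simp only [AffineMap.lineMap_apply, vsub_eq_sub, vadd_eq_add, smul_eq_mul]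
  module

include hW hv hcompat in
/-- Primitives exist along any path; their increments `F 1 * (F 0)⁻¹` are the values of the glued
cocycle. -/
theorem exists_isPrimitive (γ : C(I, X)) : ∃ F, IsPrimitive W v γ F := by
  obtain ⟨F, hF⟩ := exists_square_primitive hW hv hcompat (γ.comp ⟨Prod.fst, continuous_fst⟩)
  refine ⟨_, hF γ (0, 0) (1, 0) ?_ ?_ ?_⟩
  · exact ⟨le_rfl, Prod.le_def.2 ⟨zero_le_one, zero_le_one⟩⟩
  · exact ⟨Prod.le_def.2 ⟨zero_le_one, le_rfl⟩, Prod.le_def.2 ⟨le_rfl, zero_le_one⟩⟩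
  · intro t
    change γ t = γ (Set.projIcc 0 1 zero_le_one (AffineMap.lineMap ((0 : ℝ), (0 : ℝ)) (1, 0) (t : ℝ)).1)
    have : (AffineMap.lineMap ((0 : ℝ), (0 : ℝ)) (1, 0) (t : ℝ)).1 = (t : ℝ) := by
      simp [AffineMap.lineMap_apply]
    rw [this]
    congr 1
    exact (Set.projIcc_val zero_le_one t).symm

include hW hv hcompat in
/-- Cocycles on sets whose interiors cover the space can be glued if they agree on the paths in
the overlaps. -/
theorem exists_glue : ∃ V : C(I, X) → 𝒢, IsCocycleOn Set.univ V ∧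
    (∀ i (γ : C(I, X)), (∀ t, γ t ∈ W i) → V γ = v i γ) ∧
    ∀ γ F, IsPrimitive W v γ F → V γ = F 1 * (F 0)⁻¹ := by
  choose F hF using exists_isPrimitive hW hv hcompat
  have hV : ∀ γ G, IsPrimitive W v γ G → F γ 1 * (F γ 0)⁻¹ = G 1 * (G 0)⁻¹ :=
    fun γ G hG => (hF γ).unique hG
  refine ⟨fun γ => F γ 1 * (F γ 0)⁻¹, ?_, ?_, hV⟩
  · intro f _
    obtain ⟨G, hG⟩ := exists_square_primitive hW hv hcompat f
    have m0 : ((0, 0) : ℝ × ℝ) ∈ Set.Icc (0 : ℝ × ℝ) 1 :=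
      ⟨le_rfl, Prod.le_def.2 ⟨zero_le_one, zero_le_one⟩⟩
    have m1 : ((1, 0) : ℝ × ℝ) ∈ Set.Icc (0 : ℝ × ℝ) 1 :=
      ⟨Prod.le_def.2 ⟨zero_le_one, le_rfl⟩, Prod.le_def.2 ⟨le_rfl, zero_le_one⟩⟩
    have m2 : ((1, 1) : ℝ × ℝ) ∈ Set.Icc (0 : ℝ × ℝ) 1 :=
      ⟨Prod.le_def.2 ⟨zero_le_one, zero_le_one⟩, le_rfl⟩
    have hp (t : I) : Set.projIcc (0 : ℝ) 1 zero_le_one (t : ℝ) = t := Set.projIcc_val zero_le_one t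
    have e1 := hV _ _ (hG (f.comp lowerSide) (0, 0) (1, 0) m0 m1 (by
      intro t
      change f (t, 0) = f (Set.projIcc 0 1 zero_le_one _, Set.projIcc 0 1 zero_le_one _)
      simp [AffineMap.lineMap_apply, hp]))
    have e2 := hV _ _ (hG (f.comp rightSide) (1, 0) (1, 1) m1 m2 (by
      intro t
      change f (1, t) = f (Set.projIcc 0 1 zero_le_one _, Set.projIcc 0 1 zero_le_one _)
      simp [AffineMap.lineMap_apply, hp]))
    have e3 := hV _ _ (hG (f.comp diagonalSide) (0, 0) (1, 1) m0 m2 (by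
      intro t
      change f (t, t) = f (Set.projIcc 0 1 zero_le_one _, Set.projIcc 0 1 zero_le_one _)
      simp [AffineMap.lineMap_apply, hp]))
    simp only [AffineMap.lineMap_apply_zero, AffineMap.lineMap_apply_one] at e1 e2 e3
    simp only [e1, e2, e3]
    group
  · intro i γ hγ
    have hmem : ∀ s, extendPath γ s ∈ W i := fun s => hγ _
    have hprim : IsPrimitive W v γ fun t => v i (segmentMap (extendPath γ) 0 t) := by
      refine ⟨1, one_pos, fun s _ t _ _ => ?_⟩
      rw [localValue_eq hcompat (i := i) fun _ => hmem _]
      exact (hv i).segment_mul (extendPath γ) convex_univ (fun z _ => hmem z) trivial trivial trivial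
    have h0 : v i (segmentMap (extendPath γ) 0 0) = 1 := by
      have := (hv i).segment_mul (extendPath γ) convex_univ (fun z _ => hmem z)
        (a := 0) (b := 0) (c := 0) trivial trivial trivial
      exact left_eq_mul.1 this
    beta_reduce
    rw [hV _ _ hprim, h0, segmentMap_extendPath]
    simp

end Glue

/-- A cocycle is determined by its values on the paths in the sets of a cover. -/
theorem IsCocycleOn.eq_of_cover {ι : Type*} {W : ι → Set X} (hW : ∀ x, ∃ i, W i ∈ nhds x)
    {V V' : C(I, X) → 𝒢} (hV : IsCocycleOn Set.univ V) (hV' : IsCocycleOn Set.univ V')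
    (h : ∀ i (γ : C(I, X)), (∀ t, γ t ∈ W i) → V γ = V' γ) : V = V' := by
  funext γ
  have hseg (U : C(I, X) → 𝒢) (hU : IsCocycleOn Set.univ U) (s t : ℝ) :
      U (segmentMap (extendPath γ) 0 t) =
        U (segmentMap (extendPath γ) s t) * U (segmentMap (extendPath γ) 0 s) :=
    hU.segment_mul (extendPath γ) convex_univ (fun _ _ => trivial) trivial trivial trivial
  obtain ⟨δ, hδ, hd⟩ := exists_lebesgue_number hW (γ.comp ⟨Prod.fst, continuous_fst⟩)
  have := eq_of_locally_constant (fun t => (V' (segmentMap (extendPath γ) 0 t))⁻¹ *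
    V (segmentMap (extendPath γ) 0 t)) hδ fun s hs t ht hst => by
      rw [hseg V hV s t, hseg V' hV' s t]
      obtain ⟨i, hi⟩ := hd (⟨s, hs⟩, 0)
      rw [h i (segmentMap (extendPath γ) s t)]
      · group
      · intro r
        have hr : AffineMap.lineMap s t (r : ℝ) ∈ I := (convex_Icc (0 : ℝ) 1).lineMap_mem hs ht r.2
        have h1 := hi (⟨_, hr⟩, 0) (by
          rw [Prod.dist_eq, dist_self, max_eq_left dist_nonneg]
          change dist (AffineMap.lineMap s t (r : ℝ)) s < δ
          rw [dist_lineMap_left, Real.norm_of_nonneg r.2.1]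
          have := r.2.2
          have := dist_nonneg (x := s) (y := t)
          nlinarith)
        change γ (Set.projIcc 0 1 zero_le_one _) ∈ W i
        rw [Set.projIcc_of_mem zero_le_one hr]
        exact h1
  have h0 (U : C(I, X) → 𝒢) (hU : IsCocycleOn Set.univ U) :
      U (segmentMap (extendPath γ) 0 0) = 1 := left_eq_mul.1 (hseg U hU 0 0)
  simp only [h0 V hV, h0 V' hV', segmentMap_extendPath] at this
  rw [inv_one, one_mul, eq_inv_mul_iff_mul_eq, mul_one] at this
  exact this.symm

/-! ### Comparison of cocycles through a simply connected cover -/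

/-- Two cocycles on the image of a simply connected space with path lifting agree up to a twist
as soon as they agree up to a twist on the points of the fibres. -/
theorem IsCocycleOn.exists_twist_of_cover {W : Set X} {v v' : C(I, X) → 𝒢} (hv : IsCocycleOn W v)
    (hv' : IsCocycleOn W v') {E : Type*} [TopologicalSpace E] [SimplyConnectedSpace E] (q : C(E, X))
    (hq : ∀ e, q e ∈ W)
    (hlift : ∀ γ : C(I, X), (∀ t, γ t ∈ W) → ∃ γ' : C(I, E), q.comp γ' = γ) (e₀ : E) (c : 𝒢)
    (h : ∀ (e e' : E), q e = q e' → ∃ (p : Path e₀ e) (p' : Path e₀ e'),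
      v' (q.comp p) * c * (v (q.comp p))⁻¹ = v' (q.comp p') * c * (v (q.comp p'))⁻¹) :
    ∃ u : X → 𝒢, u (q e₀) = c ∧
      ∀ γ : C(I, X), (∀ t, γ t ∈ W) → v' γ = u (γ 1) * v γ * (u (γ 0))⁻¹ := by
  have hvq : IsCocycleOn Set.univ fun γ => v (q.comp γ) := by
    convert hv.comap q
    ext e
    simp [hq e]
  have hvq' : IsCocycleOn Set.univ fun γ => v' (q.comp γ) := by
    convert hv'.comap q
    ext e
    simp [hq e]
  have hp {e : E} (p p' : Path e₀ e) : v (q.comp p) = v (q.comp p') :=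
    hvq.of_homotopic (SimplyConnectedSpace.paths_homotopic p p')
  have hp' {e : E} (p p' : Path e₀ e) : v' (q.comp p) = v' (q.comp p') :=
    hvq'.of_homotopic (SimplyConnectedSpace.paths_homotopic p p')
  let U (e : E) : 𝒢 := v' (q.comp (PathConnectedSpace.somePath e₀ e)) * c *
    (v (q.comp (PathConnectedSpace.somePath e₀ e)))⁻¹
  have hU {e : E} (p : Path e₀ e) : U e = v' (q.comp p) * c * (v (q.comp p))⁻¹ := by
    simp only [U]
    rw [hp _ p, hp' _ p]
  have hUq (e e' : E) (hee : q e = q e') : U e = U e' := by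
    obtain ⟨p, p', hpp⟩ := h e e' hee
    rw [hU p, hU p', hpp]
  let u : X → 𝒢 := Function.extend q U fun _ => 1
  have hu (e : E) : u (q e) = U e := by
    have hex : ∃ e', q e' = q e := ⟨e, rfl⟩
    classical
    simp only [u]
    rw [Function.extend_def, dif_pos hex]
    exact hUq _ _ hex.choose_spec
  refine ⟨u, ?_, ?_⟩
  · rw [hu, hU (Path.refl e₀)]
    have h1 : v (q.comp (Path.refl e₀ : C(I, E))) = 1 := hvq.const (x := e₀) trivial
    have h2 : v' (q.comp (Path.refl e₀ : C(I, E))) = 1 := hvq'.const (x := e₀) trivial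
    rw [h1, h2]
    group
  · intro γ hγ
    obtain ⟨γ', rfl⟩ := hlift γ hγ
    let r : Path (γ' 0) (γ' 1) := ⟨γ', rfl, rfl⟩
    let s := PathConnectedSpace.somePath e₀ (γ' 0)
    have h1 : v (q.comp (s.trans r)) = v (q.comp γ') * v (q.comp s) :=
      hvq.trans s r (fun _ => trivial) fun _ => trivial
    have h2 : v' (q.comp (s.trans r)) = v' (q.comp γ') * v' (q.comp s) :=
      hvq'.trans s r (fun _ => trivial) fun _ => trivial
    change v' (q.comp γ') = u (q (γ' 1)) * v (q.comp γ') * (u (q (γ' 0)))⁻¹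
    rw [hu, hu, hU (s.trans r), hU s, h1, h2]
    group

end Cocycles

/-! ### Deck transformations and deformation retracts -/

section Deck

variable {X : Type*} [TopologicalSpace X] {𝒢 : Type*} [Group 𝒢]

/-- Two cocycles on the image of a simply connected space `E` with path lifting agree up to a twist
if they agree on the loops that come from deck transformations generating the fibre relation. -/
theorem IsCocycleOn.exists_twist_of_deck {W : Set X} {v v' : C(I, X) → 𝒢} (hv : IsCocycleOn W v)
    (hv' : IsCocycleOn W v') {E : Type*} [TopologicalSpace E] [SimplyConnectedSpace E] (q : C(E, X))
    (hq : ∀ e, q e ∈ W)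
    (hlift : ∀ γ : C(I, X), (∀ t, γ t ∈ W) → ∃ γ' : C(I, E), q.comp γ' = γ) (e₀ : E) (c : 𝒢)
    (T : Set C(E, E)) (hT : ∀ τ ∈ T, q.comp τ = q)
    (hloop : ∀ τ ∈ T, ∃ m : Path e₀ (τ e₀), v' (q.comp m) * c = c * v (q.comp m))
    (hfib : ∀ e e', q e = q e' → Relation.EqvGen (fun a b => (∃ τ ∈ T, b = τ a) ∨
      ∃ p : Path a b, ∀ t, q (p t) = q a) e e') :
    ∃ u : X → 𝒢, u (q e₀) = c ∧
      ∀ γ : C(I, X), (∀ t, γ t ∈ W) → v' γ = u (γ 1) * v γ * (u (γ 0))⁻¹ := by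
  have hvq : IsCocycleOn Set.univ fun γ => v (q.comp γ) := by
    convert hv.comap q
    ext e
    simp [hq e]
  have hvq' : IsCocycleOn Set.univ fun γ => v' (q.comp γ) := by
    convert hv'.comap q
    ext e
    simp [hq e]
  let U {e : E} (p : Path e₀ e) : 𝒢 := v' (q.comp p) * c * (v (q.comp p))⁻¹
  have hU {e : E} (p p' : Path e₀ e) : U p = U p' := by
    simp only [U]
    rw [hvq.of_homotopic (SimplyConnectedSpace.paths_homotopic p p'),
      hvq'.of_homotopic (SimplyConnectedSpace.paths_homotopic p p')]
  refine hv.exists_twist_of_cover hv' q hq hlift e₀ c fun e e' hee => ?_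
  refine ⟨PathConnectedSpace.somePath e₀ e, PathConnectedSpace.somePath e₀ e', ?_⟩
  change U _ = U _
  have hfe := hfib e e' hee
  clear hee
  induction hfe with
  | rel a b hab =>
    rcases hab with ⟨τ, hτ, rfl⟩ | ⟨p, hp⟩
    · obtain ⟨m, hm⟩ := hloop τ hτ
      rw [hU (PathConnectedSpace.somePath e₀ (τ a))
        (m.trans ((PathConnectedSpace.somePath e₀ a).map τ.continuous))]
      simp only [U]
      have h1 := hvq.trans m ((PathConnectedSpace.somePath e₀ a).map τ.continuous)
        (fun _ => trivial) fun _ => trivial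
      have h2 := hvq'.trans m ((PathConnectedSpace.somePath e₀ a).map τ.continuous)
        (fun _ => trivial) fun _ => trivial
      have h3 : q.comp ((PathConnectedSpace.somePath e₀ a).map τ.continuous : C(I, E)) =
          q.comp (PathConnectedSpace.somePath e₀ a : C(I, E)) := by
        ext t
        exact DFunLike.congr_fun (hT τ hτ) _
      beta_reduce at h1 h2
      rw [h1, h2, h3, mul_assoc (v' _) (v' _) c, hm]
      group
    · rw [hU (PathConnectedSpace.somePath e₀ b) ((PathConnectedSpace.somePath e₀ a).trans p)]
      simp only [U]
      have h1 := hvq.trans (PathConnectedSpace.somePath e₀ a) p (fun _ => trivial) fun _ => trivial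
      have h2 := hvq'.trans (PathConnectedSpace.somePath e₀ a) p (fun _ => trivial) fun _ => trivial
      have h3 : q.comp (p : C(I, E)) = .const I (q a) := by
        ext t
        exact hp t
      beta_reduce at h1 h2
      rw [h1, h2, h3, hv.const (hq a), hv'.const (hq a), one_mul, one_mul]
  | refl a => rfl
  | symm a b hab ih => exact ih.symm
  | trans a b c hab hbc ih ih' => exact ih.trans ih'

instance : ContractibleSpace I := (convex_Icc (0 : ℝ) 1).contractibleSpace ⟨0, by simp⟩

instance : LocallyPathConnectedSpace I := (convex_Icc (0 : ℝ) 1).locallyPathConnectedSpace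

/-- A continuous choice of the argument of a function without zeros on a simply connected space. -/
theorem exists_angle {A : Type*} [TopologicalSpace A] [SimplyConnectedSpace A]
    [LocallyPathConnectedSpace A] (g : C(A, ℂ)) (h : ∀ t, g t ≠ 0) :
    ∃ θ : C(A, ℝ), ∀ t, g t = (‖g t‖ : ℂ) * Complex.exp ((θ t : ℂ) * Complex.I) := by
  let g' : C(A, Circle) := ⟨fun t => ⟨g t / ‖g t‖, by
    rw [Submonoid.unitSphere, ← SetLike.mem_coe]
    simp [h t]⟩, by
      refine Continuous.subtype_mk ?_ _
      exact g.continuous.div (by fun_prop) fun t => by simpa using h t⟩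
  have hg' (t : A) : ((g' t : Circle) : ℂ) = g t / ‖g t‖ := rfl
  obtain ⟨a₀⟩ : Nonempty A := inferInstance
  obtain ⟨θ, ⟨-, hθ⟩, -⟩ := Circle.isCoveringMap_exp.existsUnique_continuousMap_lifts g' a₀
    (Complex.arg (g' a₀)) (Circle.exp_arg _)
  refine ⟨θ, fun t => ?_⟩
  have h2 : Circle.exp (θ t) = g' t := congrFun hθ t
  rw [← Circle.coe_exp, h2, hg', mul_div_cancel₀]
  simpa using h t

end Deck

/-- A strong deformation retract has the same fundamental group. -/
theorem fundamentalGroup_map_bijective {P Y : Type*} [TopologicalSpace P] [TopologicalSpace Y]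
    (f : C(P, Y)) (r : C(Y, P)) (hr : ∀ x, r (f x) = x) (H : C(I × Y, Y)) (h0 : ∀ y, H (0, y) = y)
    (h1 : ∀ y, H (1, y) = f (r y)) (hH : ∀ t x, H (t, f x) = f x) (b : P) :
    Function.Bijective (FundamentalGroup.map f b) := by
  constructor
  · intro g g' hgg
    obtain ⟨p, rfl⟩ := Path.Homotopic.Quotient.mk_surjective g
    obtain ⟨q, rfl⟩ := Path.Homotopic.Quotient.mk_surjective g'
    have h : (p.map f.continuous).Homotopic (q.map f.continuous) :=
      Path.Homotopic.Quotient.exact hgg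
    have h2 := (h.map r).pathCast (hr b).symm (hr b).symm
    refine Path.Homotopic.Quotient.eq.2 ?_
    convert h2 using 1
    · ext t
      exact (hr _).symm
    · ext t
      exact (hr _).symm
  · intro g
    obtain ⟨p, rfl⟩ := Path.Homotopic.Quotient.mk_surjective g
    let q : Path b b := (p.map r.continuous).cast (hr b).symm (hr b).symm
    refine ⟨FundamentalGroup.fromPath (Path.Homotopic.Quotient.mk q), ?_⟩
    refine Path.Homotopic.Quotient.eq.2 (Path.Homotopic.symm ⟨⟨⟨⟨fun z => H (z.1, p z.2),
      by fun_prop⟩, fun t => h0 _, fun t => h1 _⟩, ?_⟩⟩)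
    rintro t x (rfl | rfl)
    · change H (t, p 0) = p 0
      rw [p.source, hH]
    · change H (t, p 1) = p 1
      rw [p.target, hH]

/-! ### Coordinates on the 3-sphere -/

section Coordinates

theorem fin_two_rev_ne (i : Fin 2) : i.rev ≠ i := by fin_cases i <;> decide

theorem fin_two_eq_or (i j : Fin 2) : j = i ∨ j = i.rev := by
  fin_cases i <;> fin_cases j <;> simp [Fin.rev]

theorem S3.norm_sq (x : S3) (i : Fin 2) : ‖x.1 i‖ ^ 2 + ‖x.1 i.rev‖ ^ 2 = 1 := by
  have h : ‖x.1‖ = 1 := mem_sphere_zero_iff_norm.1 x.2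
  rw [EuclideanSpace.norm_eq, Real.sqrt_eq_one, Fin.sum_univ_two] at h
  fin_cases i
  · exact h
  · exact (add_comm _ _).trans h

theorem S3.ext_coords {x y : S3} (i : Fin 2) (h : x.1 i = y.1 i) (h' : x.1 i.rev = y.1 i.rev) :
    x = y := by
  refine Subtype.ext (PiLp.ext fun j => ?_)
  rcases fin_two_eq_or i j with rfl | rfl
  · exact h
  · exact h'

/-- The vector with coordinate `i` equal to `z` and the other coordinate equal to `w`. -/
def coordVector (i : Fin 2) (z w : ℂ) : EuclideanSpace ℂ (Fin 2) :=
  WithLp.toLp 2 fun j => if j = i then z else w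

theorem coordVector_self (i : Fin 2) (z w : ℂ) : coordVector i z w i = z := by simp [coordVector]

theorem coordVector_rev (i : Fin 2) (z w : ℂ) : coordVector i z w i.rev = w := by
  simp [coordVector, fin_two_rev_ne]

theorem coordVector_ne_zero {i : Fin 2} {z w : ℂ} (h : z ≠ 0 ∨ w ≠ 0) : coordVector i z w ≠ 0 := by
  intro h0
  rcases h with h | h
  · exact h (by rw [← coordVector_self i z w, h0]; rfl)
  · exact h (by rw [← coordVector_rev i z w, h0]; rfl)

theorem norm_coordVector (i : Fin 2) (z w : ℂ) :
    ‖coordVector i z w‖ = √(‖z‖ ^ 2 + ‖w‖ ^ 2) := by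
  rw [EuclideanSpace.norm_eq, Fin.sum_univ_two]
  fin_cases i
  · simp [coordVector]
  · simp [coordVector, add_comm]

/-- The point of the sphere on the ray through `coordVector i z w`. -/
def spherePoint (i : Fin 2) (z w : ℂ) (h : z ≠ 0 ∨ w ≠ 0) : S3 :=
  ⟨(‖coordVector i z w‖⁻¹ : ℝ) • coordVector i z w, by
    rw [mem_sphere_zero_iff_norm, norm_smul, norm_inv, norm_norm]
    exact inv_mul_cancel₀ (norm_ne_zero_iff.2 (coordVector_ne_zero h))⟩

theorem spherePoint_self {i : Fin 2} {z w : ℂ} {h : z ≠ 0 ∨ w ≠ 0} (h1 : ‖z‖ ^ 2 + ‖w‖ ^ 2 = 1) :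
    (spherePoint i z w h).1 i = z := by
  simp [spherePoint, norm_coordVector, h1, coordVector_self]

theorem spherePoint_rev {i : Fin 2} {z w : ℂ} {h : z ≠ 0 ∨ w ≠ 0} (h1 : ‖z‖ ^ 2 + ‖w‖ ^ 2 = 1) :
    (spherePoint i z w h).1 i.rev = w := by
  simp [spherePoint, norm_coordVector, h1, coordVector_rev]

theorem spherePoint_coords (i : Fin 2) (x : S3) {z w : ℂ} (h : z ≠ 0 ∨ w ≠ 0) (hz : x.1 i = z)
    (hw : x.1 i.rev = w) : spherePoint i z w h = x := by
  have h1 : ‖z‖ ^ 2 + ‖w‖ ^ 2 = 1 := by rw [← hz, ← hw, S3.norm_sq]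
  refine S3.ext_coords i ?_ ?_
  · rw [spherePoint_self h1, hz]
  · rw [spherePoint_rev h1, hw]

theorem continuous_spherePoint {Y : Type*} [TopologicalSpace Y] (i : Fin 2) {f g : Y → ℂ}
    (hf : Continuous f) (hg : Continuous g) (h : ∀ y, f y ≠ 0 ∨ g y ≠ 0) :
    Continuous fun y => spherePoint i (f y) (g y) (h y) := by
  have hc : Continuous fun y => coordVector i (f y) (g y) := by
    refine (PiLp.continuous_toLp 2 _).comp (continuous_pi fun j => ?_)
    by_cases hj : j = i <;> simp only [hj, if_true, if_false] <;> assumption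
  refine Continuous.subtype_mk ?_ _
  exact (hc.norm.inv₀ fun y => norm_ne_zero_iff.2 (coordVector_ne_zero (h y))).smul hc

end Coordinates

/-! ### The exteriors in coordinates -/

namespace HopfLikeLink

variable (L : HopfLikeLink)

/-- The coordinates of the normal position of the link. -/
def coord (i : Fin 2) (x : S3) : ℂ := (L.h x).1 i

theorem continuous_coord (i : Fin 2) : Continuous (L.coord i) :=
  ((PiLp.continuous_apply 2 _ i).comp continuous_subtype_val).comp L.h.continuous

theorem coord_norm_sq (i : Fin 2) (x : S3) : ‖L.coord i x‖ ^ 2 + ‖L.coord i.rev x‖ ^ 2 = 1 :=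
  S3.norm_sq _ i

theorem coord_symm (i : Fin 2) (y : S3) : L.coord i (L.h.symm y) = y.1 i := by
  rw [coord, Homeomorph.apply_symm_apply]

theorem eq_of_coord {x y : S3} (i : Fin 2) (h : L.coord i x = L.coord i y)
    (h' : L.coord i.rev x = L.coord i.rev y) : x = y :=
  L.h.injective (S3.ext_coords i h h')

theorem mem_knot_exterior_iff {i : Fin 2} {x : S3} (h : (L.coord i x).re ≤ 4 / 5) :
    x ∈ (L.knot i).exterior ↔ 1 / 2 ≤ ‖L.coord i.rev x‖ := by
  rw [TubedKnot.exterior, Set.mem_compl_iff, L.mem_tube_iff i x h, not_lt]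
  rfl

theorem mem_exterior_iff (i : Fin 2) (x : S3) : x ∈ L.exterior ↔
    x ∈ (L.knot i).exterior ∧ x ∈ (L.knot i.rev).exterior := by
  rw [exterior, Set.mem_compl_iff, Set.mem_iUnion, not_exists]
  constructor
  · exact fun h => ⟨h _, h _⟩
  · rintro ⟨h, h'⟩ j
    rcases fin_two_eq_or i j with rfl | rfl
    · exact h
    · exact h'

theorem coord_rev_re_le {i : Fin 2} {x : S3} (h : 3 / 4 ≤ (L.coord i x).re) :
    (L.coord i.rev x).re ≤ 67 / 100 := by
  have h1 := L.coord_norm_sq i x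
  have h2 := Complex.re_le_norm (L.coord i x)
  have h3 := Complex.re_le_norm (L.coord i.rev x)
  by_contra h4
  nlinarith

theorem mem_knot_rev_exterior {i : Fin 2} {x : S3} (h : 3 / 4 ≤ (L.coord i x).re) :
    x ∈ (L.knot i.rev).exterior := by
  rw [mem_knot_exterior_iff, Fin.rev_rev]
  · have := Complex.re_le_norm (L.coord i x)
    linarith
  · have := L.coord_rev_re_le h
    linarith

/-! #### The deformation of the exterior of a knot to its knotted piece -/

variable (i : Fin 2)

/-- The coordinate `i` of the deformation of `X(Kᵢ)` to `Pᵢ`: it moves to the segment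
`re z = 4/5`, `(im z)² ≤ 11/100`, in the disc `|z|² ≤ 3/4`. The exterior lies over this disc since
the other coordinate has norm at least `1/2` there, and `11/100 = 3/4 - (4/5)²`. -/
def deformCoord (t : ℝ) (z : ℂ) : ℂ :=
  (1 - t : ℝ) • z + t • (⟨4 / 5, max (-√(11 / 100)) (min (√(11 / 100)) z.im)⟩ : ℂ)

theorem deformCoord_re (t : ℝ) (z : ℂ) : (deformCoord t z).re = (1 - t) * z.re + t * (4 / 5) := by
  simp [deformCoord]

theorem continuous_deformCoord : Continuous fun p : ℝ × ℂ => deformCoord p.1 p.2 := by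
  have : Continuous fun p : ℝ × ℂ =>
      (⟨4 / 5, max (-√(11 / 100)) (min (√(11 / 100)) p.2.im)⟩ : ℂ) := by
    have e : (fun p : ℝ × ℂ => (⟨4 / 5, max (-√(11 / 100)) (min (√(11 / 100)) p.2.im)⟩ : ℂ)) =
        fun p => (4 / 5 : ℂ) +
          ((max (-√(11 / 100)) (min (√(11 / 100)) p.2.im) : ℝ) : ℂ) * Complex.I := by
      funext p
      apply Complex.ext <;> simp
    rw [e]
    fun_prop
  unfold deformCoord
  fun_prop

theorem norm_sq_deformCoord_le {t : ℝ} (ht : t ∈ I) {z : ℂ} (hz : ‖z‖ ^ 2 ≤ 3 / 4) :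
    ‖deformCoord t z‖ ^ 2 ≤ 3 / 4 := by
  have hs : √(3 / 4) ^ 2 = 3 / 4 := Real.sq_sqrt (by norm_num)
  have h11 : √(11 / 100) ^ 2 = 11 / 100 := Real.sq_sqrt (by norm_num)
  have hsq := Real.sqrt_nonneg (11 / 100)
  have h1 : ‖z‖ ≤ √(3 / 4) := Real.le_sqrt_of_sq_le hz
  have h2 : ‖(⟨4 / 5, max (-√(11 / 100)) (min (√(11 / 100)) z.im)⟩ : ℂ)‖ ≤ √(3 / 4) := by
    refine Real.le_sqrt_of_sq_le ?_
    rw [← Complex.normSq_eq_norm_sq, Complex.normSq_apply]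
    have h3 : -√(11 / 100) ≤ max (-√(11 / 100)) (min (√(11 / 100)) z.im) := le_max_left _ _
    have h4 : max (-√(11 / 100)) (min (√(11 / 100)) z.im) ≤ √(11 / 100) :=
      max_le (by linarith) (min_le_left _ _)
    dsimp only
    nlinarith
  have h5 : deformCoord t z ∈ Metric.closedBall (0 : ℂ) (√(3 / 4)) := by
    refine convex_closedBall (0 : ℂ) (√(3 / 4)) ?_ ?_ (by linarith [ht.2]) ht.1 (by ring)
    · simpa using h1
    · simpa using h2
  rw [mem_closedBall_zero_iff] at h5
  calc ‖deformCoord t z‖ ^ 2 ≤ √(3 / 4) ^ 2 := by gcongr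
    _ = 3 / 4 := hs

theorem deformCoord_eq_self (t : ℝ) {z : ℂ} (hz : ‖z‖ ^ 2 ≤ 3 / 4) (hre : z.re = 4 / 5) :
    deformCoord t z = z := by
  have h11 : √(11 / 100) ^ 2 = 11 / 100 := Real.sq_sqrt (by norm_num)
  have hsq := Real.sqrt_nonneg (11 / 100)
  rw [← Complex.normSq_eq_norm_sq, Complex.normSq_apply, hre] at hz
  have h1 : |z.im| ≤ √(11 / 100) := Real.abs_le_sqrt (by nlinarith)
  rw [abs_le] at h1
  have h2 : (⟨4 / 5, max (-√(11 / 100)) (min (√(11 / 100)) z.im)⟩ : ℂ) = z := by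
    rw [min_eq_right h1.2, max_eq_right h1.1]
    exact Complex.ext hre.symm rfl
  rw [deformCoord, h2, ← add_smul]
  simp

/-- The coordinate `i.rev` of the deformation of `X(Kᵢ)` to `Pᵢ`. -/
def deformCoordRev (t : ℝ) (z w : ℂ) : ℂ :=
  ((√(1 - ‖deformCoord t z‖ ^ 2) / max ‖w‖ (1 / 2) : ℝ) : ℂ) * w

theorem norm_deformCoordRev {t : ℝ} (ht : t ∈ I) {z w : ℂ} (h : ‖z‖ ^ 2 + ‖w‖ ^ 2 = 1)
    (hw : 1 / 2 ≤ ‖w‖) : ‖deformCoord t z‖ ^ 2 + ‖deformCoordRev t z w‖ ^ 2 = 1 ∧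
      1 / 2 ≤ ‖deformCoordRev t z w‖ := by
  have hz := norm_sq_deformCoord_le ht (z := z) (by nlinarith)
  have h1 : ‖deformCoordRev t z w‖ = √(1 - ‖deformCoord t z‖ ^ 2) := by
    rw [deformCoordRev, max_eq_left hw, norm_mul, Complex.norm_real, Real.norm_eq_abs,
      abs_of_nonneg (by positivity), div_mul_cancel₀]
    linarith
  rw [h1]
  constructor
  · rw [Real.sq_sqrt (by linarith)]
    ring
  · refine Real.le_sqrt_of_sq_le ?_
    linarith

theorem deformCoordRev_eq_self {t : ℝ} {z w : ℂ} (h : ‖z‖ ^ 2 + ‖w‖ ^ 2 = 1)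
    (hw : 1 / 2 ≤ ‖w‖) (hz : deformCoord t z = z) : deformCoordRev t z w = w := by
  rw [deformCoordRev, max_eq_left hw, hz, ← h, add_sub_cancel_left, Real.sqrt_sq (by linarith),
    div_self (by linarith)]
  simp

theorem deformCoord_ne_zero {t : ℝ} (ht : t ∈ I) {x : S3} (hx : x ∈ (L.knot i).exterior) :
    deformCoord t (L.coord i x) ≠ 0 ∨ deformCoordRev t (L.coord i x) (L.coord i.rev x) ≠ 0 := by
  by_cases hre : (L.coord i x).re ≤ 4 / 5
  · right
    have h := (L.mem_knot_exterior_iff hre).1 hx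
    have := (norm_deformCoordRev ht (L.coord_norm_sq i x) h).2
    intro h0
    rw [h0, norm_zero] at this
    norm_num at this
  · left
    intro h0
    have := deformCoord_re t (L.coord i x)
    rw [h0, Complex.zero_re] at this
    nlinarith [ht.1, ht.2]

/-- The deformation of `X(Kᵢ)` to `Pᵢ`. -/
def deform (p : I × (L.knot i).exterior) : S3 :=
  open Classical in
  if (L.coord i p.2).re ≤ 4 / 5 then
    L.h.symm (spherePoint i _ _ (L.deformCoord_ne_zero i p.1.2 p.2.2)) else p.2

variable {i} in
theorem deform_coord {p : I × (L.knot i).exterior} (h : (L.coord i p.2).re ≤ 4 / 5) :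
    L.coord i (L.deform i p) = deformCoord p.1 (L.coord i p.2) ∧
      1 / 2 ≤ ‖L.coord i.rev (L.deform i p)‖ := by
  have h1 := norm_deformCoordRev p.1.2 (L.coord_norm_sq i p.2)
    ((L.mem_knot_exterior_iff h).1 p.2.2)
  rw [deform, if_pos h, coord_symm, coord_symm, spherePoint_self h1.1, spherePoint_rev h1.1]
  exact ⟨rfl, h1.2⟩

variable {i} in
theorem deform_eq_self_of_coord {p : I × (L.knot i).exterior}
    (h : deformCoord p.1 (L.coord i p.2) = L.coord i p.2) : L.deform i p = p.2 := by
  by_cases hre : (L.coord i p.2).re ≤ 4 / 5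
  · have h2 := deformCoordRev_eq_self (L.coord_norm_sq i p.2)
      ((L.mem_knot_exterior_iff hre).1 p.2.2) h
    rw [deform, if_pos hre, spherePoint_coords i (L.h p.2), Homeomorph.symm_apply_apply]
    · exact h.symm
    · exact h2.symm
  · rw [deform, if_neg hre]

theorem deform_zero (x : (L.knot i).exterior) : L.deform i (0, x) = x :=
  L.deform_eq_self_of_coord (by simp [deformCoord])

variable {i} in
theorem deform_of_le (t : I) {x : (L.knot i).exterior} (h : 4 / 5 ≤ (L.coord i x).re) :
    L.deform i (t, x) = x := by
  rcases h.eq_or_lt with h | h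
  · refine L.deform_eq_self_of_coord (deformCoord_eq_self _ ?_ h.symm)
    have h1 := L.coord_norm_sq i x
    have h2 := (L.mem_knot_exterior_iff h.symm.le).1 x.2
    simp only
    nlinarith
  · rw [deform, if_neg (not_le.2 h)]

variable {i} in
theorem le_deform_coord_re {c : ℝ} (hc : c ≤ 4 / 5) (t : I) {x : (L.knot i).exterior}
    (h : c ≤ (L.coord i x).re) : c ≤ (L.coord i (L.deform i (t, x))).re := by
  by_cases hre : (L.coord i x).re ≤ 4 / 5
  · rw [(L.deform_coord (p := (t, x)) hre).1, deformCoord_re]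
    nlinarith [t.2.1, t.2.2]
  · rw [deform, if_neg hre]
    exact h

theorem le_deform_one_coord_re (x : (L.knot i).exterior) :
    4 / 5 ≤ (L.coord i (L.deform i (1, x))).re := by
  by_cases hre : (L.coord i x).re ≤ 4 / 5
  · rw [(L.deform_coord (p := (1, x)) hre).1, deformCoord_re]
    simp
  · rw [deform, if_neg hre]
    exact (not_le.1 hre).le

theorem deform_mem_knot_exterior (p : I × (L.knot i).exterior) :
    L.deform i p ∈ (L.knot i).exterior := by
  by_cases hre : (L.coord i p.2).re ≤ 4 / 5
  · have h := L.deform_coord hre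
    rw [mem_knot_exterior_iff]
    · exact h.2
    · rw [h.1, deformCoord_re]
      nlinarith [p.1.2.1, p.1.2.2]
  · rw [deform, if_neg hre]
    exact p.2.2

theorem continuous_deform : Continuous (L.deform i) := by
  have hc : Continuous fun p : I × (L.knot i).exterior => L.coord i p.2 :=
    (L.continuous_coord i).comp (continuous_subtype_val.comp continuous_snd)
  have hc' : Continuous fun p : I × (L.knot i).exterior => L.coord i.rev p.2 :=
    (L.continuous_coord i.rev).comp (continuous_subtype_val.comp continuous_snd)
  have h1 : Continuous fun p : I × (L.knot i).exterior => deformCoord p.1 (L.coord i p.2) :=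
    continuous_deformCoord.comp
      ((continuous_subtype_val.comp continuous_fst).prodMk hc)
  have h2 : Continuous fun p : I × (L.knot i).exterior =>
      deformCoordRev p.1 (L.coord i p.2) (L.coord i.rev p.2) := by
    unfold deformCoordRev
    refine (Complex.continuous_ofReal.comp (Continuous.div ?_ ?_ fun p => ?_)).mul hc'
    · fun_prop
    · fun_prop
    · have : (1 / 2 : ℝ) ≤ max ‖L.coord i.rev p.2‖ (1 / 2) := le_max_right _ _
      linarith
  refine Continuous.if_le (L.h.symm.continuous.comp (continuous_spherePoint i h1 h2 _))
    (continuous_subtype_val.comp continuous_snd) (Complex.continuous_re.comp hc) continuous_const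
    fun p hp => ?_
  have h3 := L.deform_of_le (i := i) p.1 (x := p.2) hp.ge
  rw [deform, if_pos hp.le] at h3
  exact h3

/-- The deformation of `X(Kᵢ)` in itself. -/
def deformKnot : C(I × (L.knot i).exterior, (L.knot i).exterior) :=
  ⟨fun p => ⟨L.deform i p, L.deform_mem_knot_exterior i p⟩,
    (L.continuous_deform i).subtype_mk _⟩

/-- The retraction of `X(Kᵢ)` to `Pᵢ`. -/
def retract : C((L.knot i).exterior, L.piece i) :=
  ⟨fun x => ⟨L.deform i (1, x), (L.mem_exterior_iff i _).2 ⟨L.deform_mem_knot_exterior i _,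
    L.mem_knot_rev_exterior (by linarith [L.le_deform_one_coord_re i x])⟩,
      L.le_deform_one_coord_re i x⟩,
    ((L.continuous_deform i).comp (by fun_prop)).subtype_mk _⟩

theorem retract_pieceToKnot (x : L.piece i) : L.retract i (L.pieceToKnot i x) = x :=
  Subtype.ext (L.deform_of_le 1 x.2.2)

theorem pieceToKnot_bijective :
    Function.Bijective (FundamentalGroup.map (L.pieceToKnot i) (L.basePoint i)) :=
  fundamentalGroup_map_bijective (L.pieceToKnot i) (L.retract i) (L.retract_pieceToKnot i)
    (L.deformKnot i) (fun x => Subtype.ext (L.deform_zero i x)) (fun _ => rfl)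
    (fun t x => Subtype.ext (L.deform_of_le t x.2.2)) _

end HopfLikeLink

/-! ### The winding cocycle of the punctured plane -/

section Winding

theorem exp_mul_I_eq {a b : ℝ} (h : Complex.exp ((a : ℂ) * Complex.I) =
    Complex.exp ((b : ℂ) * Complex.I)) : ∃ n : ℤ, b = a + n * (2 * Real.pi) := by
  obtain ⟨n, hn⟩ := Complex.exp_eq_exp_iff_exists_int.1 h.symm
  refine ⟨n, ?_⟩
  have h1 : (b : ℂ) * Complex.I = ((a + n * (2 * Real.pi) : ℝ) : ℂ) * Complex.I := by
    rw [hn]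
    push_cast
    ring
  exact_mod_cast mul_right_cancel₀ Complex.I_ne_zero h1

theorem angle_eq_arg_add {z : ℂ} (hz : z ≠ 0) {θ : ℝ}
    (h : z = (‖z‖ : ℂ) * Complex.exp ((θ : ℂ) * Complex.I)) :
    ∃ n : ℤ, θ = Complex.arg z + n * (2 * Real.pi) := by
  apply exp_mul_I_eq
  have h0 : (‖z‖ : ℂ) ≠ 0 := by simpa using hz
  refine mul_left_cancel₀ h0 ?_
  rw [Complex.norm_mul_exp_arg_mul_I, ← h]

/-- The number of windings of a path in the punctured plane around the origin, corrected by
the arguments of the end points. It is `0` if the path has no continuous argument. -/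
def windingNumber (γ : C(I, ℂ)) : ℤ :=
  open Classical in
  if h : ∃ n : ℤ, ∃ θ : C(I, ℝ), (∀ t, γ t = (‖γ t‖ : ℂ) * Complex.exp ((θ t : ℂ) * Complex.I)) ∧
    θ 1 - θ 0 = Complex.arg (γ 1) - Complex.arg (γ 0) + n * (2 * Real.pi) then h.choose else 0

/-- Continuous functions with values in `2πℤ` on a connected space are constant. -/
theorem constant_of_int_multiple {A : Type*} [TopologicalSpace A] [PreconnectedSpace A]
    {f : A → ℝ} (hf : Continuous f) (h : ∀ t, ∃ n : ℤ, f t = n * (2 * Real.pi)) (s t : A) :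
    f s = f t := by
  choose n hn using h
  have h2 : IsLocallyConstant n := by
    rw [IsLocallyConstant.iff_eventually_eq]
    intro x
    have h3 : ∀ᶠ y in nhds x, |f y - f x| < 2 * Real.pi := by
      have := (hf.tendsto x).sub_const (f x)
      rw [sub_self] at this
      exact (this.abs.eventually (gt_mem_nhds (by simpa using Real.pi_pos)))
    filter_upwards [h3] with y hy
    rw [hn, hn, ← sub_mul, abs_mul, abs_of_pos Real.two_pi_pos] at hy
    have h4 : |((n y - n x : ℤ) : ℝ)| < 1 := by
      push_cast
      have := Real.two_pi_pos
      by_contra h5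
      nlinarith
    have h5 : |n y - n x| < 1 := by exact_mod_cast h4
    have := Int.abs_lt_one_iff.1 h5
    omega
  rw [hn, hn, h2.apply_eq_of_preconnectedSpace s t]

/-- Any continuous choice of the argument computes the winding number. -/
theorem windingNumber_spec {γ : C(I, ℂ)} (hγ : ∀ t, γ t ≠ 0) {θ : C(I, ℝ)}
    (h : ∀ t, γ t = (‖γ t‖ : ℂ) * Complex.exp ((θ t : ℂ) * Complex.I)) :
    θ 1 - θ 0 = Complex.arg (γ 1) - Complex.arg (γ 0) + windingNumber γ * (2 * Real.pi) := by
  obtain ⟨n₁, h₁⟩ := angle_eq_arg_add (hγ 1) (h 1)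
  obtain ⟨n₀, h₀⟩ := angle_eq_arg_add (hγ 0) (h 0)
  have hex : ∃ n : ℤ, ∃ θ : C(I, ℝ),
      (∀ t, γ t = (‖γ t‖ : ℂ) * Complex.exp ((θ t : ℂ) * Complex.I)) ∧
      θ 1 - θ 0 = Complex.arg (γ 1) - Complex.arg (γ 0) + n * (2 * Real.pi) := by
    refine ⟨n₁ - n₀, θ, h, ?_⟩
    rw [h₁, h₀]
    push_cast
    ring
  rw [windingNumber, dif_pos hex]
  obtain ⟨θ', h', e⟩ := hex.choose_spec
  rw [← e]
  have := constant_of_int_multiple (f := fun t => θ t - θ' t) (by fun_prop) (fun t => by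
    have h0 : (‖γ t‖ : ℂ) ≠ 0 := by simpa using hγ t
    obtain ⟨n, hn⟩ := exp_mul_I_eq (mul_left_cancel₀ h0 ((h' t).symm.trans (h t)))
    exact ⟨n, by rw [hn]; ring⟩) 0 1
  linarith

/-- The winding number is a cocycle on the punctured plane, as the arguments of the end points
cancel on triangles. -/
theorem isCocycleOn_windingNumber :
    IsCocycleOn {z : ℂ | z ≠ 0} fun γ => Multiplicative.ofAdd (windingNumber γ) := by
  intro f hf
  obtain ⟨θ, hθ⟩ := exists_angle f hf
  have h1 := windingNumber_spec (γ := f.comp lowerSide) (fun t => hf _)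
    (θ := θ.comp lowerSide) fun t => hθ _
  have h2 := windingNumber_spec (γ := f.comp rightSide) (fun t => hf _)
    (θ := θ.comp rightSide) fun t => hθ _
  have h3 := windingNumber_spec (γ := f.comp diagonalSide) (fun t => hf _)
    (θ := θ.comp diagonalSide) fun t => hθ _
  rw [← ofAdd_add]
  have a1 : (f.comp diagonalSide) 0 = (f.comp lowerSide) 0 := rfl
  have a2 : (f.comp diagonalSide) 1 = (f.comp rightSide) 1 := rfl
  have a3 : (f.comp lowerSide) 1 = (f.comp rightSide) 0 := rfl
  have b1 : (θ.comp diagonalSide) 0 = (θ.comp lowerSide) 0 := rfl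
  have b2 : (θ.comp diagonalSide) 1 = (θ.comp rightSide) 1 := rfl
  have b3 : (θ.comp lowerSide) 1 = (θ.comp rightSide) 0 := rfl
  rw [a1, a2, b1, b2] at h3
  rw [a3, b3] at h1
  have h4 : (windingNumber (f.comp diagonalSide) : ℝ) * (2 * Real.pi) =
      (windingNumber (f.comp rightSide) + windingNumber (f.comp lowerSide) : ℤ) *
        (2 * Real.pi) := by
    push_cast
    linarith
  exact_mod_cast mul_right_cancel₀ Real.two_pi_pos.ne' h4

theorem windingNumber_of_slitPlane {γ : C(I, ℂ)} (h : ∀ t, γ t ∈ Complex.slitPlane) :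
    windingNumber γ = 0 := by
  have h1 := windingNumber_spec (γ := γ) (fun t => Complex.slitPlane_ne_zero (h t))
    (θ := ⟨fun t => Complex.arg (γ t), by
      refine continuous_iff_continuousAt.2 fun t => ?_
      exact (Complex.continuousAt_arg (h t)).comp γ.continuous.continuousAt⟩)
    fun t => (Complex.norm_mul_exp_arg_mul_I _).symm
  simp only [ContinuousMap.coe_mk] at h1
  have h2 : (windingNumber γ : ℝ) * (2 * Real.pi) = 0 := by linarith
  simpa [Real.pi_ne_zero] using h2

theorem windingNumber_circle {γ : C(I, ℂ)} {r : ℝ} (hr : 0 < r)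
    (h : ∀ t, γ t = r * Complex.exp ((2 * Real.pi * t : ℝ) * Complex.I)) :
    windingNumber γ = 1 := by
  have hn : ∀ t, ‖γ t‖ = r := by
    intro t
    rw [h, norm_mul, Complex.norm_exp_ofReal_mul_I, mul_one, Complex.norm_real, Real.norm_eq_abs,
      abs_of_pos hr]
  have h1 := windingNumber_spec (γ := γ) (fun t h0 => by
    have := hn t
    rw [h0, norm_zero] at this
    exact hr.ne this) (θ := ⟨fun t => 2 * Real.pi * t, by fun_prop⟩) fun t => by
      rw [hn t, h t]
      rfl
  have h2 : γ 1 = γ 0 := by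
    rw [h, h]
    simp [Complex.exp_two_pi_mul_I]
  simp only [ContinuousMap.coe_mk, h2] at h1
  have h3 : (windingNumber γ : ℝ) * (2 * Real.pi) = (1 : ℤ) * (2 * Real.pi) := by
    simp at h1 ⊢
    linarith
  exact_mod_cast mul_right_cancel₀ Real.two_pi_pos.ne' h3

end Winding

/-! ### Cocycles on the product of a circle with a convex set or an interval -/

section DiscCircle

variable {X : Type*} [TopologicalSpace X] {𝒢 : Type*} [Group 𝒢]

/-- Multiples of `2π` are reached by steps of `2π` in both directions. -/
theorem eqvGen_int_translate {E : Type*} {r : E → E → Prop} (f : ℝ → E)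
    (h : ∀ a, r (f a) (f (a + 2 * Real.pi))) (a : ℝ) (n : ℤ) :
    Relation.EqvGen r (f a) (f (a + n * (2 * Real.pi))) := by
  induction n with
  | zero =>
    have : a + (0 : ℤ) * (2 * Real.pi) = a := by simp
    rw [this]
    exact Relation.EqvGen.refl _
  | succ n ih =>
    refine ih.trans _ _ _ (Relation.EqvGen.rel _ _ ?_)
    convert h (a + n * (2 * Real.pi)) using 2
    · simp
    · push_cast
      ring
  | pred n ih =>
    refine ih.trans _ _ _ (Relation.EqvGen.symm _ _ (Relation.EqvGen.rel _ _ ?_))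
    convert h (a + (-n - 1 : ℤ) * (2 * Real.pi)) using 2
    push_cast
    ring

theorem norm_sq_add_sqrt {z : ℂ} (hz : ‖z‖ < 1) (θ : ℝ) :
    ‖z‖ ^ 2 + ‖(√(1 - ‖z‖ ^ 2) : ℂ) * Complex.exp ((θ : ℂ) * Complex.I)‖ ^ 2 = 1 := by
  rw [norm_mul, Complex.norm_exp_ofReal_mul_I, mul_one, Complex.norm_real, Real.norm_eq_abs, sq_abs,
    Real.sq_sqrt]
  · ring
  · nlinarith [norm_nonneg z]

theorem sqrt_mul_exp_ne_zero {z : ℂ} (hz : ‖z‖ < 1) (θ : ℝ) :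
    (√(1 - ‖z‖ ^ 2) : ℂ) * Complex.exp ((θ : ℂ) * Complex.I) ≠ 0 := by
  refine mul_ne_zero ?_ (Complex.exp_ne_zero _)
  have : 0 < √(1 - ‖z‖ ^ 2) := Real.sqrt_pos.2 (by nlinarith [norm_nonneg z])
  exact_mod_cast this.ne'

/-- The point of the sphere over a point `z` of the disc, with the argument `θ` of the other
coordinate. -/
def discPoint (i : Fin 2) (D : Set ℂ) (hD : ∀ z ∈ D, ‖z‖ < 1) (e : ℝ × D) : S3 :=
  spherePoint i e.2 ((√(1 - ‖(e.2 : ℂ)‖ ^ 2) : ℂ) * Complex.exp ((e.1 : ℂ) * Complex.I))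
    (Or.inr (sqrt_mul_exp_ne_zero (hD _ e.2.2) _))

theorem discPoint_self {i : Fin 2} {D : Set ℂ} {hD : ∀ z ∈ D, ‖z‖ < 1} (e : ℝ × D) :
    (discPoint i D hD e).1 i = e.2 :=
  spherePoint_self (norm_sq_add_sqrt (hD _ e.2.2) _)

theorem discPoint_rev {i : Fin 2} {D : Set ℂ} {hD : ∀ z ∈ D, ‖z‖ < 1} (e : ℝ × D) :
    (discPoint i D hD e).1 i.rev =
      (√(1 - ‖(e.2 : ℂ)‖ ^ 2) : ℂ) * Complex.exp ((e.1 : ℂ) * Complex.I) :=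
  spherePoint_rev (norm_sq_add_sqrt (hD _ e.2.2) _)

theorem continuous_discPoint (i : Fin 2) (D : Set ℂ) (hD : ∀ z ∈ D, ‖z‖ < 1) :
    Continuous (discPoint i D hD) :=
  continuous_spherePoint i (by fun_prop) (by fun_prop) _

/-- Paths over `D` lift to the cover `ℝ × D`. -/
theorem discPoint_lift {i : Fin 2} {D : Set ℂ} {hD : ∀ z ∈ D, ‖z‖ < 1} (γ : C(I, S3))
    (hγ : ∀ t, (γ t).1 i ∈ D) : ∃ γ' : C(I, ℝ × D), ∀ t, discPoint i D hD (γ' t) = γ t := by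
  have hsq (t : I) : ‖(γ t).1 i.rev‖ = √(1 - ‖(γ t).1 i‖ ^ 2) := by
    have h := S3.norm_sq (γ t) i
    rw [← eq_sub_iff_add_eq'] at h
    rw [← h, Real.sqrt_sq (norm_nonneg _)]
  have hc (j : Fin 2) : Continuous fun t => (γ t).1 j :=
    (PiLp.continuous_apply 2 _ j).comp (continuous_subtype_val.comp γ.continuous)
  obtain ⟨θ, hθ⟩ := exists_angle ⟨fun t => (γ t).1 i.rev, hc _⟩ (fun t => by
    change (γ t).1 i.rev ≠ 0
    rw [← norm_ne_zero_iff, hsq]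
    exact (Real.sqrt_pos.2 (by nlinarith [norm_nonneg ((γ t).1 i), hD _ (hγ t)])).ne')
  refine ⟨⟨fun t => (θ t, ⟨(γ t).1 i, hγ t⟩), by
    have := hc i
    fun_prop⟩, fun t => S3.ext_coords i ?_ ?_⟩
  · rw [discPoint_self]
    rfl
  · rw [discPoint_rev]
    refine Eq.trans ?_ (hθ t).symm
    change ((√(1 - ‖(γ t).1 i‖ ^ 2) : ℝ) : ℂ) * _ = (‖(γ t).1 i.rev‖ : ℂ) * _
    rw [hsq]
    rfl

/-- Two cocycles on the part of the sphere over a convex set in a disc agree up to a twist if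
they agree on a circle. -/
theorem IsCocycleOn.exists_twist_disc (i : Fin 2) {D : Set ℂ} (hDc : Convex ℝ D)
    (hD : ∀ z ∈ D, ‖z‖ < 1) (j : C(X, S3)) (hj : Function.Injective j) (q : C(ℝ × D, X))
    (hq : ∀ e, j (q e) = discPoint i D hD e) {v v' : C(I, X) → 𝒢}
    (hv : IsCocycleOn {x | (j x).1 i ∈ D} v) (hv' : IsCocycleOn {x | (j x).1 i ∈ D} v')
    (e₀ : ℝ × D) (c : 𝒢) (m : Path e₀ (e₀.1 + 2 * Real.pi, e₀.2))
    (hm : v' (q.comp m) * c = c * v (q.comp m)) :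
    ∃ u : X → 𝒢, u (q e₀) = c ∧
      ∀ γ : C(I, X), (∀ t, (j (γ t)).1 i ∈ D) → v' γ = u (γ 1) * v γ * (u (γ 0))⁻¹ := by
  have : ContractibleSpace D := hDc.contractibleSpace ⟨e₀.2, e₀.2.2⟩
  let τ : C(ℝ × D, ℝ × D) := ⟨fun e => (e.1 + 2 * Real.pi, e.2), by fun_prop⟩
  refine hv.exists_twist_of_deck hv' q (fun e => ?_) (fun γ hγ => ?_) e₀ c {τ} ?_ ?_ ?_
  · change (j (q e)).1 i ∈ D
    rw [hq, discPoint_self]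
    exact e.2.2
  · obtain ⟨γ', hγ'⟩ := discPoint_lift (hD := hD) (j.comp γ) hγ
    refine ⟨γ', ?_⟩
    ext1 t
    apply hj
    exact (hq _).trans (hγ' t)
  · rintro _ rfl
    ext1 e
    apply hj
    change j (q _) = j (q e)
    rw [hq, hq]
    refine S3.ext_coords i ?_ ?_
    · rw [discPoint_self, discPoint_self]
      rfl
    · rw [discPoint_rev, discPoint_rev]
      congr 1
      change Complex.exp (((e.1 + 2 * Real.pi : ℝ) : ℂ) * Complex.I) = _
      push_cast
      rw [add_mul, Complex.exp_add, Complex.exp_two_pi_mul_I, mul_one]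
  · rintro _ rfl
    exact ⟨m, hm⟩
  · rintro ⟨a, z⟩ ⟨a', z'⟩ h
    have h1 : discPoint i D hD (a, z) = discPoint i D hD (a', z') := by rw [← hq, ← hq, h]
    obtain rfl : z = z' := by
      have := congrArg (fun y : S3 => y.1 i) h1
      simp only [discPoint_self] at this
      exact Subtype.ext this
    have h2 := congrArg (fun y : S3 => y.1 i.rev) h1
    simp only [discPoint_rev] at h2
    have h3 : 0 < √(1 - ‖(z : ℂ)‖ ^ 2) :=
      Real.sqrt_pos.2 (by nlinarith [norm_nonneg (z : ℂ), hD _ z.2])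
    obtain ⟨n, rfl⟩ := exp_mul_I_eq (mul_left_cancel₀ (by exact_mod_cast h3.ne') h2)
    exact eqvGen_int_translate (fun a => ((a, z) : ℝ × D)) (fun a => Or.inl ⟨τ, rfl, rfl⟩) a n

end DiscCircle

/-! ### The regions of the exterior of the link -/

namespace HopfLikeLink

variable (L : HopfLikeLink)

/-- The part of `X(L)` near the knotted part of the component `i`. -/
def knottedRegion (i : Fin 2) : Set L.exterior := {x | 3 / 4 ≤ (L.coord i x).re}

/-- The part of `X(L)` outside the two balls, where the link is the Hopf link. -/
def middleRegion : Set L.exterior := {x | ∀ i, (L.coord i x).re ≤ 4 / 5}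

/-- The three parts of `X(L)`. -/
def region : Option (Fin 2) → Set L.exterior
  | none => L.middleRegion
  | some i => L.knottedRegion i

theorem continuous_coord_exterior (i : Fin 2) : Continuous fun x : L.exterior => L.coord i x :=
  (L.continuous_coord i).comp continuous_subtype_val

/-- The interiors of the three regions cover `X(L)`, since the bounds `3/4` and `4/5` overlap. -/
theorem exists_region_mem_nhds (x : L.exterior) : ∃ o, L.region o ∈ nhds x := by
  have hc (i : Fin 2) := Complex.continuous_re.comp (L.continuous_coord_exterior i)
  by_cases h : ∃ i, 3 / 4 < (L.coord i x).re
  · obtain ⟨i, hi⟩ := h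
    refine ⟨some i, ?_⟩
    filter_upwards [(hc i).continuousAt.eventually (lt_mem_nhds hi)] with y hy
    exact hy.le
  · push Not at h
    refine ⟨none, ?_⟩
    have h1 (i : Fin 2) := (hc i).continuousAt.eventually
      (gt_mem_nhds ((h i).trans_lt (by norm_num : (3 / 4 : ℝ) < 4 / 5)))
    filter_upwards [h1 0, h1 1] with y h0 h1 i
    fin_cases i
    · exact h0.le
    · exact h1.le

/-- The two knotted regions are disjoint, as `2 (3/4)² > 1`. -/
theorem knottedRegion_disjoint {i : Fin 2} {x : L.exterior} (h : x ∈ L.knottedRegion i) :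
    x ∉ L.knottedRegion i.rev := by
  intro h'
  have h1 := L.coord_rev_re_le h
  have h2 : 3 / 4 ≤ (L.coord i.rev x).re := h'
  linarith

theorem half_le_norm_coord {x : L.exterior} {i : Fin 2} (h : (L.coord i x).re ≤ 4 / 5) :
    1 / 2 ≤ ‖L.coord i.rev x‖ :=
  (L.mem_knot_exterior_iff h).1 ((L.mem_exterior_iff i x).1 x.2).1

theorem mem_exterior_of_norm {x : S3} (h : ∀ i, (L.coord i x).re ≤ 4 / 5)
    (h' : ∀ i, 1 / 2 ≤ ‖L.coord i x‖) : x ∈ L.exterior :=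
  (L.mem_exterior_iff 0 x).2 ⟨(L.mem_knot_exterior_iff (h _)).2 (h' _),
    (L.mem_knot_exterior_iff (h _)).2 (h' _)⟩

/-! #### The overlaps -/

/-- The disc over which an overlap of two regions lies. -/
def overlapDisc : Set ℂ := {z | 3 / 4 ≤ z.re ∧ z.re ≤ 4 / 5 ∧ ‖z‖ ≤ √(3 / 4)}

theorem convex_overlapDisc : Convex ℝ overlapDisc := by
  have h1 : Convex ℝ {z : ℂ | 3 / 4 ≤ z.re} := convex_halfSpace_re_ge _
  have h2 : Convex ℝ {z : ℂ | z.re ≤ 4 / 5} := convex_halfSpace_re_le _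
  have h3 : Convex ℝ {z : ℂ | ‖z‖ ≤ √(3 / 4)} := by
    have e : {z : ℂ | ‖z‖ ≤ √(3 / 4)} = Metric.closedBall 0 (√(3 / 4)) := by
      ext z
      simp [Metric.mem_closedBall, dist_zero_right]
    rw [e]
    exact convex_closedBall _ _
  exact h1.inter (h2.inter h3)

theorem norm_sq_le_of_mem_overlapDisc {z : ℂ} (h : z ∈ overlapDisc) : ‖z‖ ^ 2 ≤ 3 / 4 := by
  calc ‖z‖ ^ 2 ≤ √(3 / 4) ^ 2 := by
        gcongr
        exact h.2.2
    _ = 3 / 4 := Real.sq_sqrt (by norm_num)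

theorem norm_lt_one_of_mem_overlapDisc : ∀ z ∈ overlapDisc, ‖z‖ < 1 := by
  intro z h
  nlinarith [norm_sq_le_of_mem_overlapDisc h, norm_nonneg z]

/-- The homeomorphism to the normal position, restricted to the exterior. -/
def toSphere : C(L.exterior, S3) := ⟨fun x => L.h x, L.h.continuous.comp continuous_subtype_val⟩

theorem toSphere_injective : Function.Injective L.toSphere :=
  L.h.injective.comp Subtype.val_injective

theorem mem_overlapDisc_iff {i : Fin 2} {x : L.exterior} :
    L.coord i x ∈ overlapDisc ↔ x ∈ L.knottedRegion i ∧ x ∈ L.middleRegion := by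
  constructor
  · intro h
    refine ⟨h.1, fun j => ?_⟩
    rcases fin_two_eq_or i j with rfl | rfl
    · exact h.2.1
    · linarith [L.coord_rev_re_le h.1]
  · rintro ⟨h1, h2⟩
    refine ⟨h1, h2 i, Real.le_sqrt_of_sq_le ?_⟩
    have := L.half_le_norm_coord (h2 i)
    have := L.coord_norm_sq i x
    nlinarith

theorem discPoint_mem_exterior (i : Fin 2) (e : ℝ × overlapDisc) :
    L.h.symm (discPoint i overlapDisc norm_lt_one_of_mem_overlapDisc e) ∈ L.exterior := by
  have h1 : L.coord i (L.h.symm (discPoint i overlapDisc norm_lt_one_of_mem_overlapDisc e)) = e.2 :=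
    by rw [coord_symm, discPoint_self]
  have h2 := L.coord_norm_sq i
    (L.h.symm (discPoint i overlapDisc norm_lt_one_of_mem_overlapDisc e))
  have h3 := e.2.2
  rw [L.mem_exterior_iff i]
  constructor
  · rw [mem_knot_exterior_iff _ (by rw [h1]; exact h3.2.1)]
    rw [h1] at h2
    have := norm_sq_le_of_mem_overlapDisc h3
    by_contra h4
    nlinarith [norm_nonneg (L.coord i.rev
      (L.h.symm (discPoint i overlapDisc norm_lt_one_of_mem_overlapDisc e)))]
  · apply mem_knot_rev_exterior
    rw [h1]
    exact h3.1

/-- The parametrization of an overlap. -/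
def overlapMap (i : Fin 2) : C(ℝ × overlapDisc, L.exterior) :=
  ⟨fun e => ⟨L.h.symm (discPoint i overlapDisc norm_lt_one_of_mem_overlapDisc e),
    L.discPoint_mem_exterior i e⟩,
    (L.h.symm.continuous.comp (continuous_discPoint _ _ _)).subtype_mk _⟩

theorem four_fifths_mem_overlapDisc : (4 / 5 : ℂ) ∈ overlapDisc := by
  refine ⟨by norm_num, by norm_num, Real.le_sqrt_of_sq_le ?_⟩
  norm_num

/-- The meridian of a component, as a path in `X(L)`. -/
def meridianPath (i : Fin 2) :
    Path (L.pieceToExterior i (L.basePoint i)) (L.pieceToExterior i (L.basePoint i)) :=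
  (L.meridianLoop i).map (L.pieceToExterior i).continuous

theorem coord_meridianPath (i : Fin 2) (t : I) : L.coord i (L.meridianPath i t) = 4 / 5 := by
  change L.coord i (L.h.symm (modelMeridian i t)) = _
  rw [coord_symm, modelMeridian_self]

theorem coord_rev_meridianPath (i : Fin 2) (t : I) : L.coord i.rev (L.meridianPath i t) =
    (3 / 5 : ℂ) * Complex.exp ((2 * Real.pi * t : ℝ) * Complex.I) := by
  change L.coord i.rev (L.h.symm (modelMeridian i t)) = _
  rw [coord_symm]
  simp [modelMeridian, fin_two_rev_ne]

variable {𝒢 : Type*} [Group 𝒢]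

theorem sqrt_one_sub_four_fifths : √(1 - ‖(4 / 5 : ℂ)‖ ^ 2) = 3 / 5 := by
  rw [Real.sqrt_eq_iff_mul_self_eq] <;> norm_num

theorem overlapMap_eq (i : Fin 2) (t : I) :
    L.overlapMap i (2 * Real.pi * t, ⟨4 / 5, four_fifths_mem_overlapDisc⟩) = L.meridianPath i t := by
  refine Subtype.ext (L.eq_of_coord i ?_ ?_)
  · rw [coord_meridianPath]
    change L.coord i (L.h.symm _) = _
    rw [coord_symm, discPoint_self]
  · rw [coord_rev_meridianPath]
    change L.coord i.rev (L.h.symm _) = _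
    rw [coord_symm, discPoint_rev, sqrt_one_sub_four_fifths]
    push_cast
    rfl

theorem overlapMap_zero (i : Fin 2) :
    L.overlapMap i (0, ⟨4 / 5, four_fifths_mem_overlapDisc⟩) =
      L.pieceToExterior i (L.basePoint i) := by
  have := L.overlapMap_eq i 0
  rw [(L.meridianPath i).source] at this
  rw [← this]
  simp

/-- Cocycles on an overlap agree up to a twist if they agree on the meridian. -/
theorem exists_twist_overlap (i : Fin 2) {v v' : C(I, L.exterior) → 𝒢}
    (hv : IsCocycleOn (L.knottedRegion i ∩ L.middleRegion) v)
    (hv' : IsCocycleOn (L.knottedRegion i ∩ L.middleRegion) v') (c : 𝒢)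
    (hm : v' (L.meridianPath i) * c = c * v (L.meridianPath i)) :
    ∃ u : L.exterior → 𝒢, u (L.pieceToExterior i (L.basePoint i)) = c ∧
      ∀ γ : C(I, L.exterior), (∀ t, γ t ∈ L.knottedRegion i ∩ L.middleRegion) →
        v' γ = u (γ 1) * v γ * (u (γ 0))⁻¹ := by
  have hW : {x : L.exterior | (L.toSphere x).1 i ∈ overlapDisc} =
      L.knottedRegion i ∩ L.middleRegion := by
    ext x
    exact L.mem_overlapDisc_iff
  let e₀ : ℝ × overlapDisc := (0, ⟨4 / 5, four_fifths_mem_overlapDisc⟩)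
  let m : Path e₀ (e₀.1 + 2 * Real.pi, e₀.2) :=
    { toFun := fun t => (2 * Real.pi * t, e₀.2)
      continuous_toFun := by fun_prop
      source' := by simp [e₀]
      target' := by simp [e₀] }
  have hqm : (L.overlapMap i).comp (m : C(I, ℝ × overlapDisc)) =
      (L.meridianPath i : C(I, L.exterior)) := by
    ext1 t
    exact L.overlapMap_eq i t
  obtain ⟨u, hu, h⟩ := IsCocycleOn.exists_twist_disc i convex_overlapDisc
    norm_lt_one_of_mem_overlapDisc L.toSphere L.toSphere_injective (L.overlapMap i)
    (fun e => L.h.apply_symm_apply _) (v := v) (v' := v') (hW ▸ hv) (hW ▸ hv') e₀ c m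
    (by rw [hqm, hm])
  refine ⟨u, ?_, fun γ hγ => h γ fun t => L.mem_overlapDisc_iff.2 (hγ t)⟩
  rw [← hu, L.overlapMap_zero i]

theorem joinedIn_overlap (i : Fin 2) {x : L.exterior}
    (hx : x ∈ L.knottedRegion i ∩ L.middleRegion) :
    JoinedIn (L.knottedRegion i ∩ L.middleRegion) (L.pieceToExterior i (L.basePoint i)) x := by
  have hne : ContractibleSpace overlapDisc :=
    convex_overlapDisc.contractibleSpace ⟨_, four_fifths_mem_overlapDisc⟩
  obtain ⟨γ, hγ⟩ := discPoint_lift (hD := norm_lt_one_of_mem_overlapDisc) (.const I (L.h x))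
    (i := i) fun _ => L.mem_overlapDisc_iff.2 hx
  have h1 : L.overlapMap i (γ 0) = x := by
    apply L.toSphere_injective
    exact (L.h.apply_symm_apply _).trans (hγ 0)
  let p := PathConnectedSpace.somePath ((0, ⟨4 / 5, four_fifths_mem_overlapDisc⟩) :
    ℝ × overlapDisc) (γ 0)
  refine ⟨(p.map (L.overlapMap i).continuous).cast (L.overlapMap_zero i).symm h1.symm, fun t => ?_⟩
  refine L.mem_overlapDisc_iff.1 ?_
  change L.coord i (L.h.symm (discPoint i overlapDisc norm_lt_one_of_mem_overlapDisc (p t))) ∈ _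
  rw [coord_symm, discPoint_self]
  exact (p t).2.2

end HopfLikeLink

/-! ### Gluing twists, and cocycles on the 3-sphere -/

section GlobalTwist

variable {X : Type*} [TopologicalSpace X] {𝒢 : Type*} [Group 𝒢]

/-- A twist between two cocycles is determined on a path component by its value at one point. -/
theorem eq_of_twist_of_joinedIn {W : Set X} {v v' : C(I, X) → 𝒢} {u u' : X → 𝒢}
    (hu : ∀ γ : C(I, X), (∀ t, γ t ∈ W) → v' γ = u (γ 1) * v γ * (u (γ 0))⁻¹)
    (hu' : ∀ γ : C(I, X), (∀ t, γ t ∈ W) → v' γ = u' (γ 1) * v γ * (u' (γ 0))⁻¹) {x y : X}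
    (h : JoinedIn W x y) (hx : u x = u' x) : u y = u' y := by
  obtain ⟨p, hp⟩ := h
  have h1 := (hu p hp).symm.trans (hu' p hp)
  rw [ContinuousMap.coe_coe, p.target, p.source, hx] at h1
  exact mul_right_cancel (mul_right_cancel h1)

/-- Twists on the sets of a cover that agree at a point of each component of the overlaps fit
together. -/
theorem IsCocycleOn.exists_global_twist {ι : Type*} {W : ι → Set X} (hW : ∀ x, ∃ i, W i ∈ nhds x)
    {v v' : C(I, X) → 𝒢} (hv : IsCocycleOn Set.univ v) (hv' : IsCocycleOn Set.univ v')
    (u : ι → X → 𝒢) (hu : ∀ i (γ : C(I, X)), (∀ t, γ t ∈ W i) →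
      v' γ = u i (γ 1) * v γ * (u i (γ 0))⁻¹)
    (hov : ∀ i j x, x ∈ W i → x ∈ W j → ∃ y, u i y = u j y ∧ JoinedIn (W i ∩ W j) y x) :
    ∃ U : X → 𝒢, (∀ i, ∀ x ∈ W i, U x = u i x) ∧
      ∀ γ : C(I, X), v' γ = U (γ 1) * v γ * (U (γ 0))⁻¹ := by
  choose j hj using hW
  have hU : ∀ i, ∀ x ∈ W i, u (j x) x = u i x := by
    intro i x hx
    obtain ⟨y, hy, hJ⟩ := hov (j x) i x (mem_of_mem_nhds (hj x)) hx
    exact eq_of_twist_of_joinedIn (W := W (j x) ∩ W i) (fun γ hγ => hu _ γ fun t => (hγ t).1)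
      (fun γ hγ => hu _ γ fun t => (hγ t).2) hJ hy
  refine ⟨fun x => u (j x) x, hU, fun γ => ?_⟩
  refine congrFun (IsCocycleOn.eq_of_cover (fun x => ⟨j x, hj x⟩) hv'
    (hv.twist fun x => u (j x) x) fun i γ hγ => ?_) γ
  rw [hU i _ (hγ 0), hU i _ (hγ 1)]
  exact hu i γ hγ

/-- Cocycles on the 3-sphere are trivial, by the two stereographic projections: the 3-sphere is
simply connected. -/
theorem S3.exists_primitive {v : C(I, S3) → 𝒢} (hv : IsCocycleOn Set.univ v) :
    ∃ u : S3 → 𝒢, ∀ γ : C(I, S3), v γ = u (γ 1) * (u (γ 0))⁻¹ := by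
  let _ : InnerProductSpace ℝ (EuclideanSpace ℂ (Fin 2)) := InnerProductSpace.complexToReal
  let n : Bool → EuclideanSpace ℂ (Fin 2) := fun b =>
    (if b then 1 else -1 : ℂ) • EuclideanSpace.single 0 1
  have hn : ∀ b, ‖n b‖ = 1 := by
    intro b
    cases b <;> simp [n]
  let N : Bool → S3 := fun b => ⟨n b, mem_sphere_zero_iff_norm.2 (hn b)⟩
  have hN : N true ≠ N false := by
    intro h
    have := congrArg (fun x : S3 => x.1 0) h
    simp [N, n] at this
    norm_num at this
  have hneg : N false = -N true := by
    apply Subtype.ext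
    simp [N, n]
  -- the complements of the two poles
  let W : Bool → Set S3 := fun b => {N b}ᶜ
  have hW : ∀ x, ∃ b, W b ∈ nhds x := by
    intro x
    by_cases hx : x = N true
    · refine ⟨false, isOpen_compl_singleton.mem_nhds ?_⟩
      rw [hx]
      exact hN
    · exact ⟨true, isOpen_compl_singleton.mem_nhds hx⟩
  let q (b : Bool) : C((ℝ ∙ n b)ᗮ, S3) := ⟨(stereographic (hn b)).symm, by
    have := (stereographic (hn b)).continuousOn_symm
    rwa [stereographic_target, continuousOn_univ] at this⟩
  have hsrc (b : Bool) : (stereographic (hn b)).source = W b := stereographic_source _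
  have hq (b : Bool) (e) : q b e ∈ W b := by
    rw [← hsrc]
    exact (stereographic (hn b)).map_target (by rw [stereographic_target]; trivial)
  have hqs (b : Bool) (x : S3) (hx : x ∈ W b) : q b (stereographic (hn b) x) = x :=
    (stereographic (hn b)).left_inv (by rwa [hsrc])
  have hsq (b : Bool) (e) : stereographic (hn b) (q b e) = e :=
    (stereographic (hn b)).right_inv (by rw [stereographic_target]; trivial)
  have htw (b : Bool) (e₀) (c : 𝒢) : ∃ u : S3 → 𝒢, u (q b e₀) = c ∧
      ∀ γ : C(I, S3), (∀ t, γ t ∈ W b) → v γ = u (γ 1) * 1 * (u (γ 0))⁻¹ := by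
    refine IsCocycleOn.exists_twist_of_deck isCocycleOn_one (hv.mono (Set.subset_univ _)) (q b)
      (hq b) ?_ e₀ c ∅ (by simp) (by simp) ?_
    · intro γ hγ
      refine ⟨⟨fun t => stereographic (hn b) (γ t), ?_⟩, ?_⟩
      · refine (stereographic (hn b)).continuousOn.comp_continuous γ.continuous fun t => ?_
        rw [hsrc]
        exact hγ t
      · ext1 t
        exact hqs b _ (hγ t)
    · intro e e' h
      rw [← hsq b e, h, hsq b e']
      exact Relation.EqvGen.refl _
  -- The intersection of the two charts is a punctured real vector space of dimension 3, hence
  -- connected, so that the primitives on the charts can be chosen to agree on it.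
  have hrank : 1 < Module.rank ℝ (ℝ ∙ n true)ᗮ := by
    have hfin : Module.finrank ℝ (EuclideanSpace ℂ (Fin 2)) = 4 := by
      rw [← Module.finrank_mul_finrank ℝ ℂ]
      simp
    have hne : n true ≠ 0 := by
      rw [← norm_ne_zero_iff, hn]
      exact one_ne_zero
    have h1 := Submodule.finrank_add_finrank_orthogonal (ℝ ∙ n true)
    rw [finrank_span_singleton hne, hfin] at h1
    rw [← Module.finrank_eq_rank]
    have : Module.finrank ℝ (ℝ ∙ n true)ᗮ = 3 := by omega
    rw [this]
    norm_num
  have hconn := isPathConnected_compl_singleton_of_one_lt_rank hrank 0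
  have hN0 : q true 0 = N false := by
    have := stereographic_apply_neg (N true)
    rw [← hneg] at this
    rw [← hqs true (N false) hN.symm]
    exact congrArg _ this.symm
  obtain ⟨e₁, he₁, hJ⟩ := hconn
  have hov : ∀ x ∈ W true ∩ W false, JoinedIn (W true ∩ W false) (q true e₁) x := by
    rintro x ⟨hx, hx'⟩
    obtain ⟨p, hp⟩ := hJ (y := stereographic (hn true) x) (by
      intro h0
      apply hx'
      rw [← hqs true x hx, Set.mem_singleton_iff.1 h0, hN0]
      rfl)
    refine ⟨(p.map (q true).continuous).cast rfl (hqs true x hx).symm, fun t => ⟨hq _ _, fun h => ?_⟩⟩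
    apply hp t
    have h' : q true (p t) = q true 0 := by rw [hN0]; exact h
    rw [← hsq true (p t), h', hsq]
    rfl
  obtain ⟨u₁, hu₁, h₁⟩ := htw true e₁ 1
  have hmem : q true e₁ ∈ W false := by
    intro h
    apply he₁
    have h' : q true e₁ = q true 0 := by rw [hN0]; exact h
    rw [← hsq true e₁, h', hsq]
    rfl
  obtain ⟨u₂, hu₂, h₂⟩ := htw false (stereographic (hn false) (q true e₁)) 1
  rw [hqs false _ hmem] at hu₂
  obtain ⟨U, -, hU⟩ := IsCocycleOn.exists_global_twist hW (isCocycleOn_one (𝒢 := 𝒢)) hv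
    (fun b => if b then u₁ else u₂) (by
      intro b γ hγ
      cases b
      · exact h₂ γ hγ
      · exact h₁ γ hγ) (by
      intro b b' x hx hx'
      cases b <;> cases b'
      · exact ⟨x, rfl, JoinedIn.refl ⟨hx, hx⟩⟩
      · exact ⟨q true e₁, by simp [hu₁, hu₂], Set.inter_comm _ _ ▸ hov x ⟨hx', hx⟩⟩
      · exact ⟨q true e₁, by simp [hu₁, hu₂], hov x ⟨hx, hx'⟩⟩
      · exact ⟨x, rfl, JoinedIn.refl ⟨hx, hx⟩⟩)
  exact ⟨U, fun γ => by rw [hU γ, mul_one]⟩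

end GlobalTwist

instance : LocallyPathConnectedSpace S3 := by
  let _ : InnerProductSpace ℝ (EuclideanSpace ℂ (Fin 2)) := InnerProductSpace.complexToReal
  have hfin : Module.finrank ℝ (EuclideanSpace ℂ (Fin 2)) = 3 + 1 := by
    rw [← Module.finrank_mul_finrank ℝ ℂ]
    simp
  have : Fact (Module.finrank ℝ (EuclideanSpace ℂ (Fin 2)) = 3 + 1) := ⟨hfin⟩
  let _ := EuclideanSpace.instChartedSpaceSphere (E := EuclideanSpace ℂ (Fin 2)) (n := 3)
  exact ChartedSpace.locallyPathConnectedSpace (EuclideanSpace ℝ (Fin 3)) S3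

theorem S3.pathConnectedSpace : PathConnectedSpace S3 := by
  let _ : InnerProductSpace ℝ (EuclideanSpace ℂ (Fin 2)) := InnerProductSpace.complexToReal
  have hfin : Module.finrank ℝ (EuclideanSpace ℂ (Fin 2)) = 4 := by
    rw [← Module.finrank_mul_finrank ℝ ℂ]
    simp
  refine isPathConnected_iff_pathConnectedSpace.1 (isPathConnected_sphere ?_ 0 zero_le_one)
  rw [← Module.finrank_eq_rank, hfin]
  norm_num

/-! ### The exterior of a knot -/

namespace TubedKnot

variable (K : TubedKnot)

theorem param_mem_exterior {q : Circle × ℂ} : K.param q ∈ K.exterior ↔ 1 ≤ ‖q.2‖ := by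
  rw [← not_lt, exterior, Set.mem_compl_iff, tube, K.isOpenEmbedding.injective.mem_set_image]
  rfl

theorem param_mem_core {q : Circle × ℂ} : K.param q ∈ K.core ↔ q.2 = 0 :=
  K.isOpenEmbedding.injective.mem_set_image

/-- The closed tube of radius `r` around the knot. -/
def closedTube (r : ℝ) : Set S3 := K.param '' {q | ‖q.2‖ ≤ r}

theorem isClosed_closedTube (r : ℝ) : IsClosed (K.closedTube r) := by
  have : {q : Circle × ℂ | ‖q.2‖ ≤ r} = Set.univ ×ˢ Metric.closedBall 0 r := by
    ext q
    simp
  rw [closedTube, this]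
  exact ((isCompact_univ.prod (isCompact_closedBall 0 r)).image
    K.isOpenEmbedding.continuous).isClosed

theorem compl_closedTube_mem_nhds {x : S3} (hx : x ∉ Set.range K.param) (r : ℝ) :
    (K.closedTube r)ᶜ ∈ nhds x :=
  (K.isClosed_closedTube r).isOpen_compl.mem_nhds fun h => hx (Set.image_subset_range _ _ h)

theorem isOpen_openTube (r : ℝ) : IsOpen (K.param '' {q | ‖q.2‖ < r}) :=
  K.isOpenEmbedding.isOpenMap _ (isOpen_lt (by fun_prop) continuous_const)

theorem compl_closedTube_subset : (K.closedTube 1)ᶜ ⊆ K.exterior := by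
  apply Set.compl_subset_compl.2
  exact Set.image_mono fun q (hq : ‖q.2‖ < 1) => hq.le

/-- The coordinates in the neighbourhood of the knot. -/
def tubeCoord : Set.range K.param ≃ₜ Circle × ℂ := K.isOpenEmbedding.isEmbedding.toHomeomorph.symm

theorem param_tubeCoord (x : Set.range K.param) : K.param (K.tubeCoord x) = x :=
  congrArg Subtype.val (K.isOpenEmbedding.isEmbedding.toHomeomorph.apply_symm_apply x)

theorem tubeCoord_param (q : Circle × ℂ) : K.tubeCoord ⟨K.param q, q, rfl⟩ = q :=
  K.isOpenEmbedding.isEmbedding.toHomeomorph.symm_apply_apply q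

theorem joinedIn_param {z z' : Circle} {w w' : ℂ} (hw : 1 ≤ ‖w‖) (hw' : 1 ≤ ‖w'‖) :
    JoinedIn K.exterior (K.param (z, w)) (K.param (z', w')) := by
  have h1 : Joined z z' := PathConnectedSpace.joined z z'
  obtain ⟨p⟩ := h1
  have hne : ∀ w : ℂ, 1 ≤ ‖w‖ → w ≠ 0 := fun w h h0 => by
    rw [h0, norm_zero] at h
    linarith
  -- the exterior of the unit disc is the image of a half-plane
  have h2 : ∃ f : C(I, ℂ), f 0 = w ∧ f 1 = w' ∧ ∀ t, 1 ≤ ‖f t‖ := by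
    refine ⟨⟨fun t => Complex.exp ((1 - (t : ℝ) : ℝ) * Complex.log w + (t : ℝ) * Complex.log w'),
      by fun_prop⟩, ?_, ?_, fun t => ?_⟩
    · simp [Complex.exp_log (hne w hw)]
    · simp [Complex.exp_log (hne w' hw')]
    · change 1 ≤ ‖Complex.exp _‖
      rw [Complex.norm_exp, Real.one_le_exp_iff, Complex.add_re,
        Complex.re_ofReal_mul, Complex.re_ofReal_mul, Complex.log_re, Complex.log_re]
      have a1 := Real.log_nonneg hw
      have a2 := Real.log_nonneg hw'
      exact add_nonneg (mul_nonneg (sub_nonneg.2 t.2.2) a1) (mul_nonneg t.2.1 a2)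
  obtain ⟨f, hf0, hf1, hf⟩ := h2
  refine ⟨⟨⟨fun t => K.param (p t, f t), K.isOpenEmbedding.continuous.comp (by fun_prop)⟩,
    by simp [hf0], by simp [hf1]⟩, fun t => K.param_mem_exterior.2 (hf t)⟩

/-- The exterior of a knot is connected: the neighbourhood of the knot together with the component
of a boundary torus in the exterior is open and closed in the 3-sphere. -/
theorem isPathConnected_exterior : IsPathConnected K.exterior := by
  have := S3.pathConnectedSpace
  let t₀ : S3 := K.param (1, 1)
  have ht₀ : t₀ ∈ K.exterior := K.param_mem_exterior.2 (by simp)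
  refine ⟨t₀, ht₀, fun {y} hy => ?_⟩
  have hloc : ∀ x ∉ Set.range K.param, ∃ U ∈ nhds x, ∀ y ∈ U,
      y ∈ K.exterior ∧ JoinedIn K.exterior x y := by
    intro x hx
    obtain ⟨U, ⟨hU, hUc⟩, hU'⟩ := (LocallyPathConnectedSpace.path_connected_basis x).mem_iff.1
      (K.compl_closedTube_mem_nhds hx 1)
    have hsub : U ⊆ K.exterior := hU'.trans K.compl_closedTube_subset
    exact ⟨U, hU, fun y hy => ⟨hsub hy, (hUc.joinedIn x (mem_of_mem_nhds hU) y hy).mono hsub⟩⟩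
  let A : Set S3 := Set.range K.param ∪ {x | JoinedIn K.exterior t₀ x}
  have hA : IsClopen A := by
    constructor
    · rw [← isOpen_compl_iff, isOpen_iff_mem_nhds]
      intro x hx
      have hx1 : x ∉ Set.range K.param := fun h => hx (Or.inl h)
      obtain ⟨U, hU, hU'⟩ := hloc x hx1
      filter_upwards [hU] with y hy hyA
      apply hx
      right
      have h1 := (hU' y hy)
      rcases hyA with ⟨⟨z, w⟩, rfl⟩ | hyA
      · exact (K.joinedIn_param (by simp) (K.param_mem_exterior.1 h1.1)).trans h1.2.symm
      · exact JoinedIn.trans hyA h1.2.symm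
    · rw [isOpen_iff_mem_nhds]
      intro x hx
      by_cases hx1 : x ∈ Set.range K.param
      · exact Filter.mem_of_superset (K.isOpenEmbedding.isOpen_range.mem_nhds hx1)
          Set.subset_union_left
      · obtain ⟨U, hU, hU'⟩ := hloc x hx1
        filter_upwards [hU] with y hy
        rcases hx with hx | hx
        · exact absurd hx hx1
        · exact Or.inr (JoinedIn.trans hx (hU' y hy).2)
  have hAu : A = Set.univ := hA.eq_univ ⟨t₀, Or.inl ⟨_, rfl⟩⟩
  have hyA : y ∈ A := hAu ▸ Set.mem_univ y
  rcases hyA with ⟨⟨z, w⟩, rfl⟩ | hyA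
  · exact K.joinedIn_param (by simp) (K.param_mem_exterior.1 hy)
  · exact hyA

instance : PathConnectedSpace K.exterior :=
  isPathConnected_iff_pathConnectedSpace.1 K.isPathConnected_exterior

end TubedKnot

/-! ### Cocycles on the exterior of a knot -/

namespace TubedKnot

variable (K : TubedKnot) {𝒢 : Type*} [Group 𝒢]

/-- The parallel of the knot through the points `(z, 1)`, from `z₀`. -/
def parallel (z₀ : Circle) : C(I, S3) :=
  ⟨fun t => K.param (z₀ * Circle.exp (2 * Real.pi * t), 1),
    K.isOpenEmbedding.continuous.comp (by fun_prop)⟩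

/-- The circle of radius `r` around the knot in the fibre over `z₀`. -/
def fibreCircle (z₀ : Circle) (r : ℝ) : C(I, S3) :=
  ⟨fun t => K.param (z₀, (r : ℂ) * Complex.exp ((2 * Real.pi * t : ℝ) * Complex.I)),
    K.isOpenEmbedding.continuous.comp (by fun_prop)⟩

/-- The universal cover of the collar of the exterior. -/
def collarMap (z₀ : Circle) : C(ℝ × ℝ × Set.Icc (1 : ℝ) (3 / 2), S3) :=
  ⟨fun e => K.param (z₀ * Circle.exp e.1, (e.2.2 : ℂ) * Complex.exp ((e.2.1 : ℂ) * Complex.I)),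
    K.isOpenEmbedding.continuous.comp (by fun_prop)⟩

theorem norm_collar {r b : ℝ} (hr : 1 ≤ r) : ‖(r : ℂ) * Complex.exp ((b : ℂ) * Complex.I)‖ = r := by
  rw [norm_mul, Complex.norm_exp_ofReal_mul_I, mul_one, Complex.norm_real, Real.norm_eq_abs,
    abs_of_pos (by linarith)]

/-- Cocycles on the collar, a torus times an interval with the cover `ℝ² × [1, 3/2]`, agree up to a
twist if they are conjugate by the same element on the parallel and on the meridian. -/
theorem exists_twist_collar (z₀ : Circle) {v v' : C(I, S3) → 𝒢}
    (hv : IsCocycleOn (K.exterior ∩ K.closedTube (3 / 2)) v)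
    (hv' : IsCocycleOn (K.exterior ∩ K.closedTube (3 / 2)) v') (c : 𝒢)
    (h₁ : v' (K.parallel z₀) * c = c * v (K.parallel z₀))
    (h₂ : v' (K.fibreCircle z₀ 1) * c = c * v (K.fibreCircle z₀ 1)) :
    ∃ u : S3 → 𝒢, ∀ γ : C(I, S3), (∀ t, γ t ∈ K.exterior ∩ K.closedTube (3 / 2)) →
      v' γ = u (γ 1) * v γ * (u (γ 0))⁻¹ := by
  have : ContractibleSpace (Set.Icc (1 : ℝ) (3 / 2)) :=
    (convex_Icc _ _).contractibleSpace ⟨1, by norm_num⟩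
  let E := ℝ × ℝ × Set.Icc (1 : ℝ) (3 / 2)
  let r₁ : Set.Icc (1 : ℝ) (3 / 2) := ⟨1, by norm_num⟩
  -- the generators of the group of deck transformations
  let τ₁ : C(E, E) := ⟨fun e => (e.1 + 2 * Real.pi, e.2), by fun_prop⟩
  let τ₂ : C(E, E) := ⟨fun e => (e.1, e.2.1 + 2 * Real.pi, e.2.2), by fun_prop⟩
  have hτ₁ : (K.collarMap z₀).comp τ₁ = K.collarMap z₀ := by
    ext1 e
    change K.param (z₀ * Circle.exp (e.1 + 2 * Real.pi), _) = K.param _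
    rw [Circle.exp_add, Circle.exp_two_pi, mul_one]
    rfl
  have hτ₂ : (K.collarMap z₀).comp τ₂ = K.collarMap z₀ := by
    ext1 e
    change K.param (_, (e.2.2 : ℂ) * Complex.exp (((e.2.1 + 2 * Real.pi : ℝ) : ℂ) * Complex.I)) =
      K.param _
    push_cast
    rw [add_mul, Complex.exp_add, Complex.exp_two_pi_mul_I, mul_one]
    rfl
  suffices h : ∃ u : S3 → 𝒢, u (K.collarMap z₀ ((0, 0, r₁) : E)) = c ∧
      ∀ γ : C(I, S3), (∀ t, γ t ∈ K.exterior ∩ K.closedTube (3 / 2)) →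
        v' γ = u (γ 1) * v γ * (u (γ 0))⁻¹ from h.imp fun _ h => h.2
  refine hv.exists_twist_of_deck hv' (K.collarMap z₀) (fun e => ?_) (fun γ hγ => ?_)
    ((0, 0, r₁) : E) c {τ₁, τ₂} ?_ ?_ ?_
  · refine ⟨K.param_mem_exterior.2 ?_, _, ?_, rfl⟩
    · simp only [norm_collar e.2.2.2.1]
      exact e.2.2.2.1
    · simp only [Set.mem_ofPred_eq, norm_collar e.2.2.2.1]
      exact e.2.2.2.2
  · have hr : ∀ t, γ t ∈ Set.range K.param := fun t => Set.image_subset_range _ _ (hγ t).2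
    let g : C(I, Circle × ℂ) := ⟨fun t => K.tubeCoord ⟨γ t, hr t⟩, by fun_prop⟩
    have hg : ∀ t, K.param (g t) = γ t := fun t => K.param_tubeCoord ⟨γ t, hr t⟩
    have hg1 : ∀ t, 1 ≤ ‖(g t).2‖ := fun t => by
      rw [← K.param_mem_exterior, hg]
      exact (hγ t).1
    have hg2 : ∀ t, ‖(g t).2‖ ≤ 3 / 2 := fun t => by
      obtain ⟨q, hq, hq'⟩ := (hγ t).2
      rwa [K.isOpenEmbedding.injective ((hg t).trans hq'.symm)]
    obtain ⟨a, ha⟩ := exists_angle ⟨fun t => ((z₀⁻¹ * (g t).1 : Circle) : ℂ), by fun_prop⟩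
      fun t => Circle.coe_ne_zero _
    obtain ⟨b, hb⟩ := exists_angle ⟨fun t => (g t).2, by fun_prop⟩ fun t h0 => by
      have h0' : (g t).2 = 0 := h0
      have := hg1 t
      rw [h0', norm_zero] at this
      linarith
    refine ⟨⟨fun t => (a t, b t, ⟨‖(g t).2‖, hg1 t, hg2 t⟩), by fun_prop⟩, ?_⟩
    ext1 t
    rw [← hg t]
    refine congrArg K.param (Prod.ext ?_ (hb t).symm)
    change z₀ * Circle.exp (a t) = (g t).1
    have h3 : Circle.exp (a t) = z₀⁻¹ * (g t).1 := by
      apply Circle.ext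
      refine Eq.trans ?_ (ha t).symm
      change _ = ((‖((z₀⁻¹ * (g t).1 : Circle) : ℂ)‖ : ℝ) : ℂ) * _
      rw [Circle.norm_coe, Circle.coe_exp]
      simp
    rw [h3, mul_inv_cancel_left]
  · rintro τ (rfl | rfl)
    exacts [hτ₁, hτ₂]
  · rintro τ (rfl | rfl)
    · refine ⟨⟨⟨fun t => (2 * Real.pi * t, 0, r₁), by fun_prop⟩, by simp, by simp [τ₁]⟩, ?_⟩
      convert h₁ using 3
      all_goals
        ext1 t
        simp [collarMap, parallel, r₁]
    · refine ⟨⟨⟨fun t => (0, 2 * Real.pi * t, r₁), by fun_prop⟩, by simp, by simp [τ₂]⟩, ?_⟩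
      convert h₂ using 3
      all_goals
        ext1 t
        simp [collarMap, fibreCircle, r₁]
  · rintro ⟨a, b, r⟩ ⟨a', b', r'⟩ h
    have h3 := K.isOpenEmbedding.injective h
    have h4 := congrArg Prod.snd h3
    simp only at h4
    obtain rfl : r = r' := by
      have := congrArg norm h4
      rw [norm_collar r.2.1, norm_collar r'.2.1] at this
      exact Subtype.ext this
    have h5 : Circle.exp a = Circle.exp a' := mul_left_cancel (congrArg Prod.fst h3)
    have h5' := congrArg (fun z : Circle => (z : ℂ)) h5
    simp only [Circle.coe_exp] at h5'
    obtain ⟨n, rfl⟩ := exp_mul_I_eq h5'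
    have hr0 : ((r : ℝ) : ℂ) ≠ 0 := by
      have := r.2.1
      exact_mod_cast (by linarith : (0 : ℝ) < r).ne'
    obtain ⟨m, rfl⟩ := exp_mul_I_eq (mul_left_cancel₀ hr0 h4)
    exact (eqvGen_int_translate (fun a => ((a, b, r) : E)) (fun a => Or.inl ⟨τ₁, by simp, rfl⟩) a
      n).trans _ _ _ (eqvGen_int_translate (fun b => ((_, b, r) : E))
        (fun b => Or.inl ⟨τ₂, by simp, rfl⟩) b m)

/-- The parallel projection of the closed tube to the exterior. -/
def tubeToParallel : C(K.closedTube (3 / 2), K.exterior) :=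
  ⟨fun x => ⟨K.param ((K.tubeCoord ⟨x, Set.image_subset_range _ _ x.2⟩).1, 1),
    K.param_mem_exterior.2 (by simp)⟩,
    (K.isOpenEmbedding.continuous.comp (by fun_prop)).subtype_mk _⟩

/-- A cocycle on the exterior of a knot that is trivial on a meridian is trivial: it extends to the
3-sphere. -/
theorem exists_primitive_of_fibreCircle {v : C(I, K.exterior) → 𝒢} (hv : IsCocycleOn Set.univ v)
    (z₀ : Circle) (h : extendCocycle K.exterior v (K.fibreCircle z₀ 1) = 1) :
    ∃ u : K.exterior → 𝒢, ∀ γ : C(I, K.exterior), v γ = u (γ 1) * (u (γ 0))⁻¹ := by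
  let N := K.closedTube (3 / 2)
  let v₁ := extendCocycle K.exterior v
  have hv₁ : IsCocycleOn K.exterior v₁ := hv.extend
  -- On the tube take the values of `v` on the projections of paths to the parallel. This agrees
  -- with `v` on the generators of the fundamental group of the torus: on the parallel by
  -- definition, and on the meridian since both are trivial there. So the two cocycles can be
  -- glued.
  let w : C(I, N) → 𝒢 := fun γ => v (K.tubeToParallel.comp γ)
  have hw : IsCocycleOn Set.univ w := hv.comap K.tubeToParallel
  let v₂ := extendCocycle N w
  have hv₂ : IsCocycleOn N v₂ := hw.extend
  have hv₂e (γ : C(I, S3)) (hγ : ∀ t, γ t ∈ N) (δ : C(I, S3)) (hδ : ∀ t, δ t =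
      K.tubeToParallel ⟨γ t, hγ t⟩) : v₂ γ = v₁ δ := by
    have hδ' : ∀ t, δ t ∈ K.exterior := fun t => by
      rw [hδ]
      exact Subtype.coe_prop _
    simp only [v₂, v₁, extendCocycle]
    rw [dif_pos hγ, dif_pos hδ']
    change v _ = v _
    congr 1
    ext1 t
    exact Subtype.ext (hδ t).symm
  have hproj (q : Circle × ℂ) (hq : K.param q ∈ N) :
      (K.tubeToParallel ⟨K.param q, hq⟩ : S3) = K.param (q.1, 1) := by
    change K.param ((K.tubeCoord ⟨K.param q, _⟩).1, 1) = _
    rw [K.tubeCoord_param]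
  obtain ⟨u, hu⟩ := K.exists_twist_collar z₀ (hv₂.mono Set.inter_subset_right)
    (hv₁.mono Set.inter_subset_left) 1 (by
      rw [mul_one, one_mul]
      have hN : ∀ t, K.parallel z₀ t ∈ N := fun t => ⟨_, by norm_num, rfl⟩
      exact (hv₂e _ hN _ fun t => (hproj _ (hN t)).symm).symm) (by
      rw [mul_one, one_mul]
      have hN : ∀ t, K.fibreCircle z₀ 1 t ∈ N := fun t => ⟨_, by
        change ‖_‖ ≤ (3 / 2 : ℝ)
        rw [norm_collar le_rfl]
        norm_num, rfl⟩
      refine h.trans ?_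
      rw [hv₂e _ hN (.const I (K.param (z₀, 1))) fun t => (hproj _ (hN t)).symm]
      exact (hv₁.const (K.param_mem_exterior.2 (by simp))).symm)
  let W : Bool → Set S3 := fun b => if b then K.exterior else N
  let V : Bool → C(I, S3) → 𝒢 := fun b =>
    if b then v₁ else fun γ => u (γ 1) * v₂ γ * (u (γ 0))⁻¹
  have hW : ∀ x, ∃ b, W b ∈ nhds x := by
    intro x
    by_cases hx : x ∈ K.param '' {q | ‖q.2‖ < 3 / 2}
    · exact ⟨false, Filter.mem_of_superset ((K.isOpen_openTube _).mem_nhds hx)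
        (Set.image_mono fun q (hq : ‖q.2‖ < 3 / 2) => hq.le)⟩
    · refine ⟨true, Filter.mem_of_superset ((K.isClosed_closedTube 1).isOpen_compl.mem_nhds ?_)
        K.compl_closedTube_subset⟩
      rintro ⟨q, hq, rfl⟩
      exact hx ⟨q, lt_of_le_of_lt (b := (1 : ℝ)) hq (by norm_num), rfl⟩
  have hV : ∀ b, IsCocycleOn (W b) (V b) := by
    intro b
    cases b
    · exact hv₂.twist u
    · exact hv₁
  obtain ⟨V', hV', hVW, -⟩ := exists_glue hW hV (by
    intro b b' γ hb hb'
    cases b <;> cases b'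
    · rfl
    · exact (hu γ fun t => ⟨hb' t, hb t⟩).symm
    · exact hu γ fun t => ⟨hb t, hb' t⟩
    · rfl)
  obtain ⟨U, hU⟩ := S3.exists_primitive hV'
  refine ⟨fun x => U x, fun γ => ?_⟩
  rw [← extendCocycle_comp v γ]
  exact (hVW true _ fun t => (γ t).2).symm.trans (hU _)

/-- The radial projection of the complement of the knot to the exterior. -/
def radialRetract (x : {x : S3 // x ∉ K.core}) : S3 :=
  open Classical in
  if h : (x : S3) ∈ Set.range K.param then
    K.param ((K.tubeCoord ⟨x, h⟩).1,
      (max 1 ‖(K.tubeCoord ⟨x, h⟩).2‖⁻¹ : ℝ) * (K.tubeCoord ⟨x, h⟩).2) else x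

theorem radialRetract_param {q : Circle × ℂ} (hq : K.param q ∉ K.core) :
    K.radialRetract ⟨K.param q, hq⟩ = K.param (q.1, (max 1 ‖q.2‖⁻¹ : ℝ) * q.2) := by
  rw [radialRetract, dif_pos ⟨q, rfl⟩, K.tubeCoord_param]

theorem radialRetract_mem (x : {x : S3 // x ∉ K.core}) : K.radialRetract x ∈ K.exterior := by
  obtain ⟨x, hx⟩ := x
  by_cases h : x ∈ Set.range K.param
  · obtain ⟨q, rfl⟩ := h
    have hq : 0 < ‖q.2‖ := norm_pos_iff.2 fun h => hx (K.param_mem_core.2 h)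
    rw [radialRetract_param, K.param_mem_exterior, norm_mul, Complex.norm_real, Real.norm_eq_abs,
      abs_of_pos (lt_max_of_lt_left one_pos)]
    calc 1 = ‖q.2‖⁻¹ * ‖q.2‖ := (inv_mul_cancel₀ hq.ne').symm
      _ ≤ _ := by
        gcongr
        exact le_max_right _ _
  · rw [radialRetract, dif_neg h]
    rintro ⟨q, -, rfl⟩
    exact h ⟨q, rfl⟩

theorem radialRetract_eq_self (x : {x : S3 // x ∉ K.core}) (hx : (x : S3) ∈ K.exterior) :
    K.radialRetract x = x := by
  obtain ⟨x, hx'⟩ := x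
  by_cases h : x ∈ Set.range K.param
  · obtain ⟨q, rfl⟩ := h
    have hq := K.param_mem_exterior.1 hx
    rw [radialRetract_param, max_eq_left (inv_le_one_of_one_le₀ hq)]
    simp
  · rw [radialRetract, dif_neg h]

theorem continuous_radialRetract : Continuous K.radialRetract := by
  rw [continuous_iff_continuousAt]
  rintro ⟨x, hx⟩
  by_cases h : x ∈ Set.range K.param
  · let O : Set {x : S3 // x ∉ K.core} := {y | (y : S3) ∈ Set.range K.param}
    have hO : IsOpen O := K.isOpenEmbedding.isOpen_range.preimage continuous_subtype_val
    refine ContinuousOn.continuousAt (s := O) ?_ (hO.mem_nhds h)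
    rw [continuousOn_iff_continuous_domRestrict]
    have e : O.domRestrict K.radialRetract = fun y : O => K.param ((K.tubeCoord ⟨y.1, y.2⟩).1,
        (max 1 ‖(K.tubeCoord ⟨y.1, y.2⟩).2‖⁻¹ : ℝ) * (K.tubeCoord ⟨y.1, y.2⟩).2) := by
      ext1 y
      exact dif_pos y.2
    rw [e]
    refine K.isOpenEmbedding.continuous.comp ?_
    have hc : Continuous fun y : O => K.tubeCoord ⟨y.1, y.2⟩ := by fun_prop
    have hn : ∀ y : O, ‖(K.tubeCoord ⟨y.1, y.2⟩).2‖ ≠ 0 := by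
      intro y h0
      apply y.1.2
      have := K.param_tubeCoord ⟨y.1, y.2⟩
      rw [← this]
      exact K.param_mem_core.2 (norm_eq_zero.1 h0)
    have hc2 := (continuous_snd.comp hc).norm.inv₀ hn
    refine (continuous_fst.comp hc).prodMk (Continuous.mul ?_ (continuous_snd.comp hc))
    exact Complex.continuous_ofReal.comp (continuous_const.max hc2)
  · have h1 : ∀ᶠ y : {x : S3 // x ∉ K.core} in nhds ⟨x, hx⟩, K.radialRetract y = y := by
      filter_upwards [continuous_subtype_val.continuousAt.preimage_mem_nhds
        (K.compl_closedTube_mem_nhds h 1)] with y hy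
      exact K.radialRetract_eq_self y (K.compl_closedTube_subset hy)
    exact continuous_subtype_val.continuousAt.congr (h1.mono fun y hy => hy.symm)

end TubedKnot

namespace HopfLikeLink

variable (L : HopfLikeLink) (i : Fin 2) {𝒢 : Type*} [Group 𝒢]

theorem mem_core_iff_coord {i : Fin 2} {x : S3} (h : (L.coord i x).re ≤ 4 / 5) :
    x ∈ (L.knot i).core ↔ L.coord i.rev x = 0 := L.mem_core_iff i x h

/-- The meridian as a path in `X(Kᵢ)`. -/
def knotMeridianPath : Path (L.pieceToKnot i (L.basePoint i)) (L.pieceToKnot i (L.basePoint i)) :=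
  (L.meridianLoop i).map (L.pieceToKnot i).continuous

/-- The open part of the disc over which a component is standard. -/
def standardDisc : Set ℂ := {z | z.re ≤ 4 / 5 ∧ ‖z‖ < 1}

theorem convex_standardDisc : Convex ℝ standardDisc := by
  have h3 : Convex ℝ {z : ℂ | ‖z‖ < 1} := by
    have e : {z : ℂ | ‖z‖ < 1} = Metric.ball 0 1 := by
      ext z
      simp
    rw [e]
    exact convex_ball _ _
  exact (convex_halfSpace_re_le _).inter h3

/-- A cocycle on `X(Kᵢ)` that is trivial on the meridian is trivial. The meridian spans the
cocycle near the circle around the point `xᵢ = -1` of the knot. -/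
theorem exists_primitive_of_meridian {v : C(I, (L.knot i).exterior) → 𝒢}
    (hv : IsCocycleOn Set.univ v) (h : v (L.knotMeridianPath i) = 1) :
    ∃ u : (L.knot i).exterior → 𝒢, ∀ γ : C(I, (L.knot i).exterior),
      v γ = u (γ 1) * (u (γ 0))⁻¹ := by
  let K := L.knot i
  -- the point `xᵢ = -1` of the knot
  let y : S3 := L.h.symm (spherePoint i (-1) 0 (Or.inl (by norm_num)))
  have hy1 : L.coord i y = -1 := by
    rw [coord_symm, spherePoint_self]
    simp
  have hy2 : L.coord i.rev y = 0 := by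
    rw [coord_symm, spherePoint_rev]
    simp
  have hy : y ∈ K.core := by
    rw [L.mem_core_iff_coord (by rw [hy1]; norm_num), hy2]
  obtain ⟨⟨z₀, w₀⟩, hw₀, hz₀⟩ := hy
  obtain rfl : w₀ = 0 := hw₀
  let Y := {x : S3 // x ∉ K.core}
  -- Near this point the coordinates of the tube are not those of the sphere, so the cocycle is
  -- pulled back to the whole complement of the knot.
  let R : C(Y, K.exterior) := ⟨fun x => ⟨K.radialRetract x, K.radialRetract_mem x⟩,
    K.continuous_radialRetract.subtype_mk _⟩
  let v' : C(I, Y) → 𝒢 := fun γ => v (R.comp γ)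
  have hv' : IsCocycleOn Set.univ v' := hv.comap R
  let j : C(Y, S3) := ⟨fun x => L.h x, L.h.continuous.comp continuous_subtype_val⟩
  have hD : ∀ z ∈ standardDisc, ‖z‖ < 1 := fun z hz => hz.2
  have hY (e : ℝ × standardDisc) : L.h.symm (discPoint i standardDisc hD e) ∉ K.core := by
    rw [L.mem_core_iff_coord, coord_symm, discPoint_rev]
    · exact sqrt_mul_exp_ne_zero (hD _ e.2.2) _
    · rw [coord_symm, discPoint_self]
      exact e.2.2.1
  let q : C(ℝ × standardDisc, Y) := ⟨fun e => ⟨L.h.symm (discPoint i standardDisc hD e), hY e⟩,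
    (L.h.symm.continuous.comp (continuous_discPoint _ _ _)).subtype_mk _⟩
  let e₀ : ℝ × standardDisc := (0, ⟨4 / 5, by norm_num, by norm_num⟩)
  let m : Path e₀ (e₀.1 + 2 * Real.pi, e₀.2) :=
    { toFun := fun t => (2 * Real.pi * t, e₀.2)
      continuous_toFun := by fun_prop
      source' := by simp [e₀]
      target' := by simp [e₀] }
  have hm : R.comp (q.comp (m : C(I, ℝ × standardDisc))) = (L.knotMeridianPath i : C(I, _)) := by
    ext1 t
    apply Subtype.ext
    have h1 : L.h.symm (discPoint i standardDisc hD (m t)) = L.h.symm (modelMeridian i t) := by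
      refine congrArg _ (S3.ext_coords i ?_ ?_)
      · rw [discPoint_self, modelMeridian_self]
        rfl
      · rw [discPoint_rev]
        change (√(1 - ‖(4 / 5 : ℂ)‖ ^ 2) : ℂ) * _ = _
        rw [sqrt_one_sub_four_fifths]
        simp [modelMeridian, fin_two_rev_ne, m]
    have h2 := K.radialRetract_eq_self (q (m t)) (by
      change L.h.symm (discPoint i standardDisc hD (m t)) ∈ _
      rw [h1]
      exact (L.pieceToKnot i ⟨_, L.meridian_mem_piece i t⟩).2)
    exact h2.trans h1
  obtain ⟨u, -, hu⟩ := IsCocycleOn.exists_twist_disc i convex_standardDisc hD j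
    (L.h.injective.comp Subtype.val_injective) q (fun e => L.h.apply_symm_apply _)
    (v := fun _ => (1 : 𝒢)) (v' := v') isCocycleOn_one (hv'.mono (Set.subset_univ _)) e₀ 1 m (by
      rw [mul_one, mul_one]
      exact (congrArg v hm).trans h)
  -- the small circles around the point lie over the disc
  obtain ⟨ε, hε, hε1, hεD⟩ : ∃ ε > 0, ε ≤ 1 ∧ ∀ w : ℂ, ‖w‖ ≤ ε →
      (L.coord i (K.param (z₀, w))).re ≤ 4 / 5 := by
    have hc : Continuous fun w : ℂ => (L.coord i (K.param (z₀, w))).re :=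
      Complex.continuous_re.comp ((L.continuous_coord i).comp
        (K.isOpenEmbedding.continuous.comp (by fun_prop)))
    have h0 : (L.coord i (K.param (z₀, 0))).re < 4 / 5 := by
      rw [hz₀, hy1]
      norm_num
    obtain ⟨δ, hδ, h⟩ := Metric.eventually_nhds_iff.1
      (hc.continuousAt.eventually (gt_mem_nhds h0))
    refine ⟨min (δ / 2) 1, by positivity, min_le_right _ _, fun w hw => (h ?_).le⟩
    rw [dist_zero_right]
    linarith [min_le_left (δ / 2) 1]
  have hnorm (t : ℝ) : ‖(ε : ℂ) * Complex.exp ((2 * Real.pi * t : ℝ) * Complex.I)‖ = ε := by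
    rw [norm_mul, Complex.norm_exp_ofReal_mul_I, mul_one, Complex.norm_real, Real.norm_eq_abs,
      abs_of_pos hε]
  have hne (t : I) : K.fibreCircle z₀ ε t ∉ K.core := by
    intro h
    have h' : _ * _ = (0 : ℂ) := K.param_mem_core.1 h
    have := hnorm t
    rw [h', norm_zero] at this
    exact hε.ne this
  let γ : C(I, Y) := ⟨fun t => ⟨K.fibreCircle z₀ ε t, hne t⟩, by fun_prop⟩
  have hγ1 : γ 1 = γ 0 := by
    apply Subtype.ext
    simp [γ, TubedKnot.fibreCircle, Complex.exp_two_pi_mul_I]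
  -- the cocycle is a coboundary over the disc, and the small circle is a loop there
  have hγ : v' γ = 1 := by
    rw [hu γ, hγ1]
    · group
    · intro t
      have hre := hεD _ (hnorm t).le
      have h1 : L.coord i.rev (K.fibreCircle z₀ ε t) ≠ 0 := fun h =>
        hne t ((L.mem_core_iff_coord hre).2 h)
      have h2 := L.coord_norm_sq i (K.fibreCircle z₀ ε t)
      refine ⟨hre, ?_⟩
      change ‖L.coord i (K.fibreCircle z₀ ε t)‖ < 1
      have := norm_pos_iff.2 h1
      by_contra h3
      nlinarith
  refine K.exists_primitive_of_fibreCircle hv z₀ ?_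
  rw [← hγ]
  have h1 : ∀ t, K.fibreCircle z₀ 1 t = K.radialRetract (γ t) := by
    intro t
    refine Eq.trans ?_ (K.radialRetract_param (hne t)).symm
    simp only [hnorm]
    rw [max_eq_right ((one_le_inv₀ hε).2 hε1)]
    change K.param _ = _
    rw [← mul_assoc, ← Complex.ofReal_mul, inv_mul_cancel₀ hε.ne']
  have h2 : K.fibreCircle z₀ 1 = ContinuousMap.comp ⟨Subtype.val, continuous_subtype_val⟩
      (R.comp γ) := by
    ext1 t
    exact h1 t
  rw [h2]
  exact extendCocycle_comp v (R.comp γ)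

end HopfLikeLink

/-! ### A linking function for an arc in 3-space -/

section Linking

/-- The Euclidean length on `ℝ × ℂ`. -/
def spaceLength (u : ℝ × ℂ) : ℝ := √(u.1 ^ 2 + ‖u.2‖ ^ 2)

/-- The Euclidean inner product on `ℝ × ℂ`. -/
def spaceDot (u u' : ℝ × ℂ) : ℝ := u.1 * u'.1 + (u.2 * (starRingEnd ℂ) u'.2).re

theorem spaceLength_sq (u : ℝ × ℂ) : spaceLength u ^ 2 = u.1 ^ 2 + ‖u.2‖ ^ 2 :=
  Real.sq_sqrt (by positivity)

theorem spaceLength_nonneg (u : ℝ × ℂ) : 0 ≤ spaceLength u := Real.sqrt_nonneg _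

/-- The two vectors are non-zero and do not point in opposite directions. -/
def NotOpposite (u u' : ℝ × ℂ) : Prop := 0 < spaceLength u * spaceLength u' + spaceDot u u'

theorem notOpposite_of_close {u u' : ℝ × ℂ}
    (h : (u'.1 - u.1) ^ 2 + ‖u'.2 - u.2‖ ^ 2 < u.1 ^ 2 + ‖u.2‖ ^ 2) : NotOpposite u u' := by
  have h1 := mul_nonneg (spaceLength_nonneg u) (spaceLength_nonneg u')
  have h2 : 0 < spaceDot u u' := by
    unfold spaceDot
    rw [← Complex.normSq_eq_norm_sq, ← Complex.normSq_eq_norm_sq] at h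
    simp only [Complex.normSq_apply, Complex.sub_re, Complex.sub_im] at h
    simp only [Complex.mul_re, Complex.conj_re, Complex.conj_im]
    nlinarith [sq_nonneg u'.1, sq_nonneg u'.2.re, sq_nonneg u'.2.im]
  unfold NotOpposite
  linarith

theorem notOpposite_of_height {u u' : ℝ × ℂ} (h : 0 < u.1 * u'.1) : NotOpposite u u' := by
  have h1 : ‖u.2‖ * ‖u'.2‖ ≤ spaceLength u * spaceLength u' := by
    have a (u : ℝ × ℂ) : ‖u.2‖ ≤ spaceLength u := Real.le_sqrt_of_sq_le (by nlinarith)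
    exact mul_le_mul (a u) (a u') (norm_nonneg _) (spaceLength_nonneg _)
  have h2 := (abs_le.1 (Complex.abs_re_le_norm (u.2 * (starRingEnd ℂ) u'.2))).1
  rw [norm_mul, Complex.norm_conj] at h2
  unfold NotOpposite spaceDot
  linarith

/-- A vector is not opposite to a vertical unit vector unless it points along the axis the other
way. -/
theorem notOpposite_vertical {u : ℝ × ℂ} {a : ℝ} (ha : |a| = 1) (h : u.2 = 0 → 0 < a * u.1) :
    NotOpposite (a, 0) u := by
  have h1 : spaceLength (a, 0) = 1 := by
    simp [spaceLength, ← sq_abs a, ha]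
  have h2 := spaceLength_sq u
  have h3 := spaceLength_nonneg u
  unfold NotOpposite spaceDot
  rw [h1]
  simp only [zero_mul, Complex.zero_re, add_zero, one_mul]
  by_cases hw : u.2 = 0
  · have := h hw
    linarith
  · have hw' := norm_pos_iff.2 hw
    have h4 : (a * u.1) ^ 2 = u.1 ^ 2 := by rw [mul_pow, ← sq_abs a, ha]; ring
    by_contra h5
    nlinarith

/-- The operator `|u| + u · σ` of the spin representation; it is non-negative, and for `u ≠ 0` it is
a multiple of the projection to the spinors that point in the direction `u`. -/
def spin (u : ℝ × ℂ) (φ : ℂ × ℂ) : ℂ × ℂ :=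
  ((spaceLength u + u.1 : ℝ) * φ.1 + (starRingEnd ℂ) u.2 * φ.2,
    u.2 * φ.1 + (spaceLength u - u.1 : ℝ) * φ.2)

/-- The projections to the spinors in the directions `u`, `u'` satisfy `P' P P' = c P'`, where the
constant `c` vanishes only for opposite directions. -/
theorem spin_spin_spin (u u' : ℝ × ℂ) (φ : ℂ × ℂ) : spin u' (spin u (spin u' φ)) =
    ((2 * (spaceLength u' * spaceLength u + spaceDot u' u) : ℝ) : ℂ) • spin u' φ := by
  have h (u : ℝ × ℂ) : (spaceLength u : ℂ) ^ 2 = (u.1 : ℂ) ^ 2 + u.2 * (starRingEnd ℂ) u.2 := by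
    rw [Complex.mul_conj, Complex.normSq_eq_norm_sq]
    exact_mod_cast spaceLength_sq u
  have hd : (spaceDot u' u : ℂ) =
      u'.1 * u.1 + (u'.2 * (starRingEnd ℂ) u.2 + (starRingEnd ℂ) u'.2 * u.2) / 2 := by
    rw [spaceDot, Complex.ofReal_add, Complex.re_eq_add_conj, map_mul, Complex.conj_conj]
    push_cast
    ring
  have h' := h u'
  obtain ⟨a, w⟩ := u
  obtain ⟨a', w'⟩ := u'
  obtain ⟨x, y⟩ := φ
  simp only [spin, Prod.smul_mk, smul_eq_mul, Prod.mk.injEq] at *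
  push_cast
  rw [hd]
  generalize (starRingEnd ℂ) w = v at *
  generalize (starRingEnd ℂ) w' = v' at *
  generalize (spaceLength (a, w) : ℂ) = l at *
  generalize (spaceLength (a', w') : ℂ) = l' at *
  constructor
  · linear_combination ((a - l) * x + v * y) * h'
  · linear_combination (w * x - (l + a) * y) * h'

theorem spin_ne_zero {u u' : ℝ × ℂ} {φ : ℂ × ℂ} (h : NotOpposite u' u) (hφ : spin u' φ ≠ 0) :
    spin u (spin u' φ) ≠ 0 := by
  intro h0
  have h1 := spin_spin_spin u u' φ
  rw [h0] at h1
  have h2 : spin u' 0 = 0 := by simp [spin]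
  rw [h2] at h1
  have h3 : ((2 * (spaceLength u' * spaceLength u + spaceDot u' u) : ℝ) : ℂ) ≠ 0 := by
    have : 0 < spaceLength u' * spaceLength u + spaceDot u' u := h
    exact_mod_cast (by linarith : (0 : ℝ) < 2 * _).ne'
  exact (smul_ne_zero h3 hφ) h1.symm

theorem spin_vertical {a : ℝ} (ha : |a| = 1) (φ : ℂ × ℂ) :
    spin (a, 0) φ = ((1 + a : ℝ) * φ.1, (1 - a : ℝ) * φ.2) := by
  have h1 : spaceLength (a, 0) = 1 := by
    simp [spaceLength, ← sq_abs a, ha]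
  simp [spin, h1]

theorem continuous_spin {Y : Type*} [TopologicalSpace Y] {f : Y → ℝ × ℂ} {g : Y → ℂ × ℂ}
    (hf : Continuous f) (hg : Continuous g) : Continuous fun y => spin (f y) (g y) := by
  unfold spin spaceLength
  have := Complex.continuous_conj
  fun_prop

/-- The product of the spin operators of a sequence of vectors, applied to the spinor `(1, 0)` of
the upward direction. -/
def spinChain (u : ℕ → ℝ × ℂ) : ℕ → ℂ × ℂ
  | 0 => (1, 0)
  | n + 1 => spin (u n) (spinChain u n)

theorem continuous_spinChain {Y : Type*} [TopologicalSpace Y] {f : ℕ → Y → ℝ × ℂ}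
    (hf : ∀ n, Continuous (f n)) (n : ℕ) : Continuous fun y => spinChain (fun n => f n y) n := by
  induction n with
  | zero => exact continuous_const
  | succ n ih => exact continuous_spin (hf n) ih

/-- A chain of vectors from one that does not point downward to one that does not point upward,
without opposite neighbours, transports the upward spinor to one that is not a multiple of it. -/
theorem spinChain_snd_ne_zero {u : ℕ → ℝ × ℂ} {N : ℕ} (h₀ : (u 0).2 = 0 → 0 < (u 0).1)
    (h : ∀ n < N, NotOpposite (u n) (u (n + 1))) (h₁ : (u N).2 = 0 → (u N).1 < 0) :
    (spinChain u (N + 1)).2 ≠ 0 := by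
  have key : ∀ n ≤ N, spinChain u (n + 1) ≠ 0 := by
    intro n hn
    induction n with
    | zero =>
      have e : spinChain u 0 = spin (1, 0) (1 / 2, 0) := by
        rw [spin_vertical (by simp)]
        simp [spinChain]
        norm_num
      change spin (u 0) (spinChain u 0) ≠ 0
      rw [e]
      refine spin_ne_zero (notOpposite_vertical (by simp) fun hw => by simpa using h₀ hw) ?_
      rw [← e]
      simp [spinChain]
    | succ n ih => exact spin_ne_zero (h n (by omega)) (ih (by omega))
  have h2 := spin_ne_zero (u := (-1, 0)) (u' := u N) (φ := spinChain u N) (by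
    have := notOpposite_vertical (u := u N) (a := -1) (by simp) fun hw => by
      have := h₁ hw
      linarith
    unfold NotOpposite at this ⊢
    have e : spaceDot (u N) (-1, 0) = spaceDot (-1, 0) (u N) := by simp [spaceDot, mul_comm]
    rw [e, mul_comm]
    exact this) (key N le_rfl)
  intro h0
  apply h2
  rw [spin_vertical (by simp)]
  have h0' : (spin (u N) (spinChain u N)).2 = 0 := h0
  simp [h0']

/-- On a constant chain the operators are all multiples of one projection. -/
theorem spinChain_const (u : ℝ × ℂ) (n : ℕ) :
    (spinChain (fun _ => u) (n + 1)) = ((2 * spaceLength u) ^ n : ℂ) • spin u (1, 0) := by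
  induction n with
  | zero => simp [spinChain]
  | succ n ih =>
    have h : (spaceLength u : ℂ) ^ 2 = (u.1 : ℂ) ^ 2 + u.2 * (starRingEnd ℂ) u.2 := by
      rw [Complex.mul_conj, Complex.normSq_eq_norm_sq]
      exact_mod_cast spaceLength_sq u
    have h1 : spin u (spinChain (fun _ => u) (n + 1)) = _ := congrArg _ ih
    refine h1.trans ?_
    simp only [spin, Prod.smul_mk, smul_eq_mul, Prod.mk.injEq]
    push_cast
    constructor
    · linear_combination (-(2 * (spaceLength u : ℂ)) ^ n) * h
    · ring

/-- A cocycle in a commutative group takes equal values on freely homotopic loops. -/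
theorem IsCocycleOn.of_free_homotopy {X 𝒢 : Type*} [TopologicalSpace X] [CommGroup 𝒢] {W : Set X}
    {v : C(I, X) → 𝒢} (hv : IsCocycleOn W v) (H : C(I × I, X)) (hH : ∀ z, H z ∈ W)
    (hc : ∀ s, H (s, 0) = H (s, 1)) {p q : C(I, X)} (hp : ∀ t, H (0, t) = p t)
    (hq : ∀ t, H (1, t) = q t) : v p = v q := by
  have e1 := hv H hH
  have e2 := hv (H.comp ⟨Prod.swap, continuous_swap⟩) fun _ => hH _
  have a1 : (H.comp ⟨Prod.swap, continuous_swap⟩).comp diagonalSide = H.comp diagonalSide := rfl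
  have a2 : (H.comp ⟨Prod.swap, continuous_swap⟩).comp rightSide = H.comp lowerSide := by
    ext1 t
    exact (hc t).symm
  have a3 : (H.comp ⟨Prod.swap, continuous_swap⟩).comp lowerSide = p := by
    ext1 t
    exact hp t
  have a4 : H.comp rightSide = q := by
    ext1 t
    exact hq t
  rw [a1, a2, a3] at e2
  rw [e2, a4, mul_comm] at e1
  exact mul_right_cancel e1

/-- For an arc `c` in 3-space, there is a function without zeros on a compact set off the arc and
the vertical rays below and above its end points, with winding number `1` on the horizontal
circles around the lower ray. It is a matrix coefficient of the product of the spin operators of the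
vectors from the points of a fine subdivision of the arc. -/
theorem exists_linking_function {X : Type*} [TopologicalSpace X] [CompactSpace X] (f : C(X, ℝ × ℂ))
    (c : C(I, ℝ × ℂ)) (hc : ∀ t x, c t ≠ f x) (hc₀ : (c 0).2 = 0)
    (h₀ : ∀ x, (f x).2 = 0 → (c 0).1 < (f x).1)
    (h₁ : ∀ x, (f x).2 = (c 1).2 → (f x).1 < (c 1).1) :
    ∃ g : C(X, ℂ), (∀ x, g x ≠ 0) ∧ ∀ (p : C(I, X)) (r h : ℝ), 0 < r → (∀ t, h < (c t).1) →
      (∀ t, f (p t) = (h, (r : ℂ) * Complex.exp ((2 * Real.pi * t : ℝ) * Complex.I))) →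
      windingNumber (g.comp p) = 1 := by
  -- a lower bound for the distance from the arc
  obtain ⟨δ, hδ, hdist⟩ : ∃ δ > 0, ∀ t x,
      2 * δ ^ 2 ≤ ((f x).1 - (c t).1) ^ 2 + ‖(f x).2 - (c t).2‖ ^ 2 := by
    cases isEmpty_or_nonempty X
    · exact ⟨1, one_pos, fun _ x => isEmptyElim x⟩
    let G : I × X → ℝ := fun z => ((f z.2).1 - (c z.1).1) ^ 2 + ‖(f z.2).2 - (c z.1).2‖ ^ 2
    have hG : Continuous G := by fun_prop
    obtain ⟨z, -, hz⟩ := isCompact_univ.exists_isMinOn Set.univ_nonempty hG.continuousOn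
    have hpos : 0 < G z := by
      refine lt_of_le_of_ne (by positivity) fun h0 => hc z.1 z.2 ?_
      have e1 : (f z.2).1 - (c z.1).1 = 0 := by
        have : 0 = ((f z.2).1 - (c z.1).1) ^ 2 + ‖(f z.2).2 - (c z.1).2‖ ^ 2 := h0
        nlinarith [sq_nonneg ‖(f z.2).2 - (c z.1).2‖]
      have e2 : ‖(f z.2).2 - (c z.1).2‖ = 0 := by
        have : 0 = ((f z.2).1 - (c z.1).1) ^ 2 + ‖(f z.2).2 - (c z.1).2‖ ^ 2 := h0
        nlinarith [sq_nonneg ((f z.2).1 - (c z.1).1)]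
      exact Prod.ext (sub_eq_zero.1 e1).symm (sub_eq_zero.1 (norm_eq_zero.1 e2)).symm
    refine ⟨√(G z / 2), Real.sqrt_pos.2 (by positivity), fun t x => ?_⟩
    rw [Real.sq_sqrt (by positivity)]
    have := hz (Set.mem_univ (t, x))
    have h' : G z ≤ G (t, x) := this
    simp only [G] at h' ⊢
    linarith
  -- A subdivision of the arc into steps shorter than `δ`: from a point of the image of `f`
  -- neighbouring points of the subdivision are not seen in opposite directions.
  obtain ⟨η, hη, hunif⟩ := Metric.uniformContinuous_iff.1
    (CompactSpace.uniformContinuous_of_continuous c.continuous) δ hδ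
  obtain ⟨N, hN⟩ := exists_nat_gt (1 / η)
  have hN0 : (0 : ℝ) < N := lt_trans (by positivity) hN
  let s (n : ℕ) : I := Set.projIcc 0 1 zero_le_one ((n : ℝ) / N)
  have hs0 : s 0 = 0 := by simp [s]
  have hsN : s N = 1 := by
    simp only [s, div_self hN0.ne']
    exact Set.projIcc_right (zero_le_one (α := ℝ))
  have hs (n : ℕ) : dist (c (s (n + 1))) (c (s n)) < δ := by
    apply hunif
    have hlip : LipschitzWith 1 (Set.projIcc (0 : ℝ) 1 zero_le_one) := LipschitzWith.projIcc _
    refine (hlip.dist_le_mul _ _).trans_lt ?_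
    rw [NNReal.coe_one, one_mul, Real.dist_eq, ← sub_div]
    push_cast
    rw [add_sub_cancel_left, abs_of_pos (by positivity), div_lt_iff₀ hN0]
    rwa [div_lt_iff₀ hη, mul_comm] at hN
  let F (x : X) : ℂ := (spinChain (fun n => f x - c (s n)) (N + 1)).2
  have hF : Continuous F := continuous_snd.comp (continuous_spinChain (fun n => by fun_prop) _)
  refine ⟨⟨F, hF⟩, fun x => ?_, fun p r h hr hh hp => ?_⟩
  · change (spinChain (fun n => f x - c (s n)) (N + 1)).2 ≠ 0
    refine spinChain_snd_ne_zero (fun h => ?_) (fun n hn => ?_) fun h => ?_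
    · simp only [hs0, Prod.snd_sub, Prod.fst_sub, hc₀, sub_zero] at h ⊢
      exact sub_pos.2 (h₀ x h)
    · apply notOpposite_of_close
      refine lt_of_lt_of_le ?_ (hdist (s n) x)
      have h1 := hs n
      rw [Prod.dist_eq, max_lt_iff, Real.dist_eq, dist_eq_norm] at h1
      simp only [Prod.snd_sub, Prod.fst_sub, sub_sub_sub_cancel_left]
      rw [norm_sub_rev]
      have h3 := abs_lt.1 h1.1
      have h4 := norm_nonneg ((c (s (n + 1))).2 - (c (s n)).2)
      nlinarith [h1.2]
    · simp only [hsN, Prod.snd_sub, Prod.fst_sub] at h ⊢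
      exact sub_neg.2 (h₁ x (sub_eq_zero.1 h))
  · -- The circle lies below the arc. Contraction of the arc to its lower end point does not change
    -- the winding number, and for a constant chain the function is a positive multiple of the
    -- horizontal coordinate.
    let H : C(I × I, ℂ) := ⟨fun z => (spinChain (fun n => f (p z.2) -
      ((1 - (z.1 : ℝ)) • c (s n) + (z.1 : ℝ) • c 0)) (N + 1)).2,
      continuous_snd.comp (continuous_spinChain (fun n => by fun_prop) _)⟩
    have hneg (z : I × I) (n : ℕ) :
        (f (p z.2) - ((1 - (z.1 : ℝ)) • c (s n) + (z.1 : ℝ) • c 0)).1 < 0 := by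
      rw [hp]
      simp only [Prod.fst_sub, Prod.fst_add, Prod.smul_fst, smul_eq_mul]
      exact sub_neg.2 ((convex_Ioi h) (hh (s n)) (hh 0) (sub_nonneg.2 z.1.2.2) z.1.2.1 (by ring))
    have hH0 (z : I × I) : H z ≠ 0 := by
      change (spinChain (fun n => f (p z.2) -
        ((1 - (z.1 : ℝ)) • c (s n) + (z.1 : ℝ) • c 0)) (N + 1)).2 ≠ 0
      refine spinChain_snd_ne_zero (fun h0 => ?_) (fun n hn => ?_) fun _ => hneg z N
      · exfalso
        rw [hs0, hp, ← add_smul, sub_add_cancel, one_smul, Prod.snd_sub, hc₀, sub_zero] at h0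
        have : (r : ℂ) ≠ 0 := by exact_mod_cast hr.ne'
        exact (mul_ne_zero this (Complex.exp_ne_zero _)) h0
      · exact notOpposite_of_height (mul_pos_of_neg_of_neg (hneg z n) (hneg z (n + 1)))
    have hp01 : f (p 0) = f (p 1) := by
      rw [hp, hp]
      simp [Complex.exp_two_pi_mul_I]
    let q : C(I, ℂ) := H.comp ⟨fun t => (1, t), by fun_prop⟩
    have h1 := isCocycleOn_windingNumber.of_free_homotopy H hH0 (fun z => by
      change (spinChain (fun n => f (p 0) - ((1 - (z : ℝ)) • c (s n) + (z : ℝ) • c 0)) (N + 1)).2 =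
        (spinChain (fun n => f (p 1) - ((1 - (z : ℝ)) • c (s n) + (z : ℝ) • c 0)) (N + 1)).2
      rw [hp01]) (p := (ContinuousMap.mk F hF).comp p) (q := q) (fun t => by
      simp [H, F]) (fun t => rfl)
    refine (Multiplicative.ofAdd.injective h1).trans ?_
    have hlen : 0 < spaceLength (h - (c 0).1, (r : ℂ)) := Real.sqrt_pos.2 (by
      have : ‖(r : ℂ)‖ = r := by simp [abs_of_pos hr]
      simp only [this]
      positivity)
    refine windingNumber_circle (r := (2 * spaceLength (h - (c 0).1, (r : ℂ))) ^ N * r)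
      (by positivity) fun t => ?_
    have hu : ∀ n, f (p t) - ((1 - ((1 : I) : ℝ)) • c (s n) + ((1 : I) : ℝ) • c 0) =
        (h - (c 0).1, (r : ℂ) * Complex.exp ((2 * Real.pi * t : ℝ) * Complex.I)) := by
      intro n
      rw [hp]
      ext1 <;> simp [hc₀]
    have hl : spaceLength (h - (c 0).1, (r : ℂ) * Complex.exp ((2 * Real.pi * t : ℝ) * Complex.I)) =
        spaceLength (h - (c 0).1, (r : ℂ)) := by
      simp only [spaceLength, norm_mul, Complex.norm_exp_ofReal_mul_I, mul_one]
    change (spinChain (fun n => f (p t) - ((1 - ((1 : I) : ℝ)) • c (s n) +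
      ((1 : I) : ℝ) • c 0)) (N + 1)).2 = _
    simp only [hu]
    rw [spinChain_const, hl]
    simp only [spin, Prod.smul_snd, smul_eq_mul]
    push_cast
    ring

end Linking

namespace HopfLikeLink

variable (L : HopfLikeLink) (i : Fin 2)

/-- The stereographic projection from the point `xᵢ = -1`, in the coordinates of the normal
position. The standard part of the component `i` goes to the vertical axis. -/
def stereo (x : S3) : ℝ × ℂ :=
  ((L.coord i x).im / (1 + (L.coord i x).re),
    L.coord i.rev x / ((1 + (L.coord i x).re : ℝ) : ℂ))

variable {i} in
theorem coord_re_im (x : S3) :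
    (L.coord i x).re ^ 2 + (L.coord i x).im ^ 2 + ‖L.coord i.rev x‖ ^ 2 = 1 := by
  have := L.coord_norm_sq i x
  rw [← Complex.normSq_eq_norm_sq, Complex.normSq_apply] at this
  linarith

variable {i} in
theorem coord_eq_neg_one {x : S3} (h : 1 + (L.coord i x).re ≤ 0) :
    L.coord i x = -1 ∧ L.coord i.rev x = 0 := by
  have h1 := L.coord_re_im (i := i) x
  have h2 : (L.coord i x).re = -1 := by
    nlinarith [sq_nonneg (L.coord i x).im, sq_nonneg ‖L.coord i.rev x‖]
  refine ⟨Complex.ext (by simp [h2]) ?_, ?_⟩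
  · simp only [Complex.neg_im, Complex.one_im, neg_zero]
    nlinarith [sq_nonneg (L.coord i x).im, sq_nonneg ‖L.coord i.rev x‖]
  · rw [← norm_eq_zero]
    nlinarith [sq_nonneg (L.coord i x).im, sq_nonneg ‖L.coord i.rev x‖]

variable {i} in
theorem stereo_norm_sq {x : S3} (h : 0 < 1 + (L.coord i x).re) :
    ((L.stereo i x).1 ^ 2 + ‖(L.stereo i x).2‖ ^ 2) * (1 + (L.coord i x).re) =
      1 - (L.coord i x).re := by
  have h1 := L.coord_re_im (i := i) x
  simp only [stereo]
  rw [norm_div, Complex.norm_real, Real.norm_eq_abs, abs_of_pos h]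
  field_simp
  linarith

variable {i} in
theorem stereo_injective {x y : S3} (hx : 0 < 1 + (L.coord i x).re)
    (hy : 0 < 1 + (L.coord i y).re) (h : L.stereo i x = L.stereo i y) : x = y := by
  have h1 := L.stereo_norm_sq hx
  have h2 := L.stereo_norm_sq hy
  rw [h] at h1
  have h3 : (L.coord i x).re = (L.coord i y).re := by
    have : 0 ≤ (L.stereo i y).1 ^ 2 + ‖(L.stereo i y).2‖ ^ 2 := by positivity
    nlinarith
  have h4 := congrArg Prod.fst h
  have h5 := congrArg Prod.snd h
  simp only [stereo, h3] at h4 h5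
  have h6 : ((1 + (L.coord i y).re : ℝ) : ℂ) ≠ 0 := by exact_mod_cast hy.ne'
  exact L.eq_of_coord i (Complex.ext h3 ((div_left_inj' hy.ne').1 h4)) ((div_left_inj' h6).1 h5)

variable {i} in
theorem continuousAt_stereo {x : S3} (h : 0 < 1 + (L.coord i x).re) :
    ContinuousAt (L.stereo i) x := by
  have h1 := (L.continuous_coord i).continuousAt (x := x)
  have h2 := (L.continuous_coord i.rev).continuousAt (x := x)
  have h3 := Complex.continuous_re.continuousAt.comp h1
  have h4 := Complex.continuous_im.continuousAt.comp h1
  have h5 : ContinuousAt (fun x => 1 + (L.coord i x).re) x := continuousAt_const.add h3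
  refine (h4.div h5 h.ne').prodMk (h2.div (Complex.continuous_ofReal.continuousAt.comp h5) ?_)
  exact_mod_cast h.ne'

variable {i} in
theorem one_add_re_pos_of_mem {x : S3} (h : x ∈ (L.knot i).exterior) :
    0 < 1 + (L.coord i x).re := by
  by_contra h0
  obtain ⟨h1, h2⟩ := L.coord_eq_neg_one (not_lt.1 h0)
  have := (L.mem_knot_exterior_iff (by rw [h1]; norm_num)).1 h
  rw [h2, norm_zero] at this
  norm_num at this

variable {i} in
/-- The part of the vertical axis outside the knotted ball is disjoint from the exterior. -/
theorem stereo_ne_of_snd_eq_zero {x : S3} (h : x ∈ (L.knot i).exterior)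
    (h0 : (L.stereo i x).2 = 0) : (L.stereo i x).1 ^ 2 < 1 := by
  have hp := L.one_add_re_pos_of_mem h
  have h1 := L.stereo_norm_sq hp
  rw [h0, norm_zero] at h1
  by_contra h2
  have h3 : (L.coord i x).re ≤ 4 / 5 := by nlinarith
  have h4 := (L.mem_knot_exterior_iff h3).1 h
  have h5 : L.coord i.rev x = 0 := by
    have h6 : ((1 + (L.coord i x).re : ℝ) : ℂ) ≠ 0 := by exact_mod_cast hp.ne'
    exact (div_eq_zero_iff.1 h0).resolve_right h6
  rw [h5, norm_zero] at h4
  norm_num at h4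

/-- The arc of the component `i` outside the pole of the stereographic projection, cut off at the
heights `±1`. -/
theorem exists_arc : ∃ c : C(I, ℝ × ℂ), c 0 = (-1, 0) ∧ c 1 = (1, 0) ∧ (∀ t, -1 ≤ (c t).1) ∧
    ∀ t, ∀ x ∈ (L.knot i).exterior, c t ≠ L.stereo i x := by
  let K := L.knot i
  have hpt (z : ℂ) (hz : ‖z‖ = 1) (hre : z.re ≤ 4 / 5) : ∃ k : Circle,
      L.coord i (K.param (k, 0)) = z ∧ L.coord i.rev (K.param (k, 0)) = 0 := by
    let y : S3 := L.h.symm (spherePoint i z 0 (Or.inl (by rw [← norm_ne_zero_iff, hz]; simp)))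
    have hy1 : L.coord i y = z := by
      rw [coord_symm, spherePoint_self]
      simp [hz]
    have hy2 : L.coord i.rev y = 0 := by
      rw [coord_symm, spherePoint_rev]
      simp [hz]
    obtain ⟨⟨k, w⟩, hw, hk⟩ := (L.mem_core_iff_coord (by rw [hy1]; exact hre)).2 hy2
    obtain rfl : w = 0 := hw
    refine ⟨k, ?_, ?_⟩
    · exact (congrArg _ hk).trans hy1
    · exact (congrArg _ hk).trans hy2
  -- the parameters of the pole `-1` and of the points `-I`, `I`, which go to the heights `-1`, `1`
  obtain ⟨k₀, h₀, h₀'⟩ := hpt (-1) (by simp) (by norm_num)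
  obtain ⟨k₁, h₁, h₁'⟩ := hpt (-Complex.I) (by simp) (by norm_num)
  obtain ⟨k₂, h₂, h₂'⟩ := hpt Complex.I (by simp) (by norm_num)
  have hne₁ : k₁ ∈ ({k₀}ᶜ : Set Circle) := by
    rintro rfl
    rw [h₀] at h₁
    simpa using congrArg Complex.re h₁
  have hne₂ : k₂ ∈ ({k₀}ᶜ : Set Circle) := by
    rintro rfl
    rw [h₀] at h₂
    simpa using congrArg Complex.re h₂
  obtain ⟨p, hp⟩ := (Circle.isPathConnected_compl_singleton k₀).joinedIn k₁ hne₁ k₂ hne₂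
  have hpos (t : I) : 0 < 1 + (L.coord i (K.param (p t, 0))).re := by
    by_contra hle
    obtain ⟨e1, e2⟩ := L.coord_eq_neg_one (not_lt.1 hle)
    have := K.isOpenEmbedding.injective (L.eq_of_coord i (e1.trans h₀.symm) (e2.trans h₀'.symm))
    exact hp t (congrArg Prod.fst this)
  let s (t : I) : ℝ × ℂ := L.stereo i (K.param (p t, 0))
  have hs : Continuous s := by
    rw [continuous_iff_continuousAt]
    intro t
    have hc : Continuous fun t => K.param (p t, 0) :=
      K.isOpenEmbedding.continuous.comp (by fun_prop)
    exact (L.continuousAt_stereo (hpos t)).comp (f := fun t => K.param (p t, 0)) hc.continuousAt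
  -- Outside the heights between `-1` and `1` the knot is standard and lies on the vertical axis.
  -- Cutting off moves these points to `(±1, 0)`, which do not come from the exterior.
  refine ⟨⟨fun t => (max (-1) (min 1 (s t).1), (s t).2), by fun_prop⟩, ?_, ?_, ?_, ?_⟩
  · simp [s, stereo, h₁, h₁']
  · simp [s, stereo, h₂, h₂']
  · exact fun t => le_max_left _ _
  · intro t x hx h
    replace h : (max (-1) (min 1 (s t).1), (s t).2) = L.stereo i x := h
    have e1 : max (-1) (min 1 (s t).1) = (L.stereo i x).1 := congrArg Prod.fst h
    have e2 : (s t).2 = (L.stereo i x).2 := (congrArg Prod.snd h :)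
    by_cases hle : (s t).1 ^ 2 ≤ 1
    · have h3 := abs_le.1 ((sq_le_one_iff_abs_le_one _).1 hle)
      rw [min_eq_right h3.2, max_eq_right h3.1] at e1
      have h4 := L.stereo_injective (hpos t) (L.one_add_re_pos_of_mem hx) (Prod.ext e1 e2)
      rw [← h4] at hx
      have := K.param_mem_exterior.1 hx
      norm_num at this
    · have h3 := L.stereo_norm_sq (hpos t)
      have hre : (L.coord i (K.param (p t, 0))).re ≤ 4 / 5 := by
        have h4 : 1 < (L.stereo i (K.param (p t, 0))).1 ^ 2 := not_le.1 hle
        nlinarith [sq_nonneg ‖(L.stereo i (K.param (p t, 0))).2‖, hpos t]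
      have h5 := (L.mem_core_iff_coord hre).1 (K.param_mem_core.2 rfl)
      have h6 : (s t).2 = 0 := by simp [s, stereo, h5]
      have h7 := L.stereo_ne_of_snd_eq_zero hx (e2.symm.trans h6)
      rw [← e1] at h7
      rcases lt_or_ge 1 (s t).1 with h8 | h8
      · rw [min_eq_left h8.le] at h7
        norm_num at h7
      · have h9 : (s t).1 ≤ -1 := by nlinarith
        rw [min_eq_right h8, max_eq_left h9] at h7
        norm_num at h7

/-- The linking number with the component `i`. -/
theorem exists_linking_cocycle : ∃ v : C(I, (L.knot i).exterior) → Multiplicative ℤ,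
    IsCocycleOn Set.univ v ∧ v (L.knotMeridianPath i) = Multiplicative.ofAdd 1 := by
  obtain ⟨c, hc0, hc1, hcl, hcx⟩ := L.exists_arc i
  have : CompactSpace (L.knot i).exterior := isCompact_iff_compactSpace.1
    ((L.knot i).isOpen_openTube 1).isClosed_compl.isCompact
  let f : C((L.knot i).exterior, ℝ × ℂ) := ⟨fun x => L.stereo i x, by
    rw [continuous_iff_continuousAt]
    exact fun x => (L.continuousAt_stereo (L.one_add_re_pos_of_mem x.2)).comp
      continuous_subtype_val.continuousAt⟩
  obtain ⟨g, hg, hg1⟩ := exists_linking_function f c (fun t x => hcx t x x.2) (by rw [hc0])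
    (fun x hx => by
      have := L.stereo_ne_of_snd_eq_zero x.2 hx
      rw [hc0]
      change (-1 : ℝ) < (L.stereo i x).1
      nlinarith)
    (fun x hx => by
      rw [hc1] at hx ⊢
      have := L.stereo_ne_of_snd_eq_zero x.2 hx
      change (L.stereo i x).1 < 1
      nlinarith)
  let v : C(I, (L.knot i).exterior) → Multiplicative ℤ := fun p =>
    Multiplicative.ofAdd (windingNumber (g.comp p))
  have hv : IsCocycleOn Set.univ v := by
    convert isCocycleOn_windingNumber.comap g
    ext x
    simpa using hg x
  refine ⟨v, hv, ?_⟩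
  -- The meridian slides along the standard part of the component, by a rotation of `xᵢ` to the
  -- argument `π + arcsin (3/5)`. There `xᵢ = (-16 - 12 i) / 25`, and the stereographic projection
  -- is the circle of radius `5/3` at the height `-4/3`, below the arc.
  let ψ (s : ℝ) : ℝ := s * (Real.pi + Real.arcsin (3 / 5))
  have hn (s t : ℝ) : ‖(4 / 5 : ℂ) * Complex.exp ((s : ℂ) * Complex.I)‖ ^ 2 +
      ‖(3 / 5 : ℂ) * Complex.exp ((2 * Real.pi * t : ℝ) * Complex.I)‖ ^ 2 = 1 := by
    rw [norm_mul, norm_mul, Complex.norm_exp_ofReal_mul_I, Complex.norm_exp_ofReal_mul_I]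
    norm_num
  let P (z : I × I) : S3 := L.h.symm (spherePoint i
    ((4 / 5 : ℂ) * Complex.exp ((ψ z.1 : ℂ) * Complex.I))
    ((3 / 5 : ℂ) * Complex.exp ((2 * Real.pi * z.2 : ℝ) * Complex.I))
    (Or.inl (mul_ne_zero (by norm_num) (Complex.exp_ne_zero _))))
  have hP1 (z : I × I) : L.coord i (P z) = (4 / 5 : ℂ) * Complex.exp ((ψ z.1 : ℂ) * Complex.I) := by
    rw [coord_symm, spherePoint_self (hn _ _)]
  have hP2 (z : I × I) : L.coord i.rev (P z) =
      (3 / 5 : ℂ) * Complex.exp ((2 * Real.pi * z.2 : ℝ) * Complex.I) := by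
    rw [coord_symm, spherePoint_rev (hn _ _)]
  have hPm (z : I × I) : P z ∈ (L.knot i).exterior := by
    rw [L.mem_knot_exterior_iff, hP2, norm_mul, Complex.norm_exp_ofReal_mul_I]
    · norm_num
    · rw [hP1]
      refine (Complex.re_le_norm _).trans ?_
      rw [norm_mul, Complex.norm_exp_ofReal_mul_I]
      norm_num
  have hPc : Continuous P := L.h.symm.continuous.comp (continuous_spherePoint i
    (by fun_prop) (by fun_prop) _)
  let H : C(I × I, (L.knot i).exterior) := ⟨fun z => ⟨P z, hPm z⟩, hPc.subtype_mk _⟩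
  have h1 := hv.of_free_homotopy H (fun _ => trivial) (fun s => by
    refine Subtype.ext (L.eq_of_coord i ((hP1 (s, 0)).trans (hP1 (s, 1)).symm) ?_)
    refine (hP2 (s, 0)).trans (Eq.trans ?_ (hP2 (s, 1)).symm)
    simp [Complex.exp_two_pi_mul_I]) (p := L.knotMeridianPath i)
    (q := H.comp ⟨fun t => (1, t), by fun_prop⟩) (fun t => by
      refine Subtype.ext (L.eq_of_coord i ((hP1 _).trans ?_) ((hP2 _).trans ?_))
      · refine Eq.trans ?_ (L.coord_meridianPath i t).symm
        simp [ψ]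
      · exact (L.coord_rev_meridianPath i t).symm) (fun t => rfl)
  rw [h1]
  refine congrArg Multiplicative.ofAdd (hg1 (H.comp ⟨fun t => (1, t), by fun_prop⟩) (5 / 3) (-4 / 3) (by norm_num)
    (fun t => lt_of_lt_of_le (by norm_num) (hcl t)) fun t => ?_)
  have hψ : Complex.exp ((ψ 1 : ℂ) * Complex.I) = ⟨-4 / 5, -3 / 5⟩ := by
    rw [Complex.exp_mul_I, ← Complex.ofReal_cos, ← Complex.ofReal_sin]
    have hcos : Real.cos (ψ 1) = -4 / 5 := by
      simp only [ψ, one_mul]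
      rw [add_comm, Real.cos_add_pi, Real.cos_arcsin]
      rw [show (1 - (3 / 5 : ℝ) ^ 2) = (4 / 5) ^ 2 by norm_num, Real.sqrt_sq (by norm_num)]
      norm_num
    have hsin : Real.sin (ψ 1) = -3 / 5 := by
      simp only [ψ, one_mul]
      rw [add_comm, Real.sin_add_pi, Real.sin_arcsin (by norm_num) (by norm_num)]
      norm_num
    rw [hcos, hsin]
    apply Complex.ext <;> simp
  have hP1' : L.coord i (P (1, t)) = ⟨-16 / 25, -12 / 25⟩ := by
    rw [hP1]
    change (4 / 5 : ℂ) * Complex.exp ((ψ 1 : ℂ) * Complex.I) = _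
    rw [hψ]
    apply Complex.ext <;> simp <;> norm_num
  change L.stereo i (P (1, t)) = _
  rw [stereo, hP1', hP2]
  ext1
  · norm_num
  · push_cast
    ring

end HopfLikeLink

/-! ### The middle region -/

namespace HopfLikeLink

variable (L : HopfLikeLink)

/-- The largest possible norm of a coordinate with the argument `a` in the middle region. -/
def maxRadius (a : ℝ) : ℝ := 4 / 5 / max (Real.cos a) (4 / 5 / √(3 / 4))

theorem four_fifths_le_sqrt : 4 / 5 ≤ √(3 / 4 : ℝ) := Real.le_sqrt_of_sq_le (by norm_num)

theorem maxCos_pos (a : ℝ) : 0 < max (Real.cos a) (4 / 5 / √(3 / 4)) :=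
  lt_max_of_lt_right (by have := four_fifths_le_sqrt; positivity)

/-- The bound `√(3/4)` comes from the norm of the other coordinate, which is at least `1/2` outside
the standard tube, and the bound `4/5` on the real part from the ball. -/
theorem le_maxRadius_iff {a ρ : ℝ} (hρ : 0 ≤ ρ) :
    ρ ≤ maxRadius a ↔ ρ ^ 2 ≤ 3 / 4 ∧ ρ * Real.cos a ≤ 4 / 5 := by
  have h := four_fifths_le_sqrt
  rw [maxRadius, le_div_iff₀ (maxCos_pos a), mul_max_of_nonneg _ _ hρ, max_le_iff, and_comm,
    ← mul_div_assoc, div_le_iff₀ (by linarith)]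
  refine and_congr ⟨fun h1 => ?_, fun h1 => ?_⟩ Iff.rfl
  · have h2 : ρ ≤ √(3 / 4) := by linarith
    have := Real.sq_sqrt (by norm_num : (0 : ℝ) ≤ 3 / 4)
    nlinarith
  · have := Real.le_sqrt_of_sq_le h1
    linarith

theorem maxRadius_nonneg (a : ℝ) : 0 ≤ maxRadius a :=
  div_nonneg (by norm_num) (maxCos_pos a).le

theorem maxRadius_sq_le (a : ℝ) : maxRadius a ^ 2 ≤ 3 / 4 :=
  ((le_maxRadius_iff (maxRadius_nonneg a)).1 le_rfl).1

theorem four_fifths_le_maxRadius (a : ℝ) : 4 / 5 ≤ maxRadius a :=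
  (le_maxRadius_iff (by norm_num)).2 ⟨by norm_num, by linarith [Real.cos_le_one a]⟩

theorem continuous_maxRadius : Continuous maxRadius := by
  unfold maxRadius
  exact continuous_const.div (by fun_prop) fun a => (maxCos_pos a).ne'

/-- The norm of the coordinate `0` in the middle region, cut off at its possible values. -/
def middleRadius (e : ℝ × ℝ × ℝ) : ℝ :=
  max √(1 - maxRadius e.2.2 ^ 2) (min (maxRadius e.2.1) e.1)

theorem continuous_middleRadius : Continuous middleRadius := by
  unfold middleRadius
  have := continuous_maxRadius
  fun_prop

theorem sqrt_one_sub_maxRadius_le (b : ℝ) : √(1 - maxRadius b ^ 2) ≤ 3 / 5 := by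
  refine Real.sqrt_le_iff.2 ⟨by norm_num, ?_⟩
  nlinarith [four_fifths_le_maxRadius b]

theorem middleRadius_le (e : ℝ × ℝ × ℝ) : middleRadius e ≤ maxRadius e.2.1 :=
  max_le (by linarith [sqrt_one_sub_maxRadius_le e.2.2, four_fifths_le_maxRadius e.2.1])
    (min_le_left _ _)

theorem middleRadius_nonneg (e : ℝ × ℝ × ℝ) : 0 ≤ middleRadius e :=
  le_max_of_le_left (Real.sqrt_nonneg _)

theorem middleRadius_sq_le (e : ℝ × ℝ × ℝ) : middleRadius e ^ 2 ≤ 3 / 4 :=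
  ((le_maxRadius_iff (middleRadius_nonneg e)).1 (middleRadius_le e)).1

theorem sqrt_one_sub_middleRadius_le (e : ℝ × ℝ × ℝ) :
    √(1 - middleRadius e ^ 2) ≤ maxRadius e.2.2 := by
  refine Real.sqrt_le_iff.2 ⟨maxRadius_nonneg _, ?_⟩
  have h1 : √(1 - maxRadius e.2.2 ^ 2) ≤ middleRadius e := le_max_left _ _
  have h2 := Real.sq_sqrt (show 0 ≤ 1 - maxRadius e.2.2 ^ 2 by linarith [maxRadius_sq_le e.2.2])
  nlinarith [Real.sqrt_nonneg (1 - maxRadius e.2.2 ^ 2)]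

theorem middleRadius_eq_self {s a b : ℝ} (h : s ≤ maxRadius a) (h' : √(1 - maxRadius b ^ 2) ≤ s) :
    middleRadius (s, a, b) = s := by
  simp only [middleRadius]
  rw [min_eq_right h, max_eq_right h']

/-- The open unit disc. -/
def openDisc : Set ℂ := {z | ‖z‖ < 1}

theorem norm_ofReal_mul_exp {r : ℝ} (hr : 0 ≤ r) (a : ℝ) :
    ‖(r : ℂ) * Complex.exp ((a : ℂ) * Complex.I)‖ = r := by
  rw [norm_mul, Complex.norm_exp_ofReal_mul_I, mul_one, Complex.norm_real, Real.norm_eq_abs,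
    abs_of_nonneg hr]

theorem re_ofReal_mul_exp (r a : ℝ) :
    ((r : ℂ) * Complex.exp ((a : ℂ) * Complex.I)).re = r * Real.cos a := by
  rw [Complex.re_ofReal_mul, Complex.exp_ofReal_mul_I_re]

/-- The point of the sphere with `‖x₀‖ = r` and the arguments `a`, `b`. -/
def torusPoint (e : ℝ × ℝ × ℝ) : S3 :=
  discPoint 0 openDisc (fun _ h => h)
    (e.2.2, ⟨(middleRadius e : ℂ) * Complex.exp ((e.2.1 : ℂ) * Complex.I), by
      rw [openDisc, Set.mem_ofPred_eq, norm_ofReal_mul_exp (middleRadius_nonneg e)]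
      nlinarith [middleRadius_sq_le e, middleRadius_nonneg e]⟩)

theorem continuous_torusPoint : Continuous torusPoint := by
  refine (continuous_discPoint 0 openDisc fun _ h => h).comp ?_
  have := continuous_middleRadius
  fun_prop

theorem torusPoint_zero (e : ℝ × ℝ × ℝ) : (torusPoint e).1 0 =
    (middleRadius e : ℂ) * Complex.exp ((e.2.1 : ℂ) * Complex.I) :=
  discPoint_self _

theorem torusPoint_one (e : ℝ × ℝ × ℝ) : (torusPoint e).1 1 =
    (√(1 - middleRadius e ^ 2) : ℂ) * Complex.exp ((e.2.2 : ℂ) * Complex.I) := by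
  refine (discPoint_rev (i := 0) (D := openDisc) _).trans ?_
  simp only [norm_ofReal_mul_exp (middleRadius_nonneg e)]

theorem torusPoint_mem (e : ℝ × ℝ × ℝ) : (∀ i, (L.coord i (L.h.symm (torusPoint e))).re ≤ 4 / 5) ∧
    ∀ i, 1 / 2 ≤ ‖L.coord i (L.h.symm (torusPoint e))‖ := by
  have h1 := (le_maxRadius_iff (middleRadius_nonneg e)).1 (middleRadius_le e)
  have h2 := (le_maxRadius_iff (Real.sqrt_nonneg _)).1 (sqrt_one_sub_middleRadius_le e)
  have h3 := Real.sq_sqrt (show 0 ≤ 1 - middleRadius e ^ 2 by linarith [h1.1])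
  constructor <;> intro i <;> fin_cases i <;> simp only [Fin.zero_eta, Fin.mk_one] <;>
    rw [coord_symm]
  · rw [torusPoint_zero, re_ofReal_mul_exp]
    exact h1.2
  · rw [torusPoint_one, re_ofReal_mul_exp]
    exact h2.2
  · rw [torusPoint_zero, norm_ofReal_mul_exp (middleRadius_nonneg e)]
    nlinarith [middleRadius_nonneg e]
  · rw [torusPoint_one, norm_ofReal_mul_exp (Real.sqrt_nonneg _)]
    nlinarith [Real.sqrt_nonneg (1 - middleRadius e ^ 2)]

/-- The universal cover of the middle region. -/
def middleMap : C(ℝ × ℝ × ℝ, L.exterior) :=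
  ⟨fun e => ⟨L.h.symm (torusPoint e),
    L.mem_exterior_of_norm (L.torusPoint_mem e).1 (L.torusPoint_mem e).2⟩,
    (L.h.symm.continuous.comp continuous_torusPoint).subtype_mk _⟩

theorem middleMap_mem (e : ℝ × ℝ × ℝ) : L.middleMap e ∈ L.middleRegion := (L.torusPoint_mem e).1

theorem middleMap_ext {x : L.exterior} {e : ℝ × ℝ × ℝ}
    (h₀ : L.coord 0 x = (middleRadius e : ℂ) * Complex.exp ((e.2.1 : ℂ) * Complex.I))
    (h₁ : L.coord 1 x = (√(1 - middleRadius e ^ 2) : ℂ) * Complex.exp ((e.2.2 : ℂ) * Complex.I)) :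
    L.middleMap e = x := by
  refine Subtype.ext (L.eq_of_coord 0 ?_ ?_)
  · refine Eq.trans ?_ h₀.symm
    exact (L.coord_symm 0 _).trans (torusPoint_zero e)
  · refine Eq.trans ?_ h₁.symm
    exact (L.coord_symm 1 _).trans (torusPoint_one e)

theorem coord_middleMap_zero (e : ℝ × ℝ × ℝ) : L.coord 0 (L.middleMap e) =
    (middleRadius e : ℂ) * Complex.exp ((e.2.1 : ℂ) * Complex.I) :=
  (L.coord_symm 0 _).trans (torusPoint_zero e)

theorem coord_middleMap_one (e : ℝ × ℝ × ℝ) : L.coord 1 (L.middleMap e) =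
    (√(1 - middleRadius e ^ 2) : ℂ) * Complex.exp ((e.2.2 : ℂ) * Complex.I) :=
  (L.coord_symm 1 _).trans (torusPoint_one e)

/-- Paths in the middle region lift to its cover, by their radius and their two arguments. -/
theorem exists_middleMap_lift (γ : C(I, L.exterior)) (hγ : ∀ t, γ t ∈ L.middleRegion) :
    ∃ γ' : C(I, ℝ × ℝ × ℝ), L.middleMap.comp γ' = γ := by
  have hn (t : I) (i : Fin 2) : 1 / 2 ≤ ‖L.coord i (γ t)‖ := by
    have := L.half_le_norm_coord (hγ t i.rev)
    rwa [Fin.rev_rev] at this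
  have hne (t : I) (i : Fin 2) : L.coord i (γ t) ≠ 0 := fun h => by
    have := hn t i
    rw [h, norm_zero] at this
    norm_num at this
  have hc (i : Fin 2) := (L.continuous_coord_exterior i).comp γ.continuous
  obtain ⟨a, ha⟩ := exists_angle ⟨fun t => L.coord 0 (γ t), hc 0⟩ fun t => hne t 0
  obtain ⟨b, hb⟩ := exists_angle ⟨fun t => L.coord 1 (γ t), hc 1⟩ fun t => hne t 1
  have ha' (t) : L.coord 0 (γ t) = (‖L.coord 0 (γ t)‖ : ℂ) * Complex.exp ((a t : ℂ) * Complex.I) :=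
    ha t
  have hb' (t) : L.coord 1 (γ t) = (‖L.coord 1 (γ t)‖ : ℂ) * Complex.exp ((b t : ℂ) * Complex.I) :=
    hb t
  have hs := (hc 0).norm
  refine ⟨⟨fun t => (‖L.coord 0 (γ t)‖, a t, b t), by
    have h : Continuous fun t => ‖L.coord 0 (γ t)‖ := hs
    fun_prop⟩, ?_⟩
  ext1 t
  have hsq : ‖L.coord 0 (γ t)‖ ^ 2 + ‖L.coord 1 (γ t)‖ ^ 2 = 1 := L.coord_norm_sq 0 (γ t)
  have h0 : ‖L.coord 0 (γ t)‖ ≤ maxRadius (a t) := by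
    rw [le_maxRadius_iff (norm_nonneg _), ← re_ofReal_mul_exp, ← ha']
    exact ⟨by nlinarith [hn t 1], hγ t 0⟩
  have h1 : ‖L.coord 1 (γ t)‖ ≤ maxRadius (b t) := by
    rw [le_maxRadius_iff (norm_nonneg _), ← re_ofReal_mul_exp, ← hb']
    exact ⟨by nlinarith [hn t 0], hγ t 1⟩
  have hr : middleRadius (‖L.coord 0 (γ t)‖, a t, b t) = ‖L.coord 0 (γ t)‖ := by
    refine middleRadius_eq_self h0 (Real.sqrt_le_iff.2 ⟨norm_nonneg _, ?_⟩)
    nlinarith [norm_nonneg (L.coord 1 (γ t))]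
  refine L.middleMap_ext ?_ ?_
  · change _ = ((middleRadius (‖L.coord 0 (γ t)‖, a t, b t) : ℝ) : ℂ) * _
    rw [hr]
    exact ha' t
  · change _ = ((√(1 - middleRadius (‖L.coord 0 (γ t)‖, a t, b t) ^ 2) : ℝ) : ℂ) * _
    rw [hr, eq_sub_of_add_eq' hsq |>.symm, Real.sqrt_sq (norm_nonneg _)]
    exact hb' t

theorem middleMap_translate (s a b : ℝ) :
    L.middleMap (s, a + 2 * Real.pi, b) = L.middleMap (s, a, b) ∧
      L.middleMap (s, a, b + 2 * Real.pi) = L.middleMap (s, a, b) := by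
  have hm (a : ℝ) : maxRadius (a + 2 * Real.pi) = maxRadius a := by
    rw [maxRadius, Real.cos_add_two_pi, maxRadius]
  have he (a : ℝ) : Complex.exp (((a + 2 * Real.pi : ℝ) : ℂ) * Complex.I) =
      Complex.exp ((a : ℂ) * Complex.I) := by
    push_cast
    rw [add_mul, Complex.exp_add, Complex.exp_two_pi_mul_I, mul_one]
  constructor <;> refine L.middleMap_ext ?_ ?_ <;>
    simp only [coord_middleMap_zero, coord_middleMap_one, middleRadius, hm, he]

/-- The fibres of `middleMap` are generated by the translations by `2π` and by the segments on which
the cut-off radius is constant. -/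
theorem eqvGen_of_middleMap_eq (T : Set C(ℝ × ℝ × ℝ, ℝ × ℝ × ℝ))
    (hT₁ : ⟨fun e => (e.1, e.2.1 + 2 * Real.pi, e.2.2), by fun_prop⟩ ∈ T)
    (hT₂ : ⟨fun e => (e.1, e.2.1, e.2.2 + 2 * Real.pi), by fun_prop⟩ ∈ T) (e e' : ℝ × ℝ × ℝ)
    (h : L.middleMap e = L.middleMap e') :
    Relation.EqvGen (fun a b => (∃ τ ∈ T, b = τ a) ∨
      ∃ p : Path a b, ∀ t, L.middleMap (p t) = L.middleMap a) e e' := by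
  obtain ⟨s, a, b⟩ := e
  obtain ⟨s', a', b'⟩ := e'
  have h0 := congrArg (fun x : L.exterior => L.coord 0 x) h
  have h1 := congrArg (fun x : L.exterior => L.coord 1 x) h
  simp only [coord_middleMap_zero, coord_middleMap_one] at h0 h1
  have hr : middleRadius (s, a, b) = middleRadius (s', a', b') := by
    have := congrArg norm h0
    rwa [norm_ofReal_mul_exp (middleRadius_nonneg _),
      norm_ofReal_mul_exp (middleRadius_nonneg _)] at this
  have hne (i : Fin 2) : ‖L.coord i (L.middleMap (s', a', b'))‖ ≠ 0 := by
    have := (L.torusPoint_mem (s', a', b')).2 i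
    intro h
    have h' : ‖L.coord i (L.h.symm (torusPoint (s', a', b')))‖ = 0 := h
    linarith
  have hne0 := hne 0
  have hne1 := hne 1
  rw [coord_middleMap_zero, norm_ofReal_mul_exp (middleRadius_nonneg _)] at hne0
  rw [coord_middleMap_one, norm_ofReal_mul_exp (Real.sqrt_nonneg _)] at hne1
  rw [hr] at h0 h1
  obtain ⟨n, rfl⟩ := exp_mul_I_eq (mul_left_cancel₀ (by exact_mod_cast hne0) h0)
  obtain ⟨m, rfl⟩ := exp_mul_I_eq (mul_left_cancel₀ (by exact_mod_cast hne1) h1)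
  refine ((eqvGen_int_translate (fun a => ((s, a, b) : ℝ × ℝ × ℝ))
    (fun a => Or.inl ⟨_, hT₁, rfl⟩) a n).trans _ _ _ (eqvGen_int_translate
      (fun b => ((s, _, b) : ℝ × ℝ × ℝ)) (fun b => Or.inl ⟨_, hT₂, rfl⟩) b m)).trans _ _ _ ?_
  refine Relation.EqvGen.rel _ _ (Or.inr ?_)
  set a' := a + n * (2 * Real.pi)
  set b' := b + m * (2 * Real.pi)
  have hm (n : ℤ) (a : ℝ) : maxRadius (a + n * (2 * Real.pi)) = maxRadius a := by
    rw [maxRadius, Real.cos_add_int_mul_two_pi, maxRadius]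
  have hr' : middleRadius (s, a', b') = middleRadius (s', a', b') := by
    rw [← hr]
    simp only [middleRadius, a', b', hm]
  refine ⟨⟨⟨fun t => ((1 - (t : ℝ)) * s + t * s', a', b'), by fun_prop⟩, by simp, by simp⟩,
    fun t => ?_⟩
  -- the cut-off radius is monotone in `s`, so it is constant between two equal values
  have hmono : Monotone fun s => middleRadius (s, a', b') := fun s s' hs =>
    max_le_max le_rfl (min_le_min le_rfl hs)
  have hconst : middleRadius ((1 - (t : ℝ)) * s + t * s', a', b') = middleRadius (s, a', b') := by
    have h1 : min s s' ≤ (1 - (t : ℝ)) * s + t * s' :=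
      (convex_Ici (min s s')) (min_le_left s s') (min_le_right s s') (sub_nonneg.2 t.2.2) t.2.1
        (by ring)
    have h2 : (1 - (t : ℝ)) * s + t * s' ≤ max s s' :=
      (convex_Iic (max s s')) (le_max_left s s') (le_max_right s s') (sub_nonneg.2 t.2.2) t.2.1
        (by ring)
    have h3 := hmono h1
    have h4 := hmono h2
    have h5 : middleRadius (min s s', a', b') = middleRadius (s, a', b') := by
      rcases min_choice s s' with h | h <;> rw [h]
      exact hr'.symm
    have h6 : middleRadius (max s s', a', b') = middleRadius (s, a', b') := by
      rcases max_choice s s' with h | h <;> rw [h]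
      exact hr'.symm
    exact le_antisymm (h4.trans h6.le) (h5.ge.trans h3)
  refine L.middleMap_ext ?_ ?_
  · rw [coord_middleMap_zero]
    change _ = ((middleRadius ((1 - (t : ℝ)) * s + t * s', a', b') : ℝ) : ℂ) * _
    rw [hconst]
    rfl
  · rw [coord_middleMap_one]
    change _ = ((√(1 - middleRadius ((1 - (t : ℝ)) * s + t * s', a', b') ^ 2) : ℝ) : ℂ) * _
    rw [hconst]
    rfl

/-! #### The two meridians in the middle region -/

theorem middleRadius_of_mem {s a b : ℝ} (h : 3 / 5 ≤ s) (h' : s ≤ 4 / 5) :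
    middleRadius (s, a, b) = s :=
  middleRadius_eq_self (h'.trans (four_fifths_le_maxRadius a))
    ((sqrt_one_sub_maxRadius_le b).trans h)

theorem middleMap_meridian_zero (t : I) :
    L.middleMap (4 / 5, 0, 2 * Real.pi * t) = L.meridianPath 0 t := by
  refine L.middleMap_ext ?_ ?_
  · rw [L.coord_meridianPath, middleRadius_of_mem (by norm_num) le_rfl]
    simp
  · refine (L.coord_rev_meridianPath 0 t).trans ?_
    rw [middleRadius_of_mem (by norm_num) le_rfl]
    congr 1
    rw [show (1 - (4 / 5 : ℝ) ^ 2) = (3 / 5) ^ 2 by norm_num, Real.sqrt_sq (by norm_num)]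
    norm_num

theorem middleMap_meridian_one (t : I) :
    L.middleMap (3 / 5, 2 * Real.pi * t, 0) = L.meridianPath 1 t := by
  refine L.middleMap_ext ?_ ?_
  · refine (L.coord_rev_meridianPath 1 t).trans ?_
    rw [middleRadius_of_mem le_rfl (by norm_num)]
    push_cast
    rfl
  · rw [L.coord_meridianPath, middleRadius_of_mem le_rfl (by norm_num)]
    rw [show (1 - (3 / 5 : ℝ) ^ 2) = (4 / 5) ^ 2 by norm_num, Real.sqrt_sq (by norm_num)]
    simp

theorem middleMap_base_zero : L.middleMap (4 / 5, 0, 0) = L.pieceToExterior 0 (L.basePoint 0) := by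
  have := L.middleMap_meridian_zero 0
  rw [(L.meridianPath 0).source] at this
  rw [← this]
  simp

theorem middleMap_base_one : L.middleMap (3 / 5, 0, 0) = L.pieceToExterior 1 (L.basePoint 1) := by
  have := L.middleMap_meridian_one 0
  rw [(L.meridianPath 1).source] at this
  rw [← this]
  simp

/-- The path in the cover of the middle region between the two base points, over the arguments
`a`, `0`. -/
def bridgeLift (a : ℝ) : Path ((4 / 5, a, 0) : ℝ × ℝ × ℝ) (3 / 5, a, 0) :=
  ⟨⟨fun t => (4 / 5 - t / 5, a, 0), by fun_prop⟩, by simp, by simp; norm_num⟩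

/-- The path in the middle region between the two base points. -/
def bridge : Path (L.pieceToExterior 0 (L.basePoint 0)) (L.pieceToExterior 1 (L.basePoint 1)) :=
  ((bridgeLift 0).map L.middleMap.continuous).cast L.middleMap_base_zero.symm
    L.middleMap_base_one.symm

theorem bridge_mem (t : I) : L.bridge t ∈ L.middleRegion := L.middleMap_mem _

/-- The path in the cover of the middle region that turns the argument of the coordinate `1` once. -/
def secondLift (s a : ℝ) : Path ((s, a, 0) : ℝ × ℝ × ℝ) (s, a, 2 * Real.pi) :=
  ⟨⟨fun t => (s, a, 2 * Real.pi * t), by fun_prop⟩, by simp, by simp⟩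

/-- The path in the cover of the middle region that turns the argument of the coordinate `0` once, at
the radius `3/5` of the meridian of the component `1`. -/
def firstLift (b : ℝ) : Path ((3 / 5, 0, b) : ℝ × ℝ × ℝ) (3 / 5, 2 * Real.pi, b) :=
  ⟨⟨fun t => (3 / 5, 2 * Real.pi * t, b), by fun_prop⟩, by simp, by simp⟩

theorem middleMap_comp_secondLift {a : ℝ}
    (h : ∀ b, L.middleMap (4 / 5, a, b) = L.middleMap (4 / 5, 0, b)) :
    L.middleMap.comp (secondLift (4 / 5) a : C(I, ℝ × ℝ × ℝ)) = L.meridianPath 0 := by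
  ext1 t
  exact (h _).trans (L.middleMap_meridian_zero t)

variable {𝒢 : Type*} [Group 𝒢]

theorem IsCocycleOn.comp_middleMap {v : C(I, L.exterior) → 𝒢} (hv : IsCocycleOn L.middleRegion v) :
    IsCocycleOn Set.univ fun γ => v (L.middleMap.comp γ) := by
  convert hv.comap L.middleMap
  ext e
  simp [L.middleMap_mem e]

/-- The loop over the path that goes around the meridian of the component `1`, in the cover of the
middle region. -/
theorem cocycle_bridge_loop {v : C(I, L.exterior) → 𝒢} (hv : IsCocycleOn L.middleRegion v) :
    v (L.middleMap.comp (((bridgeLift 0).trans (firstLift 0)).trans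
      (bridgeLift (2 * Real.pi)).symm : Path _ _)) =
        (v L.bridge)⁻¹ * v (L.meridianPath 1) * v L.bridge := by
  have hvq := IsCocycleOn.comp_middleMap L hv
  have h1 := hvq.trans ((bridgeLift 0).trans (firstLift 0)) (bridgeLift (2 * Real.pi)).symm
    (fun _ => trivial) fun _ => trivial
  have h2 := hvq.trans (bridgeLift 0) (firstLift 0) (fun _ => trivial) fun _ => trivial
  have h3 := hvq.symm (bridgeLift (2 * Real.pi)) fun _ => trivial
  beta_reduce at h1 h2 h3
  rw [h1, h2, h3]
  have e1 : L.middleMap.comp (bridgeLift 0 : C(I, ℝ × ℝ × ℝ)) = L.bridge := rfl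
  have e2 : L.middleMap.comp (bridgeLift (2 * Real.pi) : C(I, ℝ × ℝ × ℝ)) = L.bridge := by
    ext1 t
    refine Eq.trans ?_ (L.middleMap_translate _ 0 0).1
    change L.middleMap (4 / 5 - t / 5, 2 * Real.pi, 0) = _
    rw [zero_add]
  have e3 : L.middleMap.comp (firstLift 0 : C(I, ℝ × ℝ × ℝ)) = L.meridianPath 1 := by
    ext1 t
    exact L.middleMap_meridian_one t
  rw [e1, e2, e3, mul_assoc]

/-- Cocycles on the middle region agree up to a twist if they agree on the two meridians. -/
theorem exists_twist_middle {v v' : C(I, L.exterior) → 𝒢} (hv : IsCocycleOn L.middleRegion v)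
    (hv' : IsCocycleOn L.middleRegion v') (c : 𝒢)
    (h₀ : v' (L.meridianPath 0) * c = c * v (L.meridianPath 0))
    (h₁ : ((v' L.bridge)⁻¹ * v' (L.meridianPath 1) * v' L.bridge) * c =
      c * ((v L.bridge)⁻¹ * v (L.meridianPath 1) * v L.bridge)) :
    ∃ u : L.exterior → 𝒢, u (L.pieceToExterior 0 (L.basePoint 0)) = c ∧
      ∀ γ : C(I, L.exterior), (∀ t, γ t ∈ L.middleRegion) →
        v' γ = u (γ 1) * v γ * (u (γ 0))⁻¹ := by
  let τ₁ : C(ℝ × ℝ × ℝ, ℝ × ℝ × ℝ) := ⟨fun e => (e.1, e.2.1 + 2 * Real.pi, e.2.2), by fun_prop⟩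
  let τ₂ : C(ℝ × ℝ × ℝ, ℝ × ℝ × ℝ) := ⟨fun e => (e.1, e.2.1, e.2.2 + 2 * Real.pi), by fun_prop⟩
  rw [← L.middleMap_base_zero]
  refine hv.exists_twist_of_deck hv' L.middleMap L.middleMap_mem L.exists_middleMap_lift
    (4 / 5, 0, 0) c {τ₁, τ₂} ?_ ?_ (L.eqvGen_of_middleMap_eq _ (Or.inl rfl) (Or.inr rfl))
  · rintro τ (rfl | rfl) <;> ext1 ⟨s, a, b⟩
    · exact (L.middleMap_translate s a b).1
    · exact (L.middleMap_translate s a b).2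
  · rintro τ (rfl | rfl)
    · refine ⟨(((bridgeLift 0).trans (firstLift 0)).trans (bridgeLift (2 * Real.pi)).symm).cast rfl
        (by simp [τ₁]), ?_⟩
      have e (v : C(I, L.exterior) → 𝒢) (hv : IsCocycleOn L.middleRegion v) :=
        L.cocycle_bridge_loop hv
      exact (congrArg (· * c) (e v' hv')).trans (h₁.trans (congrArg (c * ·) (e v hv)).symm)
    · refine ⟨(secondLift (4 / 5) 0).cast rfl (by simp [τ₂]), ?_⟩
      have e := L.middleMap_comp_secondLift (a := 0) fun _ => rfl
      rw [← e] at h₀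
      exact h₀

/-- The two meridians commute, since the middle region deforms to a torus. -/
theorem commute_meridians {v : C(I, L.exterior) → 𝒢} (hv : IsCocycleOn L.middleRegion v) :
    Commute (v (L.meridianPath 0)) ((v L.bridge)⁻¹ * v (L.meridianPath 1) * v L.bridge) := by
  have hvq := IsCocycleOn.comp_middleMap L hv
  let m : Path ((4 / 5, 0, 0) : ℝ × ℝ × ℝ) (4 / 5, 2 * Real.pi, 0) :=
    ((bridgeLift 0).trans (firstLift 0)).trans (bridgeLift (2 * Real.pi)).symm
  let τ : C(ℝ × ℝ × ℝ, ℝ × ℝ × ℝ) := ⟨fun e => (e.1, e.2.1, e.2.2 + 2 * Real.pi), by fun_prop⟩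
  let m' : Path ((4 / 5, 0, 2 * Real.pi) : ℝ × ℝ × ℝ) (4 / 5, 2 * Real.pi, 2 * Real.pi) :=
    (m.map τ.continuous).cast (by simp [τ]) (by simp [τ])
  have e1 : L.middleMap.comp (m' : C(I, ℝ × ℝ × ℝ)) = L.middleMap.comp (m : C(I, ℝ × ℝ × ℝ)) := by
    ext1 t
    exact (L.middleMap_translate _ _ _).2
  have h1 := hvq.trans (secondLift (4 / 5) 0) m' (fun _ => trivial) fun _ => trivial
  have h2 := hvq.trans m (secondLift (4 / 5) (2 * Real.pi)) (fun _ => trivial) fun _ => trivial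
  have h3 := hvq.of_homotopic (SimplyConnectedSpace.paths_homotopic
    ((secondLift (4 / 5) 0).trans m') (m.trans (secondLift (4 / 5) (2 * Real.pi))))
  beta_reduce at h1 h2 h3
  rw [h1, h2, e1, L.cocycle_bridge_loop hv, L.middleMap_comp_secondLift fun _ => rfl,
    L.middleMap_comp_secondLift (a := 2 * Real.pi) fun b => by
      have := (L.middleMap_translate (4 / 5) 0 b).1
      rwa [zero_add] at this] at h3
  exact h3.symm

end HopfLikeLink

/-! ### The fundamental group of the exterior of the link -/

theorem commute_conj_of_commute {G : Type*} [Group G] {x y b : G} (h : Commute x (b⁻¹ * y * b))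
    (g : G) : Commute (g⁻¹ * x * g) ((b * g)⁻¹ * y * (b * g)) := by
  have h3 := h.map (MulAut.conj g⁻¹).toMonoidHom
  convert h3 using 1 <;> simp [mul_assoc]

namespace HopfLikeLink

variable (L : HopfLikeLink)

/-- The inclusion `X(L) → X(Kᵢ)`. -/
def exteriorToKnot (i : Fin 2) : C(L.exterior, (L.knot i).exterior) :=
  ⟨fun x => ⟨x, ((L.mem_exterior_iff i x).1 x.2).1⟩, by fun_prop⟩

theorem deform_mem_exterior {i : Fin 2} (s : I) {x : (L.knot i).exterior}
    (hx : 3 / 4 ≤ (L.coord i x).re) : L.deform i (s, x) ∈ L.exterior :=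
  (L.mem_exterior_iff i _).2 ⟨L.deform_mem_knot_exterior i _,
    L.mem_knot_rev_exterior (L.le_deform_coord_re (by norm_num) s hx)⟩

theorem basePoint_mem (i : Fin 2) :
    L.pieceToExterior i (L.basePoint i) ∈ L.knottedRegion i ∩ L.middleRegion := by
  have h := L.coord_meridianPath i 0
  rw [(L.meridianPath i).source] at h
  refine L.mem_overlapDisc_iff.1 ?_
  rw [h]
  exact four_fifths_mem_overlapDisc

theorem joinedIn_knottedRegion {i : Fin 2} {x : L.exterior} (hx : x ∈ L.knottedRegion i) :
    JoinedIn (L.knottedRegion i) (L.pieceToExterior i (L.basePoint i)) x := by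
  let p : Path (L.pieceToKnot i (L.basePoint i)) (L.exteriorToKnot i x) :=
    PathConnectedSpace.somePath _ _
  have hd1 : L.pieceToExterior i (L.retract i (L.exteriorToKnot i x)) = ⟨L.deform i (1, _),
    L.deform_mem_exterior (x := L.exteriorToKnot i x) 1 hx⟩ := rfl
  have h1 : JoinedIn (L.knottedRegion i) (L.pieceToExterior i (L.basePoint i))
      (L.pieceToExterior i (L.retract i (L.exteriorToKnot i x))) := by
    refine ⟨(p.map ((L.pieceToExterior i).comp (L.retract i)).continuous).cast ?_ rfl, fun t => ?_⟩
    · exact congrArg _ (L.retract_pieceToKnot i _).symm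
    · exact le_trans (by norm_num) (L.le_deform_one_coord_re i _)
  refine h1.trans (JoinedIn.symm ⟨⟨⟨fun s => ⟨L.deform i (s, L.exteriorToKnot i x),
    L.deform_mem_exterior s hx⟩, ((L.continuous_deform i).comp (by fun_prop)).subtype_mk _⟩,
    Subtype.ext (L.deform_zero i _), rfl⟩, fun s => ?_⟩)
  exact L.le_deform_coord_re (by norm_num) s hx

theorem joinedIn_middleRegion {x : L.exterior} (hx : x ∈ L.middleRegion) :
    JoinedIn L.middleRegion (L.pieceToExterior 0 (L.basePoint 0)) x := by
  obtain ⟨γ, hγ⟩ := L.exists_middleMap_lift (.const I x) fun _ => hx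
  have h0 : L.middleMap (γ 0) = x := DFunLike.congr_fun hγ 0
  let p : Path ((4 / 5, 0, 0) : ℝ × ℝ × ℝ) (γ 0) := PathConnectedSpace.somePath _ _
  exact ⟨(p.map L.middleMap.continuous).cast L.middleMap_base_zero.symm h0.symm,
    fun t => L.middleMap_mem _⟩

theorem joined_exterior (x : L.exterior) : Joined (L.pieceToExterior 0 (L.basePoint 0)) x := by
  obtain ⟨o, ho⟩ := L.exists_region_mem_nhds x
  have hx := mem_of_mem_nhds ho
  cases o with
  | none => exact (L.joinedIn_middleRegion hx).joined
  | some i =>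
    exact (L.joinedIn_middleRegion (L.basePoint_mem i).2).joined.trans
      (L.joinedIn_knottedRegion hx).joined

instance : PathConnectedSpace L.exterior :=
  ⟨⟨L.pieceToExterior 0 (L.basePoint 0)⟩,
    fun x y => (L.joined_exterior x).symm.trans (L.joined_exterior y)⟩

variable {𝒢 : Type*} [Group 𝒢]

/-- The loops near the knotted part can be deformed to the knotted piece. -/
theorem exists_loop_piece {i : Fin 2}
    (p : Path (L.pieceToExterior i (L.basePoint i)) (L.pieceToExterior i (L.basePoint i)))
    (hp : ∀ t, p t ∈ L.knottedRegion i) :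
    ∃ p' : Path (L.basePoint i) (L.basePoint i),
      ∀ v : C(I, L.exterior) → 𝒢, IsCocycleOn (L.knottedRegion i) v →
        v p = v (p'.map (L.pieceToExterior i).continuous) := by
  refine ⟨(p.map ((L.retract i).comp (L.exteriorToKnot i)).continuous).cast
    (L.retract_pieceToKnot i _).symm (L.retract_pieceToKnot i _).symm, fun v hv => ?_⟩
  refine hv.of_homotopy ⟨fun z => ⟨L.deform i (z.1, L.exteriorToKnot i (p z.2)),
    L.deform_mem_exterior z.1 (hp z.2)⟩, ((L.continuous_deform i).comp
      (by fun_prop)).subtype_mk _⟩ (fun z => L.le_deform_coord_re (by norm_num) z.1 (hp z.2))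
    (fun s => ?_) (fun s => ?_) (fun t => Subtype.ext (L.deform_zero i _)) (fun t => rfl)
  all_goals
    apply Subtype.ext
    change L.deform i (s, L.exteriorToKnot i (p _)) = L.deform i (0, L.exteriorToKnot i (p _))
    first | rw [p.source] | rw [p.target]
    have h := (L.basePoint i).2.2
    exact (L.deform_of_le (x := L.exteriorToKnot i (L.pieceToExterior i (L.basePoint i))) s h).trans
      (L.deform_of_le (x := L.exteriorToKnot i (L.pieceToExterior i (L.basePoint i))) 0 h).symm

variable {x₀ : L.exterior}

theorem pieceHom_mk (i : Fin 2) (γ : Path x₀ (L.pieceToExterior i (L.basePoint i)))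
    (p : Path (L.basePoint i) (L.basePoint i)) :
    L.pieceHom i γ (FundamentalGroup.fromPath (Path.Homotopic.Quotient.mk p)) =
      FundamentalGroup.fromPath (Path.Homotopic.Quotient.mk
        (γ.trans ((p.map (L.pieceToExterior i).continuous).trans γ.symm))) := rfl

/-- The value of a homomorphism on a loop in a piece, in terms of the associated cocycle. -/
theorem cocycle_pieceHom {v : C(I, L.exterior) → 𝒢} (hv : IsCocycleOn Set.univ v)
    {f : FundamentalGroup L.exterior x₀ →* 𝒢} (hf : ∀ p : Path x₀ x₀,
      v p = f (FundamentalGroup.fromPath (Path.Homotopic.Quotient.mk p))) (i : Fin 2)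
    (γ : Path x₀ (L.pieceToExterior i (L.basePoint i))) (p : Path (L.basePoint i) (L.basePoint i)) :
    f (L.pieceHom i γ (FundamentalGroup.fromPath (Path.Homotopic.Quotient.mk p))) =
      (v γ)⁻¹ * v (p.map (L.pieceToExterior i).continuous) * v γ := by
  rw [pieceHom_mk, ← hf, hv.trans _ _ (fun _ => trivial) fun _ => trivial,
    hv.trans _ _ (fun _ => trivial) fun _ => trivial, hv.symm _ fun _ => trivial]

/-- The isomorphism `π₁(Pᵢ) ≃ π₁(X(Kᵢ))`. -/
def pieceEquiv (i : Fin 2) : FundamentalGroup (L.piece i) (L.basePoint i) ≃*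
    FundamentalGroup (L.knot i).exterior (L.pieceToKnot i (L.basePoint i)) :=
  MulEquiv.ofBijective (FundamentalGroup.map (L.pieceToKnot i) _) (L.pieceToKnot_bijective i)

/-- The homomorphism `π₁(X(Kᵢ)) → π₁(X(L))` given by the inclusions of `Pᵢ`. -/
def knotHom (i : Fin 2) (γ : Path x₀ (L.pieceToExterior i (L.basePoint i))) :
    FundamentalGroup (L.knot i).exterior (L.pieceToKnot i (L.basePoint i)) →*
      FundamentalGroup L.exterior x₀ :=
  (L.pieceHom i γ).comp (L.pieceEquiv i).symm.toMonoidHom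

theorem knotHom_map (i : Fin 2) (γ : Path x₀ (L.pieceToExterior i (L.basePoint i)))
    (g : FundamentalGroup (L.piece i) (L.basePoint i)) :
    L.knotHom i γ (FundamentalGroup.map (L.pieceToKnot i) _ g) = L.pieceHom i γ g :=
  congrArg (L.pieceHom i γ) ((L.pieceEquiv i).symm_apply_apply g)

theorem knotHom_knotMeridian (i : Fin 2) (γ : Path x₀ (L.pieceToExterior i (L.basePoint i))) :
    L.knotHom i γ (L.knotMeridian i) = L.pieceHom i γ (L.meridian i) :=
  L.knotHom_map i γ _

/-- The paths to the two base points that run together up to the bridge. -/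
def bridgedPath (γ : Path x₀ (L.pieceToExterior 0 (L.basePoint 0))) :
    ∀ i, Path x₀ (L.pieceToExterior i (L.basePoint i))
  | 0 => γ
  | 1 => γ.trans L.bridge

theorem commute_knotHom (γ : Path x₀ (L.pieceToExterior 0 (L.basePoint 0))) :
    Commute (L.knotHom 0 (L.bridgedPath γ 0) (L.knotMeridian 0))
      (L.knotHom 1 (L.bridgedPath γ 1) (L.knotMeridian 1)) := by
  obtain ⟨v, hv, hf⟩ := exists_isCocycleOn_of_hom (MonoidHom.id (FundamentalGroup L.exterior x₀))
  have h0 := L.cocycle_pieceHom hv hf 0 (L.bridgedPath γ 0) (L.meridianLoop 0)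
  have h1 := L.cocycle_pieceHom hv hf 1 (L.bridgedPath γ 1) (L.meridianLoop 1)
  rw [L.knotHom_knotMeridian, L.knotHom_knotMeridian]
  refine (congrArg₂ Commute h0 h1).mpr ?_
  have h2 := L.commute_meridians (hv.mono (Set.subset_univ _))
  have e1 : v (L.bridgedPath γ 1) = v L.bridge * v γ :=
    hv.trans γ L.bridge (fun _ => trivial) fun _ => trivial
  have e0 : v (L.bridgedPath γ 0) = v γ := rfl
  rw [e1, e0]
  exact commute_conj_of_commute h2 _

/-- The group of the link is generated by the two knot groups: two homomorphisms that agree on them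
are given by cocycles that agree up to twists on each of the three regions, and these twists fit
together. -/
theorem hom_ext_of_knotHom (γ : Path x₀ (L.pieceToExterior 0 (L.basePoint 0)))
    (f f' : FundamentalGroup L.exterior x₀ →* 𝒢)
    (h : ∀ i, f.comp (L.knotHom i (L.bridgedPath γ i)) =
      f'.comp (L.knotHom i (L.bridgedPath γ i))) : f = f' := by
  obtain ⟨v, hv, hf⟩ := exists_isCocycleOn_of_hom f
  obtain ⟨v', hv', hf'⟩ := exists_isCocycleOn_of_hom f'
  let e (i : Fin 2) : 𝒢 := v' (L.bridgedPath γ i) * (v (L.bridgedPath γ i))⁻¹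
  -- the cocycles are conjugate on the loops in the pieces
  have hloop (i : Fin 2) (p : Path (L.basePoint i) (L.basePoint i)) :
      v' (p.map (L.pieceToExterior i).continuous) =
        e i * v (p.map (L.pieceToExterior i).continuous) * (e i)⁻¹ := by
    have h0 := L.cocycle_pieceHom hv hf i (L.bridgedPath γ i) p
    have h1 := L.cocycle_pieceHom hv' hf' i (L.bridgedPath γ i) p
    rw [← L.knotHom_map] at h0 h1
    have h2 := DFunLike.congr_fun (h i) (FundamentalGroup.map (L.pieceToKnot i) _
      (FundamentalGroup.fromPath (Path.Homotopic.Quotient.mk p)))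
    rw [MonoidHom.comp_apply, MonoidHom.comp_apply, h0, h1] at h2
    simp only [e]
    rw [mul_inv_rev, inv_inv]
    calc _ = v' (L.bridgedPath γ i) * ((v' (L.bridgedPath γ i))⁻¹ *
        v' (p.map (L.pieceToExterior i).continuous) * v' (L.bridgedPath γ i)) *
          (v' (L.bridgedPath γ i))⁻¹ := by group
      _ = _ := by
        rw [← h2]
        group
  have hk (i : Fin 2) := (hv.mono (Set.subset_univ (L.knottedRegion i))).exists_twist
    (hv'.mono (Set.subset_univ _)) (fun x hx => L.joinedIn_knottedRegion hx) (e i) (by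
      intro p hp
      obtain ⟨p', hp'⟩ := L.exists_loop_piece (𝒢 := 𝒢) p hp
      rw [hp' v (hv.mono (Set.subset_univ _)), hp' v' (hv'.mono (Set.subset_univ _)), hloop])
  choose u hu hu' using hk
  have e1 : v (L.bridgedPath γ 1) = v L.bridge * v γ :=
    hv.trans γ L.bridge (fun _ => trivial) fun _ => trivial
  have e1' : v' (L.bridgedPath γ 1) = v' L.bridge * v' γ :=
    hv'.trans γ L.bridge (fun _ => trivial) fun _ => trivial
  have he1 : e 1 = v' L.bridge * e 0 * (v L.bridge)⁻¹ := by
    simp only [e]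
    rw [e1, e1', mul_inv_rev]
    simp only [bridgedPath, mul_assoc]
  have hm (i : Fin 2) := hloop i (L.meridianLoop i)
  change ∀ i, v' (L.meridianPath i) = e i * v (L.meridianPath i) * (e i)⁻¹ at hm
  obtain ⟨w, hw, hw'⟩ := L.exists_twist_middle (hv.mono (Set.subset_univ _))
    (hv'.mono (Set.subset_univ _)) (e 0) (by
      rw [hm]
      group) (by
      rw [hm, he1]
      group)
  have hw1 : w (L.pieceToExterior 1 (L.basePoint 1)) = e 1 := by
    have := hw' L.bridge L.bridge_mem
    rw [ContinuousMap.coe_coe, L.bridge.source, L.bridge.target, hw] at this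
    rw [he1, this]
    group
  have hwi (i : Fin 2) : u i (L.pieceToExterior i (L.basePoint i)) =
      w (L.pieceToExterior i (L.basePoint i)) := by
    rw [hu i (L.basePoint_mem i).1]
    fin_cases i
    · exact hw.symm
    · exact hw1.symm
  let U : Option (Fin 2) → L.exterior → 𝒢
    | none => w
    | some i => u i
  obtain ⟨V, hVU, hV⟩ := IsCocycleOn.exists_global_twist L.exists_region_mem_nhds hv hv' U (by
    rintro (_ | i) γ hγ
    · exact hw' γ hγ
    · exact hu' i γ hγ) (by
    rintro (_ | i) (_ | j) x hx hx'
    · exact ⟨x, rfl, JoinedIn.refl ⟨hx, hx⟩⟩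
    · exact ⟨_, (hwi j).symm, Set.inter_comm _ _ ▸ L.joinedIn_overlap j ⟨hx', hx⟩⟩
    · exact ⟨_, hwi i, L.joinedIn_overlap i ⟨hx, hx'⟩⟩
    · rcases fin_two_eq_or i j with rfl | rfl
      · exact ⟨x, rfl, JoinedIn.refl ⟨hx, hx⟩⟩
      · exact absurd hx' (L.knottedRegion_disjoint hx))
  have hV0 : V x₀ = 1 := by
    have h1 := hV γ
    rw [ContinuousMap.coe_coe, γ.source, γ.target, hVU none _ (L.basePoint_mem 0).2] at h1
    change v' γ = w _ * _ * _ at h1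
    rw [hw] at h1
    simp only [e, bridgedPath, inv_mul_cancel_right] at h1
    simpa using h1
  ext1 g
  obtain ⟨p, rfl⟩ := Path.Homotopic.Quotient.mk_surjective g
  have h1 := hV p
  rw [hf', ContinuousMap.coe_coe, p.source, p.target, hV0, hf] at h1
  simpa using h1.symm

/-- Homomorphisms of the two knot groups for which the meridians commute extend to the group of the
link: the cocycles of the knots are glued along the middle region. -/
theorem exists_hom_of_knotHom (γ : Path x₀ (L.pieceToExterior 0 (L.basePoint 0)))
    (f : ∀ i, FundamentalGroup (L.knot i).exterior (L.pieceToKnot i (L.basePoint i)) →* 𝒢)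
    (h : Commute (f 0 (L.knotMeridian 0)) (f 1 (L.knotMeridian 1))) :
    ∃ F : FundamentalGroup L.exterior x₀ →* 𝒢,
      ∀ i, F.comp (L.knotHom i (L.bridgedPath γ i)) = f i := by
  choose w hw hwf using fun i => exists_isCocycleOn_of_hom (f i)
  let v (i : Fin 2) : C(I, L.exterior) → 𝒢 := fun p => w i ((L.exteriorToKnot i).comp p)
  have hv (i : Fin 2) : IsCocycleOn Set.univ (v i) := (hw i).comap (L.exteriorToKnot i)
  have hvp (i : Fin 2) (p : Path (L.basePoint i) (L.basePoint i)) :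
      v i (p.map (L.pieceToExterior i).continuous) = f i (FundamentalGroup.map (L.pieceToKnot i) _
        (FundamentalGroup.fromPath (Path.Homotopic.Quotient.mk p))) :=
    hwf i (p.map (L.pieceToKnot i).continuous)
  let a (i : Fin 2) : 𝒢 := f i (L.knotMeridian i)
  have hvm (i : Fin 2) : v i (L.meridianPath i) = a i := hvp i (L.meridianLoop i)
  let c (i : Fin 2) : C(L.exterior, ℂ) := ⟨fun x => L.coord i x, L.continuous_coord_exterior i⟩
  let N (i : Fin 2) (p : C(I, L.exterior)) : ℤ := windingNumber ((c i).comp p)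
  have hne (i : Fin 2) {x : L.exterior} (hx : x ∈ L.middleRegion) : c i x ≠ 0 := by
    intro h0
    have h1 := L.half_le_norm_coord (hx i.rev)
    rw [Fin.rev_rev] at h1
    change L.coord i x = 0 at h0
    rw [h0, norm_zero] at h1
    norm_num at h1
  have hN (i : Fin 2) : IsCocycleOn L.middleRegion fun p => Multiplicative.ofAdd (N i p) :=
    (isCocycleOn_windingNumber.comap (c i)).mono fun x hx => hne i hx
  have hNs (i : Fin 2) (p : C(I, L.exterior)) (hp : ∀ t, 0 < (L.coord i (p t)).re) : N i p = 0 :=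
    windingNumber_of_slitPlane fun t => Or.inl (hp t)
  have hN1 (i : Fin 2) : N i.rev (L.meridianPath i) = 1 :=
    windingNumber_circle (r := 3 / 5) (by norm_num) fun t => by
      refine (L.coord_rev_meridianPath i t).trans ?_
      norm_num
  have hN0 (i : Fin 2) : N i (L.meridianPath i) = 0 := hNs i _ fun t => by
    have h := L.coord_meridianPath i t
    change 0 < (L.coord i (L.meridianPath i t)).re
    rw [h]
    norm_num
  -- The cocycle on the middle region. The meridian of the component `i` winds once around the
  -- coordinate `i.rev` and not around the coordinate `i`.
  let m (p : C(I, L.exterior)) : 𝒢 := a 0 ^ N 1 p * a 1 ^ N 0 p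
  have hm : IsCocycleOn L.middleRegion m := by
    intro p hp
    have h0 : N 0 _ = N 0 _ + N 0 _ := Multiplicative.ofAdd.injective (hN 0 p hp)
    have h1 : N 1 _ = N 1 _ + N 1 _ := Multiplicative.ofAdd.injective (hN 1 p hp)
    simp only [m]
    rw [h0, h1, zpow_add, zpow_add]
    have hc := (h.zpow_zpow (N 1 (p.comp lowerSide)) (N 0 (p.comp rightSide))).eq
    change a 0 ^ _ * a 1 ^ _ = a 1 ^ _ * a 0 ^ _ at hc
    simp only [mul_assoc]
    rw [← mul_assoc (a 0 ^ N 1 (p.comp lowerSide)), hc, mul_assoc]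
  have hmm (i : Fin 2) : m (L.meridianPath i) = a i := by
    simp only [m]
    fin_cases i
    · have h1 := hN1 0
      have h2 := hN0 0
      change N 1 _ = 1 at h1
      simp [h1, h2]
    · have h1 := hN1 1
      have h2 := hN0 1
      change N 0 _ = 1 at h1
      simp [h1, h2]
  have hmb : m L.bridge = 1 := by
    have h0 : N 0 L.bridge = 0 := hNs 0 _ fun t => by
      change 0 < (L.coord 0 (L.middleMap (4 / 5 - t / 5, 0, 0))).re
      rw [L.coord_middleMap_zero, re_ofReal_mul_exp,
        middleRadius_of_mem (by linarith [t.2.2]) (by linarith [t.2.1]), Real.cos_zero, mul_one]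
      linarith [t.2.2]
    have h1 : N 1 L.bridge = 0 := hNs 1 _ fun t => by
      change 0 < (L.coord 1 (L.middleMap (4 / 5 - t / 5, 0, 0))).re
      rw [L.coord_middleMap_one, re_ofReal_mul_exp,
        middleRadius_of_mem (by linarith [t.2.2]) (by linarith [t.2.1]), Real.cos_zero, mul_one]
      have h1 := t.2.1
      have h2 := t.2.2
      exact Real.sqrt_pos.2 (by nlinarith)
    simp [m, h0, h1]
  have htw (i : Fin 2) := L.exists_twist_overlap i ((hv i).mono (Set.subset_univ _))
    (hm.mono Set.inter_subset_right) 1 (by rw [hmm, hvm, mul_one, one_mul])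
  choose u hu hu' using htw
  let V : Option (Fin 2) → C(I, L.exterior) → 𝒢
    | none => m
    | some i => fun p => u i (p 1) * v i p * (u i (p 0))⁻¹
  -- after a twist the cocycles agree on the overlaps, where the knotted regions are solid tori
  -- around the meridian
  obtain ⟨v', hv', hV, -⟩ := exists_glue (W := L.region) (v := V) L.exists_region_mem_nhds (by
    rintro (_ | i)
    · exact hm
    · exact ((hv i).mono (Set.subset_univ _)).twist (u i)) (by
    rintro (_ | i) (_ | j) p hp hp'
    · rfl
    · exact hu' j p fun t => ⟨hp' t, hp t⟩
    · exact (hu' i p fun t => ⟨hp t, hp' t⟩).symm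
    · rcases fin_two_eq_or i j with rfl | rfl
      · rfl
      · exact absurd (hp' 0) (L.knottedRegion_disjoint (hp 0)))
  have hbr : v' (L.bridgedPath γ 1) = v' γ := by
    refine (hv'.trans γ L.bridge (fun _ => trivial) fun _ => trivial).trans ?_
    rw [hV none L.bridge L.bridge_mem]
    change m L.bridge * _ = _
    rw [hmb, one_mul]
  refine ⟨(MulAut.conj (v' γ)).toMonoidHom.comp (hv'.toHom x₀), fun i => ?_⟩
  ext1 g
  obtain ⟨g, rfl⟩ := (L.pieceEquiv i).surjective g
  obtain ⟨p, rfl⟩ := Path.Homotopic.Quotient.mk_surjective g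
  change v' γ * hv'.toHom x₀ (L.knotHom i _ (FundamentalGroup.map (L.pieceToKnot i) _
    (FundamentalGroup.fromPath (Path.Homotopic.Quotient.mk p)))) * (v' γ)⁻¹ =
      f i (FundamentalGroup.map (L.pieceToKnot i) _
        (FundamentalGroup.fromPath (Path.Homotopic.Quotient.mk p)))
  rw [L.knotHom_map, L.cocycle_pieceHom hv' (f := hv'.toHom x₀) fun p => rfl, ← hvp]
  have hb : v' (L.bridgedPath γ i) = v' γ := by
    fin_cases i
    · rfl
    · exact hbr
  have hreg : ∀ t, p.map (L.pieceToExterior i).continuous t ∈ L.region (some i) := fun t =>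
    le_trans (by norm_num : (3 / 4 : ℝ) ≤ 4 / 5) (p t).2.2
  have hVp := hV (some i) (p.map (L.pieceToExterior i).continuous) hreg
  rw [hb, hVp]
  change v' γ * ((v' γ)⁻¹ * (u i (L.pieceToExterior i (p 1)) * _ *
    (u i (L.pieceToExterior i (p 0)))⁻¹) * v' γ) * (v' γ)⁻¹ = _
  rw [p.source, p.target, hu]
  group

/-- Seifert–van Kampen: the group of the link is the free product of the two knot groups, with the
relation that the two meridians commute. -/
theorem isAmalgam_knotHom (γ : Path x₀ (L.pieceToExterior 0 (L.basePoint 0))) :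
    IsAmalgam (fun i => L.knotMeridian i) fun i => L.knotHom i (L.bridgedPath γ i) where
  commute := L.commute_knotHom γ
  hom_ext _ _ f f' h := L.hom_ext_of_knotHom γ f f' h
  exists_hom _ _ f h := L.exists_hom_of_knotHom γ f h

end HopfLikeLink

/-! ### The free abelianizations -/

section FreeAbelianization

variable {X : Type*} [TopologicalSpace X] {x₀ : X}

theorem toFreeH1_surjective : Function.Surjective (toFreeH1 X x₀) :=
  (QuotientGroup.mk'_surjective _).comp QuotientGroup.mk_surjective

/-- The homomorphism on `FH₁` given by a homomorphism of the fundamental group to a torsion-free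
abelian group. -/
theorem exists_freeH1_lift {A : Type*} [CommGroup A] (hA : ∀ (a : A) (n : ℕ), 0 < n → a ^ n = 1 → a = 1)
    (f : FundamentalGroup X x₀ →* A) :
    ∃ F : FreeH1 X x₀ →* A, ∀ g, F (toFreeH1 X x₀ g) = f g := by
  refine ⟨QuotientGroup.lift _ (Abelianization.lift f) fun g hg => ?_, fun g => rfl⟩
  obtain ⟨n, hn, h⟩ := isOfFinOrder_iff_pow_eq_one.1 hg
  refine hA _ n hn ?_
  rw [← map_pow, h, map_one]

theorem eq_one_of_pow_eq_one_int (a : Multiplicative ℤ) (n : ℕ) (hn : 0 < n) (h : a ^ n = 1) :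
    a = 1 := by
  have h1 : n • a.toAdd = 0 := h
  have h2 : a.toAdd = 0 := by
    rw [nsmul_eq_mul] at h1
    rcases mul_eq_zero.1 h1 with h | h
    · have : n = 0 := by exact_mod_cast h
      omega
    · exact h
  exact h2

end FreeAbelianization

namespace HopfLikeLink

variable (L : HopfLikeLink)

/-- A homomorphism of the knot group that kills the meridian is trivial. -/
theorem knot_hom_eq_one (i : Fin 2) {A : Type*} [Group A]
    (f : FundamentalGroup (L.knot i).exterior (L.pieceToKnot i (L.basePoint i)) →* A)
    (h : f (L.knotMeridian i) = 1) : f = 1 := by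
  obtain ⟨v, hv, hf⟩ := exists_isCocycleOn_of_hom f
  obtain ⟨u, hu⟩ := L.exists_primitive_of_meridian i hv ((hf (L.knotMeridianPath i)).trans h)
  ext1 g
  obtain ⟨p, rfl⟩ := Path.Homotopic.Quotient.mk_surjective g
  refine (hf p).symm.trans ?_
  rw [hu, ContinuousMap.coe_coe, p.source, p.target, mul_inv_cancel]
  rfl

theorem knot_hom_ext {i : Fin 2} {A : Type*} [CommGroup A]
    {f f' : FundamentalGroup (L.knot i).exterior (L.pieceToKnot i (L.basePoint i)) →* A}
    (h : f (L.knotMeridian i) = f' (L.knotMeridian i)) : f = f' := by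
  have := L.knot_hom_eq_one i (f / f') (by rw [MonoidHom.div_apply, h, div_self'])
  exact div_eq_one.1 this

/-- The linking number with the component `i`. -/
def linkingHom (i : Fin 2) :
    FundamentalGroup (L.knot i).exterior (L.pieceToKnot i (L.basePoint i)) →* Multiplicative ℤ :=
  (L.exists_linking_cocycle i).choose_spec.1.toHom _

theorem linkingHom_knotMeridian (i : Fin 2) :
    L.linkingHom i (L.knotMeridian i) = Multiplicative.ofAdd 1 :=
  (L.exists_linking_cocycle i).choose_spec.2

theorem toFreeH1_knot (i : Fin 2)
    (g : FundamentalGroup (L.knot i).exterior (L.pieceToKnot i (L.basePoint i))) :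
    toFreeH1 _ _ g = L.knotVariable i ^ (L.linkingHom i g).toAdd := by
  have : toFreeH1 _ _ = (zpowersHom _ (L.knotVariable i)).comp (L.linkingHom i) :=
    L.knot_hom_ext (by
      rw [MonoidHom.comp_apply, linkingHom_knotMeridian]
      simp [knotVariable])
  exact DFunLike.congr_fun this g

/-- `FH₁` of the exterior of a knot is infinite cyclic, generated by the class of the meridian. -/
theorem exists_freeH1_knot_equiv (i : Fin 2) :
    ∃ e : Multiplicative ℤ ≃* FreeH1 (L.knot i).exterior (L.pieceToKnot i (L.basePoint i)),
      e (Multiplicative.ofAdd 1) = L.knotVariable i := by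
  obtain ⟨F, hF⟩ := exists_freeH1_lift eq_one_of_pow_eq_one_int (L.linkingHom i)
  have h1 : F (L.knotVariable i) = Multiplicative.ofAdd 1 :=
    (hF _).trans (L.linkingHom_knotMeridian i)
  refine ⟨MonoidHom.toMulEquiv (zpowersHom _ (L.knotVariable i)) F ?_ ?_, ?_⟩
  · refine MonoidHom.ext_mint ?_
    simp [h1]
  · refine MonoidHom.ext fun x => ?_
    obtain ⟨g, rfl⟩ := toFreeH1_surjective x
    rw [MonoidHom.comp_apply, hF, L.toFreeH1_knot]
    simp
  · exact zpow_one (L.knotVariable i)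

variable {x₀ : L.exterior}

/-- The homomorphisms of the pieces for two paths differ by a conjugation. -/
theorem exists_pieceHom_conj (i : Fin 2) (γ γ' : Path x₀ (L.pieceToExterior i (L.basePoint i))) :
    ∃ h : FundamentalGroup L.exterior x₀, ∀ g, L.pieceHom i γ' g = h * L.pieceHom i γ g * h⁻¹ := by
  obtain ⟨v, hv, hf⟩ := exists_isCocycleOn_of_hom (MonoidHom.id (FundamentalGroup L.exterior x₀))
  refine ⟨(v γ')⁻¹ * v γ, fun g => ?_⟩
  obtain ⟨p, rfl⟩ := Path.Homotopic.Quotient.mk_surjective g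
  have h0 := L.cocycle_pieceHom hv hf i γ p
  have h1 := L.cocycle_pieceHom hv hf i γ' p
  refine h1.trans (Eq.trans ?_ (congrArg (fun x => (v γ')⁻¹ * v γ * x * ((v γ')⁻¹ * v γ)⁻¹) h0).symm)
  group

theorem linkVariable_eq (i : Fin 2) (γ γ' : Path x₀ (L.pieceToExterior i (L.basePoint i))) :
    L.linkVariable i γ' = toFreeH1 _ _ (L.knotHom i γ (L.knotMeridian i)) := by
  obtain ⟨h, hh⟩ := L.exists_pieceHom_conj i γ γ'
  rw [linkVariable, hh, map_mul, map_mul, map_inv, knotHom_knotMeridian, mul_comm, inv_mul_cancel_left]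

variable (γ : ∀ i, Path x₀ (L.pieceToExterior i (L.basePoint i)))

theorem toFreeH1_knotHom (i : Fin 2) (γ' : Path x₀ (L.pieceToExterior i (L.basePoint i)))
    (g : FundamentalGroup (L.knot i).exterior (L.pieceToKnot i (L.basePoint i))) :
    toFreeH1 _ _ (L.knotHom i γ' g) = L.linkVariable i (γ i) ^ (L.linkingHom i g).toAdd := by
  have : (toFreeH1 _ _).comp (L.knotHom i γ') =
      (zpowersHom _ (L.linkVariable i (γ i))).comp (L.linkingHom i) :=
    L.knot_hom_ext (by
      rw [MonoidHom.comp_apply, MonoidHom.comp_apply, linkingHom_knotMeridian,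
        L.linkVariable_eq i γ' (γ i)]
      simp)
  exact DFunLike.congr_fun this g

/-- `FH₁` of the exterior of the link is free abelian on the classes of the meridians. -/
theorem exists_freeH1_link_equiv :
    ∃ e : Multiplicative ℤ × Multiplicative ℤ ≃* FreeH1 L.exterior x₀,
      ∀ a, e a = L.linkVariable 0 (γ 0) ^ a.1.toAdd * L.linkVariable 1 (γ 1) ^ a.2.toAdd := by
  have hA := L.isAmalgam_knotHom (γ 0)
  let f : ∀ i, FundamentalGroup (L.knot i).exterior (L.pieceToKnot i (L.basePoint i)) →*
      Multiplicative ℤ × Multiplicative ℤ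
    | 0 => (L.linkingHom 0).prod 1
    | 1 => MonoidHom.prod 1 (L.linkingHom 1)
  obtain ⟨F, hF⟩ := hA.exists_hom _ f (Commute.all _ _)
  obtain ⟨E, hE⟩ := exists_freeH1_lift (fun a n hn h => Prod.ext
    (eq_one_of_pow_eq_one_int _ n hn (congrArg Prod.fst h))
    (eq_one_of_pow_eq_one_int _ n hn (congrArg Prod.snd h))) F
  have hEθ (i : Fin 2) (g) : E (toFreeH1 _ _ (L.knotHom i (L.bridgedPath (γ 0) i) g)) = f i g :=
    (hE _).trans (DFunLike.congr_fun (hF i) g)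
  have hEx (i : Fin 2) : E (L.linkVariable i (γ i)) = f i (L.knotMeridian i) := by
    rw [L.linkVariable_eq i (L.bridgedPath (γ 0) i), hEθ]
  have hE0 : E (L.linkVariable 0 (γ 0)) = (Multiplicative.ofAdd 1, 1) := by
    rw [hEx, ← L.linkingHom_knotMeridian 0]
    rfl
  have hE1 : E (L.linkVariable 1 (γ 1)) = (1, Multiplicative.ofAdd 1) := by
    rw [hEx, ← L.linkingHom_knotMeridian 1]
    rfl
  let e : Multiplicative ℤ × Multiplicative ℤ →* FreeH1 L.exterior x₀ :=
    (zpowersHom _ (L.linkVariable 0 (γ 0))).coprod (zpowersHom _ (L.linkVariable 1 (γ 1)))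
  have he (a) : e a = L.linkVariable 0 (γ 0) ^ a.1.toAdd * L.linkVariable 1 (γ 1) ^ a.2.toAdd := by
    simp [e]
  refine ⟨MonoidHom.toMulEquiv e E ?_ ?_, he⟩
  · refine MonoidHom.ext fun a => ?_
    rw [MonoidHom.comp_apply, he, map_mul, map_zpow, map_zpow, hE0, hE1]
    refine Prod.ext ?_ ?_
    · simp [← ofAdd_zsmul]
    · simp [← ofAdd_zsmul]
  · have key : (e.comp E).comp (toFreeH1 L.exterior x₀) = toFreeH1 L.exterior x₀ := by
      refine hA.hom_ext _ _ _ fun i => ?_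
      ext1 g
      rw [MonoidHom.comp_apply, MonoidHom.comp_apply, MonoidHom.comp_apply, MonoidHom.comp_apply,
        hEθ, he, L.toFreeH1_knotHom γ]
      fin_cases i <;> simp [f]
    refine MonoidHom.ext fun x => ?_
    obtain ⟨g, rfl⟩ := toFreeH1_surjective x
    exact DFunLike.congr_fun key g

theorem coordinates_bijective : Function.Bijective (L.coordinates γ) := by
  obtain ⟨e, he⟩ := L.exists_freeH1_link_equiv γ
  have h0 : e (Multiplicative.ofAdd 1, 1) = L.linkVariable 0 (γ 0) := by simp [he]
  have h1 : e (1, Multiplicative.ofAdd 1) = L.linkVariable 1 (γ 1) := by simp [he]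
  constructor
  · intro φ φ' h
    refine AddMonoidHom.ext fun x => ?_
    obtain ⟨a, ha⟩ := e.surjective x.toMul
    have hx : x = a.1.toAdd • Additive.ofMul (L.linkVariable 0 (γ 0)) +
        a.2.toAdd • Additive.ofMul (L.linkVariable 1 (γ 1)) := by
      rw [← ofMul_zpow, ← ofMul_zpow, ← ofMul_mul, ← he, ha]
      rfl
    have e0 := congrArg Prod.fst h
    have e1 := congrArg Prod.snd h
    simp only [coordinates] at e0 e1
    rw [hx, map_add, map_add, map_zsmul, map_zsmul, map_zsmul, map_zsmul, e0, e1]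
  · rintro ⟨s, t⟩
    let φ : RealH1 L.exterior x₀ :=
      { toFun := fun x => (e.symm x.toMul).1.toAdd * s + (e.symm x.toMul).2.toAdd * t
        map_zero' := by simp
        map_add' := fun x y => by
          simp only [toMul_add, map_mul, Prod.fst_mul, Prod.snd_mul, toAdd_mul, Int.cast_add]
          ring }
    refine ⟨φ, Prod.ext ?_ ?_⟩
    · change ((e.symm (L.linkVariable 0 (γ 0))).1.toAdd : ℝ) * s +
        (e.symm (L.linkVariable 0 (γ 0))).2.toAdd * t = s
      rw [← h0, MulEquiv.symm_apply_apply]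
      simp
    · change ((e.symm (L.linkVariable 1 (γ 1))).1.toAdd : ℝ) * s +
        (e.symm (L.linkVariable 1 (γ 1))).2.toAdd * t = t
      rw [← h1, MulEquiv.symm_apply_apply]
      simp

end HopfLikeLink

/-! ### Rings of Laurent polynomials -/

section LaurentRings

open Polynomial

theorem isPrincipalIdealRing_laurentPolynomial (𝔽 : Type*) [Field 𝔽] :
    IsPrincipalIdealRing (LaurentPolynomial 𝔽) := by
  refine ⟨fun J => ?_⟩
  rw [← IsLocalization.map_under (Submonoid.powers (X : 𝔽[X])) (LaurentPolynomial 𝔽) J]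
  exact Submodule.IsPrincipal.map_ringHom _ (IsPrincipalIdealRing.principal _)

theorem isNoetherianRing_laurentPolynomial (R : Type*) [CommRing R] [IsNoetherianRing R] :
    IsNoetherianRing (LaurentPolynomial R) :=
  IsLocalization.isNoetherianRing (Submonoid.powers (X : R[X])) _ inferInstance

theorem uniqueFactorizationMonoid_laurentPolynomial (R : Type*) [CommRing R] [IsDomain R]
    [UniqueFactorizationMonoid R] : UniqueFactorizationMonoid (LaurentPolynomial R) :=
  UniqueFactorizationMonoid.of_isLocalization (Submonoid.powers (X : R[X])) _

/-- The group ring of an infinite cyclic group is a ring of Laurent polynomials. -/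
def groupRingEquivLaurent (R : Type*) [CommRing R] {F : Type*} [CommGroup F]
    (e : Multiplicative ℤ ≃* F) : LaurentPolynomial R ≃+* MonoidAlgebra R F :=
  (AddMonoidAlgebra.toMultiplicative R ℤ).trans (MonoidAlgebra.mapDomainRingEquiv R e)

/-- The group ring of a free abelian group of rank two is a ring of Laurent polynomials over a
ring of Laurent polynomials. -/
def groupRingEquivLaurentLaurent (R : Type*) [CommRing R] {F : Type*} [CommGroup F]
    (e : Multiplicative ℤ × Multiplicative ℤ ≃* F) :
    LaurentPolynomial (MonoidAlgebra R (Multiplicative ℤ)) ≃+* MonoidAlgebra R F :=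
  ((groupRingEquivLaurent _ (MulEquiv.refl _)).trans
    MonoidAlgebra.curryRingEquiv.symm).trans (MonoidAlgebra.mapDomainRingEquiv R e)

variable {𝔽 : Type*} [Field 𝔽] {F : Type*} [CommGroup F]

theorem isPrincipalIdealRing_groupRing (e : Multiplicative ℤ ≃* F) :
    IsPrincipalIdealRing (MonoidAlgebra 𝔽 F) := by
  have := isPrincipalIdealRing_laurentPolynomial 𝔽
  exact IsPrincipalIdealRing.of_surjective (groupRingEquivLaurent 𝔽 e)
    (groupRingEquivLaurent 𝔽 e).surjective

theorem uniqueProds_of_equiv_int (e : Multiplicative ℤ ≃* F) : UniqueProds F :=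
  e.uniqueProds_iff.1 inferInstance

theorem uniqueProds_of_equiv_int_prod (e : Multiplicative ℤ × Multiplicative ℤ ≃* F) :
    UniqueProds F :=
  e.uniqueProds_iff.1 inferInstance

theorem isNoetherianRing_groupRing (e : Multiplicative ℤ × Multiplicative ℤ ≃* F) :
    IsNoetherianRing (MonoidAlgebra 𝔽 F) := by
  have := isPrincipalIdealRing_groupRing (𝔽 := 𝔽) (MulEquiv.refl (Multiplicative ℤ))
  have := isNoetherianRing_laurentPolynomial (MonoidAlgebra 𝔽 (Multiplicative ℤ))
  exact isNoetherianRing_of_ringEquiv _ (groupRingEquivLaurentLaurent 𝔽 e)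

theorem uniqueFactorizationMonoid_groupRing (e : Multiplicative ℤ × Multiplicative ℤ ≃* F) :
    UniqueFactorizationMonoid (MonoidAlgebra 𝔽 F) := by
  have := isPrincipalIdealRing_groupRing (𝔽 := 𝔽) (MulEquiv.refl (Multiplicative ℤ))
  have := uniqueFactorizationMonoid_laurentPolynomial (MonoidAlgebra 𝔽 (Multiplicative ℤ))
  exact (groupRingEquivLaurentLaurent 𝔽 e).toMulEquiv.uniqueFactorizationMonoid this

end LaurentRings

/-! ### Newton polytopes -/

section NewtonPolytope

variable {𝔽 : Type*} [Field 𝔽] {F : Type*} [CommGroup F]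

/-- `M` is the maximum of `φ` on the support of `p`. -/
def IsSupportMax (φ : Additive F →+ ℝ) (p : MonoidAlgebra 𝔽 F) (M : ℝ) : Prop :=
  IsGreatest ((fun f => φ (Additive.ofMul f)) '' (p.coeff.support : Set F)) M

theorem exists_isSupportMax (φ : Additive F →+ ℝ) {p : MonoidAlgebra 𝔽 F} (hp : p ≠ 0) :
    ∃ M, IsSupportMax φ p M := by
  have hne : p.coeff.support.Nonempty := by
    rw [Finsupp.support_nonempty_iff]
    exact fun h => hp (MonoidAlgebra.coeff_eq_zero.1 h)
  obtain ⟨f, hf, h⟩ := p.coeff.support.exists_max_image (fun f => φ (Additive.ofMul f)) hne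
  exact ⟨_, ⟨f, hf, rfl⟩, by rintro _ ⟨g, hg, rfl⟩; exact h g hg⟩

/-- The faces of Newton polytopes add up: among the products of a maximal element of the support of
`p` and one of the support of `q`, some is reached only once. -/
theorem IsSupportMax.mul [UniqueProds F] {φ : Additive F →+ ℝ} {p q : MonoidAlgebra 𝔽 F} {M N : ℝ}
    (hp : IsSupportMax φ p M) (hq : IsSupportMax φ q N) : IsSupportMax φ (p * q) (M + N) := by
  classical
  constructor
  · let A := p.coeff.support.filter fun f => φ (Additive.ofMul f) = M
    let B := q.coeff.support.filter fun f => φ (Additive.ofMul f) = N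
    have hA : A.Nonempty := by
      obtain ⟨f, hf, h⟩ := hp.1
      exact ⟨f, Finset.mem_filter.2 ⟨hf, h⟩⟩
    have hB : B.Nonempty := by
      obtain ⟨f, hf, h⟩ := hq.1
      exact ⟨f, Finset.mem_filter.2 ⟨hf, h⟩⟩
    obtain ⟨a, ha, b, hb, hab⟩ := UniqueProds.uniqueMul_of_nonempty hA hB
    obtain ⟨ha, ha'⟩ := Finset.mem_filter.1 ha
    obtain ⟨hb, hb'⟩ := Finset.mem_filter.1 hb
    have hu : UniqueMul p.coeff.support q.coeff.support a b := by
      intro c d hc hd hcd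
      have h1 : φ (Additive.ofMul c) ≤ M := hp.2 ⟨c, hc, rfl⟩
      have h2 : φ (Additive.ofMul d) ≤ N := hq.2 ⟨d, hd, rfl⟩
      have h3 : φ (Additive.ofMul c) + φ (Additive.ofMul d) = M + N := by
        rw [← map_add, ← ofMul_mul, hcd, ofMul_mul, map_add, ha', hb']
      exact hab (Finset.mem_filter.2 ⟨hc, by linarith⟩) (Finset.mem_filter.2 ⟨hd, by linarith⟩) hcd
    refine ⟨a * b, ?_, ?_⟩
    · rw [Finset.mem_coe, Finsupp.mem_support_iff, MonoidAlgebra.coeff_mul_mul_of_uniqueMul hu]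
      exact mul_ne_zero (Finsupp.mem_support_iff.1 ha) (Finsupp.mem_support_iff.1 hb)
    · change φ (Additive.ofMul (a * b)) = M + N
      rw [ofMul_mul, map_add, ha', hb']
  · rintro _ ⟨f, hf, rfl⟩
    obtain ⟨c, hc, d, hd, rfl⟩ := Finset.mem_mul.1 (MonoidAlgebra.support_coeff_mul_subset _ _ hf)
    change φ (Additive.ofMul (c * d)) ≤ M + N
    rw [ofMul_mul, map_add]
    exact add_le_add (hp.2 ⟨c, hc, rfl⟩) (hq.2 ⟨d, hd, rfl⟩)

theorem isSupportMax_single (φ : Additive F →+ ℝ) (f : F) :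
    IsSupportMax φ (MonoidAlgebra.single f (1 : 𝔽)) (φ (Additive.ofMul f)) := by
  have : ((MonoidAlgebra.single f (1 : 𝔽)).coeff.support : Set F) = {f} := by
    rw [MonoidAlgebra.coeff_single, Finsupp.support_single _ one_ne_zero]
    exact Finset.coe_singleton f
  rw [IsSupportMax, this, Set.image_singleton]
  exact isGreatest_singleton

theorem IsSupportMax.add_neg_nonneg {φ : Additive F →+ ℝ} {p : MonoidAlgebra 𝔽 F} {M N : ℝ}
    (hM : IsSupportMax φ p M) (hN : IsSupportMax (-φ) p N) : 0 ≤ M + N := by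
  obtain ⟨f, hf, -⟩ := hM.1
  have h1 : φ (Additive.ofMul f) ≤ M := hM.2 ⟨f, hf, rfl⟩
  have h2 : -φ (Additive.ofMul f) ≤ N := hN.2 ⟨f, hf, rfl⟩
  linarith

/-- `φ` varies by `w` on the support of `p`. -/
def IsSupportWidth (φ : Additive F →+ ℝ) (p : MonoidAlgebra 𝔽 F) (w : ℝ) : Prop :=
  ∃ M N, IsSupportMax φ p M ∧ IsSupportMax (-φ) p N ∧ w = M + N

theorem exists_isSupportWidth (φ : Additive F →+ ℝ) {p : MonoidAlgebra 𝔽 F} (hp : p ≠ 0) :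
    ∃ w, IsSupportWidth φ p w := by
  obtain ⟨M, hM⟩ := exists_isSupportMax φ hp
  obtain ⟨N, hN⟩ := exists_isSupportMax (-φ) hp
  exact ⟨_, M, N, hM, hN, rfl⟩

theorem IsSupportWidth.nonneg {φ : Additive F →+ ℝ} {p : MonoidAlgebra 𝔽 F} {w : ℝ}
    (h : IsSupportWidth φ p w) : 0 ≤ w := by
  obtain ⟨M, N, hM, hN, rfl⟩ := h
  exact hM.add_neg_nonneg hN

theorem IsSupportWidth.unique {φ : Additive F →+ ℝ} {p : MonoidAlgebra 𝔽 F} {w w' : ℝ}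
    (h : IsSupportWidth φ p w) (h' : IsSupportWidth φ p w') : w = w' := by
  obtain ⟨M, N, hM, hN, rfl⟩ := h
  obtain ⟨M', N', hM', hN', rfl⟩ := h'
  rw [hM.unique hM', hN.unique hN']

theorem IsSupportWidth.mul [UniqueProds F] {φ : Additive F →+ ℝ} {p q : MonoidAlgebra 𝔽 F}
    {w w' : ℝ} (h : IsSupportWidth φ p w) (h' : IsSupportWidth φ q w') :
    IsSupportWidth φ (p * q) (w + w') := by
  obtain ⟨M, N, hM, hN, rfl⟩ := h
  obtain ⟨M', N', hM', hN', rfl⟩ := h'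
  exact ⟨_, _, hM.mul hM', hN.mul hN', by ring⟩

theorem isSupportWidth_single (φ : Additive F →+ ℝ) (f : F) :
    IsSupportWidth φ (MonoidAlgebra.single f (1 : 𝔽)) 0 :=
  ⟨_, _, isSupportMax_single φ f, isSupportMax_single (-φ) f, by simp⟩

/-- The widths of a unit and of its inverse are non-negative and add up to that of `1`. -/
theorem isSupportWidth_of_isUnit [UniqueProds F] (φ : Additive F →+ ℝ) {u : MonoidAlgebra 𝔽 F}
    (hu : IsUnit u) : IsSupportWidth φ u 0 := by
  obtain ⟨v, huv⟩ := hu.exists_right_inv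
  obtain ⟨w, hw⟩ := exists_isSupportWidth φ hu.ne_zero
  obtain ⟨w', hw'⟩ := exists_isSupportWidth φ (right_ne_zero_of_mul_eq_one huv)
  have h := hw.mul hw'
  rw [huv, MonoidAlgebra.one_def] at h
  have h0 := h.unique (isSupportWidth_single φ 1)
  have : w = 0 := by linarith [hw.nonneg, hw'.nonneg]
  rwa [this] at hw

theorem IsSupportWidth.of_associated [UniqueProds F] {φ : Additive F →+ ℝ}
    {p q : MonoidAlgebra 𝔽 F} {w : ℝ} (h : IsSupportWidth φ p w) (hpq : Associated p q) :
    IsSupportWidth φ q w := by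
  obtain ⟨u, rfl⟩ := hpq
  simpa using h.mul (isSupportWidth_of_isUnit φ u.isUnit)

/-- The Alexander norm is the width of the Alexander polynomial. -/
theorem alexanderNorm_eq {X : Type*} [TopologicalSpace X] {x₀ : X} {k : ℕ}
    (α : FundamentalGroup X x₀ →* GL (Fin k) 𝔽) (φ : RealH1 X x₀) {w : ℝ}
    (h : IsSupportWidth φ (alexanderPoly α 1) w) : alexanderNorm α φ = w := by
  obtain ⟨M, N, hM, hN, rfl⟩ := h
  refine IsGreatest.csSup_eq ⟨?_, ?_⟩
  · obtain ⟨f, hf, rfl⟩ := hM.1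
    obtain ⟨g, hg, rfl⟩ := hN.1
    exact ⟨f, hf, g, hg, (sub_eq_add_neg _ _).symm⟩
  · rintro _ ⟨f, hf, g, hg, rfl⟩
    have h1 : φ (Additive.ofMul f) ≤ M := hM.2 ⟨f, hf, rfl⟩
    have h2 : -φ (Additive.ofMul g) ≤ N := hN.2 ⟨g, hg, rfl⟩
    linarith

variable {E : Type*} [CommGroup E]

theorem coeff_mapDomain_support {ι : E →* F} (hι : Function.Injective ι) (p : MonoidAlgebra 𝔽 E) :
    ((MonoidAlgebra.mapDomainRingHom 𝔽 ι p).coeff.support : Set F) = ι '' p.coeff.support := by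
  classical
  have : (MonoidAlgebra.mapDomainRingHom 𝔽 ι p).coeff = Finsupp.mapDomain ι p.coeff := rfl
  rw [this, Finsupp.mapDomain_support_of_injective hι, Finset.coe_image]

theorem IsSupportMax.mapDomain {ι : E →* F} (hι : Function.Injective ι) {φ : Additive F →+ ℝ}
    {p : MonoidAlgebra 𝔽 E} {M : ℝ} (h : IsSupportMax (φ.comp ι.toAdditive) p M) :
    IsSupportMax φ (MonoidAlgebra.mapDomainRingHom 𝔽 ι p) M := by
  rw [IsSupportMax, coeff_mapDomain_support hι, Set.image_image]
  exact h

theorem IsSupportWidth.mapDomain {ι : E →* F} (hι : Function.Injective ι) {φ : Additive F →+ ℝ}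
    {p : MonoidAlgebra 𝔽 E} {w : ℝ} (h : IsSupportWidth (φ.comp ι.toAdditive) p w) :
    IsSupportWidth φ (MonoidAlgebra.mapDomainRingHom 𝔽 ι p) w := by
  obtain ⟨M, N, hM, hN, rfl⟩ := h
  exact ⟨M, N, hM.mapDomain hι, IsSupportMax.mapDomain hι hN, rfl⟩

/-- For an infinite cyclic group the width is a multiple of the degree. -/
theorem isSupportWidth_laurentDegree (e : Multiplicative ℤ ≃* E) {x : E}
    (hx : e (Multiplicative.ofAdd 1) = x) {p : MonoidAlgebra 𝔽 E} (hp : p ≠ 0)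
    (φ : Additive E →+ ℝ) :
    IsSupportWidth φ p (laurentDegree x p * |φ (Additive.ofMul x)|) := by
  have hex (f : E) : ∃ a : ℤ, x ^ a = f := by
    obtain ⟨a, rfl⟩ := e.surjective f
    refine ⟨a.toAdd, ?_⟩
    rw [← hx, ← map_zpow, ← ofAdd_zsmul, smul_eq_mul, mul_one, ofAdd_toAdd]
  have hxe (a : ℤ) : x ^ a = e (Multiplicative.ofAdd a) := by
    rw [← hx, ← map_zpow, ← ofAdd_zsmul, smul_eq_mul, mul_one]
  have hφ (a : ℤ) : φ (Additive.ofMul (x ^ a)) = a * φ (Additive.ofMul x) := by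
    rw [ofMul_zpow, map_zsmul, zsmul_eq_mul]
  let S : Finset ℤ := p.coeff.support.preimage (fun a : ℤ => x ^ a) fun a _ b _ h => by
    simpa [hxe] using h
  have hS (a : ℤ) : a ∈ S ↔ p.coeff (x ^ a) ≠ 0 := by
    exact Finset.mem_preimage.trans Finsupp.mem_support_iff
  have hne : S.Nonempty := by
    have : p.coeff.support.Nonempty := by
      rw [Finsupp.support_nonempty_iff]
      exact fun h => hp (MonoidAlgebra.coeff_eq_zero.1 h)
    obtain ⟨f, hf⟩ := this
    obtain ⟨a, rfl⟩ := hex f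
    exact ⟨a, (hS a).2 (Finsupp.mem_support_iff.1 hf)⟩
  obtain ⟨a, ha, ha'⟩ := S.exists_max_image id hne
  obtain ⟨b, hb, hb'⟩ := S.exists_min_image id hne
  simp only [id] at ha' hb'
  have hdeg : laurentDegree x p = a - b := by
    refine IsGreatest.csSup_eq ⟨⟨a, b, (hS a).1 ha, (hS b).1 hb, rfl⟩, ?_⟩
    rintro _ ⟨c, d, hc, hd, rfl⟩
    have h1 := ha' c ((hS c).2 hc)
    have h2 := hb' d ((hS d).2 hd)
    omega
  have hmax (ψ : Additive E →+ ℝ) (c : ℤ) (hc : c ∈ S)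
      (h : ∀ d ∈ S, ψ (Additive.ofMul (x ^ d)) ≤ ψ (Additive.ofMul (x ^ c))) :
      IsSupportMax ψ p (ψ (Additive.ofMul (x ^ c))) := by
    refine ⟨⟨x ^ c, Finsupp.mem_support_iff.2 ((hS c).1 hc), rfl⟩, ?_⟩
    rintro _ ⟨f, hf, rfl⟩
    obtain ⟨d, rfl⟩ := hex f
    exact h d ((hS d).2 (Finsupp.mem_support_iff.1 hf))
  have hle1 (d : ℤ) (hd : d ∈ S) : (d : ℝ) ≤ a := by exact_mod_cast ha' d hd
  have hle2 (d : ℤ) (hd : d ∈ S) : (b : ℝ) ≤ d := by exact_mod_cast hb' d hd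
  rw [hdeg]
  rcases le_total 0 (φ (Additive.ofMul x)) with h0 | h0
  · refine ⟨_, _, hmax φ a ha fun d hd => ?_, hmax (-φ) b hb fun d hd => ?_, ?_⟩
    · rw [hφ, hφ]
      exact mul_le_mul_of_nonneg_right (hle1 d hd) h0
    · rw [AddMonoidHom.neg_apply, AddMonoidHom.neg_apply, hφ, hφ]
      exact neg_le_neg (mul_le_mul_of_nonneg_right (hle2 d hd) h0)
    · rw [AddMonoidHom.neg_apply, hφ, hφ, abs_of_nonneg h0]
      push_cast
      ring
  · refine ⟨_, _, hmax φ b hb fun d hd => ?_, hmax (-φ) a ha fun d hd => ?_, ?_⟩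
    · rw [hφ, hφ]
      exact mul_le_mul_of_nonpos_right (hle2 d hd) h0
    · rw [AddMonoidHom.neg_apply, AddMonoidHom.neg_apply, hφ, hφ]
      exact neg_le_neg (mul_le_mul_of_nonpos_right (hle1 d hd) h0)
    · rw [AddMonoidHom.neg_apply, hφ, hφ, abs_of_nonpos h0]
      push_cast
      ring

theorem laurentDegree_zero (x : E) : laurentDegree x (0 : MonoidAlgebra 𝔽 E) = 0 := by
  have : {d : ℤ | ∃ a b : ℤ, (0 : MonoidAlgebra 𝔽 E).coeff (x ^ a) ≠ 0 ∧
      (0 : MonoidAlgebra 𝔽 E).coeff (x ^ b) ≠ 0 ∧ d = a - b} = ∅ := by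
    rw [Set.eq_empty_iff_forall_notMem]
    rintro d ⟨a, b, ha, -⟩
    exact ha rfl
  rw [laurentDegree, this, Int.csSup_empty]

/-- Nonzero Laurent polynomials in different variables are coprime: a common divisor has width zero
in both directions. -/
theorem isRelPrime_mapDomain [UniqueProds F] {E : Fin 2 → Type*} [∀ i, CommGroup (E i)]
    (ι : ∀ i, E i →* F) (hι : ∀ i, Function.Injective (ι i)) (ψ : Fin 2 → Additive F →+ ℝ)
    (hψ : ∀ f g, (∀ i, ψ i (Additive.ofMul f) = ψ i (Additive.ofMul g)) → f = g)
    (h0 : ∀ i j, i ≠ j → ∀ x, ψ i (Additive.ofMul (ι j x)) = 0)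
    (p : ∀ i, MonoidAlgebra 𝔽 (E i)) (hp : ∀ i, p i ≠ 0) :
    IsRelPrime (MonoidAlgebra.mapDomainRingHom 𝔽 (ι 0) (p 0))
      (MonoidAlgebra.mapDomainRingHom 𝔽 (ι 1) (p 1)) := by
  have hne (i) : MonoidAlgebra.mapDomainRingHom 𝔽 (ι i) (p i) ≠ 0 := fun h =>
    hp i (MonoidAlgebra.mapDomain_injective (hι i) 
      (h.trans (map_zero (MonoidAlgebra.mapDomainRingHom 𝔽 (ι i))).symm))
  have hw (i j) (hij : i ≠ j) :
      IsSupportWidth (ψ i) (MonoidAlgebra.mapDomainRingHom 𝔽 (ι j) (p j)) 0 := by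
    refine IsSupportWidth.mapDomain (hι j) ?_
    have hz : (ψ i).comp (ι j).toAdditive = 0 := AddMonoidHom.ext fun x => h0 i j hij x.toMul
    rw [hz]
    obtain ⟨w, hw⟩ := exists_isSupportWidth (0 : Additive (E j) →+ ℝ) (hp j)
    obtain ⟨M, N, hM, hN, rfl⟩ := id hw
    obtain ⟨f, hf, hfM⟩ := hM.1
    obtain ⟨g, hg, hgN⟩ := hN.1
    have : M + N = 0 := by
      rw [← hfM, ← hgN]
      simp
    rwa [this] at hw
  have hdiv (i j) (hij : i ≠ j) (d : MonoidAlgebra 𝔽 F)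
      (hd : d ∣ MonoidAlgebra.mapDomainRingHom 𝔽 (ι j) (p j)) : IsSupportWidth (ψ i) d 0 := by
    obtain ⟨c, hc⟩ := hd
    have hne' := hne j
    rw [hc] at hne'
    obtain ⟨w, hw1⟩ := exists_isSupportWidth (ψ i) (left_ne_zero_of_mul hne')
    obtain ⟨w', hw2⟩ := exists_isSupportWidth (ψ i) (right_ne_zero_of_mul hne')
    have h := hw1.mul hw2
    rw [← hc] at h
    have h0 := h.unique (hw i j hij)
    have : w = 0 := by linarith [hw1.nonneg, hw2.nonneg]
    rwa [this] at hw1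
  intro d hd0 hd1
  have hd (i) : IsSupportWidth (ψ i) d 0 := by
    fin_cases i
    · exact hdiv 0 1 (by decide) d hd1
    · exact hdiv 1 0 (by decide) d hd0
  -- a common divisor has a single monomial, hence is a unit
  have heq : ∀ f ∈ d.coeff.support, ∀ g ∈ d.coeff.support, f = g := by
    intro f hf g hg
    refine hψ f g fun i => ?_
    obtain ⟨M, N, hM, hN, h⟩ := hd i
    have h1 : ψ i (Additive.ofMul f) ≤ M := hM.2 ⟨f, hf, rfl⟩
    have h2 : -ψ i (Additive.ofMul f) ≤ N := hN.2 ⟨f, hf, rfl⟩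
    have h3 : ψ i (Additive.ofMul g) ≤ M := hM.2 ⟨g, hg, rfl⟩
    have h4 : -ψ i (Additive.ofMul g) ≤ N := hN.2 ⟨g, hg, rfl⟩
    linarith
  obtain ⟨M, N, hM, -⟩ := hd 0
  obtain ⟨f, hf, -⟩ := hM.1
  have hsingle : d = MonoidAlgebra.single f (d.coeff f) := by
    refine MonoidAlgebra.coeff_injective (Finsupp.ext fun g => ?_)
    rw [MonoidAlgebra.coeff_single]
    by_cases hg : d.coeff g = 0
    · rw [hg, Finsupp.single_eq_of_ne]
      rintro rfl
      exact Finsupp.mem_support_iff.1 hf hg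
    · rw [heq g (Finsupp.mem_support_iff.2 hg) f hf, Finsupp.single_eq_same]
  refine IsUnit.of_mul_eq_one (MonoidAlgebra.single f⁻¹ (d.coeff f)⁻¹) ?_
  rw [hsingle]
  simp only [MonoidAlgebra.coeff_single, Finsupp.single_eq_same]
  rw [MonoidAlgebra.single_mul_single, mul_inv_cancel, mul_inv_cancel₀ (Finsupp.mem_support_iff.1 hf),
    MonoidAlgebra.one_def]

end NewtonPolytope

/-! ### Characteristic polynomials -/

section Determinants

variable {𝔽 : Type*} [Field 𝔽] {F : Type*} [CommGroup F] {k : ℕ}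

/-- An element of infinite order is a transcendental variable of the group ring. -/
theorem coeff_aeval_single {x : F} (hx : Function.Injective fun n : ℕ => x ^ n)
    (p : Polynomial 𝔽) (n : ℕ) :
    (Polynomial.aeval (MonoidAlgebra.single x (1 : 𝔽)) p).coeff (x ^ n) = p.coeff n := by
  classical
  induction p using Polynomial.induction_on' with
  | add p q hp hq => rw [map_add, MonoidAlgebra.coeff_add, Finsupp.add_apply, hp, hq, Polynomial.coeff_add]
  | monomial m a =>
    rw [Polynomial.aeval_monomial, MonoidAlgebra.single_pow, one_pow, Polynomial.coeff_monomial,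
      MonoidAlgebra.coe_algebraMap]
    simp only [Function.comp_apply, Algebra.algebraMap_self, RingHom.id_apply]
    rw [MonoidAlgebra.single_mul_single, one_mul, mul_one, MonoidAlgebra.coeff_single,
      Finsupp.single_apply]
    exact if_congr hx.eq_iff rfl rfl

/-- Up to the unit `det A`, this determinant is the characteristic polynomial of `A⁻¹` at `x`. -/
theorem det_single_smul_sub_one_ne_zero {x : F} (hx : Function.Injective fun n : ℕ => x ^ n)
    (A : GL (Fin k) 𝔽) :
    Matrix.det (MonoidAlgebra.single x (1 : 𝔽) •
      A.val.map (algebraMap 𝔽 (MonoidAlgebra 𝔽 F)) - 1) ≠ 0 := by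
  have hchar : Polynomial.aeval (MonoidAlgebra.single x (1 : 𝔽)) (A⁻¹).val.charpoly =
      Matrix.det (MonoidAlgebra.single x (1 : 𝔽) • (1 : Matrix (Fin k) (Fin k) (MonoidAlgebra 𝔽 F)) -
        (A⁻¹).val.map (algebraMap 𝔽 (MonoidAlgebra 𝔽 F))) := by
    rw [Matrix.charpoly, AlgHom.map_det]
    congr 1
    ext a b
    by_cases hab : a = b
    · subst hab
      simp
    · simp [hab]
  have hne : Polynomial.aeval (MonoidAlgebra.single x (1 : 𝔽)) (A⁻¹).val.charpoly ≠ 0 := by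
    intro h
    refine (Matrix.charpoly_monic (A⁻¹).val).ne_zero (Polynomial.ext fun n => ?_)
    rw [← coeff_aeval_single hx, h]
    rfl
  intro h
  apply hne
  have hfac : MonoidAlgebra.single x (1 : 𝔽) • (1 : Matrix (Fin k) (Fin k) (MonoidAlgebra 𝔽 F)) -
      (A⁻¹).val.map (algebraMap 𝔽 (MonoidAlgebra 𝔽 F)) =
      (A⁻¹).val.map (algebraMap 𝔽 (MonoidAlgebra 𝔽 F)) * (MonoidAlgebra.single x (1 : 𝔽) •
      A.val.map (algebraMap 𝔽 (MonoidAlgebra 𝔽 F)) - 1) := by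
    rw [mul_sub, mul_one, Matrix.mul_smul, ← Matrix.map_mul, ← Units.val_mul, inv_mul_cancel,
      Units.val_one, Matrix.map_one _ (map_zero _) (map_one _)]
  rw [hchar, hfac, Matrix.det_mul, h, mul_zero]

end Determinants

/-! ### The unit ball -/

/-- A vertex of the ball of a weighted `ℓ¹`-norm is not a proper convex combination. -/
theorem eq_vertex_of_combination {a b r ε : ℝ} (ha : 0 < a) (hb : 0 < b) (hε : ε = 1 ∨ ε = -1)
    {s s' t t' u v : ℝ} (hu : 0 < u) (hv : 0 < v) (huv : u + v = 1)
    (h : a * |s| + b * |t| ≤ r) (h' : a * |s'| + b * |t'| ≤ r) (hs : u * s + v * s' = ε * (r / a)) :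
    s = ε * (r / a) ∧ t = 0 := by
  have hle (x y : ℝ) (hxy : a * |x| + b * |y| ≤ r) : ε * x ≤ r / a := by
    rw [le_div_iff₀ ha]
    have h1 : ε * x ≤ |x| := by
      rcases hε with rfl | rfl
      · rw [one_mul]
        exact le_abs_self x
      · rw [neg_one_mul]
        exact neg_le_abs x
    nlinarith [mul_nonneg hb.le (abs_nonneg y), mul_le_mul_of_nonneg_left h1 ha.le]
  have hεε : ε * ε = 1 := by rcases hε with rfl | rfl <;> norm_num
  have h1 := hle s t h
  have h2 := hle s' t' h'
  have h3 : u * (ε * s) + v * (ε * s') = r / a := by linear_combination ε * hs + (r / a) * hεε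
  have h4 : ε * s = r / a := by
    by_contra hne
    have hlt := mul_lt_mul_of_pos_left (lt_of_le_of_ne h1 hne) hu
    have hle' := mul_le_mul_of_nonneg_left h2 hv.le
    have : u * (r / a) + v * (r / a) = r / a := by rw [← add_mul, huv, one_mul]
    linarith
  have h5 : s = ε * (r / a) := by linear_combination ε * h4 - s * hεε
  refine ⟨h5, ?_⟩
  have h6 : r ≤ a * |s| := by
    rw [h5, abs_mul, show |ε| = 1 by rcases hε with rfl | rfl <;> simp, one_mul]
    have := mul_le_mul_of_nonneg_left (le_abs_self (r / a)) ha.le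
    rwa [mul_div_cancel₀ _ ha.ne'] at this
  have h7 : b * |t| ≤ 0 := by linarith
  exact abs_nonpos_iff.1 (nonpos_of_mul_nonpos_right h7 hb)

/-- A point of the open segment between opposite vertices is a proper convex combination. -/
theorem eq_vertex_of_extreme {a r s : ℝ} (ha : 0 < a) (hr : 0 < r) (hs : a * |s| ≤ r)
    (h : ∀ u v : ℝ, 0 < u → 0 < v → u + v = 1 → u * (r / a) + v * (-(r / a)) = s → s = r / a) :
    s = r / a ∨ s = -(r / a) := by
  have hra : 0 < r / a := div_pos hr ha
  have h1 : |s| ≤ r / a := by rwa [le_div_iff₀ ha, mul_comm]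
  obtain ⟨h2, h3⟩ := abs_le.1 h1
  by_contra! hne
  have h4 : s < r / a := lt_of_le_of_ne h3 hne.1
  have h5 : -(r / a) < s := lt_of_le_of_ne h2 hne.2.symm
  refine hne.1 (h ((1 + s / (r / a)) / 2) ((1 - s / (r / a)) / 2) ?_ ?_ (by ring) ?_)
  · have : -1 < s / (r / a) := by rw [lt_div_iff₀ hra]; linarith
    linarith
  · have : s / (r / a) < 1 := by rw [div_lt_one hra]; exact h4
    linarith
  · have : s / (r / a) * (r / a) = s := div_mul_cancel₀ _ hra.ne'
    linear_combination this

/-- The extreme points of the ball of a weighted `ℓ¹`-norm. -/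
theorem extremePoints_l1_ball {a b r : ℝ} (ha : 0 < a) (hb : 0 < b) (hr : 0 < r) :
    {q : ℝ × ℝ | a * |q.1| + b * |q.2| ≤ r}.extremePoints ℝ =
      {(r / a, 0), (-(r / a), 0), (0, r / b), (0, -(r / b))} := by
  have hra : a * (r / a) = r := mul_div_cancel₀ _ ha.ne'
  have hrb : b * (r / b) = r := mul_div_cancel₀ _ hb.ne'
  have hra0 : |r / a| = r / a := abs_of_pos (div_pos hr ha)
  have hrb0 : |r / b| = r / b := abs_of_pos (div_pos hr hb)
  ext ⟨s, t⟩
  rw [mem_extremePoints_iff_left]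
  simp only [Set.mem_insert_iff, Set.mem_singleton_iff, Prod.mk.injEq]
  constructor
  · rintro ⟨hq, hext⟩
    have hq : a * |s| + b * |t| ≤ r := hq
    by_cases ht : t = 0
    · subst ht
      rw [abs_zero, mul_zero, add_zero] at hq
      have hv := eq_vertex_of_extreme ha hr hq fun u v hu hv huv h => (congrArg Prod.fst
        (hext (r / a, 0) (by simp [hra0, hra]) (-(r / a), 0) (by simp [hra0, hra])
          ⟨u, v, hu, hv, huv, by simpa using h⟩)).symm
      rcases hv with h | h
      · exact Or.inl ⟨h, rfl⟩
      · exact Or.inr (Or.inl ⟨h, rfl⟩)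
    by_cases hs : s = 0
    · subst hs
      rw [abs_zero, mul_zero, zero_add] at hq
      have hv := eq_vertex_of_extreme hb hr hq fun u v hu hv huv h => (congrArg Prod.snd
        (hext (0, r / b) (by simp [hrb0, hrb]) (0, -(r / b)) (by simp [hrb0, hrb])
          ⟨u, v, hu, hv, huv, by simpa using h⟩)).symm
      rcases hv with h | h
      · exact Or.inr (Or.inr (Or.inl ⟨rfl, h⟩))
      · exact Or.inr (Or.inr (Or.inr ⟨rfl, h⟩))
    exfalso
    have h1 : 0 < a * |s| := mul_pos ha (abs_pos.2 hs)
    have h2 : 0 < b * |t| := mul_pos hb (abs_pos.2 ht)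
    -- a point off the axes lies between the points of the axes on the same sphere
    set n := a * |s| + b * |t| with hn
    have hnpos : 0 < n := by linarith
    have hu : 0 < a * |s| / n := div_pos h1 hnpos
    have hv : 0 < b * |t| / n := div_pos h2 hnpos
    refine ht (congrArg Prod.snd (hext (s / (a * |s| / n), 0) ?_ (0, t / (b * |t| / n)) ?_
      ⟨a * |s| / n, b * |t| / n, hu, hv, ?_, ?_⟩)).symm
    · change a * |s / (a * |s| / n)| + b * |(0 : ℝ)| ≤ r
      rw [abs_div, abs_of_pos hu, abs_zero, mul_zero, add_zero, ← mul_div_assoc,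
        div_div_cancel₀ h1.ne']
      exact hq
    · change a * |(0 : ℝ)| + b * |t / (b * |t| / n)| ≤ r
      rw [abs_div, abs_of_pos hv, abs_zero, mul_zero, zero_add, ← mul_div_assoc,
        div_div_cancel₀ h2.ne']
      exact hq
    · rw [← add_div, ← hn, div_self hnpos.ne']
    · refine Prod.ext ?_ ?_
      · simp [mul_div_cancel₀ _ hu.ne']
      · simp [mul_div_cancel₀ _ hv.ne']
  · have hV {x y ε : ℝ} (hε : ε = 1 ∨ ε = -1) (hx : x = ε * (r / a)) (hy : y = 0) :
        a * |x| + b * |y| ≤ r := by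
      rw [hx, hy, abs_mul, hra0]
      rcases hε with rfl | rfl <;> simp [hra]
    have hH {x y ε : ℝ} (hε : ε = 1 ∨ ε = -1) (hx : x = 0) (hy : y = ε * (r / b)) :
        a * |x| + b * |y| ≤ r := by
      rw [hx, hy, abs_mul, hrb0]
      rcases hε with rfl | rfl <;> simp [hrb]
    have h1 {ε : ℝ} (hε : ε = 1 ∨ ε = -1) (hx : s = ε * (r / a)) (hy : t = 0) :
        (s, t) ∈ {q : ℝ × ℝ | a * |q.1| + b * |q.2| ≤ r} ∧
        ∀ x₁ ∈ {q : ℝ × ℝ | a * |q.1| + b * |q.2| ≤ r},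
          ∀ x₂ ∈ {q : ℝ × ℝ | a * |q.1| + b * |q.2| ≤ r}, (s, t) ∈ openSegment ℝ x₁ x₂ →
            x₁ = (s, t) := by
      refine ⟨hV hε hx hy, ?_⟩
      rintro ⟨x, y⟩ hxy ⟨x', y'⟩ hxy' ⟨u, v, hu, hv, huv, h⟩
      have := eq_vertex_of_combination ha hb hε hu hv huv hxy hxy'
        ((congrArg Prod.fst h).trans hx)
      exact Prod.ext (this.1.trans hx.symm) (this.2.trans hy.symm)
    have h2 {ε : ℝ} (hε : ε = 1 ∨ ε = -1) (hx : s = 0) (hy : t = ε * (r / b)) :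
        (s, t) ∈ {q : ℝ × ℝ | a * |q.1| + b * |q.2| ≤ r} ∧
        ∀ x₁ ∈ {q : ℝ × ℝ | a * |q.1| + b * |q.2| ≤ r},
          ∀ x₂ ∈ {q : ℝ × ℝ | a * |q.1| + b * |q.2| ≤ r}, (s, t) ∈ openSegment ℝ x₁ x₂ →
            x₁ = (s, t) := by
      refine ⟨hH hε hx hy, ?_⟩
      rintro ⟨x, y⟩ hxy ⟨x', y'⟩ hxy' ⟨u, v, hu, hv, huv, h⟩
      have := eq_vertex_of_combination hb ha hε hu hv huv ((add_comm _ _).trans_le hxy)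
        ((add_comm _ _).trans_le hxy') ((congrArg Prod.snd h).trans hy)
      exact Prod.ext (this.2.trans hx.symm) (this.1.trans hy.symm)
    rintro (⟨hx, hy⟩ | ⟨hx, hy⟩ | ⟨hx, hy⟩ | ⟨hx, hy⟩)
    · exact h1 (Or.inl rfl) (by rw [hx, one_mul]) hy
    · exact h1 (Or.inr rfl) (by rw [hx, neg_one_mul]) hy
    · exact h2 (Or.inl rfl) hx (by rw [hy, one_mul])
    · exact h2 (Or.inr rfl) hx (by rw [hy, neg_one_mul])

/-! ### Orders and twisted actions -/

section TwistedAction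

theorem span_moduleOrder {R : Type*} [CommRing R] [IsPrincipalIdealRing R]
    (M : Type*) [AddCommGroup M] [Module R M] [Module.Finite R M] :
    fittingIdeal R M = Ideal.span {moduleOrder R M} := by
  obtain ⟨δ, hδ⟩ := (IsPrincipalIdealRing.principal (fittingIdeal R M)).principal
  have h : IsGcdOf (fittingIdeal R M) δ := by
    rw [hδ]
    exact isGcdOf_span δ
  exact hδ.trans ((isGcdOf_moduleOrder h).span_eq hδ).symm

theorem IsGcdOf.associated {R : Type*} [CommRing R] [IsDomain R] {𝔞 : Ideal R} {δ δ' : R}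
    (h : IsGcdOf 𝔞 δ) (h' : IsGcdOf 𝔞 δ') : Associated δ δ' :=
  Ideal.span_singleton_eq_span_singleton.1 (le_antisymm (h.2 _ h'.1) (h'.2 _ h.1))

/-- Over a principal ideal domain, the order of the derivations that vanish on `μ` is the product
of the order of `H₁` with `det(ρ(μ) - 1)`, divided by the order of `H₀`. -/
theorem exists_order_relDerivationModule {R : Type*} [CommRing R] [IsDomain R]
    [IsPrincipalIdealRing R] {k : ℕ} {X : Type*} [TopologicalSpace X] [PathConnectedSpace X]
    {x₀ : X} (ρ : FundamentalGroup X x₀ →* Module.End R (Fin k → R)) (μ : FundamentalGroup X x₀)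
    (hfin : Module.Finite R (TwistedHomology ρ 1)) (hdet : LinearMap.det (ρ μ - 1) ≠ 0) :
    Module.Finite R (RelDerivationModule ρ {μ}) ∧ ∃ Δ : R,
      Δ * moduleOrder R (TwistedHomology ρ 0) =
        moduleOrder R (TwistedHomology ρ 1) * LinearMap.det (ρ μ - 1) ∧
      fittingIdeal R (RelDerivationModule ρ {μ}) = Ideal.span {Δ} := by
  obtain ⟨e1⟩ := nonempty_twistedHomology_one_equiv ρ
  obtain ⟨e0⟩ := nonempty_twistedHomology_zero_equiv ρ
  have hfin1 : Module.Finite R (LinearMap.ker (augmentation ρ)) := Module.Finite.equiv e1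
  have hfin0 : Module.Finite R (TwistedHomology ρ 0) := Module.Finite.equiv e0.symm
  obtain ⟨hfinR, h⟩ := fittingIdeal_relDerivationModule ρ μ hdet
  refine ⟨hfinR, ?_⟩
  rw [← fittingIdeal_congr e0, ← fittingIdeal_congr e1, span_moduleOrder (TwistedHomology ρ 0),
    span_moduleOrder (TwistedHomology ρ 1)] at h
  obtain ⟨δ, hδ⟩ := (IsPrincipalIdealRing.principal (fittingIdeal R
    (RelDerivationModule ρ {μ}))).principal
  rw [hδ] at h
  change Ideal.span {δ} * _ = _ at h
  rw [Ideal.span_singleton_mul_span_singleton, Ideal.span_singleton_mul_span_singleton,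
    Ideal.span_singleton_eq_span_singleton] at h
  obtain ⟨u, hu⟩ := h
  refine ⟨δ * u, ?_, ?_⟩
  · rw [← hu]
    ring
  · rw [hδ]
    exact (Ideal.span_singleton_mul_right_unit u.isUnit δ).symm

variable {𝔽 : Type*} [Field 𝔽] {k : ℕ} {X : Type*} [TopologicalSpace X] {x₀ : X} {F : Type*}
  [CommGroup F]

theorem det_twistedAction_sub_one (α : FundamentalGroup X x₀ →* GL (Fin k) 𝔽)
    (ψ : FundamentalGroup X x₀ →* F) (g : FundamentalGroup X x₀) :
    LinearMap.det (twistedAction α ψ g - 1) =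
      Matrix.det (MonoidAlgebra.single (ψ g) (1 : 𝔽) •
        (α g).val.map (algebraMap 𝔽 (MonoidAlgebra 𝔽 F)) - 1) := by
  rw [← LinearMap.det_toLin']
  congr 1
  rw [map_sub, map_smul, Matrix.toLin'_one]
  rfl

theorem twistedAction_apply (α : FundamentalGroup X x₀ →* GL (Fin k) 𝔽)
    (ψ : FundamentalGroup X x₀ →* F) (g : FundamentalGroup X x₀) (v : Fin k → MonoidAlgebra 𝔽 F) :
    twistedAction α ψ g v = MonoidAlgebra.single (ψ g) (1 : 𝔽) •
      ((α g).val.map (algebraMap 𝔽 (MonoidAlgebra 𝔽 F))).mulVec v := rfl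

theorem mapDomainRingHom_comp_algebraMap {E : Type*} [CommGroup E] (ι : E →* F) (a : 𝔽) :
    MonoidAlgebra.mapDomainRingHom 𝔽 ι (algebraMap 𝔽 (MonoidAlgebra 𝔽 E) a) =
      algebraMap 𝔽 (MonoidAlgebra 𝔽 F) a :=
  (MonoidAlgebra.mapDomainAlgHom 𝔽 𝔽 ι).commutes a

theorem mapDomainRingHom_det {E : Type*} [CommGroup E] (ι : E →* F) (x : E) (A : GL (Fin k) 𝔽) :
    MonoidAlgebra.mapDomainRingHom 𝔽 ι (Matrix.det (MonoidAlgebra.single x (1 : 𝔽) •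
        A.val.map (algebraMap 𝔽 (MonoidAlgebra 𝔽 E)) - 1)) =
      Matrix.det (MonoidAlgebra.single (ι x) (1 : 𝔽) •
        A.val.map (algebraMap 𝔽 (MonoidAlgebra 𝔽 F)) - 1) := by
  rw [RingHom.map_det, map_sub, map_one]
  congr 2
  ext a b
  simp only [RingHom.mapMatrix_apply, Matrix.map_apply, Matrix.smul_apply, smul_eq_mul, map_mul,
    mapDomainRingHom_comp_algebraMap]
  rw [MonoidAlgebra.mapDomainRingHom_apply, MonoidAlgebra.mapDomain_single]

/-- Base change with a conjugation by an invertible matrix. -/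
theorem relDerivationModule_baseChange_matrix {R S G : Type*} [CommRing R] [CommRing S]
    [Algebra R S] [Group G] (ρ : G →* Module.End R (Fin k → R))
    (ρ' : G →* Module.End S (Fin k → S)) {A A' : Matrix (Fin k) (Fin k) S} (h : A * A' = 1)
    (h' : A' * A = 1)
    (hA : ∀ g v, ρ' g (A.mulVec (mapVec R S _ v)) = A.mulVec (mapVec R S _ (ρ g v))) (T : Set G)
    {s r : ℕ} (p : (Fin s → R) →ₗ[R] RelDerivationModule ρ T) (hp : Function.Surjective p)
    (P : Matrix (Fin r) (Fin s) R) (hP : LinearMap.ker p = Submodule.span R (Set.range P)) :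
    ∃ q : (Fin s → S) →ₗ[S] RelDerivationModule ρ' T, Function.Surjective q ∧
      LinearMap.ker q = Submodule.span S (Set.range (P.map (algebraMap R S))) := by
  refine relDerivationModule_baseChange ρ ρ' (Matrix.toLin'OfInv h' h) (fun g v => ?_) T p hp P hP
  have e (w) : Matrix.toLin'OfInv h' h w = A.mulVec w := Matrix.toLin'_apply _ _
  rw [e, e, hA]

/-- Restriction along `θ`, with a conjugation, is a base change of twisted actions. -/
theorem exists_presentation_twistedAction {Y : Type*} [TopologicalSpace Y] {y₀ : Y}
    {E : Type*} [CommGroup E] (ι : E →* F) (θ : FundamentalGroup Y y₀ →* FundamentalGroup X x₀)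
    (β : FundamentalGroup Y y₀ →* GL (Fin k) 𝔽) (ψ' : FundamentalGroup Y y₀ →* E)
    (α : FundamentalGroup X x₀ →* GL (Fin k) 𝔽) (ψ : FundamentalGroup X x₀ →* F)
    (hψ : ∀ g, ψ (θ g) = ι (ψ' g)) (A : GL (Fin k) 𝔽) (hA : ∀ g, α (θ g) * A = A * β g)
    (T : Set (FundamentalGroup Y y₀)) {s : ℕ}
    (p : (Fin s → MonoidAlgebra 𝔽 E) →ₗ[MonoidAlgebra 𝔽 E]
      RelDerivationModule (twistedAction β ψ') T) (hp : Function.Surjective p)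
    (P : Matrix (Fin s) (Fin s) (MonoidAlgebra 𝔽 E))
    (hP : LinearMap.ker p = Submodule.span (MonoidAlgebra 𝔽 E) (Set.range P)) :
    ∃ q : (Fin s → MonoidAlgebra 𝔽 F) →ₗ[MonoidAlgebra 𝔽 F]
        RelDerivationModule ((twistedAction α ψ).comp θ) T, Function.Surjective q ∧
      LinearMap.ker q = Submodule.span (MonoidAlgebra 𝔽 F)
        (Set.range (P.map (MonoidAlgebra.mapDomainRingHom 𝔽 ι))) := by
  let alg : Algebra (MonoidAlgebra 𝔽 E) (MonoidAlgebra 𝔽 F) :=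
    (MonoidAlgebra.mapDomainRingHom 𝔽 ι).toAlgebra
  have halg (x) : algebraMap (MonoidAlgebra 𝔽 E) (MonoidAlgebra 𝔽 F) x =
    MonoidAlgebra.mapDomainRingHom 𝔽 ι x := rfl
  let c := algebraMap 𝔽 (MonoidAlgebra 𝔽 F)
  have hinv (B C : GL (Fin k) 𝔽) (h : B * C = 1) : B.val.map c * C.val.map c = 1 := by
    rw [← Matrix.map_mul, ← Units.val_mul, h, Units.val_one,
      Matrix.map_one _ (map_zero _) (map_one _)]
  have hv (g) (v : Fin k → MonoidAlgebra 𝔽 E) :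
      mapVec (MonoidAlgebra 𝔽 E) (MonoidAlgebra 𝔽 F) _ (twistedAction β ψ' g v) =
      MonoidAlgebra.single (ψ (θ g)) (1 : 𝔽) • ((β g).val.map c).mulVec
        (mapVec (MonoidAlgebra 𝔽 E) (MonoidAlgebra 𝔽 F) _ v) := by
    ext1 a
    have hβ : ((β g).val.map (algebraMap 𝔽 (MonoidAlgebra 𝔽 E))).map
        (MonoidAlgebra.mapDomainRingHom 𝔽 ι) = (β g).val.map c :=
      Matrix.ext fun a b => mapDomainRingHom_comp_algebraMap ι ((β g).val a b)
    rw [mapVec_apply, twistedAction_apply, Pi.smul_apply, Pi.smul_apply, smul_eq_mul, smul_eq_mul,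
      halg, map_mul, RingHom.map_mulVec, hψ, MonoidAlgebra.mapDomainRingHom_apply,
      MonoidAlgebra.mapDomain_single, hβ]
    rfl
  refine relDerivationModule_baseChange_matrix (twistedAction β ψ') ((twistedAction α ψ).comp θ)
    (hinv A A⁻¹ (mul_inv_cancel A)) (hinv A⁻¹ A (inv_mul_cancel A)) (fun g v => ?_) T p hp P hP
  rw [hv, MonoidHom.comp_apply, twistedAction_apply, Matrix.mulVec_smul,
    Matrix.mulVec_mulVec, Matrix.mulVec_mulVec, ← Matrix.map_mul, ← Units.val_mul, hA,
    Units.val_mul, Matrix.map_mul]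

end TwistedAction

namespace HopfLikeLink

variable (L : HopfLikeLink)

section Knot

/-- The ring `𝔽[xᵢ^{±1}]`. -/
abbrev KnotRing (𝔽 : Type*) [Field 𝔽] (i : Fin 2) : Type _ :=
  MonoidAlgebra 𝔽 (FreeH1 (L.knot i).exterior (L.pieceToKnot i (L.basePoint i)))

/-- The derivations of the group of `Kᵢ` that vanish on the meridian. -/
abbrev KnotModule {𝔽 : Type*} [Field 𝔽] {k : ℕ} (i : Fin 2)
    (β : FundamentalGroup (L.knot i).exterior (L.pieceToKnot i (L.basePoint i)) →*
      GL (Fin k) 𝔽) : Type _ :=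
  RelDerivationModule (twistedAction β (toFreeH1 _ _)) {L.knotMeridian i}

variable {𝔽 : Type*} [Field 𝔽] {k : ℕ} (i : Fin 2)
  (β : FundamentalGroup (L.knot i).exterior (L.pieceToKnot i (L.basePoint i)) →* GL (Fin k) 𝔽)

theorem knotVariable_pow_injective : Function.Injective fun n : ℕ => L.knotVariable i ^ n := by
  obtain ⟨e, he⟩ := L.exists_freeH1_knot_equiv i
  intro m n h
  simp only [← he, ← map_pow] at h
  have h1 := congrArg Multiplicative.toAdd (e.injective h)
  simpa using h1

theorem meridianDet_ne_zero : L.meridianDet i β ≠ 0 :=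
  det_single_smul_sub_one_ne_zero (L.knotVariable_pow_injective i) _

/-- The factor `Δᵢ` is the order of the relative derivation module of the knot group. -/
theorem exists_isFactor (hΔ : alexanderPoly β 1 ≠ 0) :
    Module.Finite (L.KnotRing 𝔽 i) (L.KnotModule i β) ∧ ∃ Δ, L.IsFactor i β Δ ∧
      fittingIdeal (L.KnotRing 𝔽 i) (L.KnotModule i β) = Ideal.span {Δ} := by
  obtain ⟨e, he⟩ := L.exists_freeH1_knot_equiv i
  have := uniqueProds_of_equiv_int e
  have := isPrincipalIdealRing_groupRing (𝔽 := 𝔽) e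
  have hdet : LinearMap.det (twistedAction β (toFreeH1 _ _) (L.knotMeridian i) - 1) =
      L.meridianDet i β := det_twistedAction_sub_one _ _ _
  obtain ⟨hfin, Δ, h, hΔ'⟩ := exists_order_relDerivationModule (twistedAction β (toFreeH1 _ _))
    (L.knotMeridian i) (isOrderOf_moduleOrder hΔ).finite (hdet ▸ L.meridianDet_ne_zero i β)
  rw [hdet] at h
  refine ⟨hfin, Δ, ⟨fun h0 => ?_, h⟩, hΔ'⟩
  rw [alexanderPoly] at h0
  rw [h0, mul_zero] at h
  exact mul_ne_zero hΔ (L.meridianDet_ne_zero i β) h.symm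

/-- The factor is determined by the defining equation, as the denominator is non-zero. -/
theorem IsFactor.fittingIdeal_eq {L : HopfLikeLink} {i : Fin 2}
    {β : FundamentalGroup (L.knot i).exterior (L.pieceToKnot i (L.basePoint i)) →* GL (Fin k) 𝔽}
    {Δ} (h : L.IsFactor i β Δ) (hΔ : alexanderPoly β 1 ≠ 0) :
    fittingIdeal (L.KnotRing 𝔽 i) (L.KnotModule i β) = Ideal.span {Δ} := by
  obtain ⟨e, he⟩ := L.exists_freeH1_knot_equiv i
  have := uniqueProds_of_equiv_int e
  obtain ⟨-, Δ', h', hf⟩ := L.exists_isFactor i β hΔ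
  rw [hf, mul_right_cancel₀ h.1 (h'.2.trans h.2.symm)]

/-- A representation of rank zero has a factor of degree zero. -/
theorem IsFactor.laurentDegree_eq_zero {L : HopfLikeLink} {i : Fin 2}
    {β : FundamentalGroup (L.knot i).exterior (L.pieceToKnot i (L.basePoint i)) →* GL (Fin k) 𝔽}
    {Δ} (h : L.IsFactor i β Δ) (hΔ : alexanderPoly β 1 ≠ 0) (hk : k = 0) :
    laurentDegree (L.knotVariable i) Δ = 0 := by
  subst hk
  obtain ⟨e, he⟩ := L.exists_freeH1_knot_equiv i
  have := uniqueProds_of_equiv_int e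
  have hsub : Subsingleton (L.KnotModule i β) := (Submodule.mkQ_surjective _).comp
    (Submodule.mkQ_surjective _) |>.subsingleton
  have hu : IsUnit Δ := by
    rw [← Ideal.span_singleton_eq_top, ← h.fittingIdeal_eq hΔ,
      fittingIdeal_eq_top_of_subsingleton]
  let φ : Additive (FreeH1 (L.knot i).exterior (L.pieceToKnot i (L.basePoint i))) →+ ℝ :=
    { toFun := fun x => (e.symm x.toMul).toAdd
      map_zero' := by simp
      map_add' := fun x y => by simp }
  have hφ : φ (Additive.ofMul (L.knotVariable i)) = 1 := by
    change ((e.symm (L.knotVariable i)).toAdd : ℝ) = 1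
    rw [← he, MulEquiv.symm_apply_apply]
    simp
  have h1 := (isSupportWidth_laurentDegree e he hu.ne_zero φ).unique (isSupportWidth_of_isUnit φ hu)
  rw [hφ, abs_one, mul_one] at h1
  exact_mod_cast h1

end Knot

end HopfLikeLink

/-! ### The order of the twisted homology of the link exterior -/

universe u

/-- For an amalgam along commuting elements with coprime determinants, the order of the first
twisted homology is the product of the orders of the relative derivation modules of the factors. -/
theorem associated_moduleOrder_of_isAmalgam {X : Type} [TopologicalSpace X] [PathConnectedSpace X]
    {x₀ : X} {G : Fin 2 → Type} [∀ i, Group (G i)] {μ : ∀ i, G i}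
    {θ : ∀ i, G i →* FundamentalGroup X x₀} (h : IsAmalgam.{u} μ θ) {R : Type u} [CommRing R]
    [IsDomain R] [UniqueFactorizationMonoid R] [IsNoetherianRing R] {k : ℕ}
    (ρ : FundamentalGroup X x₀ →* Module.End R (Fin k → R))
    (hne : LinearMap.det (ρ (θ 1 (μ 1)) - 1) ≠ 0)
    (hrel : IsRelPrime (LinearMap.det (ρ (θ 0 (μ 0)) - 1)) (LinearMap.det (ρ (θ 1 (μ 1)) - 1)))
    {s t : ℕ} (p : (Fin s → R) →ₗ[R] RelDerivationModule (ρ.comp (θ 0)) {μ 0})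
    (hp : Function.Surjective p) (P : Matrix (Fin s) (Fin s) R)
    (hP : LinearMap.ker p = Submodule.span R (Set.range P))
    (q : (Fin t → R) →ₗ[R] RelDerivationModule (ρ.comp (θ 1)) {μ 1})
    (hq : Function.Surjective q) (Q : Matrix (Fin t) (Fin t) R)
    (hQ : LinearMap.ker q = Submodule.span R (Set.range Q)) :
    Associated (P.det * Q.det) (moduleOrder R (TwistedHomology ρ 1)) := by
  obtain ⟨e⟩ := h.nonempty_relDerivationModule_equiv ρ
  have hfin0 := Module.Finite.of_surjective p hp
  have hfin1 := Module.Finite.of_surjective q hq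
  have hfin : Module.Finite R (RelDerivationModule ρ {θ 0 (μ 0), θ 1 (μ 1)}) :=
    Module.Finite.equiv e.symm
  have hδ : fittingIdeal R (RelDerivationModule ρ {θ 0 (μ 0), θ 1 (μ 1)}) =
      Ideal.span {P.det * Q.det} := by
    rw [fittingIdeal_congr e]
    exact exists_square_presentation_of_exact (LinearMap.inl R _ _) (LinearMap.snd R _ _)
      LinearMap.snd_surjective (LinearMap.range_inl R _ _).symm LinearMap.inl_injective
      p hp P hP q hq Q hQ
  obtain ⟨hfinK, hgcd⟩ := isGcdOf_fittingIdeal_ker_augmentation ρ h.commute hne hrel hδ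
  obtain ⟨e1⟩ := nonempty_twistedHomology_one_equiv ρ
  have hfinH : Module.Finite R (TwistedHomology ρ 1) := Module.Finite.equiv e1.symm
  rw [← fittingIdeal_congr e1] at hgcd
  exact hgcd.associated (isGcdOf_moduleOrder hgcd)

namespace HopfLikeLink

variable (L : HopfLikeLink) {x₀ : L.exterior}
  (γ : ∀ i, Path x₀ (L.pieceToExterior i (L.basePoint i)))

/-- The embedding `FH₁(X(Kᵢ)) → FH₁(X(L))` that maps `xᵢ` to `xᵢ`. -/
def variableHom (i : Fin 2) :
    FreeH1 (L.knot i).exterior (L.pieceToKnot i (L.basePoint i)) →* FreeH1 L.exterior x₀ :=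
  (zpowersHom _ (L.linkVariable i (γ i))).comp
    (L.exists_freeH1_knot_equiv i).choose.symm.toMonoidHom

theorem variableHom_knotVariable (i : Fin 2) :
    L.variableHom γ i (L.knotVariable i) = L.linkVariable i (γ i) := by
  have he := (L.exists_freeH1_knot_equiv i).choose_spec
  change zpowersHom _ (L.linkVariable i (γ i))
    ((L.exists_freeH1_knot_equiv i).choose.symm (L.knotVariable i)) = _
  rw [(MulEquiv.symm_apply_eq _).2 he.symm]
  exact zpow_one (L.linkVariable i (γ i))

theorem variableHom_toFreeH1 (i : Fin 2) (γ' : Path x₀ (L.pieceToExterior i (L.basePoint i)))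
    (g : FundamentalGroup (L.knot i).exterior (L.pieceToKnot i (L.basePoint i))) :
    toFreeH1 _ _ (L.knotHom i γ' g) = L.variableHom γ i (toFreeH1 _ _ g) := by
  rw [L.toFreeH1_knotHom γ, L.toFreeH1_knot, map_zpow, variableHom_knotVariable]

/-- Cohomology classes of `X(L)` are determined by their values on the two meridians, which are
arbitrary. -/
theorem exists_realH1 (c : Fin 2 → ℝ) :
    ∃ φ : RealH1 L.exterior x₀, ∀ i, φ (Additive.ofMul (L.linkVariable i (γ i))) = c i := by
  obtain ⟨φ, hφ⟩ := (L.coordinates_bijective γ).2 (c 0, c 1)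
  refine ⟨φ, fun i => ?_⟩
  fin_cases i
  · exact congrArg Prod.fst hφ
  · exact congrArg Prod.snd hφ

theorem exists_zpow_variable (i : Fin 2)
    (x : FreeH1 (L.knot i).exterior (L.pieceToKnot i (L.basePoint i))) :
    ∃ a : ℤ, x = L.knotVariable i ^ a := by
  obtain ⟨g, rfl⟩ := toFreeH1_surjective x
  exact ⟨_, L.toFreeH1_knot i g⟩

theorem variableHom_injective (i : Fin 2) : Function.Injective (L.variableHom γ i) := by
  rw [injective_iff_map_eq_one]
  intro x hx
  obtain ⟨a, rfl⟩ := L.exists_zpow_variable i x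
  obtain ⟨φ, hφ⟩ := L.exists_realH1 γ fun _ => 1
  rw [map_zpow, variableHom_knotVariable] at hx
  have h := congrArg (fun y => φ (Additive.ofMul y)) hx
  simp only [ofMul_zpow, map_zsmul, hφ, ofMul_one, map_zero, mul_one, zsmul_eq_mul,
    Int.cast_eq_zero] at h
  rw [h, zpow_zero]

theorem linkVariable_pow_injective (i : Fin 2) :
    Function.Injective fun n : ℕ => L.linkVariable i (γ i) ^ n := by
  intro m n h
  simp only [← variableHom_knotVariable, ← map_pow] at h
  exact L.knotVariable_pow_injective i (L.variableHom_injective γ i h)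

variable {𝔽 : Type u} [Field 𝔽] {k : ℕ} (α : FundamentalGroup L.exterior x₀ →* GL (Fin k) 𝔽)

theorem uniqueProds_freeH1 (γ : ∀ i, Path x₀ (L.pieceToExterior i (L.basePoint i))) :
    UniqueProds (FreeH1 L.exterior x₀) := by
  obtain ⟨e, -⟩ := L.exists_freeH1_link_equiv γ
  exact uniqueProds_of_equiv_int_prod e

/-- The determinants of the two meridians involve different variables. -/
theorem isRelPrime_det (A : Fin 2 → GL (Fin k) 𝔽) :
    IsRelPrime
      (Matrix.det (MonoidAlgebra.single (L.linkVariable 0 (γ 0)) (1 : 𝔽) •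
        (A 0).val.map (algebraMap 𝔽 (MonoidAlgebra 𝔽 (FreeH1 L.exterior x₀))) - 1))
      (Matrix.det (MonoidAlgebra.single (L.linkVariable 1 (γ 1)) (1 : 𝔽) •
        (A 1).val.map (algebraMap 𝔽 (MonoidAlgebra 𝔽 (FreeH1 L.exterior x₀))) - 1)) := by
  have := L.uniqueProds_freeH1 γ
  obtain ⟨e, he⟩ := L.exists_freeH1_link_equiv γ
  have hex (j : Fin 2) := L.exists_realH1 γ fun i => if j = i then 1 else 0
  choose ψ hψ using hex
  have hval (j : Fin 2) (a) : ψ j (Additive.ofMul (e a)) =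
      if j = 0 then (a.1.toAdd : ℝ) else a.2.toAdd := by
    rw [he, ofMul_mul, map_add, ofMul_zpow, ofMul_zpow, map_zsmul, map_zsmul, hψ, hψ]
    fin_cases j <;> simp
  rw [← L.variableHom_knotVariable γ, ← L.variableHom_knotVariable γ, ← mapDomainRingHom_det,
    ← mapDomainRingHom_det]
  have hinj (f g) (h : ∀ i, ψ i (Additive.ofMul f) = ψ i (Additive.ofMul g)) : f = g := by
    obtain ⟨a, rfl⟩ := e.surjective f
    obtain ⟨b, rfl⟩ := e.surjective g
    have h0 := h 0
    have h1 := h 1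
    rw [hval, hval] at h0 h1
    simp only [if_true, one_ne_zero, if_false, Int.cast_inj] at h0 h1
    exact congrArg e (Prod.ext (Multiplicative.toAdd.injective h0)
      (Multiplicative.toAdd.injective h1))
  have hzero (i j : Fin 2) (hij : i ≠ j) (x) : ψ i (Additive.ofMul (L.variableHom γ j x)) = 0 := by
    obtain ⟨a, rfl⟩ := L.exists_zpow_variable j x
    rw [map_zpow, variableHom_knotVariable, ofMul_zpow, map_zsmul, hψ, if_neg hij, smul_zero]
  have hne (i : Fin 2) : Matrix.det (MonoidAlgebra.single (L.knotVariable i) (1 : 𝔽) •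
      (A i).val.map (algebraMap 𝔽 (L.KnotRing 𝔽 i)) - 1) ≠ 0 :=
    det_single_smul_sub_one_ne_zero (L.knotVariable_pow_injective i) (A i)
  have h := isRelPrime_mapDomain
    (E := fun i => FreeH1 (L.knot i).exterior (L.pieceToKnot i (L.basePoint i)))
    (L.variableHom γ) (L.variableHom_injective γ) ψ hinj hzero _ hne
  exact h

variable {β : ∀ i, FundamentalGroup (L.knot i).exterior (L.pieceToKnot i (L.basePoint i)) →*
      GL (Fin k) 𝔽}

/-- An induced representation is, up to conjugation, the restriction of `α` along `knotHom` for any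
choice of path. -/
theorem IsInducedRep.exists_conj {L : HopfLikeLink} {x₀ : L.exterior} {i : Fin 2}
    {γ : Path x₀ (L.pieceToExterior i (L.basePoint i))}
    {α : FundamentalGroup L.exterior x₀ →* GL (Fin k) 𝔽}
    {β : FundamentalGroup (L.knot i).exterior (L.pieceToKnot i (L.basePoint i)) →* GL (Fin k) 𝔽}
    (h : L.IsInducedRep i γ α β) (γ' : Path x₀ (L.pieceToExterior i (L.basePoint i))) :
    ∃ A : GL (Fin k) 𝔽, ∀ g, α (L.knotHom i γ' g) * A = A * β g := by
  obtain ⟨c, hc⟩ := L.exists_pieceHom_conj i γ γ'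
  refine ⟨α c, fun g => ?_⟩
  obtain ⟨g, rfl⟩ := (L.pieceEquiv i).surjective g
  have hg : L.pieceEquiv i g = FundamentalGroup.map (L.pieceToKnot i) _ g := rfl
  have hβ : β (FundamentalGroup.map (L.pieceToKnot i) _ g) = α (L.pieceHom i γ g) :=
    DFunLike.congr_fun h g
  rw [hg, knotHom_map, hβ, hc, ← map_mul, ← map_mul, inv_mul_cancel_right]

/-- Over the group ring of the link the relative derivation module of a knot group has a square
presentation whose determinant is the factor `Δᵢ`, in the variable of the link. -/
theorem exists_presentation_factor {i : Fin 2}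
    {β : FundamentalGroup (L.knot i).exterior (L.pieceToKnot i (L.basePoint i)) →* GL (Fin k) 𝔽}
    (hβ : L.IsInducedRep i (γ i) α β) (hΔ : alexanderPoly β 1 ≠ 0) {Δ : L.KnotRing 𝔽 i}
    (hf : L.IsFactor i β Δ) (γ' : Path x₀ (L.pieceToExterior i (L.basePoint i))) :
    ∃ (s : ℕ) (q : (Fin s → MonoidAlgebra 𝔽 (FreeH1 L.exterior x₀)) →ₗ[
        MonoidAlgebra 𝔽 (FreeH1 L.exterior x₀)]
        RelDerivationModule ((twistedAction α (toFreeH1 L.exterior x₀)).comp (L.knotHom i γ'))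
          {L.knotMeridian i})
      (Q : Matrix (Fin s) (Fin s) (MonoidAlgebra 𝔽 (FreeH1 L.exterior x₀))),
      Function.Surjective q ∧ LinearMap.ker q = Submodule.span _ (Set.range Q) ∧
      Associated Q.det (MonoidAlgebra.mapDomainRingHom 𝔽 (L.variableHom γ i) Δ) := by
  obtain ⟨e, -⟩ := L.exists_freeH1_knot_equiv i
  have := uniqueProds_of_equiv_int e
  have := isPrincipalIdealRing_groupRing (𝔽 := 𝔽) e
  obtain ⟨hfin, -⟩ := L.exists_isFactor i β hΔ
  obtain ⟨s, p, P, hp, hP⟩ := exists_square_presentation (R := L.KnotRing 𝔽 i)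
    (M := L.KnotModule i β)
  obtain ⟨A, hA⟩ := hβ.exists_conj γ'
  have hq := exists_presentation_twistedAction (L.variableHom γ i) (L.knotHom i γ') β
    (toFreeH1 (L.knot i).exterior (L.pieceToKnot i (L.basePoint i))) α (toFreeH1 L.exterior x₀)
    (L.variableHom_toFreeH1 γ i γ') A hA {L.knotMeridian i} p hp P hP
  obtain ⟨q, hq, hQ⟩ := hq
  refine ⟨s, q, P.map (MonoidAlgebra.mapDomainRingHom 𝔽 (L.variableHom γ i)), hq, hQ, ?_⟩
  have h1 := fittingIdeal_of_square p hp P hP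
  rw [hf.fittingIdeal_eq hΔ, Ideal.span_singleton_eq_span_singleton] at h1
  have h2 := h1.symm.map (MonoidAlgebra.mapDomainRingHom 𝔽 (L.variableHom γ i))
  have h3 : MonoidAlgebra.mapDomainRingHom 𝔽 (L.variableHom γ i) P.det =
      (P.map (MonoidAlgebra.mapDomainRingHom 𝔽 (L.variableHom γ i))).det := RingHom.map_det _ P
  rw [h3] at h2
  exact h2

/-- The twisted Alexander polynomial of the link is the product of the two factors. -/
theorem associated_alexanderPoly (hβ : ∀ i, L.IsInducedRep i (γ i) α (β i))
    (hΔ : ∀ i, alexanderPoly (β i) 1 ≠ 0) {Δ : ∀ i, L.KnotRing 𝔽 i}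
    (hf : ∀ i, L.IsFactor i (β i) (Δ i)) :
    Associated (MonoidAlgebra.mapDomainRingHom 𝔽 (L.variableHom γ 0) (Δ 0) *
        MonoidAlgebra.mapDomainRingHom 𝔽 (L.variableHom γ 1) (Δ 1))
      (alexanderPoly α 1) := by
  obtain ⟨e, -⟩ := L.exists_freeH1_link_equiv γ
  have := uniqueProds_of_equiv_int_prod e
  have := isNoetherianRing_groupRing (𝔽 := 𝔽) e
  have := uniqueFactorizationMonoid_groupRing (𝔽 := 𝔽) e
  have ham := L.isAmalgam_knotHom (γ 0)
  obtain ⟨s, q, Q, hq, hQ, hQΔ⟩ := L.exists_presentation_factor γ α (hβ 0) (hΔ 0) (hf 0)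
    (L.bridgedPath (γ 0) 0)
  obtain ⟨s', q', Q', hq', hQ', hQΔ'⟩ := L.exists_presentation_factor γ α (hβ 1) (hΔ 1) (hf 1)
    (L.bridgedPath (γ 0) 1)
  have hm (i : Fin 2) : toFreeH1 _ _ (L.knotHom i (L.bridgedPath (γ 0) i) (L.knotMeridian i)) =
      L.linkVariable i (γ i) := (L.linkVariable_eq i _ _).symm
  have hrel := L.isRelPrime_det γ
    fun i => α (L.knotHom i (L.bridgedPath (γ 0) i) (L.knotMeridian i))
  have hne := det_single_smul_sub_one_ne_zero (x := L.linkVariable 1 (γ 1)) (L.linkVariable_pow_injective γ 1) (α (L.knotHom 1 (L.bridgedPath (γ 0) 1) (L.knotMeridian 1)))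
  rw [← hm, ← hm, ← det_twistedAction_sub_one, ← det_twistedAction_sub_one] at hrel
  rw [← hm, ← det_twistedAction_sub_one] at hne
  exact (hQΔ.mul_mul hQΔ').symm.trans <| associated_moduleOrder_of_isAmalgam ham (twistedAction α (toFreeH1 L.exterior x₀)) hne hrel
    q hq Q hQ q' hq' Q' hQ'

end HopfLikeLink

namespace HopfLikeLink

variable (L : HopfLikeLink) {x₀ : L.exterior}
  (γ : ∀ i, Path x₀ (L.pieceToExterior i (L.basePoint i)))

/-! ### The Alexander norm -/

/-- The coordinates, as a linear isomorphism. -/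
def coordinatesEquiv : RealH1 L.exterior x₀ ≃ₗ[ℝ] ℝ × ℝ :=
  LinearEquiv.ofBijective
    { toFun := L.coordinates γ
      map_add' := fun _ _ => rfl
      map_smul' := fun _ _ => rfl } (L.coordinates_bijective γ)

/-- Each factor contributes its degree times the value of the class on the meridian, as the widths of
Newton polytopes add up in products. -/
theorem alexanderNorm_eq_of_isFactor {𝔽 : Type*} [Field 𝔽] {k : ℕ}
    {α : FundamentalGroup L.exterior x₀ →* GL (Fin k) 𝔽}
    {β : ∀ i, FundamentalGroup (L.knot i).exterior (L.pieceToKnot i (L.basePoint i)) →*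
      GL (Fin k) 𝔽}
    (hβ : ∀ i, L.IsInducedRep i (γ i) α (β i)) (hΔ : ∀ i, alexanderPoly (β i) 1 ≠ 0)
    {Δ : ∀ i, L.KnotRing 𝔽 i} (hf : ∀ i, L.IsFactor i (β i) (Δ i)) (hne : ∀ i, Δ i ≠ 0)
    (φ : RealH1 L.exterior x₀) :
    alexanderNorm α φ =
      laurentDegree (L.knotVariable 0) (Δ 0) * |(L.coordinates γ φ).1| +
        laurentDegree (L.knotVariable 1) (Δ 1) * |(L.coordinates γ φ).2| := by
  have := L.uniqueProds_freeH1 γ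
  have hw (i : Fin 2) : IsSupportWidth φ
      (MonoidAlgebra.mapDomainRingHom 𝔽 (L.variableHom γ i) (Δ i))
      (laurentDegree (L.knotVariable i) (Δ i) *
        |φ (Additive.ofMul (L.linkVariable i (γ i)))|) := by
    obtain ⟨e, he⟩ := L.exists_freeH1_knot_equiv i
    have h := isSupportWidth_laurentDegree e he (hne i) (φ.comp (L.variableHom γ i).toAdditive)
    have hval : φ.comp (L.variableHom γ i).toAdditive (Additive.ofMul (L.knotVariable i)) =
        φ (Additive.ofMul (L.linkVariable i (γ i))) := by
      rw [← L.variableHom_knotVariable γ i]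
      rfl
    rw [hval] at h
    exact h.mapDomain (L.variableHom_injective γ i)
  exact alexanderNorm_eq α φ
    (((hw 0).mul (hw 1)).of_associated (L.associated_alexanderPoly γ α hβ hΔ hf))

end HopfLikeLink

end

theorem corollary5p3 {𝔽 : Type*} [Field 𝔽] {k : ℕ} (L : HopfLikeLink) (x₀ : L.exterior)
    (γ : ∀ i, Path x₀ (L.pieceToExterior i (L.basePoint i)))
    (α : FundamentalGroup L.exterior x₀ →* GL (Fin k) 𝔽)
    (β : ∀ i, FundamentalGroup (L.knot i).exterior (L.pieceToKnot i (L.basePoint i)) →*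
      GL (Fin k) 𝔽)
    (hβ : ∀ i, L.IsInducedRep i (γ i) α (β i))
    (hΔ : ∀ i, alexanderPoly (β i) 1 ≠ 0) :
    Function.Bijective (L.coordinates γ) ∧
    (∀ i, ∃ Δ, L.IsFactor i (β i) Δ) ∧
    ∀ Δ : ∀ i, MonoidAlgebra 𝔽
        (FreeH1 (L.knot i).exterior (L.pieceToKnot i (L.basePoint i))),
      (∀ i, L.IsFactor i (β i) (Δ i)) →
      ∀ d : Fin 2 → ℤ, (∀ i, d i = laurentDegree (L.knotVariable i) (Δ i)) →
      (∀ i, 0 < d i) →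
        L.coordinates γ '' (alexanderNormBall α).extremePoints ℝ =
          {((k : ℝ) / d 0, 0), (-((k : ℝ) / d 0), 0), (0, (k : ℝ) / d 1), (0, -((k : ℝ) / d 1))} := by
  refine ⟨L.coordinates_bijective γ, fun i => ?_, fun Δ hf d hd hpos => ?_⟩
  · obtain ⟨-, Δ, h, -⟩ := L.exists_isFactor i (β i) (hΔ i)
    exact ⟨Δ, h⟩
  have hne (i : Fin 2) : Δ i ≠ 0 := by
    intro h
    have := hpos i
    rw [hd, h, laurentDegree_zero] at this
    exact lt_irrefl _ this
  have hk : 0 < k := by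
    rw [Nat.pos_iff_ne_zero]
    intro h
    have := hpos 0
    rw [hd, (hf 0).laurentDegree_eq_zero (hΔ 0) h] at this
    exact lt_irrefl _ this
  have hk' : (0 : ℝ) < k := by exact_mod_cast hk
  have hd0 : (0 : ℝ) < d 0 := by exact_mod_cast hpos 0
  have hd1 : (0 : ℝ) < d 1 := by exact_mod_cast hpos 1
  have hball : L.coordinatesEquiv γ '' alexanderNormBall α =
      {q : ℝ × ℝ | d 0 * |q.1| + d 1 * |q.2| ≤ k} := by
    have hmem (φ : RealH1 L.exterior x₀) : φ ∈ alexanderNormBall α ↔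
        L.coordinatesEquiv γ φ ∈ {q : ℝ × ℝ | d 0 * |q.1| + d 1 * |q.2| ≤ k} := by
      change 1 / (k : ℝ) * alexanderNorm α φ ≤ 1 ↔
        d 0 * |(L.coordinates γ φ).1| + d 1 * |(L.coordinates γ φ).2| ≤ k
      rw [L.alexanderNorm_eq_of_isFactor γ hβ hΔ hf hne φ, ← hd, ← hd, one_div_mul_eq_div,
        div_le_one hk']
    ext q
    constructor
    · rintro ⟨φ, hφ, rfl⟩
      exact (hmem φ).1 hφ
    · intro hq
      obtain ⟨φ, rfl⟩ := (L.coordinatesEquiv γ).surjective q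
      exact ⟨φ, (hmem φ).2 hq, rfl⟩
  rw [← extremePoints_l1_ball hd0 hd1 hk', ← hball, ← image_extremePoints]
  rfl
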